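/- Let $I=[a,b]$ with $-\infty<a<b<\infty$, let $1<q\le p<\infty$, $1/p'=1-1/p$ and $r=1/p'+1/q$. Let $u,v$ be positive functions on $I$ with $u\in L_{p'}(I)$ and $v\in L_q(I)$, and put $$(Tf)(x)=v(x)\int_a^x f(t)u(t)\,dt,\qquad (T^*h)(x)=u(x)\int_x^b v(y)h(y)\,dy,\qquad x\in I.$$ For real $t$ and $s>1$ write $(t)_{(s)}=|t|^{s-1}\operatorname{sgn}t$. A spectral triple is a triple $(g,f,\lambda)$ with $f\in L_p(I)$, $\|f\|_{p}=1$, $\lambda\in\mathbb R$, such that $$g(x)=(Tf)(x)\quad (x\in I),\qquad (f(x))_{(p)}=\lambda\,\bigl(T^*(g_{(q)})\bigr)(x)\quad\text{for almost every }x\in I.$$ For $n\in\mathbb N_0$ let $sp_n(p,q)$ be the set of all $\lambda$ occurring in spectral triples $(g,f,\lambda)$ for which $g$ has exactly $n$ distinct zeros in the open interval $(a,b)$. Then for every $n$ the maximum $\hat\lambda_n=\max sp_n(p,q)$ exists, and $$\lim_{n\to\infty} n\,\hat\lambda_n^{-1/q}=c_{pq}\Bigl(\int_I |uv|^{1/r}\,dt\Bigr)^{r},\qquad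 c_{pq}=\frac{(p')^{1/q}\,q^{1/p'}\,(p'+q)^{1/p-1/q}}{2\,B(1/q,1/p')},$$ where $B(x,y)=\int_0^1t^{x-1}(1-t)^{y-1}\,dt$ is the Beta function. -/

import Mathlib

open MeasureTheory Set Filter Topology

noncomputable section

namespace HardySpectral

/-- The signed power `t_(p) = |t|^(p-1) sgn t`. -/
def spow (p t : ℝ) : ℝ := |t| ^ (p - 1) * Real.sign t

/-- The Hardy-type operator `(T f)(x) = v(x) ∫_a^x f u`. -/
def hardyT (a : ℝ) (u v f : ℝ → ℝ) (x : ℝ) : ℝ := v x * ∫ t in a..x, f t * u t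

/-- The map `(T* h)(x) = u(x) ∫_x^b v h`. -/
def hardyTstar (b : ℝ) (u v h : ℝ → ℝ) (x : ℝ) : ℝ := u x * ∫ y in x..b, v y * h y

/-- `(g, f, lam)` is a spectral triple on `[a, b]`: `f ∈ L_p` has norm `1`, `g = T f` on `[a, b]`
(everywhere, since the zeros of `g` are going to be counted) and `f_(p) = lam T*(g_(q))` as
elements of a Lebesgue space on `[a, b]`. -/
structure IsSpectralTriple (a b p q : ℝ) (u v g f : ℝ → ℝ) (lam : ℝ) : Prop where
  memLp : MemLp f (ENNReal.ofReal p) (volume.restrict (Icc a b))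
  norm_eq_one : eLpNorm f (ENNReal.ofReal p) (volume.restrict (Icc a b)) = 1
  eq_T : ∀ x ∈ Icc a b, g x = hardyT a u v f x
  eq_Tstar : ∀ᵐ x ∂(volume.restrict (Icc a b)),
    spow p (f x) = lam * hardyTstar b u v (fun y => spow q (g y)) x

/-- The number (possibly infinite) of distinct zeros of `g` in the open interval `(a, b)`. -/
def zeroCount (a b : ℝ) (g : ℝ → ℝ) : ℕ∞ := {x ∈ Ioo a b | g x = 0}.encard

/-- The set of spectral numbers of spectral triples `(g, f, lam)` for which `g` has
exactly `n` zeros in `(a, b)`. -/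
def spN (a b p q : ℝ) (u v : ℝ → ℝ) (n : ℕ) : Set ℝ :=
  {lam | ∃ g f : ℝ → ℝ, IsSpectralTriple a b p q u v g f lam ∧ zeroCount a b g = n}

/-- The constant `c_{pq}`, with `p'` the conjugate exponent of `p`;
`ProbabilityTheory.beta` is the Beta function `B`. -/
def cConst (p p' q : ℝ) : ℝ :=
  p' ^ (1 / q) * q ^ (1 / p') * (p' + q) ^ (1 / p - 1 / q) / (2 * ProbabilityTheory.beta (1 / q) (1 / p'))

end HardySpectral

end

namespace HardySpectral

/-! ### Signed powers -/

/-! For points `P` in `[a, b]` let S(P) (`supRatio`) be the supremum of ‖Tf‖_q^q over all f with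
‖f‖_p ≤ 1 whose primitive F(x) = ∫_a^x f u vanishes at every point of `P`. The largest element of
sp_n is 1 / min S(P), the minimum being over n-point configurations, and the asymptotics are those
of this min-max problem.

No spectral number is larger. If (g, f, λ) is a spectral triple and g = vF has the zeros `P`, test
the equation with |K|^p / |F|^(p-1), where K is a competing primitive vanishing on `P`. Picone's
inequality bounds ∫ v^q |F|^(q-p) |K|^p, and because q ≤ p Young's inequality turns this into
‖Tk‖_q^q ≤ 1/λ. So f is extremal for its own zeros, S(P) ≤ 1/λ (`energy_le_of_critical`), and λ ≤ 1
/ min S.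

The bound is attained for q < p. S is lower semicontinuous, so a minimizing configuration exists,
and extremal functions exist by uniform convexity of L_p. An extremal function solves the spectral
equation up to jumps c_i in the tail integral at the points `P i` (Lagrange multipliers). Since q <
p, its primitive vanishes in (a, b) only on `P`, and its absolute value is unique by the equality
case of Young's inequality, while the signs on the components can be prescribed. Take the extremal
function that changes sign at every `P i`, move one point slightly to either side, and compare with
extremal functions of the moved configuration whose signs agree away from `P i`. Minimality yields
c_i ≥ 0 from one side and c_i ≤ 0 from the other (`multiplier_nonneg`), so the jumps vanish and 1 /
min S is spectral (`inv_min_mem_spN_of_lt`).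

For q = p the gaps between the points decouple and extremal functions may vanish on whole gaps.
Instead solutions for exponents decreasing to q are followed to the limit (`spN_nonempty_of_eq`).
Uniqueness for the homogeneous Cauchy problem keeps their zeros from merging or reaching the
boundary. Restricting the limit to a nodal interval free of a given configuration shows that its
spectral number is at least 1 / min S (`inv_le_supRatio_of_isNodal`).

Asymptotics. Let A_j be the best constant in ‖Tf‖_q ≤ A ‖f‖_p on the j-th cell of a partition into N
cells, for primitives vanishing at both ends, and let r = 1/p' + 1/q. If all interior division
points and `b` belong to `P`, then S(P)^(1/q) ≤ (max A_j) N^(r-1). If `P` is contained in the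
division points, gluing extremal functions gives (∑ A_j^(1/r))^r ≤ N S(P)^(1/q). For constant
weights α, β on an interval of length ℓ, a conserved energy gives A = c_pq αβ ℓ^r, so A^(1/r) is
additive in the interval. Approximating u and v by step functions shows that in general A^(1/r) is
the integral of c_pq^(1/r) |uv|^(1/r) up to an error with small total mass
(`exists_local_estimate`). Quantiles of this density give the upper bound for n S^(1/q); the gluing
estimate for arbitrary `P` gives the lower one. -/

theorem spow_zero (p : ℝ) : spow p 0 = 0 := by simp [spow]

theorem spow_of_pos {p t : ℝ} (ht : 0 < t) : spow p t = t ^ (p - 1) := by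
  simp [spow, abs_of_pos ht, Real.sign_of_pos ht]

theorem spow_of_nonneg {p t : ℝ} (hp : 1 < p) (ht : 0 ≤ t) : spow p t = t ^ (p - 1) := by
  rcases ht.eq_or_lt with rfl | ht
  · rw [spow_zero, Real.zero_rpow (by linarith)]
  · exact spow_of_pos ht

theorem spow_neg (p t : ℝ) : spow p (-t) = -spow p t := by
  simp [spow, Real.sign_neg]

theorem sign_mul' (s t : ℝ) : Real.sign (s * t) = Real.sign s * Real.sign t := by
  rcases lt_trichotomy s 0 with hs | rfl | hs <;> rcases lt_trichotomy t 0 with ht | rfl | ht <;>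
  simp [Real.sign_of_neg, Real.sign_of_pos, *, mul_pos_of_neg_of_neg, mul_neg_of_neg_of_pos,
    mul_neg_of_pos_of_neg]

theorem spow_mul (p s t : ℝ) : spow p (s * t) = spow p s * spow p t := by
  simp only [spow, abs_mul, sign_mul', Real.mul_rpow (abs_nonneg s) (abs_nonneg t)]; ring

theorem spow_pos {p t : ℝ} (ht : 0 < t) : 0 < spow p t := by
  rw [spow_of_pos ht]; positivity

theorem spow_neg_of_neg {p t : ℝ} (ht : t < 0) : spow p t < 0 := by
  have := spow_pos (p := p) (neg_pos.2 ht); rw [spow_neg] at this; linarith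

theorem spow_pos_iff {p t : ℝ} : 0 < spow p t ↔ 0 < t := by
  refine ⟨fun h => ?_, spow_pos⟩
  rcases lt_trichotomy t 0 with ht | rfl | ht
  · exact absurd h (spow_neg_of_neg ht).not_gt
  · simp [spow_zero] at h
  · exact ht

theorem spow_neg_iff {p t : ℝ} : spow p t < 0 ↔ t < 0 := by
  have := spow_pos_iff (p := p) (t := -t)
  rw [spow_neg] at this; simpa using this

theorem spow_eq_zero_iff {p t : ℝ} : spow p t = 0 ↔ t = 0 := by
  refine ⟨fun h => ?_, fun h => by rw [h, spow_zero]⟩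
  rcases lt_trichotomy t 0 with ht | rfl | ht
  · exact absurd h (spow_neg_of_neg ht).ne
  · rfl
  · exact absurd h (spow_pos ht).ne'

theorem abs_spow {p t : ℝ} (hp : 1 < p) : |spow p t| = |t| ^ (p - 1) := by
  rcases le_total 0 t with ht | ht
  · rw [spow_of_nonneg hp ht, abs_of_nonneg ht, abs_of_nonneg (by positivity)]
  · rw [← neg_neg t, spow_neg, abs_neg, spow_of_nonneg hp (by linarith), abs_neg,
      abs_of_nonneg (by linarith : (0:ℝ) ≤ -t), abs_of_nonneg (by have := neg_nonneg.2 ht; positivity)]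

theorem spow_mul_self {p t : ℝ} (hp : 1 < p) : spow p t * t = |t| ^ p := by
  have key : ∀ t : ℝ, 0 < t → spow p t * t = |t| ^ p := fun t ht => by
    rw [spow_of_pos ht, abs_of_pos ht, ← Real.rpow_add_one ht.ne']; simp
  rcases lt_trichotomy t 0 with ht | rfl | ht
  · have := key (-t) (by linarith)
    rwa [spow_neg, neg_mul_neg, abs_neg] at this
  · simp [spow_zero, Real.zero_rpow (by linarith : p ≠ 0)]
  · exact key t ht

theorem spow_spow {p p' t : ℝ} (h : p.HolderConjugate p') : spow p' (spow p t) = t := by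
  have key : ∀ t : ℝ, 0 < t → spow p' (spow p t) = t := fun t ht => by
    rw [spow_of_pos (spow_pos ht), spow_of_pos ht, ← Real.rpow_mul ht.le]
    have := h.sub_one_mul_conj
    have h2 : (p - 1) * (p' - 1) = 1 := by
      have := h.symm.sub_one_mul_conj
      nlinarith
    rw [h2, Real.rpow_one]
  rcases lt_trichotomy t 0 with ht | rfl | ht
  · have := key (-t) (by linarith)
    rw [spow_neg, spow_neg] at this; linarith
  · simp [spow_zero]
  · exact key t ht

theorem spow_eq {p t : ℝ} (hp : 1 < p) : spow p t = max t 0 ^ (p - 1) - max (-t) 0 ^ (p - 1) := by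
  have h0 : (0:ℝ) ^ (p - 1) = 0 := Real.zero_rpow (by linarith)
  rcases le_total 0 t with ht | ht
  · rw [spow_of_nonneg hp ht, max_eq_left ht, max_eq_right (by linarith), h0, sub_zero]
  · rw [max_eq_right ht, max_eq_left (by linarith), h0, zero_sub, ← neg_neg t, spow_neg,
      spow_of_nonneg hp (by linarith), neg_neg]

theorem continuous_spow {p : ℝ} (hp : 1 < p) : Continuous (spow p) := by
  have : spow p = fun t => max t 0 ^ (p - 1) - max (-t) 0 ^ (p - 1) := funext fun t => spow_eq hp
  rw [this]
  have h : 0 ≤ p - 1 := by linarith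
  exact ((continuous_id.max continuous_const).rpow_const fun _ => Or.inr h).sub
    ((continuous_neg.max continuous_const).rpow_const fun _ => Or.inr h)

theorem hasDerivAt_abs_rpow_spow {p : ℝ} (hp : 1 < p) (t : ℝ) :
    HasDerivAt (fun t : ℝ => |t| ^ p) (p * spow p t) t := by
  convert! hasDerivAt_abs_rpow t hp using 1
  rcases lt_trichotomy t 0 with ht | rfl | ht
  · rw [spow, Real.sign_of_neg ht]
    have h : |t| ^ (p - 1) = |t| ^ (p - 2) * |t| := by
      rw [← Real.rpow_add_one (abs_pos.2 ht.ne).ne']; ring_nf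
    rw [h, abs_of_neg ht]; ring
  · simp [spow_zero]
  · rw [spow, Real.sign_of_pos ht]
    have h : |t| ^ (p - 1) = |t| ^ (p - 2) * |t| := by
      rw [← Real.rpow_add_one (abs_pos.2 ht.ne').ne']; ring_nf
    rw [h, abs_of_pos ht]; ring

theorem continuous_abs_rpow {p : ℝ} (hp : 0 < p) : Continuous fun t : ℝ => |t| ^ p :=
  continuous_abs.rpow_const fun _ => Or.inr hp.le

theorem convexOn_abs_rpow {p : ℝ} (hp : 1 ≤ p) : ConvexOn ℝ univ fun t : ℝ => |t| ^ p := by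
  refine ⟨convex_univ, fun x _ y _ s t hs ht hst => ?_⟩
  have h1 : |s • x + t • y| ≤ s • |x| + t • |y| := by
    simp only [smul_eq_mul]
    refine (abs_add_le _ _).trans_eq ?_
    rw [abs_mul, abs_mul, abs_of_nonneg hs, abs_of_nonneg ht]
  refine (Real.rpow_le_rpow (abs_nonneg _) h1 (by linarith)).trans ?_
  exact (convexOn_rpow hp).2 (abs_nonneg x) (abs_nonneg y) hs ht hst

/-- Quantitative strict convexity of `|·| ^ p`. -/
theorem exists_abs_sub_rpow_le {p : ℝ} (hp : 1 < p) {η : ℝ} (hη : 0 < η) :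
    ∃ C > 0, ∀ x y : ℝ, |x - y| ^ p ≤ η * (|x| ^ p + |y| ^ p) +
      C * ((|x| ^ p + |y| ^ p) / 2 - |(x + y) / 2| ^ p) := by
  have hp0 : 0 < p := by linarith
  let N : ℝ × ℝ → ℝ := fun z => |z.1| ^ p + |z.2| ^ p
  let D : ℝ × ℝ → ℝ := fun z => (|z.1| ^ p + |z.2| ^ p) / 2 - |(z.1 + z.2) / 2| ^ p
  have hc := continuous_abs_rpow hp0
  have hN : Continuous N := (hc.comp continuous_fst).add (hc.comp continuous_snd)
  have hD : Continuous D := (hN.div_const 2).sub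
    (hc.comp ((continuous_fst.add continuous_snd).div_const 2))
  have hDnn : ∀ z, 0 ≤ D z := fun z => by
    have := (convexOn_abs_rpow hp.le).2 (mem_univ z.1) (mem_univ z.2) (by norm_num : (0:ℝ) ≤ 1/2)
      (by norm_num : (0:ℝ) ≤ 1/2) (by norm_num)
    simp only [smul_eq_mul] at this
    have e : (z.1 + z.2) / 2 = 1/2 * z.1 + 1/2 * z.2 := by ring
    simp only [D, e]; linarith
  have hDpos : ∀ z, z.1 ≠ z.2 → 0 < D z := by
    intro z hz
    by_cases hab : |z.1| = |z.2|
    · have h0 : z.1 + z.2 = 0 := by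
        rcases abs_eq_abs.1 hab with h | h
        · exact absurd h hz
        · linarith
      have h1 : z.1 ≠ 0 := fun h => hz (by rw [h] at h0 ⊢; linarith)
      simp only [D, h0, zero_div, abs_zero, Real.zero_rpow hp0.ne', sub_zero]
      have : 0 < |z.1| ^ p := by have := abs_pos.2 h1; positivity
      positivity
    · have := (strictConvexOn_rpow hp).2 (abs_nonneg z.1) (abs_nonneg z.2) hab
        (by norm_num : (0:ℝ) < 1/2) (by norm_num : (0:ℝ) < 1/2) (by norm_num)
      simp only [smul_eq_mul] at this
      have h2 : |(z.1 + z.2) / 2| ^ p ≤ (1/2 * |z.1| + 1/2 * |z.2|) ^ p := by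
        refine Real.rpow_le_rpow (abs_nonneg _) ?_ hp0.le
        rw [abs_div, abs_two]; linarith [abs_add_le z.1 z.2]
      simp only [D]; linarith
  -- Everything is homogeneous of degree `p`. If `|x - y| ^ p ≤ η * N` the first term suffices;
  -- otherwise the pair scales into this compact set, which avoids the diagonal, so the convexity
  -- defect `D` has a positive minimum `d` on it.
  let K : Set (ℝ × ℝ) := {z | N z = 1 ∧ η ≤ |z.1 - z.2| ^ p}
  have hK : IsCompact K := by
    refine Metric.isCompact_of_isClosed_isBounded ?_ ?_
    · exact (isClosed_eq hN continuous_const).inter (isClosed_le continuous_const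
        (hc.comp (continuous_fst.sub continuous_snd)))
    · refine (Metric.isBounded_closedBall (x := (0 : ℝ × ℝ)) (r := 1)).subset ?_
      rintro z ⟨hz, -⟩
      have h1 : |z.1| ^ p ≤ 1 := by
        have : 0 ≤ |z.2| ^ p := by positivity
        simp only [N] at hz; linarith
      have h2 : |z.2| ^ p ≤ 1 := by
        have : 0 ≤ |z.1| ^ p := by positivity
        simp only [N] at hz; linarith
      rw [mem_closedBall_zero_iff, Prod.norm_def, Real.norm_eq_abs, Real.norm_eq_abs, max_le_iff]
      refine ⟨?_, ?_⟩ <;> by_contra! h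
      · exact absurd h1 (not_le.2 (Real.one_lt_rpow h hp0))
      · exact absurd h2 (not_le.2 (Real.one_lt_rpow h hp0))
  obtain ⟨d, hd, hdK⟩ : ∃ d > 0, ∀ z ∈ K, d ≤ D z := by
    rcases K.eq_empty_or_nonempty with h | h
    · exact ⟨1, one_pos, by simp [h]⟩
    · obtain ⟨z, hz, hm⟩ := hK.exists_isMinOn h hD.continuousOn
      refine ⟨D z, hDpos z fun e => ?_, fun w hw => hm hw⟩
      have := hz.2
      rw [e, sub_self, abs_zero, Real.zero_rpow hp0.ne'] at this
      linarith
  -- The factor `2 ^ p` comes from `|x - y| ^ p ≤ 2 ^ p * N`, and `1 / d` from `N ≤ D / d` on the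
  -- cone over `K`.
  refine ⟨2 ^ p / d, by positivity, fun x y => ?_⟩
  have hbound : |x - y| ^ p ≤ 2 ^ p * (|x| ^ p + |y| ^ p) := by
    have h1 : |x - y| ≤ 2 * max |x| |y| := by
      have := abs_sub x y
      have := le_max_left |x| |y|
      have := le_max_right |x| |y|
      linarith
    refine (Real.rpow_le_rpow (abs_nonneg _) h1 hp0.le).trans ?_
    rw [Real.mul_rpow (by norm_num) (by positivity)]
    gcongr
    have h3 : 0 ≤ |x| ^ p := by positivity
    have h4 : 0 ≤ |y| ^ p := by positivity
    rcases max_cases |x| |y| with h | h <;> rw [h.1] <;> linarith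
  by_cases hxy : N (x, y) = 0
  · have h1 : 0 ≤ |x| ^ p := by positivity
    have h2 : 0 ≤ |y| ^ p := by positivity
    have h0 := hDnn (x, y)
    have hNe : |x| ^ p + |y| ^ p = 0 := hxy
    rw [hNe, mul_zero] at hbound ⊢
    have : 0 ≤ 2 ^ p / d * D (x, y) := by positivity
    simp only [D, hNe] at this
    linarith
  · have hNpos : 0 < N (x, y) := lt_of_le_of_ne (by simp only [N]; positivity) (Ne.symm hxy)
    have hNe : N (x, y) = |x| ^ p + |y| ^ p := rfl
    by_cases hle : |x - y| ^ p ≤ η * (|x| ^ p + |y| ^ p)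
    · have := mul_nonneg (by positivity : 0 ≤ 2 ^ p / d) (hDnn (x, y))
      simp only [D] at this
      linarith
    · push Not at hle
      set c := (N (x, y)) ^ (-(1 / p)) with hcdef
      have hcpos : 0 < c := Real.rpow_pos_of_pos hNpos _
      have hcp : c ^ p = (N (x, y))⁻¹ := by
        rw [hcdef, ← Real.rpow_mul hNpos.le, neg_mul, one_div_mul_cancel hp0.ne', Real.rpow_neg_one]
      have hsc : ∀ t, |c * t| ^ p = (N (x, y))⁻¹ * |t| ^ p := fun t => by
        rw [abs_mul, Real.mul_rpow (abs_nonneg _) (abs_nonneg _), abs_of_pos hcpos, hcp]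
      have hmem : (c * x, c * y) ∈ K := by
        refine ⟨?_, ?_⟩
        · simp only [N] at hsc hNpos ⊢
          rw [hsc, hsc, ← mul_add]; exact inv_mul_cancel₀ hNpos.ne'
        · simp only [← mul_sub]
          rw [hsc, hNe, inv_mul_eq_div, le_div_iff₀ (hNe ▸ hNpos)]; exact hle.le
      have h1 := hdK _ hmem
      have h2 : D (c * x, c * y) = (N (x, y))⁻¹ * D (x, y) := by
        simp only [D]
        have : (c * x + c * y) / 2 = c * ((x + y) / 2) := by ring
        rw [this, hsc, hsc, hsc]; ring
      rw [h2, inv_mul_eq_div, le_div_iff₀ hNpos] at h1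
      have h3 : 2 ^ p * N (x, y) ≤ 2 ^ p / d * D (x, y) := by
        rw [div_mul_eq_mul_div, le_div_iff₀ hd]
        have : (0:ℝ) < 2 ^ p := by positivity
        nlinarith
      have h4 : 0 ≤ η * (|x| ^ p + |y| ^ p) := by positivity
      simp only [D] at h3
      rw [hNe] at h3
      linarith

end HardySpectral

namespace HardySpectral

/-! ### Lebesgue spaces with a real exponent -/

section Lebesgue

variable {α : Type*} {m : MeasurableSpace α} {μ : Measure α} {r : ℝ} {f g : α → ℝ}

theorem memLp_ofReal_iff (hr : 0 < r) : MemLp f (ENNReal.ofReal r) μ ↔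
    AEStronglyMeasurable f μ ∧ Integrable (fun x => |f x| ^ r) μ := by
  have h := fun hf : AEStronglyMeasurable f μ => integrable_norm_rpow_iff (p := ENNReal.ofReal r) hf
    (by simpa using hr) (by simp)
  simp only [ENNReal.toReal_ofReal hr.le, Real.norm_eq_abs] at h
  exact ⟨fun H => ⟨H.1, (h H.1).2 H⟩, fun H => (h H.1).1 H.2⟩

theorem MemLp.integrable_abs_rpow (hr : 0 < r) (hf : MemLp f (ENNReal.ofReal r) μ) :
    Integrable (fun x => |f x| ^ r) μ := ((memLp_ofReal_iff hr).1 hf).2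

theorem lpNorm_ofReal (hr : 0 < r) (hf : AEStronglyMeasurable f μ) :
    lpNorm f (ENNReal.ofReal r) μ = (∫ x, |f x| ^ r ∂μ) ^ (1 / r) := by
  rw [lpNorm_eq_integral_norm_rpow_toReal (by simpa using hr) (by simp) hf]
  simp [ENNReal.toReal_ofReal hr.le]

theorem integral_abs_rpow_nonneg : 0 ≤ ∫ x, |f x| ^ r ∂μ := integral_nonneg fun x => by positivity

theorem integral_abs_rpow_eq (hr : 0 < r) (hf : AEStronglyMeasurable f μ) :
    ∫ x, |f x| ^ r ∂μ = lpNorm f (ENNReal.ofReal r) μ ^ r := by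
  rw [lpNorm_ofReal hr hf, ← Real.rpow_mul integral_abs_rpow_nonneg, one_div_mul_cancel hr.ne',
    Real.rpow_one]

theorem eLpNorm_ofReal (hr : 0 < r) (hf : MemLp f (ENNReal.ofReal r) μ) :
    eLpNorm f (ENNReal.ofReal r) μ = ENNReal.ofReal ((∫ x, |f x| ^ r ∂μ) ^ (1 / r)) := by
  rw [← lpNorm_ofReal hr hf.1, ofReal_lpNorm hf]

theorem one_le_ofReal (hr : 1 ≤ r) : 1 ≤ ENNReal.ofReal r := by simpa using hr

/-- Reverse triangle inequality for the norm of L_r, phrased with integrals of representatives. -/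
theorem tendsto_integral_abs_rpow {ι : Type*} {l : Filter ι} (hr : 1 ≤ r) {F : ι → α → ℝ}
    (hF : ∀ i, MemLp (F i) (ENNReal.ofReal r) μ) (hf : MemLp f (ENNReal.ofReal r) μ)
    (h : Tendsto (fun i => ∫ x, |F i x - f x| ^ r ∂μ) l (𝓝 0)) :
    Tendsto (fun i => ∫ x, |F i x| ^ r ∂μ) l (𝓝 (∫ x, |f x| ^ r ∂μ)) := by
  have hr0 : 0 < r := by linarith
  have h1 : Tendsto (fun i => lpNorm (F i - f) (ENNReal.ofReal r) μ) l (𝓝 0) := by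
    have : (fun i => lpNorm (F i - f) (ENNReal.ofReal r) μ) =
        fun i => (∫ x, |F i x - f x| ^ r ∂μ) ^ (1 / r) := by
      ext i; rw [lpNorm_ofReal hr0 ((hF i).sub hf).1]; rfl
    rw [this]
    have := h.rpow_const (p := 1 / r) (Or.inr (by positivity))
    rwa [Real.zero_rpow (by positivity)] at this
  have h2 : Tendsto (fun i => lpNorm (F i) (ENNReal.ofReal r) μ) l
      (𝓝 (lpNorm f (ENNReal.ofReal r) μ)) := by
    rw [tendsto_iff_dist_tendsto_zero]
    refine squeeze_zero (fun _ => dist_nonneg) (fun i => ?_) h1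
    rw [Real.dist_eq, abs_le]
    have hle := one_le_ofReal hr
    have e1 := lpNorm_add_le (f := f) (g := F i - f) hf hle
    have e2 := lpNorm_add_le (f := F i) (g := f - F i) (hF i) hle
    rw [lpNorm_sub_comm f (F i)] at e2
    simp only [add_sub_cancel] at e1 e2
    constructor <;> linarith
  have := h2.rpow_const (p := r) (Or.inr hr0.le)
  simpa only [integral_abs_rpow_eq hr0 (hF _).1, integral_abs_rpow_eq hr0 hf.1] using this

theorem exists_tendsto_of_cauchy (hr : 1 ≤ r) {F : ℕ → α → ℝ}
    (hF : ∀ i, MemLp (F i) (ENNReal.ofReal r) μ)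
    (h : Tendsto (fun i : ℕ × ℕ => ∫ x, |F i.1 x - F i.2 x| ^ r ∂μ) (atTop ×ˢ atTop) (𝓝 0)) :
    ∃ f, MemLp f (ENNReal.ofReal r) μ ∧
      Tendsto (fun i => ∫ x, |F i x - f x| ^ r ∂μ) atTop (𝓝 0) := by
  have hr0 : 0 < r := by linarith
  have : Fact (1 ≤ ENNReal.ofReal r) := ⟨one_le_ofReal hr⟩
  have hn : ∀ {g : α → ℝ} (hg : MemLp g (ENNReal.ofReal r) μ),
      (∫ x, |g x| ^ r ∂μ) = ‖hg.toLp g‖ ^ r := fun {g} hg => by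
    rw [Lp.norm_toLp, toReal_eLpNorm hg.1, integral_abs_rpow_eq hr0 hg.1]
  have hc : CauchySeq fun i => (hF i).toLp (F i) := by
    refine cauchySeq_iff_tendsto_dist_atTop_0.2 ?_
    rw [← prod_atTop_atTop_eq]
    have h2 := h.rpow_const (p := 1 / r) (Or.inr (by positivity))
    rw [Real.zero_rpow (by positivity)] at h2
    refine h2.congr fun i => ?_
    have := hn ((hF i.1).sub (hF i.2))
    simp only [Pi.sub_apply] at this
    rw [this, ← Real.rpow_mul (norm_nonneg _), mul_one_div_cancel hr0.ne', Real.rpow_one,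
      dist_eq_norm, MemLp.toLp_sub]
  obtain ⟨G, hG⟩ := cauchySeq_tendsto_of_complete hc
  refine ⟨G, Lp.memLp G, ?_⟩
  have h3 := (tendsto_iff_norm_sub_tendsto_zero.1 hG).rpow_const (p := r) (Or.inr hr0.le)
  rw [Real.zero_rpow hr0.ne'] at h3
  refine h3.congr fun i => ?_
  have := hn ((hF i).sub (Lp.memLp G))
  simp only [Pi.sub_apply] at this
  rw [this, MemLp.toLp_sub (hF i) (Lp.memLp G), Lp.toLp_coeFn]

theorem abs_integral_mul_le {p p' : ℝ} (h : p.HolderConjugate p')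
    (hf : MemLp f (ENNReal.ofReal p) μ) (hg : MemLp g (ENNReal.ofReal p') μ) :
    |∫ x, f x * g x ∂μ| ≤ (∫ x, |f x| ^ p ∂μ) ^ (1 / p) * (∫ x, |g x| ^ p' ∂μ) ^ (1 / p') := by
  refine (abs_integral_le_integral_abs).trans ?_
  simp only [abs_mul]
  exact integral_mul_norm_le_Lp_mul_Lq h hf hg

theorem integrable_mul_of_conj {p p' : ℝ} (h : p.HolderConjugate p')
    (hf : MemLp f (ENNReal.ofReal p) μ) (hg : MemLp g (ENNReal.ofReal p') μ) :
    Integrable (fun x => f x * g x) μ := by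
  have := h.ennrealOfReal
  exact hf.integrable_mul hg

theorem spow_memLp {p p' : ℝ} (h : p.HolderConjugate p') (hf : MemLp f (ENNReal.ofReal p) μ) :
    MemLp (fun x => spow p (f x)) (ENNReal.ofReal p') μ := by
  rw [memLp_ofReal_iff h.symm.pos]
  refine ⟨(continuous_spow h.lt).comp_aestronglyMeasurable hf.1, ?_⟩
  refine (MemLp.integrable_abs_rpow h.pos hf).congr (ae_of_all _ fun x => ?_)
  simp only
  rw [abs_spow h.lt, ← Real.rpow_mul (abs_nonneg _), h.sub_one_mul_conj]

theorem integrable_spow_mul (hr : 1 < r) (hf : MemLp f (ENNReal.ofReal r) μ)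
    (hg : MemLp g (ENNReal.ofReal r) μ) : Integrable (fun x => spow r (f x) * g x) μ :=
  integrable_mul_of_conj (Real.HolderConjugate.conjExponent hr).symm
    (spow_memLp (Real.HolderConjugate.conjExponent hr) hf) hg

/-- Differentiation under the integral: for `|s| < 1` the derivative of the integrand is dominated
by `r (|f| + |g|) ^ (r - 1) |g|`, which is integrable by Hölder. All first variations rest on this
formula. -/
theorem hasDerivAt_integral_abs_rpow (hr : 1 < r) (hf : MemLp f (ENNReal.ofReal r) μ)
    (hg : MemLp g (ENNReal.ofReal r) μ) :
    HasDerivAt (fun s : ℝ => ∫ x, |f x + s * g x| ^ r ∂μ) (r * ∫ x, spow r (f x) * g x ∂μ) 0 := by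
  have hr0 : 0 < r := by linarith
  have hmem : ∀ s : ℝ, MemLp (fun x => f x + s * g x) (ENNReal.ofReal r) μ := fun s =>
    hf.add (hg.const_mul s)
  have hb : MemLp (fun x => |f x| + |g x|) (ENNReal.ofReal r) μ := hf.abs.add hg.abs
  have := (hasDerivAt_integral_of_dominated_loc_of_deriv_le (μ := μ) (𝕜 := ℝ)
    (F := fun s x => |f x + s * g x| ^ r)
    (F' := fun s x => r * spow r (f x + s * g x) * g x) (x₀ := 0) (s := Metric.ball 0 1)
    (bound := fun x => r * (spow r (|f x| + |g x|) * |g x|)) (Metric.ball_mem_nhds _ one_pos)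
    (Eventually.of_forall fun s =>
      (continuous_abs_rpow hr0).comp_aestronglyMeasurable (hmem s).1)
    (MemLp.integrable_abs_rpow hr0 (hmem 0))
    (((continuous_spow hr).comp_aestronglyMeasurable (hmem 0).1).const_mul r |>.mul hg.1)
    (ae_of_all _ fun x s hs => ?_)
    ((integrable_spow_mul hr hb hg.abs).const_mul r)
    (ae_of_all _ fun x s _ => ?_)).2
  · convert! this using 1
    rw [← integral_const_mul]
    simp only [zero_mul, add_zero]
    congr 1; ext x; ring
  · rw [mem_ball_zero_iff, Real.norm_eq_abs] at hs
    rw [Real.norm_eq_abs, abs_mul, abs_mul, abs_of_pos hr0, abs_spow hr, mul_assoc,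
      spow_of_nonneg hr (by positivity)]
    gcongr
    refine (abs_add_le _ _).trans ?_
    rw [abs_mul]
    nlinarith [abs_nonneg (g x)]
  · have h1 : HasDerivAt (fun s : ℝ => f x + s * g x) (g x) s := by
      simpa using ((hasDerivAt_id s).mul_const (g x)).const_add (f x)
    exact (hasDerivAt_abs_rpow_spow hr (f x + s * g x)).comp s h1

theorem convexOn_integral_abs_rpow (hr : 1 ≤ r) (hf : MemLp f (ENNReal.ofReal r) μ)
    (hg : MemLp g (ENNReal.ofReal r) μ) :
    ConvexOn ℝ univ (fun s : ℝ => ∫ x, |f x + s * g x| ^ r ∂μ) := by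
  have hr0 : 0 < r := by linarith
  have hmem : ∀ s : ℝ, Integrable (fun x => |f x + s * g x| ^ r) μ := fun s =>
    MemLp.integrable_abs_rpow hr0 (hf.add (hg.const_mul s))
  refine ⟨convex_univ, fun s _ t _ c d hc hd hcd => ?_⟩
  simp only [smul_eq_mul]
  rw [← integral_const_mul, ← integral_const_mul,
    ← integral_add ((hmem s).const_mul c) ((hmem t).const_mul d)]
  refine integral_mono (hmem _) (((hmem s).const_mul c).add ((hmem t).const_mul d)) fun x => ?_
  have := (convexOn_abs_rpow hr).2 (mem_univ (f x + s * g x)) (mem_univ (f x + t * g x)) hc hd hcd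
  simp only [smul_eq_mul] at this
  have e : f x + (c * s + d * t) * g x = c * (f x + s * g x) + d * (f x + t * g x) := by
    linear_combination (-(f x)) * hcd
  rw [e]; exact this

/-- Uniform convexity of L_r in integrated form: two functions of norm at most 1 whose midpoint has
norm close to 1 are close to each other. This makes maximizing sequences Cauchy. -/
theorem integral_abs_sub_rpow_le (hr : 1 < r) {η : ℝ} (hη : 0 < η) :
    ∃ C > 0, ∀ {f g : α → ℝ}, MemLp f (ENNReal.ofReal r) μ → MemLp g (ENNReal.ofReal r) μ →
      ∫ x, |f x - g x| ^ r ∂μ ≤ η * (∫ x, |f x| ^ r ∂μ + ∫ x, |g x| ^ r ∂μ) +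
        C * ((∫ x, |f x| ^ r ∂μ + ∫ x, |g x| ^ r ∂μ) / 2 - ∫ x, |(f x + g x) / 2| ^ r ∂μ) := by
  have hr0 : 0 < r := by linarith
  obtain ⟨C, hC, h⟩ := exists_abs_sub_rpow_le hr hη
  refine ⟨C, hC, fun {f g} hf hg => ?_⟩
  have i1 := MemLp.integrable_abs_rpow hr0 hf
  have i2 := MemLp.integrable_abs_rpow hr0 hg
  have i3 : Integrable (fun x => |(f x + g x) / 2| ^ r) μ := by
    have := MemLp.integrable_abs_rpow hr0 ((hf.add hg).const_mul (1/2))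
    refine this.congr (ae_of_all _ fun x => ?_)
    simp only [Pi.add_apply]; ring_nf
  have i4 : Integrable (fun x => |f x - g x| ^ r) μ := MemLp.integrable_abs_rpow hr0 (hf.sub hg)
  have i12 : Integrable (fun x => |f x| ^ r + |g x| ^ r) μ := i1.add i2
  have i5 : Integrable (fun x => η * (|f x| ^ r + |g x| ^ r)) μ := i12.const_mul η
  have i6 : Integrable (fun x => (|f x| ^ r + |g x| ^ r) / 2) μ := i12.div_const 2
  have i7 : Integrable (fun x => C * ((|f x| ^ r + |g x| ^ r) / 2 - |(f x + g x) / 2| ^ r)) μ :=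
    (i6.sub i3).const_mul C
  refine (integral_mono i4 (i5.add i7) (fun x => h (f x) (g x))).trans_eq ?_
  rw [integral_add' i5 i7, integral_const_mul, integral_const_mul, integral_sub i6 i3,
    integral_div, integral_add i1 i2]

end Lebesgue

/-- Sequential Arzelà–Ascoli theorem on a compact interval. -/
theorem exists_subseq_tendstoUniformlyOn {a b : ℝ} {F : ℕ → ℝ → ℝ} {B : ℝ}
    (hB : ∀ k, ∀ x ∈ Icc a b, |F k x| ≤ B)
    (heq : ∀ ε > 0, ∃ δ > 0, ∀ k, ∀ x ∈ Icc a b, ∀ y ∈ Icc a b, |x - y| < δ → |F k x - F k y| < ε) :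
    ∃ φ : ℕ → ℕ, StrictMono φ ∧ ∃ G : ℝ → ℝ, ContinuousOn G (Icc a b) ∧
      TendstoUniformlyOn (fun k => F (φ k)) G atTop (Icc a b) := by
  have hcont : ∀ k, Continuous fun x : Icc a b => F k x := fun k => by
    rw [Metric.continuous_iff]
    intro x ε hε
    obtain ⟨δ, hδ, h⟩ := heq ε hε
    exact ⟨δ, hδ, fun y hy => h k y y.2 x x.2 hy⟩
  let f : ℕ → BoundedContinuousFunction (Icc a b) ℝ := fun k =>
    BoundedContinuousFunction.mkOfCompact ⟨fun x : Icc a b => F k x, hcont k⟩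
  have hc : IsCompact (closure (range f)) := by
    refine BoundedContinuousFunction.arzela_ascoli (Icc (-B) B) isCompact_Icc _ ?_ ?_
    · rintro _ x ⟨k, rfl⟩
      exact abs_le.1 (hB k x x.2)
    · intro x
      rw [Metric.equicontinuousAt_iff]
      intro ε hε
      obtain ⟨δ, hδ, h⟩ := heq ε hε
      refine ⟨δ, hδ, fun y hy i => ?_⟩
      obtain ⟨k, hk⟩ := i.2
      rw [← hk]
      exact h k x x.2 y y.2 (by rw [abs_sub_comm]; exact hy)
  obtain ⟨G, -, φ, hφ, hG⟩ := hc.tendsto_subseq fun k => subset_closure (mem_range_self k)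
  classical
  refine ⟨φ, hφ, fun x => if hx : x ∈ Icc a b then G ⟨x, hx⟩ else 0, ?_, ?_⟩
  · rw [continuousOn_iff_continuous_domRestrict]
    convert! G.continuous using 1
    ext x; simp [domRestrict_apply, x.2.1, x.2.2]
  · have := BoundedContinuousFunction.tendsto_iff_tendstoUniformly.1 hG
    rw [Metric.tendstoUniformly_iff] at this
    rw [Metric.tendstoUniformlyOn_iff]
    intro ε hε
    filter_upwards [this ε hε] with k hk x hx
    have := hk ⟨x, hx⟩
    simpa [hx, f] using this

end HardySpectral

/-! ### Primitives of `f u`: compactness, absolute continuity, composition and sign changes -/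

namespace HardySpectral

/-- Lebesgue measure on `[a, b]`. -/
noncomputable abbrev vol (a b : ℝ) : Measure ℝ := volume.restrict (Icc a b)

/-- The standing assumptions on the exponents and the weights of the Hardy operator. -/
structure Weights (a b p p' q : ℝ) (u v : ℝ → ℝ) : Prop where
  hab : a < b
  conj : p.HolderConjugate p'
  hq : 1 < q
  hqp : q ≤ p
  u_pos : ∀ x ∈ Icc a b, 0 < u x
  v_pos : ∀ x ∈ Icc a b, 0 < v x
  u_mem : MemLp u (ENNReal.ofReal p') (vol a b)
  v_mem : MemLp v (ENNReal.ofReal q) (vol a b)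

/-- The primitive `∫_a^x f u`. -/
noncomputable def prim (a : ℝ) (u f : ℝ → ℝ) (x : ℝ) : ℝ := ∫ t in a..x, f t * u t

theorem hardyT_eq (a : ℝ) (u v f : ℝ → ℝ) (x : ℝ) : hardyT a u v f x = v x * prim a u f x := rfl

theorem intervalIntegrable_of_integrable {a b x y : ℝ} {h : ℝ → ℝ} (hh : Integrable h (vol a b))
    (hx : x ∈ Icc a b) (hy : y ∈ Icc a b) : IntervalIntegrable h volume x y :=
  (IntegrableOn.intervalIntegrable (by
    rw [uIcc_of_le (hx.1.trans hx.2)]; exact hh) : IntervalIntegrable h volume a b).mono_set (by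
    rw [uIcc_of_le (hx.1.trans hx.2)]; exact uIcc_subset_Icc hx hy)

theorem integral_vol {a b : ℝ} (hab : a ≤ b) (h : ℝ → ℝ) :
    ∫ x, h x ∂(vol a b) = ∫ x in a..b, h x := by
  rw [intervalIntegral.integral_of_le hab, integral_Icc_eq_integral_Ioc]

theorem ae_vol_iff {a b : ℝ} {Q : ℝ → Prop} :
    (∀ᵐ x ∂(vol a b), Q x) ↔ ∀ᵐ x, x ∈ Icc a b → Q x := ae_restrict_iff' measurableSet_Icc

theorem ae_vol_mem {a b : ℝ} : ∀ᵐ x ∂(vol a b), x ∈ Icc a b := ae_restrict_mem measurableSet_Icc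

theorem ae_vol_mem_Ioo {a b : ℝ} : ∀ᵐ x ∂(vol a b), x ∈ Ioo a b := by
  have h := ae_restrict_mem (μ := (volume : Measure ℝ)) (s := Ioo a b) measurableSet_Ioo
  rwa [Measure.restrict_congr_set Ioo_ae_eq_Icc] at h

/-- The exceptional set accommodates sign changes at finitely many points; with an empty exceptional
set the statement serves for conserved quantities. -/
theorem eq_left_of_hasDerivAt_zero_off_countable {a b : ℝ} {D : ℝ → ℝ} {Z : Set ℝ}
    (hZ : Z.Countable) (hD : ContinuousOn D (Icc a b))
    (h : ∀ x ∈ Ioo a b \ Z, HasDerivAt D 0 x) : ∀ x ∈ Icc a b, D x = D a := by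
  intro x hx
  have := integral_eq_of_hasDerivAt_off_countable_of_le D (fun _ => 0) hx.1 hZ
    (hD.mono (Icc_subset_Icc_right hx.2))
    (fun y hy => h y ⟨⟨hy.1.1, hy.1.2.trans_le hx.2⟩, hy.2⟩) (by simp)
  simp at this
  linarith

/-- The Lipschitz condition is required only on a set containing the values of `F`, because powers
such as `|t| ^ r` are not globally Lipschitz. -/
theorem AbsolutelyContinuousOnInterval.comp_lipschitz {a b : ℝ} {F : ℝ → ℝ}
    (hF : AbsolutelyContinuousOnInterval F a b) {φ : ℝ → ℝ} {s : Set ℝ} {C : NNReal}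
    (hφ : LipschitzOnWith C φ s) (hs : MapsTo F (uIcc a b) s) :
    AbsolutelyContinuousOnInterval (fun x => φ (F x)) a b := by
  rw [absolutelyContinuousOnInterval_iff] at hF ⊢
  intro ε hε
  obtain ⟨δ, hδ, h⟩ := hF (ε / (C + 1)) (by positivity)
  refine ⟨δ, hδ, fun E hE hlt => ?_⟩
  have h1 := h E hE hlt
  have h2 : ∑ i ∈ Finset.range E.1, dist (φ (F (E.2 i).1)) (φ (F (E.2 i).2)) ≤
      C * ∑ i ∈ Finset.range E.1, dist (F (E.2 i).1) (F (E.2 i).2) := by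
    rw [Finset.mul_sum]
    refine Finset.sum_le_sum fun i hi => ?_
    have := hE.1 i hi
    exact hφ.dist_le_mul _ (hs this.1) _ (hs this.2)
  refine h2.trans_lt ?_
  rw [lt_div_iff₀ (by positivity)] at h1
  have : 0 ≤ ∑ i ∈ Finset.range E.1, dist (F (E.2 i).1) (F (E.2 i).2) :=
    Finset.sum_nonneg fun _ _ => dist_nonneg
  nlinarith

variable {a b p p' q : ℝ} {u v : ℝ → ℝ}

namespace Weights

theorem le (W : Weights a b p p' q u v) : a ≤ b := W.hab.le

theorem left_mem (W : Weights a b p p' q u v) : a ∈ Icc a b := ⟨le_rfl, W.le⟩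

theorem right_mem (W : Weights a b p p' q u v) : b ∈ Icc a b := ⟨W.le, le_rfl⟩

theorem q_pos (W : Weights a b p p' q u v) : 0 < q := by linarith [W.hq]

theorem p_pos (W : Weights a b p p' q u v) : 0 < p := W.conj.pos

theorem hp (W : Weights a b p p' q u v) : 1 < p := W.conj.lt

theorem integrable_mul (W : Weights a b p p' q u v) {f : ℝ → ℝ}
    (hf : MemLp f (ENNReal.ofReal p) (vol a b)) : Integrable (fun x => f x * u x) (vol a b) :=
  integrable_mul_of_conj W.conj hf W.u_mem

theorem prim_sub (W : Weights a b p p' q u v) {f : ℝ → ℝ}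
    (hf : MemLp f (ENNReal.ofReal p) (vol a b)) {x y : ℝ} (hx : x ∈ Icc a b) (hy : y ∈ Icc a b) :
    prim a u f y - prim a u f x = ∫ t in x..y, f t * u t :=
  intervalIntegral.integral_interval_sub_left
    (intervalIntegrable_of_integrable (W.integrable_mul hf) W.left_mem hy)
    (intervalIntegrable_of_integrable (W.integrable_mul hf) W.left_mem hx)

theorem prim_add (W : Weights a b p p' q u v) {f g : ℝ → ℝ}
    (hf : MemLp f (ENNReal.ofReal p) (vol a b)) (hg : MemLp g (ENNReal.ofReal p) (vol a b))
    {x : ℝ} (hx : x ∈ Icc a b) :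
    prim a u (fun t => f t + g t) x = prim a u f x + prim a u g x := by
  simp only [prim, add_mul]
  exact intervalIntegral.integral_add
    (intervalIntegrable_of_integrable (W.integrable_mul hf) W.left_mem hx)
    (intervalIntegrable_of_integrable (W.integrable_mul hg) W.left_mem hx)

end Weights

theorem prim_const_mul (c : ℝ) (f : ℝ → ℝ) (x : ℝ) :
    prim a u (fun t => c * f t) x = c * prim a u f x := by
  simp only [prim, mul_assoc, intervalIntegral.integral_const_mul]

theorem prim_self (f : ℝ → ℝ) : prim a u f a = 0 := by simp [prim]

theorem prim_congr {f g : ℝ → ℝ} (h : f =ᵐ[vol a b] g) {x : ℝ} (hx : x ∈ Icc a b) :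
    prim a u f x = prim a u g x := by
  refine intervalIntegral.integral_congr_ae ?_
  filter_upwards [ae_vol_iff.1 h] with t ht hm
  rw [uIoc_of_le hx.1] at hm
  rw [ht ⟨hm.1.le, hm.2.trans hx.2⟩]

namespace Weights

theorem abs_prim_sub_le (W : Weights a b p p' q u v) {f : ℝ → ℝ}
    (hf : MemLp f (ENNReal.ofReal p) (vol a b)) {x y : ℝ} (hx : x ∈ Icc a b) (hy : y ∈ Icc a b)
    (hxy : x ≤ y) :
    |prim a u f y - prim a u f x| ≤
      (∫ t, |f t| ^ p ∂(vol a b)) ^ (1 / p) * (∫ t in x..y, |u t| ^ p') ^ (1 / p') := by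
  have hsub : Icc x y ⊆ Icc a b := Icc_subset_Icc hx.1 hy.2
  have hle : vol x y ≤ vol a b := Measure.restrict_mono hsub le_rfl
  rw [W.prim_sub hf hx hy, ← integral_vol hxy, ← integral_vol hxy]
  refine (abs_integral_mul_le W.conj (hf.mono_measure hle) (W.u_mem.mono_measure hle)).trans ?_
  have h1 : ∫ t, |f t| ^ p ∂(vol x y) ≤ ∫ t, |f t| ^ p ∂(vol a b) :=
    integral_mono_measure hle (ae_of_all _ fun t => by positivity)
      (MemLp.integrable_abs_rpow W.p_pos hf)
  have h2 : 0 ≤ ∫ t, |u t| ^ p' ∂(vol x y) := integral_abs_rpow_nonneg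
  exact mul_le_mul_of_nonneg_right (Real.rpow_le_rpow integral_abs_rpow_nonneg h1
    (by have := W.p_pos; positivity)) (by positivity)

theorem integrable_u (W : Weights a b p p' q u v) : Integrable (fun t => |u t| ^ p') (vol a b) :=
  MemLp.integrable_abs_rpow W.conj.symm.pos W.u_mem

theorem integrable_v (W : Weights a b p p' q u v) : Integrable (fun t => |v t| ^ q) (vol a b) :=
  MemLp.integrable_abs_rpow W.q_pos W.v_mem

theorem abs_prim_le (W : Weights a b p p' q u v) {f : ℝ → ℝ}
    (hf : MemLp f (ENNReal.ofReal p) (vol a b)) {x : ℝ} (hx : x ∈ Icc a b) :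
    |prim a u f x| ≤
      (∫ t, |f t| ^ p ∂(vol a b)) ^ (1 / p) * (∫ t, |u t| ^ p' ∂(vol a b)) ^ (1 / p') := by
  have h := W.abs_prim_sub_le hf W.left_mem hx hx.1
  rw [prim_self, sub_zero] at h
  refine h.trans ?_
  have h1 : ∫ t in a..x, |u t| ^ p' ≤ ∫ t, |u t| ^ p' ∂(vol a b) := by
    rw [← integral_vol hx.1]
    exact integral_mono_measure (Measure.restrict_mono (Icc_subset_Icc_right hx.2) le_rfl)
      (ae_of_all _ fun t => by positivity) W.integrable_u
  have h2 : 0 ≤ ∫ t in a..x, |u t| ^ p' :=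
    intervalIntegral.integral_nonneg hx.1 fun t _ => by positivity
  have := W.conj.symm.pos
  have h3 : 0 ≤ ∫ t, |f t| ^ p ∂(vol a b) := integral_abs_rpow_nonneg
  gcongr

theorem continuousOn_primitive (W : Weights a b p p' q u v) {h : ℝ → ℝ}
    (hh : Integrable h (vol a b)) : ContinuousOn (fun x => ∫ t in a..x, h t) (Icc a b) := by
  have := intervalIntegral.continuousOn_primitive_interval (f := h) (a := a) (b := b) (μ := volume)
    (by rw [uIcc_of_le W.le]; exact hh)
  rwa [uIcc_of_le W.le] at this

theorem continuousOn_prim (W : Weights a b p p' q u v) {f : ℝ → ℝ}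
    (hf : MemLp f (ENNReal.ofReal p) (vol a b)) : ContinuousOn (prim a u f) (Icc a b) :=
  W.continuousOn_primitive (W.integrable_mul hf)

/-- By Hölder, the increment of the primitive over `[x, y]` is at most the L_p' norm of `u` there,
uniformly over the unit ball of L_p. With Arzelà–Ascoli this is the compactness of the operator. -/
theorem prim_equicontinuous (W : Weights a b p p' q u v) {ε : ℝ} (hε : 0 < ε) :
    ∃ δ > 0, ∀ f : ℝ → ℝ, MemLp f (ENNReal.ofReal p) (vol a b) →
      ∫ t, |f t| ^ p ∂(vol a b) ≤ 1 → ∀ x ∈ Icc a b, ∀ y ∈ Icc a b, |x - y| < δ →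
        |prim a u f x - prim a u f y| < ε := by
  have hp' := W.conj.symm.pos
  have hc : UniformContinuousOn (fun x => ∫ t in a..x, |u t| ^ p') (Icc a b) :=
    isCompact_Icc.uniformContinuousOn_of_continuous (W.continuousOn_primitive W.integrable_u)
  rw [Metric.uniformContinuousOn_iff] at hc
  obtain ⟨δ, hδ, h⟩ := hc (ε ^ p') (by positivity)
  refine ⟨δ, hδ, fun f hf hf1 => ?_⟩
  have key : ∀ x ∈ Icc a b, ∀ y ∈ Icc a b, x ≤ y → |x - y| < δ →
      |prim a u f y - prim a u f x| < ε := by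
    intro x hx y hy hxy hd
    refine (W.abs_prim_sub_le hf hx hy hxy).trans_lt ?_
    have h1 := h x hx y hy hd
    rw [Real.dist_eq, abs_sub_comm, intervalIntegral.integral_interval_sub_left
      (intervalIntegrable_of_integrable W.integrable_u W.left_mem hy)
      (intervalIntegrable_of_integrable W.integrable_u W.left_mem hx)] at h1
    have h0 : 0 ≤ ∫ t in x..y, |u t| ^ p' :=
      intervalIntegral.integral_nonneg hxy fun t _ => by positivity
    rw [abs_of_nonneg h0] at h1
    have h2 : (∫ t in x..y, |u t| ^ p') ^ (1 / p') < ε := by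
      have := Real.rpow_lt_rpow h0 h1 (by positivity : 0 < 1 / p')
      rwa [← Real.rpow_mul hε.le, mul_one_div_cancel hp'.ne', Real.rpow_one] at this
    have h3 : (∫ t, |f t| ^ p ∂(vol a b)) ^ (1 / p) ≤ 1 :=
      Real.rpow_le_one integral_abs_rpow_nonneg hf1 (by have := W.p_pos; positivity)
    have h4 : 0 ≤ (∫ t in x..y, |u t| ^ p') ^ (1 / p') := by positivity
    nlinarith
  intro x hx y hy hd
  rcases le_total x y with hxy | hxy
  · rw [abs_sub_comm]; exact key x hx y hy hxy hd
  · exact key y hy x hx hxy (by rwa [abs_sub_comm])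

theorem memLp_v_mul (W : Weights a b p p' q u v) {G : ℝ → ℝ} (hG : ContinuousOn G (Icc a b)) :
    MemLp (fun x => v x * G x) (ENNReal.ofReal q) (vol a b) := by
  obtain ⟨C, hC⟩ := isCompact_Icc.exists_bound_of_continuousOn hG
  refine MemLp.of_le_mul (c := C) W.v_mem
    (W.v_mem.1.mul (hG.aestronglyMeasurable measurableSet_Icc)) ?_
  filter_upwards [ae_vol_mem] with x hx
  rw [norm_mul, mul_comm]
  exact mul_le_mul_of_nonneg_right (hC x hx) (norm_nonneg _)

theorem memLp_hardyT (W : Weights a b p p' q u v) {f : ℝ → ℝ}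
    (hf : MemLp f (ENNReal.ofReal p) (vol a b)) :
    MemLp (hardyT a u v f) (ENNReal.ofReal q) (vol a b) :=
  W.memLp_v_mul (W.continuousOn_prim hf)

theorem tendsto_integral_of_uniform (W : Weights a b p p' q u v) {ι : Type*} {l : Filter ι}
    [l.IsCountablyGenerated] {F : ι → ℝ → ℝ} {G : ℝ → ℝ}
    (hF : ∀ i, ContinuousOn (F i) (Icc a b)) (hG : ContinuousOn G (Icc a b))
    (h : TendstoUniformlyOn F G l (Icc a b)) :
    Tendsto (fun i => ∫ x, |v x * F i x| ^ q ∂(vol a b)) l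
      (𝓝 (∫ x, |v x * G x| ^ q ∂(vol a b))) := by
  obtain ⟨C, hC⟩ := isCompact_Icc.exists_bound_of_continuousOn hG
  refine tendsto_integral_filter_of_dominated_convergence (fun x => (C + 1) ^ q * |v x| ^ q)
    (Eventually.of_forall fun i =>
      (continuous_abs_rpow W.q_pos).comp_aestronglyMeasurable (W.memLp_v_mul (hF i)).1) ?_
    (W.integrable_v.const_mul _) ?_
  · filter_upwards [Metric.tendstoUniformlyOn_iff.1 h 1 one_pos] with i hi
    filter_upwards [ae_vol_mem] with x hx
    have h1 := hi x hx
    have h2 := hC x hx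
    rw [Real.norm_eq_abs, abs_of_nonneg (by positivity), abs_mul,
      Real.mul_rpow (abs_nonneg _) (abs_nonneg _), mul_comm]
    have h4 : |F i x| ≤ C + 1 := by
      rw [Real.dist_eq] at h1
      rw [Real.norm_eq_abs] at h2
      have := abs_sub_abs_le_abs_sub (F i x) (G x)
      rw [abs_sub_comm] at this
      linarith
    have := W.q_pos
    gcongr
  · filter_upwards [ae_vol_mem] with x hx
    exact (((h.tendsto_at hx).const_mul (v x)).abs).rpow_const (Or.inr W.q_pos.le)

theorem ac_prim (W : Weights a b p p' q u v) {f : ℝ → ℝ}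
    (hf : MemLp f (ENNReal.ofReal p) (vol a b)) :
    AbsolutelyContinuousOnInterval (prim a u f) a b :=
  (intervalIntegrable_of_integrable (W.integrable_mul hf) W.left_mem
    W.right_mem).absolutelyContinuousOnInterval_intervalIntegral left_mem_uIcc

theorem ae_hasDerivAt_prim (W : Weights a b p p' q u v) {f : ℝ → ℝ}
    (hf : MemLp f (ENNReal.ofReal p) (vol a b)) :
    ∀ᵐ x ∂(vol a b), HasDerivAt (prim a u f) (f x * u x) x := by
  rw [ae_vol_iff]
  filter_upwards [(intervalIntegrable_of_integrable (W.integrable_mul hf) W.left_mem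
    W.right_mem).ae_hasDerivAt_integral] with x hx hm
  rw [uIcc_of_le W.le] at hx
  exact hx hm a W.left_mem

/-- The criterion by which nonlinear expressions in primitives are recognized as primitives again:
absolute continuity, the value 0 at `a`, and a derivative divisible by `u`. -/
theorem prim_eq_of_ac (W : Weights a b p p' q u v) {G k : ℝ → ℝ}
    (hG : AbsolutelyContinuousOnInterval G a b) (h0 : G a = 0)
    (hk : ∀ᵐ x ∂(vol a b), HasDerivAt G (k x * u x) x) {x : ℝ} (hx : x ∈ Icc a b) :
    prim a u k x = G x := by
  have h1 := (hG.mono (c := a) (d := x) (by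
    rw [uIcc_of_le hx.1, uIcc_of_le W.le]; exact Icc_subset_Icc_right hx.2)).integral_deriv_eq_sub
  rw [h0, sub_zero] at h1
  rw [← h1]
  refine intervalIntegral.integral_congr_ae ?_
  filter_upwards [ae_vol_iff.1 hk] with t ht hm
  rw [uIoc_of_le hx.1] at hm
  exact ((ht ⟨hm.1.le, hm.2.trans hx.2⟩).deriv).symm

theorem aesm_div_u (W : Weights a b p p' q u v) {h : ℝ → ℝ}
    (hh : AEStronglyMeasurable h (vol a b)) :
    AEStronglyMeasurable (fun x => h x / u x) (vol a b) :=
  (hh.aemeasurable.div W.u_mem.1.aemeasurable).aestronglyMeasurable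

/-- Composing a primitive with a contraction gives a primitive. -/
theorem exists_prim_eq_comp (W : Weights a b p p' q u v) {f : ℝ → ℝ}
    (hf : MemLp f (ENNReal.ofReal p) (vol a b)) {φ : ℝ → ℝ} (hφ : LipschitzWith 1 φ)
    (h0 : φ 0 = 0) :
    ∃ k : ℝ → ℝ, MemLp k (ENNReal.ofReal p) (vol a b) ∧
      ∫ x, |k x| ^ p ∂(vol a b) ≤ ∫ x, |f x| ^ p ∂(vol a b) ∧
      ∀ x ∈ Icc a b, prim a u k x = φ (prim a u f x) := by
  set G : ℝ → ℝ := fun x => φ (prim a u f x) with hG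
  have hac : AbsolutelyContinuousOnInterval G a b :=
    AbsolutelyContinuousOnInterval.comp_lipschitz (W.ac_prim hf) hφ.lipschitzOnWith
      (mapsTo_univ _ _)
  let k : ℝ → ℝ := fun x => deriv G x / u x
  have hkG : ∀ᵐ x ∂(vol a b), HasDerivAt G (k x * u x) x := by
    have := hac.ae_differentiableAt
    rw [uIcc_of_le W.le, ← ae_vol_iff] at this
    filter_upwards [this, ae_vol_mem] with x hx hm
    simp only [k]
    rw [div_mul_cancel₀ _ (W.u_pos x hm).ne']
    exact hx.hasDerivAt
  have hkf : ∀ᵐ x ∂(vol a b), |k x| ≤ |f x| := by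
    filter_upwards [hkG, W.ae_hasDerivAt_prim hf, ae_vol_mem] with x h1 h2 hm
    have hu := W.u_pos x hm
    have e1 := (hasDerivAt_iff_tendsto_slope.1 h1).abs
    have e2 := (hasDerivAt_iff_tendsto_slope.1 h2).abs
    -- A contraction does not increase difference quotients in absolute value, so `|k| |u| ≤ |f|
    -- |u|` in the limit.
    have := le_of_tendsto_of_tendsto e1 e2 (Eventually.of_forall fun y => by
      simp only [slope_def_field, abs_div]
      have := hφ.dist_le_mul (prim a u f y) (prim a u f x)
      simp only [Real.dist_eq, NNReal.coe_one, one_mul] at this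
      exact div_le_div_of_nonneg_right this (abs_nonneg _))
    rw [abs_mul, abs_mul] at this
    exact le_of_mul_le_mul_right this (abs_pos.2 hu.ne')
  have hk : MemLp k (ENNReal.ofReal p) (vol a b) :=
    hf.mono (W.aesm_div_u (stronglyMeasurable_deriv G).aestronglyMeasurable) hkf
  refine ⟨k, hk, ?_, fun x hx => W.prim_eq_of_ac hac (by simp [hG, prim_self, h0]) hkG hx⟩
  refine integral_mono_ae (MemLp.integrable_abs_rpow W.p_pos hk)
    (MemLp.integrable_abs_rpow W.p_pos hf) ?_
  filter_upwards [hkf] with x hx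
  exact Real.rpow_le_rpow (abs_nonneg _) hx W.p_pos.le

/-- Changing signs of a primitive on the components of the complement of a finite set on which it
vanishes. -/
theorem prim_mul_eq (W : Weights a b p p' q u v) {k s : ℝ → ℝ}
    (hk : MemLp k (ENNReal.ofReal p) (vol a b)) (hs : AEStronglyMeasurable s (vol a b))
    (hs1 : ∀ x, |s x| ≤ 1) {Z : Set ℝ} (hZ : Z.Finite)
    (hloc : ∀ x ∈ Ioo a b, x ∉ Z → ∀ᶠ y in 𝓝 x, s y = s x)
    (h0 : ∀ x ∈ Ioo a b, x ∈ Z → prim a u k x = 0) :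
    MemLp (fun x => s x * k x) (ENNReal.ofReal p) (vol a b) ∧
      ∀ x ∈ Ico a b, prim a u (fun x => s x * k x) x = s x * prim a u k x := by
  have hsk : MemLp (fun x => s x * k x) (ENNReal.ofReal p) (vol a b) := by
    refine MemLp.mono hk (hs.mul hk.1) (ae_of_all _ fun x => ?_)
    rw [norm_mul]
    exact mul_le_of_le_one_left (norm_nonneg _) (hs1 x)
  refine ⟨hsk, fun x₁ hx₁ => ?_⟩
  -- The argument stops at `x₁ < b` because `s` may jump at `b`, where `prim a u k` need not vanish.
  -- Below `b`, the difference `D` of the two sides is continuous (on `Z` because the primitive of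
  -- `k` vanishes there) and locally constant off `Z`, hence zero.
  have hsub : Icc a x₁ ⊆ Icc a b := Icc_subset_Icc_right hx₁.2.le
  have hcK : ContinuousOn (prim a u k) (Icc a x₁) := (W.continuousOn_prim hk).mono hsub
  set D : ℝ → ℝ := fun x => prim a u (fun x => s x * k x) x - s x * prim a u k x with hDdef
  have hzero : ∀ x ∈ Icc a x₁, prim a u k x = 0 →
      ContinuousWithinAt (fun x => s x * prim a u k x) (Icc a x₁) x := by
    intro x hx hz
    have h1 : Tendsto (fun y => prim a u k y) (𝓝[Icc a x₁] x) (𝓝 0) := by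
      have := hcK x hx; rwa [ContinuousWithinAt, hz] at this
    rw [ContinuousWithinAt, hz, mul_zero]
    refine squeeze_zero_norm (fun y => ?_) (by simpa using h1.abs)
    rw [norm_mul]
    exact mul_le_of_le_one_left (norm_nonneg _) (hs1 y)
  have hsK : ContinuousOn (fun x => s x * prim a u k x) (Icc a x₁) := by
    intro x hx
    rcases hx.1.eq_or_lt with rfl | hax
    · exact hzero _ hx (prim_self k)
    have hxb := hx.2.trans_lt hx₁.2
    by_cases hxZ : x ∈ Z
    · exact hzero _ hx (h0 x ⟨hax, hxb⟩ hxZ)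
    · refine ((hcK x hx).const_smul (s x)).congr_of_eventuallyEq ?_ rfl
      filter_upwards [(hloc x ⟨hax, hxb⟩ hxZ).filter_mono nhdsWithin_le_nhds] with y hy
      simp [hy]
  have hD : ContinuousOn D (Icc a x₁) := ((W.continuousOn_prim hsk).mono hsub).sub hsK
  have key := eq_left_of_hasDerivAt_zero_off_countable hZ.countable hD ?_
  · have := key x₁ ⟨hx₁.1, le_rfl⟩
    simp only [hDdef, prim_self, mul_zero, sub_zero] at this
    linarith
  · rintro x ⟨hx', hxZ⟩
    have hx : x ∈ Ioo a b := ⟨hx'.1, hx'.2.trans hx₁.2⟩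
    obtain ⟨ε, hε, hball⟩ := Metric.eventually_nhds_iff_ball.1
      ((hloc x hx hxZ).and (Ioo_mem_nhds hx.1 hx.2))
    have hev : D =ᶠ[𝓝 x] fun _ => D x := by
      filter_upwards [Metric.ball_mem_nhds x hε] with y hy
      have hxm : x ∈ Icc a b := Ioo_subset_Icc_self hx
      have hym : y ∈ Icc a b := Ioo_subset_Icc_self (hball y hy).2
      have e1 := W.prim_sub hsk hxm hym
      have e2 := W.prim_sub hk hxm hym
      have e3 : ∫ t in x..y, s t * k t * u t = s x * ∫ t in x..y, k t * u t := by
        rw [← intervalIntegral.integral_const_mul]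
        refine intervalIntegral.integral_congr fun t ht => ?_
        have : t ∈ Metric.ball x ε :=
          ((convex_ball x ε).ordConnected.uIcc_subset (Metric.mem_ball_self hε) hy) ht
        rw [(hball t this).1]; ring
      simp only [hDdef]
      rw [(hball y hy).1]
      rw [e3, ← e2] at e1
      linarith
    exact (hasDerivAt_const x (D x)).congr_of_eventuallyEq hev

/-- Continuous functions that agree on `[a, b)` agree at `b`. -/
theorem eq_right_of_eq_Ico (W : Weights a b p p' q u v) {F G : ℝ → ℝ}
    (hF : ContinuousOn F (Icc a b)) (hG : ContinuousOn G (Icc a b))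
    (h : ∀ x ∈ Ico a b, F x = G x) : F b = G b := by
  have hne : (𝓝[Ico a b] b).NeBot := by
    rw [← mem_closure_iff_nhdsWithin_neBot, closure_Ico W.hab.ne]; exact W.right_mem
  have h1 := (hF b W.right_mem).mono_left (nhdsWithin_mono b Ico_subset_Icc_self)
  have h2 := (hG b W.right_mem).mono_left (nhdsWithin_mono b Ico_subset_Icc_self)
  refine tendsto_nhds_unique h1 (h2.congr' ?_)
  filter_upwards [self_mem_nhdsWithin] with x hx using (h x hx).symm

theorem prim_right_eq_zero (W : Weights a b p p' q u v) {k l s : ℝ → ℝ}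
    (hk : MemLp k (ENNReal.ofReal p) (vol a b)) (hl : MemLp l (ENNReal.ofReal p) (vol a b))
    (hs1 : ∀ x, |s x| ≤ 1) (h : ∀ x ∈ Ico a b, prim a u l x = s x * prim a u k x)
    (hb : prim a u k b = 0) : prim a u l b = 0 := by
  have hne : (𝓝[Ico a b] b).NeBot := by
    rw [← mem_closure_iff_nhdsWithin_neBot, closure_Ico W.hab.ne]; exact W.right_mem
  have h1 := (W.continuousOn_prim hl b W.right_mem).mono_left
    (nhdsWithin_mono b Ico_subset_Icc_self)
  have h2 := (W.continuousOn_prim hk b W.right_mem).mono_left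
    (nhdsWithin_mono b Ico_subset_Icc_self)
  rw [hb] at h2
  refine tendsto_nhds_unique h1 (squeeze_zero_norm' ?_ (by simpa using h2.abs))
  filter_upwards [self_mem_nhdsWithin] with x hx
  rw [h x hx, norm_mul]
  exact mul_le_of_le_one_left (norm_nonneg _) (hs1 x)

end Weights

end HardySpectral

/-! ### The extremal problem for prescribed zeros: semicontinuity, compactness, existence -/

namespace HardySpectral

variable {a b p p' q : ℝ} {u v : ℝ → ℝ}

/-- The `r`-th power of the `L_r` norm on `[a, b]`. -/
noncomputable def energy (r a b : ℝ) (f : ℝ → ℝ) : ℝ := ∫ x, |f x| ^ r ∂(vol a b)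

theorem energy_nonneg (r a b : ℝ) (f : ℝ → ℝ) : 0 ≤ energy r a b f := integral_abs_rpow_nonneg

theorem energy_const_mul (r a b c : ℝ) (f : ℝ → ℝ) :
    energy r a b (fun x => c * f x) = |c| ^ r * energy r a b f := by
  simp only [energy, abs_mul, Real.mul_rpow (abs_nonneg _) (abs_nonneg _), integral_const_mul]

theorem hardyT_const_mul (c : ℝ) (f : ℝ → ℝ) :
    hardyT a u v (fun t => c * f t) = fun x => c * hardyT a u v f x := by
  ext x; simp only [hardyT_eq, prim_const_mul]; ring

/-- `f ∈ L_p` such that the primitive of `f u` vanishes at all points `P i`. -/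
def Admissible (a b p : ℝ) (u : ℝ → ℝ) {n : ℕ} (P : Fin n → ℝ) (f : ℝ → ℝ) : Prop :=
  MemLp f (ENNReal.ofReal p) (vol a b) ∧ ∀ i, prim a u f (P i) = 0

/-- The supremum of `‖T f‖_q ^ q` over the admissible functions `f` with `‖f‖_p ≤ 1`. -/
noncomputable def supRatio (a b p q : ℝ) (u v : ℝ → ℝ) {n : ℕ} (P : Fin n → ℝ) : ℝ :=
  sSup {y | ∃ f, Admissible a b p u P f ∧ energy p a b f ≤ 1 ∧ energy q a b (hardyT a u v f) = y}

/-- `f` is a normalized extremal function for the points `P`. -/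
structure IsExtremal (a b p q : ℝ) (u v : ℝ → ℝ) {n : ℕ} (P : Fin n → ℝ)
    (f : ℝ → ℝ) : Prop where
  adm : Admissible a b p u P f
  energy_eq : energy p a b f = 1
  energy_T : energy q a b (hardyT a u v f) = supRatio a b p q u v P

/-- Soft thresholding. -/
noncomputable def shrink (δ y : ℝ) : ℝ := y - max (-δ) (min y δ)

theorem shrink_lipschitz (δ : ℝ) : LipschitzWith 1 (shrink δ) := by
  refine LipschitzWith.of_dist_le_mul fun x y => ?_
  simp only [Real.dist_eq, shrink, NNReal.coe_one, one_mul]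
  have : ∀ x y : ℝ, x ≤ y → |x - max (-δ) (min x δ) - (y - max (-δ) (min y δ))| ≤ |x - y| := by
    intro x y hxy
    rw [abs_of_nonpos (by linarith : x - y ≤ 0), abs_le]
    rcases max_cases (-δ) (min x δ) with h1 | h1 <;> rcases max_cases (-δ) (min y δ) with h2 | h2 <;>
    rcases min_cases x δ with h3 | h3 <;> rcases min_cases y δ with h4 | h4 <;>
    constructor <;> linarith
  rcases le_total x y with h | h
  · exact this x y h
  · rw [abs_sub_comm, abs_sub_comm x y]; exact this y x h

theorem shrink_eq_zero {δ y : ℝ} (h : |y| ≤ δ) : shrink δ y = 0 := by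
  rw [abs_le] at h
  rw [shrink, min_eq_left h.2, max_eq_right h.1, sub_self]

theorem abs_sub_shrink_le {δ y : ℝ} (hδ : 0 ≤ δ) : |y - shrink δ y| ≤ δ := by
  rw [shrink, sub_sub_cancel, abs_le]
  exact ⟨le_max_left _ _, max_le (by linarith) (min_le_right _ _)⟩

namespace Weights

theorem memLp_one (_W : Weights a b p p' q u v) :
    MemLp (fun _ => (1:ℝ)) (ENNReal.ofReal p) (vol a b) :=
  memLp_const 1

theorem energy_one (W : Weights a b p p' q u v) (r : ℝ) : energy r a b (fun _ => 1) = b - a := by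
  simp [energy, W.le]

theorem prim_one_lt (W : Weights a b p p' q u v) {x y : ℝ} (hx : x ∈ Icc a b) (hy : y ∈ Icc a b)
    (hxy : x < y) : prim a u (fun _ => 1) x < prim a u (fun _ => 1) y := by
  have := W.prim_sub W.memLp_one hx hy
  have h2 : 0 < ∫ t in x..y, 1 * u t :=
    intervalIntegral.intervalIntegral_pos_of_pos_on
      (intervalIntegrable_of_integrable (W.integrable_mul W.memLp_one) hx hy)
      (fun t ht => by rw [one_mul]; exact W.u_pos t ⟨hx.1.trans ht.1.le, ht.2.le.trans hy.2⟩) hxy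
  linarith

theorem prim_one_le (W : Weights a b p p' q u v) {x y : ℝ} (hx : x ∈ Icc a b) (hy : y ∈ Icc a b)
    (hxy : x ≤ y) : prim a u (fun _ => 1) x ≤ prim a u (fun _ => 1) y := by
  rcases hxy.eq_or_lt with rfl | h
  · exact le_rfl
  · exact (W.prim_one_lt hx hy h).le

/-- A function whose primitive is a bump supported in `[c, d]`. -/
theorem exists_bump (W : Weights a b p p' q u v) {c : ℝ} (hc : c ∈ Icc a b) (y : ℝ) :
    ∃ k, MemLp k (ENNReal.ofReal p) (vol a b) ∧ energy p a b k ≤ b - a ∧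
      ∀ x ∈ Icc a b, prim a u k x =
        max 0 (min (prim a u (fun _ => 1) x - prim a u (fun _ => 1) c)
          (y - prim a u (fun _ => 1) x)) := by
  set G := prim a u (fun _ => 1)
  have hGc : 0 ≤ G c := by
    have := W.prim_one_le W.left_mem hc hc.1; rwa [prim_self] at this
  have hL : LipschitzWith 1 fun t : ℝ => max 0 (min (t - G c) (y - t)) := by
    have h1 : LipschitzWith 1 fun t : ℝ => t - G c := by
      simpa using LipschitzWith.id.sub (LipschitzWith.const (G c))
    have h2 : LipschitzWith 1 fun t : ℝ => y - t := by
      simpa using (LipschitzWith.const y).sub LipschitzWith.id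
    have h3 : LipschitzWith 1 fun t : ℝ => min (t - G c) (y - t) := by
      simpa using h1.min h2
    simpa using h3.const_max 0
  obtain ⟨k, hk, hke, hkG⟩ := W.exists_prim_eq_comp W.memLp_one hL (by
    rw [max_eq_left]; exact (min_le_left _ _).trans (by linarith))
  refine ⟨k, hk, ?_, hkG⟩
  exact hke.trans_eq (W.energy_one p)

theorem exists_bump_Ioo (W : Weights a b p p' q u v) {c d : ℝ} (hc : c ∈ Icc a b)
    (hd : d ∈ Icc a b) :
    ∃ k, MemLp k (ENNReal.ofReal p) (vol a b) ∧ energy p a b k ≤ b - a ∧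
      (∀ x ∈ Icc a b, x ∉ Ioo c d → prim a u k x = 0) ∧
      (∀ x ∈ Ioo c d, 0 < prim a u k x) := by
  obtain ⟨k, hk, hke, h⟩ := W.exists_bump hc (prim a u (fun _ => 1) d)
  refine ⟨k, hk, hke, fun x hx hxn => ?_, fun x hx => ?_⟩
  · rw [h x hx, max_eq_left]
    rcases le_or_gt x c with hxc | hxc
    · exact (min_le_left _ _).trans (by linarith [W.prim_one_le hx hc hxc])
    · have hdx : d ≤ x := by by_contra! hh; exact hxn ⟨hxc, hh⟩
      exact (min_le_right _ _).trans (by linarith [W.prim_one_le hd hx hdx])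
  · have hx' : x ∈ Icc a b := ⟨hc.1.trans hx.1.le, hx.2.le.trans hd.2⟩
    rw [h x hx']
    refine lt_max_of_lt_right (lt_min ?_ ?_)
    · linarith [W.prim_one_lt hc hx' hx.1]
    · linarith [W.prim_one_lt hx' hd hx.2]

theorem exists_bump_Ioc (W : Weights a b p p' q u v) {c : ℝ} (hc : c ∈ Icc a b) :
    ∃ k, MemLp k (ENNReal.ofReal p) (vol a b) ∧
      (∀ x ∈ Icc a c, prim a u k x = 0) ∧ (∀ x ∈ Ioc c b, 0 < prim a u k x) := by
  obtain ⟨k, hk, -, h⟩ := W.exists_bump hc (prim a u (fun _ => 1) b + 1)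
  refine ⟨k, hk, fun x hx => ?_, fun x hx => ?_⟩
  · have hx' : x ∈ Icc a b := ⟨hx.1, hx.2.trans hc.2⟩
    rw [h x hx', max_eq_left]
    exact (min_le_left _ _).trans (by linarith [W.prim_one_le hx' hc hx.2])
  · have hx' : x ∈ Icc a b := ⟨hc.1.trans hx.1.le, hx.2⟩
    rw [h x hx']
    refine lt_max_of_lt_right (lt_min ?_ ?_)
    · linarith [W.prim_one_lt hc hx' hx.1]
    · linarith [W.prim_one_le hx' W.right_mem hx.2]

/-- `‖T f‖_q` is positive as soon as the primitive is nonzero somewhere in the interval. -/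
theorem energy_hardyT_pos (W : Weights a b p p' q u v) {f : ℝ → ℝ}
    (hf : MemLp f (ENNReal.ofReal p) (vol a b)) {x : ℝ} (hx : x ∈ Icc a b)
    (h : prim a u f x ≠ 0) : 0 < energy q a b (hardyT a u v f) := by
  have hq := W.q_pos
  have hint := MemLp.integrable_abs_rpow hq (W.memLp_hardyT hf)
  refine lt_of_le_of_ne (energy_nonneg _ _ _ _) fun h0 => h ?_
  have hz := (integral_eq_zero_iff_of_nonneg (fun x => by positivity) hint).1 h0.symm
  have hz2 : prim a u f =ᵐ[vol a b] 0 := by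
    filter_upwards [hz, ae_vol_mem] with t ht hm
    have : hardyT a u v f t = 0 := by
      have h1 : |hardyT a u v f t| ^ q = 0 := ht
      rw [Real.rpow_eq_zero (abs_nonneg _) hq.ne'] at h1
      simpa using h1
    rw [hardyT_eq] at this
    exact (mul_eq_zero.1 this).resolve_left (W.v_pos t hm).ne'
  have := Measure.eqOn_Icc_of_ae_eq volume W.hab.ne hz2 (W.continuousOn_prim hf)
    continuousOn_const
  exact this hx

theorem energy_hardyT_le (W : Weights a b p p' q u v) {f : ℝ → ℝ}
    (hf : MemLp f (ENNReal.ofReal p) (vol a b)) (h1 : energy p a b f ≤ 1) :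
    energy q a b (hardyT a u v f) ≤
      ((∫ t, |u t| ^ p' ∂(vol a b)) ^ (1 / p')) ^ q * ∫ t, |v t| ^ q ∂(vol a b) := by
  rw [← integral_const_mul]
  refine integral_mono_ae (MemLp.integrable_abs_rpow W.q_pos (W.memLp_hardyT hf))
    (W.integrable_v.const_mul _) ?_
  filter_upwards [ae_vol_mem] with x hx
  rw [hardyT_eq, abs_mul, Real.mul_rpow (abs_nonneg _) (abs_nonneg _), mul_comm]
  have h2 := W.abs_prim_le hf hx
  have h3 : energy p a b f ^ (1 / p) ≤ 1 :=
    Real.rpow_le_one (energy_nonneg _ _ _ _) h1 (by have := W.p_pos; positivity)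
  have h4 : |prim a u f x| ≤ (∫ t, |u t| ^ p' ∂(vol a b)) ^ (1 / p') :=
    h2.trans (mul_le_of_le_one_left (Real.rpow_nonneg integral_abs_rpow_nonneg _) h3)
  have := W.q_pos
  gcongr

theorem bddAbove (W : Weights a b p p' q u v) {n : ℕ} (P : Fin n → ℝ) :
    BddAbove {y | ∃ f, Admissible a b p u P f ∧ energy p a b f ≤ 1 ∧
      energy q a b (hardyT a u v f) = y} := by
  refine ⟨((∫ t, |u t| ^ p' ∂(vol a b)) ^ (1 / p')) ^ q * ∫ t, |v t| ^ q ∂(vol a b), ?_⟩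
  rintro y ⟨f, hf, h1, rfl⟩
  exact W.energy_hardyT_le hf.1 h1

theorem energy_le_supRatio (W : Weights a b p p' q u v) {n : ℕ} {P : Fin n → ℝ} {f : ℝ → ℝ}
    (hf : Admissible a b p u P f) (h1 : energy p a b f ≤ 1) :
    energy q a b (hardyT a u v f) ≤ supRatio a b p q u v P :=
  le_csSup (W.bddAbove P) ⟨f, hf, h1, rfl⟩

theorem prim_eq_zero_of_energy (W : Weights a b p p' q u v) {f : ℝ → ℝ}
    (hf : MemLp f (ENNReal.ofReal p) (vol a b)) (h : energy p a b f = 0) {x : ℝ}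
    (hx : x ∈ Icc a b) : prim a u f x = 0 := by
  have h2 := W.abs_prim_le hf hx
  rw [energy] at h
  rw [h, Real.zero_rpow (by have := W.p_pos; positivity), zero_mul] at h2
  exact abs_nonpos_iff.1 h2

end Weights

theorem Admissible.const_mul {n : ℕ} {P : Fin n → ℝ} {f : ℝ → ℝ} (hf : Admissible a b p u P f)
    (c : ℝ) : Admissible a b p u P fun x => c * f x :=
  ⟨hf.1.const_mul c, fun i => by rw [prim_const_mul, hf.2 i, mul_zero]⟩

namespace Weights

theorem admissible_add (W : Weights a b p p' q u v) {n : ℕ} {P : Fin n → ℝ}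
    (hP : ∀ i, P i ∈ Icc a b) {f g : ℝ → ℝ} (hf : Admissible a b p u P f)
    (hg : Admissible a b p u P g) : Admissible a b p u P fun x => f x + g x :=
  ⟨hf.1.add hg.1, fun i => by rw [W.prim_add hf.1 hg.1 (hP i), hf.2 i, hg.2 i, add_zero]⟩

/-- Scaling: the two sides of the normalized inequality have degrees `q` and `p`, which accounts for
the exponent `q / p`. If the energy of `f` is 0, both sides vanish. -/
theorem energy_le_mul_rpow (W : Weights a b p p' q u v) {n : ℕ} {P : Fin n → ℝ} {f : ℝ → ℝ}
    (hf : Admissible a b p u P f) :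
    energy q a b (hardyT a u v f) ≤ supRatio a b p q u v P * energy p a b f ^ (q / p) := by
  have hp := W.p_pos
  have hq := W.q_pos
  rcases (energy_nonneg p a b f).eq_or_lt with h0 | hpos
  · rw [← h0, Real.zero_rpow (by positivity), mul_zero]
    refine le_of_eq ?_
    rw [energy, ← integral_zero ℝ ℝ (μ := vol a b)]
    refine integral_congr_ae ?_
    filter_upwards [ae_vol_mem] with x hx
    rw [hardyT_eq, W.prim_eq_zero_of_energy hf.1 h0.symm hx, mul_zero, abs_zero,
      Real.zero_rpow hq.ne']
  · set M := energy p a b f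
    set c := M ^ (-(1 / p))
    have hc : 0 < c := Real.rpow_pos_of_pos hpos _
    have h1 := W.energy_le_supRatio (hf.const_mul c) (by
      rw [energy_const_mul, abs_of_pos hc, ← Real.rpow_mul hpos.le, neg_mul,
        one_div_mul_cancel hp.ne', Real.rpow_neg_one]
      exact (inv_mul_cancel₀ hpos.ne').le)
    rw [hardyT_const_mul, energy_const_mul, abs_of_pos hc, ← Real.rpow_mul hpos.le] at h1
    have h2 : M ^ (-(1 / p) * q) = (M ^ (q / p))⁻¹ := by
      rw [← Real.rpow_neg hpos.le]; congr 1; ring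
    rw [h2, inv_mul_le_iff₀ (by positivity), mul_comm] at h1
    exact h1

/-- Some open subinterval of a nonempty open interval avoids a given finite set. -/
theorem exists_Ioo_disjoint {n : ℕ} (P : Fin n → ℝ) {x y : ℝ} (hxy : x < y) :
    ∃ c d, x ≤ c ∧ c < d ∧ d ≤ y ∧ ∀ i, P i ∉ Ioo c d := by
  have hfin : (range P).Finite := finite_range P
  obtain ⟨z, hz, hzP⟩ : ∃ z ∈ Ioo x y, z ∉ range P := by
    by_contra! h
    exact (Ioo_infinite hxy) (hfin.subset h)
  have hopen : IsOpen (Ioo x y \ range P) := isOpen_Ioo.sdiff hfin.isClosed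
  obtain ⟨c, d, hzc, hsub⟩ := mem_nhds_iff_exists_Ioo_subset.1 (hopen.mem_nhds ⟨hz, hzP⟩)
  have hcd := hzc.1.trans hzc.2
  have h3 : Icc c d ⊆ Icc x y := by
    rw [← closure_Ioo hcd.ne]
    exact closure_minimal ((hsub.trans sdiff_subset).trans Ioo_subset_Icc_self) isClosed_Icc
  exact ⟨c, d, (h3 (left_mem_Icc.2 hcd.le)).1, hcd, (h3 (right_mem_Icc.2 hcd.le)).2,
    fun i hi => (hsub hi).2 (mem_range_self i)⟩

theorem supRatio_pos (W : Weights a b p p' q u v) {n : ℕ} {P : Fin n → ℝ}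
    (hP : ∀ i, P i ∈ Icc a b) : 0 < supRatio a b p q u v P := by
  obtain ⟨c, d, hac, hcd, hdb, hd⟩ := exists_Ioo_disjoint P W.hab
  have hc' : c ∈ Icc a b := ⟨hac, hcd.le.trans hdb⟩
  have hd' : d ∈ Icc a b := ⟨hac.trans hcd.le, hdb⟩
  obtain ⟨k, hk, -, h0, hpos⟩ := W.exists_bump_Ioo hc' hd'
  have hadm : Admissible a b p u P k := ⟨hk, fun i => h0 _ (hP i) (hd i)⟩
  have hm : (c + d) / 2 ∈ Ioo c d := ⟨by linarith, by linarith⟩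
  have h1 := W.energy_hardyT_pos hk (x := (c + d) / 2)
    ⟨hac.trans hm.1.le, hm.2.le.trans hdb⟩ (hpos _ hm).ne'
  have h2 := W.energy_le_mul_rpow hadm
  have h3 : 0 ≤ energy p a b k ^ (q / p) := Real.rpow_nonneg (energy_nonneg _ _ _ _) _
  by_contra! hneg
  nlinarith

/-- Soft thresholding at the sum of the values `|F(P i)|` annihilates the primitive at all points at
once and moves it by at most that sum. Being a contraction, it does not increase the norm of the
density. Thus almost admissible functions become admissible. -/
theorem exists_admissible_shrink (W : Weights a b p p' q u v) {n : ℕ} {P : Fin n → ℝ}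
    (hP : ∀ i, P i ∈ Icc a b) {f : ℝ → ℝ} (hf : MemLp f (ENNReal.ofReal p) (vol a b)) :
    ∃ k, Admissible a b p u P k ∧ energy p a b k ≤ energy p a b f ∧
      ∀ x ∈ Icc a b, prim a u k x = shrink (∑ i, |prim a u f (P i)|) (prim a u f x) := by
  obtain ⟨k, hk, hke, hkp⟩ := W.exists_prim_eq_comp hf (shrink_lipschitz (∑ i, |prim a u f (P i)|))
    (shrink_eq_zero (by rw [abs_zero]; exact Finset.sum_nonneg fun _ _ => abs_nonneg _))
  refine ⟨k, ⟨hk, fun i => ?_⟩, hke, hkp⟩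
  rw [hkp _ (hP i)]
  exact shrink_eq_zero (Finset.single_le_sum (f := fun i => |prim a u f (P i)|)
    (fun _ _ => abs_nonneg _) (Finset.mem_univ i))

theorem continuousOn_shrink_prim (W : Weights a b p p' q u v) {f : ℝ → ℝ}
    (hf : MemLp f (ENNReal.ofReal p) (vol a b)) (δ : ℝ) :
    ContinuousOn (fun x => shrink δ (prim a u f x)) (Icc a b) :=
  (shrink_lipschitz δ).continuous.comp_continuousOn (W.continuousOn_prim hf)

theorem energy_hardyT_congr {f G : ℝ → ℝ} (h : ∀ x ∈ Icc a b, prim a u f x = G x) :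
    energy q a b (hardyT a u v f) = ∫ x, |v x * G x| ^ q ∂(vol a b) := by
  refine integral_congr_ae ?_
  filter_upwards [ae_vol_mem] with x hx
  rw [hardyT_eq, h x hx]

theorem tendstoUniformlyOn_shrink {ι : Type*} {l : Filter ι} {F : ι → ℝ → ℝ} {G : ℝ → ℝ}
    {δ : ι → ℝ} (hδ : Tendsto δ l (𝓝 0)) (hδ0 : ∀ i, 0 ≤ δ i)
    (h : TendstoUniformlyOn F G l (Icc a b)) :
    TendstoUniformlyOn (fun i x => shrink (δ i) (F i x)) G l (Icc a b) := by
  rw [Metric.tendstoUniformlyOn_iff] at h ⊢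
  intro ε hε
  filter_upwards [h (ε / 2) (by positivity), hδ.eventually (gt_mem_nhds (half_pos hε))]
    with i h1 h2 x hx
  have e1 := h1 x hx
  have e2 := abs_sub_shrink_le (y := F i x) (hδ0 i)
  rw [Real.dist_eq] at e1 ⊢
  have := abs_sub_le (G x) (F i x) (shrink (δ i) (F i x))
  linarith

/-- A nearly maximizing function for `P` becomes admissible for a nearby `P'` after thresholding at
`∑ |F(P' i)|`, which tends to 0; uniform convergence of the primitives makes the loss in `‖Tf‖_q`
negligible. -/
theorem supRatio_lsc (W : Weights a b p p' q u v) {n : ℕ} :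
    LowerSemicontinuousOn (fun P : Fin n → ℝ => supRatio a b p q u v P)
      (univ.pi fun _ => Icc a b) := by
  intro P hP y hy
  have hP' : ∀ i, P i ∈ Icc a b := fun i => hP i (mem_univ i)
  obtain ⟨z, ⟨f, hf, hf1, rfl⟩, hyz⟩ := exists_lt_of_lt_csSup (by
    refine ⟨_, fun _ => 0, ⟨MemLp.zero, fun i => by simp [prim]⟩, ?_, rfl⟩
    simp [energy, Real.zero_rpow W.p_pos.ne']) hy
  have hcf := W.continuousOn_prim hf.1
  have hδ : Tendsto (fun P' : Fin n → ℝ => ∑ i, |prim a u f (P' i)|)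
      (𝓝[univ.pi fun _ => Icc a b] P) (𝓝 0) := by
    have h0 : (0:ℝ) = ∑ i : Fin n, |prim a u f (P i)| := by simp [hf.2]
    rw [h0]
    refine tendsto_finsetSum _ fun i _ => Tendsto.abs ?_
    refine (hcf (P i) (hP' i)).tendsto.comp ?_
    refine tendsto_nhdsWithin_of_tendsto_nhds_of_eventually_within _
      ((continuous_apply i).continuousAt.tendsto.mono_left nhdsWithin_le_nhds) ?_
    filter_upwards [self_mem_nhdsWithin] with P' hP'
    exact hP' i (mem_univ i)
  have hu := tendstoUniformlyOn_shrink hδ (fun _ => Finset.sum_nonneg fun _ _ => abs_nonneg _)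
    (F := fun _ => prim a u f) (G := prim a u f) (a := a) (b := b) (by
      rw [Metric.tendstoUniformlyOn_iff]; intro ε hε; simp [hε])
  have ht := W.tendsto_integral_of_uniform
    (fun P' => W.continuousOn_shrink_prim hf.1 _) hcf hu
  have hev := ht.eventually (lt_mem_nhds (a := y) hyz)
  filter_upwards [hev, self_mem_nhdsWithin] with P' h1 h2
  obtain ⟨k, hk, hke, hkp⟩ := W.exists_admissible_shrink (P := P')
    (fun i => h2 i (mem_univ i)) hf.1
  refine h1.trans_le ?_
  rw [← energy_hardyT_congr (q := q) (v := v) hkp]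
  exact W.energy_le_supRatio hk (hke.trans hf1)

theorem exists_min_supRatio (W : Weights a b p p' q u v) (n : ℕ) :
    ∃ P : Fin n → ℝ, (∀ i, P i ∈ Icc a b) ∧ ∀ P' : Fin n → ℝ, (∀ i, P' i ∈ Icc a b) →
      supRatio a b p q u v P ≤ supRatio a b p q u v P' := by
  obtain ⟨P, hP, hmin⟩ := LowerSemicontinuousOn.exists_isMinOn
    (s := univ.pi fun _ : Fin n => Icc a b)
    ⟨fun _ => a, fun _ _ => W.left_mem⟩ (isCompact_univ_pi fun _ => isCompact_Icc) W.supRatio_lsc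
  exact ⟨P, fun i => hP i (mem_univ i), fun P' h => hmin fun i _ => h i⟩

/-- Maximizing sequences are relatively compact in `L_p`. -/
theorem exists_subseq_tendsto (W : Weights a b p p' q u v) {n : ℕ} {P : Fin n → ℝ}
    (hP : ∀ i, P i ∈ Icc a b) {f : ℕ → ℝ → ℝ}
    (hf : ∀ k, MemLp (f k) (ENNReal.ofReal p) (vol a b)) (hf1 : ∀ k, energy p a b (f k) ≤ 1)
    (hfP : ∀ i, Tendsto (fun k => prim a u (f k) (P i)) atTop (𝓝 0))
    (hN : Tendsto (fun k => energy q a b (hardyT a u v (f k))) atTop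
      (𝓝 (supRatio a b p q u v P))) :
    ∃ φ : ℕ → ℕ, StrictMono φ ∧ ∃ g, Admissible a b p u P g ∧ energy p a b g = 1 ∧
      energy q a b (hardyT a u v g) = supRatio a b p q u v P ∧
      Tendsto (fun k => ∫ x, |f (φ k) x - g x| ^ p ∂(vol a b)) atTop (𝓝 0) ∧
      ∀ x ∈ Icc a b, Tendsto (fun k => prim a u (f (φ k)) x) atTop (𝓝 (prim a u g x)) := by
  have hp := W.p_pos
  have hq := W.q_pos
  set S := supRatio a b p q u v P with hS
  have hSpos : 0 < S := W.supRatio_pos hP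
  obtain ⟨φ, hφ, G, hGc, hG⟩ := exists_subseq_tendstoUniformlyOn (a := a) (b := b)
    (F := fun k => prim a u (f k)) (B := (∫ t, |u t| ^ p' ∂(vol a b)) ^ (1 / p'))
    (fun k x hx => (W.abs_prim_le (hf k) hx).trans (mul_le_of_le_one_left
      (Real.rpow_nonneg integral_abs_rpow_nonneg _)
      (Real.rpow_le_one (energy_nonneg _ _ _ _) (hf1 k) (by positivity))))
    (fun ε hε => by
      obtain ⟨δ, hδ, h⟩ := W.prim_equicontinuous hε
      exact ⟨δ, hδ, fun k => h (f k) (hf k) (hf1 k)⟩)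
  have hNG : ∫ x, |v x * G x| ^ q ∂(vol a b) = S :=
    tendsto_nhds_unique (W.tendsto_integral_of_uniform
      (fun k => W.continuousOn_prim (hf (φ k))) hGc hG) (hN.comp hφ.tendsto_atTop)
  -- the midpoints of two late members of the sequence are almost extremal
  let mid : ℕ × ℕ → ℝ → ℝ := fun i x => 1 / 2 * (f (φ i.1) x + f (φ i.2) x)
  have hmid : ∀ i, MemLp (mid i) (ENNReal.ofReal p) (vol a b) := fun i =>
    ((hf _).add (hf _)).const_mul _
  have hmidp : ∀ i, ∀ x ∈ Icc a b, prim a u (mid i) x =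
      1 / 2 * (prim a u (f (φ i.1)) x + prim a u (f (φ i.2)) x) := fun i x hx => by
    simp only [mid]
    rw [prim_const_mul, W.prim_add (hf _) (hf _) hx]
  have hmidu : TendstoUniformlyOn (fun i => prim a u (mid i)) G (atTop ×ˢ atTop) (Icc a b) := by
    rw [Metric.tendstoUniformlyOn_iff] at hG ⊢
    intro ε hε
    filter_upwards [(hG ε hε).prod_mk (hG ε hε)] with i hi x hx
    have h1 := hi.1 x hx
    have h2 := hi.2 x hx
    rw [hmidp i x hx]
    rw [Real.dist_eq, abs_lt] at h1 h2 ⊢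
    constructor <;> linarith
  have hδ : Tendsto (fun i => ∑ j, |prim a u (mid i) (P j)|) (atTop ×ˢ atTop) (𝓝 0) := by
    have h0 : (0:ℝ) = ∑ j : Fin n, |(0:ℝ)| := by simp
    rw [h0]
    refine tendsto_finsetSum _ fun j _ => Tendsto.abs ?_
    have h1 := (hfP j).comp hφ.tendsto_atTop
    have h2 := ((h1.comp tendsto_fst).add (h1.comp tendsto_snd)).const_mul (1 / 2)
    rw [add_zero, mul_zero] at h2
    refine h2.congr fun i => ?_
    rw [hmidp i _ (hP j)]; rfl
  have hsh := W.tendsto_integral_of_uniform (fun i => W.continuousOn_shrink_prim (hmid i) _) hGc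
    (tendstoUniformlyOn_shrink hδ (fun _ => Finset.sum_nonneg fun _ _ => abs_nonneg _) hmidu)
  rw [hNG] at hsh
  -- The thresholded midpoint is admissible, so its `‖T ·‖_q ^ q` is at most `S` times a power of
  -- the energy of the midpoint. As the former tends to `S`, the midpoint energies tend to 1, and
  -- uniform convexity applies.
  have hlow : ∀ i, (∫ x, |v x * shrink (∑ j, |prim a u (mid i) (P j)|) (prim a u (mid i) x)| ^ q
      ∂(vol a b)) / S ≤ energy p a b (mid i) ^ (q / p) := by
    intro i
    obtain ⟨k, hk, hke, hkp⟩ := W.exists_admissible_shrink hP (hmid i)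
    rw [← energy_hardyT_congr (q := q) (v := v) hkp, div_le_iff₀ hSpos, mul_comm]
    refine (W.energy_le_mul_rpow hk).trans ?_
    exact mul_le_mul_of_nonneg_left (Real.rpow_le_rpow (energy_nonneg _ _ _ _) hke (by positivity))
      hSpos.le
  have hcau : Tendsto (fun i : ℕ × ℕ => ∫ x, |f (φ i.1) x - f (φ i.2) x| ^ p ∂(vol a b))
      (atTop ×ˢ atTop) (𝓝 0) := by
    rw [Metric.tendsto_nhds]
    intro ε hε
    obtain ⟨C, hC, hCf⟩ := integral_abs_sub_rpow_le (μ := vol a b) W.hp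
      (show 0 < ε / 4 by positivity)
    have hx : Tendsto (fun i => ((∫ x, |v x * shrink (∑ j, |prim a u (mid i) (P j)|)
        (prim a u (mid i) x)| ^ q ∂(vol a b)) / S) ^ (p / q)) (atTop ×ˢ atTop) (𝓝 1) := by
      have := (hsh.div_const S).rpow_const (p := p / q) (Or.inr (by positivity))
      rwa [div_self hSpos.ne', Real.one_rpow] at this
    have hev := hx.eventually (lt_mem_nhds (a := 1 - ε / (4 * C)) (by
      have : 0 < ε / (4 * C) := by positivity
      linarith))
    filter_upwards [hev] with i hi
    have h1 : 1 - ε / (4 * C) < energy p a b (mid i) := by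
      refine hi.trans_le ?_
      have h2 := Real.rpow_le_rpow (div_nonneg integral_abs_rpow_nonneg hSpos.le) (hlow i)
        (by positivity : 0 ≤ p / q)
      rw [← Real.rpow_mul (energy_nonneg _ _ _ _)] at h2
      have h3 : q / p * (p / q) = 1 := by field_simp
      rwa [h3, Real.rpow_one] at h2
    have h2 := hCf (hf (φ i.1)) (hf (φ i.2))
    have h3 : ∫ x, |(f (φ i.1) x + f (φ i.2) x) / 2| ^ p ∂(vol a b) = energy p a b (mid i) := by
      simp only [energy, mid]
      congr 1; ext x; congr 2; ring
    rw [h3] at h2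
    have e1 : ∫ x, |f (φ i.1) x| ^ p ∂(vol a b) ≤ 1 := hf1 _
    have e2 : ∫ x, |f (φ i.2) x| ^ p ∂(vol a b) ≤ 1 := hf1 _
    rw [Real.dist_eq, sub_zero, abs_of_nonneg integral_abs_rpow_nonneg]
    have e3 : C * (1 - energy p a b (mid i)) < ε / 4 := by
      have : 1 - energy p a b (mid i) < ε / (4 * C) := by linarith
      calc _ < C * (ε / (4 * C)) := by gcongr
        _ = ε / 4 := by field_simp
    have e4 : C * (((∫ x, |f (φ i.1) x| ^ p ∂(vol a b)) + ∫ x, |f (φ i.2) x| ^ p ∂(vol a b)) / 2 -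
        energy p a b (mid i)) ≤ C * (1 - energy p a b (mid i)) := by
      gcongr; linarith
    have e5 : ε / 4 * ((∫ x, |f (φ i.1) x| ^ p ∂(vol a b)) + ∫ x, |f (φ i.2) x| ^ p ∂(vol a b)) ≤
        ε / 4 * 2 := by gcongr; linarith
    linarith
  obtain ⟨g, hg, hgt⟩ := exists_tendsto_of_cauchy W.hp.le (fun k => hf (φ k)) hcau
  have hprim : ∀ x ∈ Icc a b, Tendsto (fun k => prim a u (f (φ k)) x) atTop
      (𝓝 (prim a u g x)) := by
    intro x hx
    rw [tendsto_iff_norm_sub_tendsto_zero]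
    have h1 := (hgt.rpow_const (p := 1 / p) (Or.inr (by positivity))).mul_const
      ((∫ t, |u t| ^ p' ∂(vol a b)) ^ (1 / p'))
    rw [Real.zero_rpow (by positivity), zero_mul] at h1
    refine squeeze_zero (fun _ => norm_nonneg _) (fun k => ?_) h1
    have h2 := W.abs_prim_le ((hf (φ k)).sub hg) hx
    have h3 : prim a u (f (φ k) - g) x = prim a u (f (φ k)) x - prim a u g x := by
      have := W.prim_add (hf (φ k)) (hg.const_mul (-1)) hx
      rw [prim_const_mul] at this
      rw [sub_eq_add_neg (prim a u (f (φ k)) x), ← neg_one_mul, ← this]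
      simp only [prim, Pi.sub_apply]
      congr 1; ext t; ring
    rw [h3] at h2
    exact h2
  have hgG : ∀ x ∈ Icc a b, prim a u g x = G x := fun x hx =>
    tendsto_nhds_unique (hprim x hx) (hG.tendsto_at hx)
  have hadm : Admissible a b p u P g := ⟨hg, fun i =>
    tendsto_nhds_unique (hprim _ (hP i)) ((hfP i).comp hφ.tendsto_atTop)⟩
  have hNg : energy q a b (hardyT a u v g) = S := by
    rw [energy_hardyT_congr hgG, hNG]
  refine ⟨φ, hφ, g, hadm, ?_, hNg, hgt, hprim⟩
  have hle : energy p a b g ≤ 1 :=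
    le_of_tendsto' (tendsto_integral_abs_rpow W.hp.le (fun k => hf (φ k)) hg hgt)
      fun k => hf1 (φ k)
  -- An energy below 1 would make `S ≤ S * M ^ (q / p)` fail.
  refine le_antisymm hle ?_
  by_contra! hlt
  have h1 := W.energy_le_mul_rpow hadm
  rw [hNg] at h1
  have h2 : energy p a b g ^ (q / p) < 1 :=
    Real.rpow_lt_one (energy_nonneg _ _ _ _) hlt (by positivity)
  nlinarith

theorem exists_extremal (W : Weights a b p p' q u v) {n : ℕ} {P : Fin n → ℝ}
    (hP : ∀ i, P i ∈ Icc a b) : ∃ f, IsExtremal a b p q u v P f := by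
  have hne : {y | ∃ f, Admissible a b p u P f ∧ energy p a b f ≤ 1 ∧
      energy q a b (hardyT a u v f) = y}.Nonempty := by
    refine ⟨_, fun _ => 0, ⟨MemLp.zero, fun i => by simp [prim]⟩, ?_, rfl⟩
    simp [energy, Real.zero_rpow W.p_pos.ne']
  obtain ⟨y, -, hy, hmem⟩ := exists_seq_tendsto_sSup hne (W.bddAbove P)
  choose f hf hf1 hfy using hmem
  obtain ⟨φ, -, g, h1, h2, h3, -⟩ := W.exists_subseq_tendsto hP (fun k => (hf k).1) hf1
    (fun i => by simp only [(hf _).2 i]; exact tendsto_const_nhds) (by simp only [hfy]; exact hy)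
  exact ⟨g, h1, h2, h3⟩

end Weights

end HardySpectral

/-! ### The Euler–Lagrange equation, its multipliers, and the zeros of extremal functions -/

namespace HardySpectral

variable {a b p p' q : ℝ} {u v : ℝ → ℝ}

/-- The integral from a point to the right end point. -/
noncomputable def tail (b : ℝ) (h : ℝ → ℝ) (x : ℝ) : ℝ := ∫ y in x..b, h y

namespace Weights

/-- Normalization is automatic for a maximizer: with energy less than 1, homogeneity would give a
value below the supremum. -/
theorem isExtremal_of_le (W : Weights a b p p' q u v) {n : ℕ} {P : Fin n → ℝ}
    (hP : ∀ i, P i ∈ Icc a b) {f : ℝ → ℝ} (hf : Admissible a b p u P f)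
    (h1 : energy p a b f ≤ 1) (h2 : supRatio a b p q u v P ≤ energy q a b (hardyT a u v f)) :
    IsExtremal a b p q u v P f := by
  have hS := W.supRatio_pos hP
  have h3 := W.energy_le_supRatio hf h1
  refine ⟨hf, le_antisymm h1 ?_, le_antisymm h3 h2⟩
  by_contra! hlt
  have h4 := W.energy_le_mul_rpow hf
  have hp := W.p_pos
  have hq := W.q_pos
  have h5 : energy p a b f ^ (q / p) < 1 :=
    Real.rpow_lt_one (energy_nonneg _ _ _ _) hlt (by positivity)
  nlinarith

theorem hardyT_add_mul (W : Weights a b p p' q u v) {f k : ℝ → ℝ}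
    (hf : MemLp f (ENNReal.ofReal p) (vol a b)) (hk : MemLp k (ENNReal.ofReal p) (vol a b))
    (s : ℝ) {x : ℝ} (hx : x ∈ Icc a b) :
    hardyT a u v (fun t => f t + s * k t) x = hardyT a u v f x + s * hardyT a u v k x := by
  simp only [hardyT_eq]
  rw [W.prim_add hf (hk.const_mul s) hx, prim_const_mul]; ring

theorem energy_hardyT_add_mul (W : Weights a b p p' q u v) {f k : ℝ → ℝ}
    (hf : MemLp f (ENNReal.ofReal p) (vol a b)) (hk : MemLp k (ENNReal.ofReal p) (vol a b))
    (s : ℝ) : energy q a b (hardyT a u v fun t => f t + s * k t) =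
      ∫ x, |hardyT a u v f x + s * hardyT a u v k x| ^ q ∂(vol a b) := by
  refine integral_congr_ae ?_
  filter_upwards [ae_vol_mem] with x hx
  rw [W.hardyT_add_mul hf hk s hx]

/-- The Euler–Lagrange equation in weak form. -/
theorem weak_eq (W : Weights a b p p' q u v) {n : ℕ} {P : Fin n → ℝ}
    (hP : ∀ i, P i ∈ Icc a b) {f : ℝ → ℝ} (hf : IsExtremal a b p q u v P f) {k : ℝ → ℝ}
    (hk : Admissible a b p u P k) :
    ∫ x, spow p (f x) * k x ∂(vol a b) =
      (supRatio a b p q u v P)⁻¹ *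
        ∫ x, spow q (hardyT a u v f x) * hardyT a u v k x ∂(vol a b) := by
  have hp := W.p_pos
  have hS := W.supRatio_pos hP
  set S := supRatio a b p q u v P
  set X := ∫ x, spow p (f x) * k x ∂(vol a b)
  set Y := ∫ x, spow q (hardyT a u v f x) * hardyT a u v k x ∂(vol a b)
  -- By homogeneity `φ ≤ 0`, with equality at 0. In `φ'(0) = 0` the factors `p` and `q / p` combine
  -- to `q`, which cancels.
  let φ : ℝ → ℝ := fun s => (∫ x, |hardyT a u v f x + s * hardyT a u v k x| ^ q ∂(vol a b)) -
    S * (∫ x, |f x + s * k x| ^ p ∂(vol a b)) ^ (q / p)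
  have hφ0 : φ 0 = 0 := by
    have e1 := hf.energy_eq
    have e2 := hf.energy_T
    simp only [energy] at e1 e2
    simp only [φ, zero_mul, add_zero, e1, e2, Real.one_rpow, mul_one, sub_self, S]
  have hφ : ∀ s, φ s ≤ 0 := fun s => by
    have h := W.energy_le_mul_rpow (W.admissible_add hP hf.adm (hk.const_mul s))
    rw [W.energy_hardyT_add_mul hf.adm.1 hk.1] at h
    simp only [φ]
    have : energy p a b (fun x => f x + s * k x) = ∫ x, |f x + s * k x| ^ p ∂(vol a b) := rfl
    rw [this] at h
    linarith
  have hmax : IsLocalMax φ 0 := Eventually.of_forall fun s => by rw [hφ0]; exact hφ s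
  have hM : (∫ x, |f x + 0 * k x| ^ p ∂(vol a b)) = 1 := by
    have e1 := hf.energy_eq
    simpa [energy] using e1
  have hd : HasDerivAt φ (q * Y - S * (p * X * (q / p) * 1 ^ (q / p - 1))) 0 := by
    have h1 := hasDerivAt_integral_abs_rpow W.hq (W.memLp_hardyT hf.adm.1) (W.memLp_hardyT hk.1)
    have h2 := (hasDerivAt_integral_abs_rpow W.hp hf.adm.1 hk.1).rpow_const (p := q / p)
      (Or.inl (by rw [hM]; exact one_ne_zero))
    rw [hM] at h2
    exact h1.sub (h2.const_mul S)
  have h0 := hmax.hasDerivAt_eq_zero hd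
  rw [Real.one_rpow] at h0
  have hq := W.q_pos
  have : q * (Y - S * X) = 0 := by
    rw [← h0]; field_simp
  have h3 : Y = S * X := by
    rcases mul_eq_zero.1 this with h | h
    · exact absurd h hq.ne'
    · linarith
  rw [h3, inv_mul_cancel_left₀ hS.ne']

theorem integrable_v_spow (W : Weights a b p p' q u v) {f : ℝ → ℝ}
    (hf : MemLp f (ENNReal.ofReal p) (vol a b)) :
    Integrable (fun y => v y * spow q (hardyT a u v f y)) (vol a b) := by
  have := integrable_spow_mul W.hq (W.memLp_hardyT hf) W.v_mem
  exact this.congr (ae_of_all _ fun x => mul_comm _ _)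

/-- Integration by parts against a primitive. -/
theorem integral_mul_prim (W : Weights a b p p' q u v) {h k : ℝ → ℝ}
    (hh : Integrable h (vol a b)) (hk : MemLp k (ENNReal.ofReal p) (vol a b)) :
    ∫ x, h x * prim a u k x ∂(vol a b) = ∫ x, k x * u x * tail b h x ∂(vol a b) := by
  have hi := intervalIntegrable_of_integrable hh W.left_mem W.right_mem
  set H : ℝ → ℝ := fun x => ∫ y in b..x, h y
  have hH : ∀ x, tail b h x = -H x := fun x => intervalIntegral.integral_symm _ _
  have hHac : AbsolutelyContinuousOnInterval H a b :=
    hi.absolutelyContinuousOnInterval_intervalIntegral right_mem_uIcc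
  have hHd : ∀ᵐ x ∂(vol a b), HasDerivAt H (h x) x := by
    rw [ae_vol_iff]
    filter_upwards [hi.ae_hasDerivAt_integral] with x hx hm
    rw [uIcc_of_le W.le] at hx
    exact hx hm b W.right_mem
  have key := hHac.integral_mul_deriv_eq_deriv_mul (W.ac_prim hk)
  rw [prim_self, mul_zero, sub_zero, show H b = 0 by simp [H], zero_mul, zero_sub,
    ← integral_vol W.le, ← integral_vol W.le] at key
  have e1 : ∫ x, h x * prim a u k x ∂(vol a b) = ∫ x, deriv H x * prim a u k x ∂(vol a b) := by
    refine integral_congr_ae ?_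
    filter_upwards [hHd] with x hx
    rw [hx.deriv]
  have e2 : ∫ x, k x * u x * tail b h x ∂(vol a b) =
      -∫ x, H x * deriv (prim a u k) x ∂(vol a b) := by
    rw [← integral_neg]
    refine integral_congr_ae ?_
    filter_upwards [W.ae_hasDerivAt_prim hk] with x hx
    rw [hx.deriv, hH]; ring
  rw [e1, e2, key, neg_neg]

theorem integral_spow_hardyT (W : Weights a b p p' q u v) {f k : ℝ → ℝ}
    (hf : MemLp f (ENNReal.ofReal p) (vol a b)) (hk : MemLp k (ENNReal.ofReal p) (vol a b)) :
    ∫ x, spow q (hardyT a u v f x) * hardyT a u v k x ∂(vol a b) =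
      ∫ x, k x * u x * tail b (fun y => v y * spow q (hardyT a u v f y)) x ∂(vol a b) := by
  rw [← W.integral_mul_prim (W.integrable_v_spow hf) hk]
  congr 1; ext x; rw [hardyT_eq a u v k]; ring

theorem continuousOn_tail (W : Weights a b p p' q u v) {h : ℝ → ℝ} (hh : Integrable h (vol a b)) :
    ContinuousOn (tail b h) (Icc a b) := by
  have h1 : ContinuousOn (fun x => (∫ t in a..b, h t) - ∫ t in a..x, h t) (Icc a b) :=
    continuousOn_const.sub (W.continuousOn_primitive hh)
  refine h1.congr fun x hx => ?_
  simp only [tail]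
  rw [intervalIntegral.integral_interval_sub_left
    (intervalIntegrable_of_integrable hh W.left_mem W.right_mem)
    (intervalIntegrable_of_integrable hh W.left_mem hx)]

/-- Lagrange multipliers for the Euler–Lagrange equation. -/
theorem exists_multipliers (W : Weights a b p p' q u v) {n : ℕ} {P : Fin n → ℝ}
    (hP : ∀ i, P i ∈ Icc a b) {f : ℝ → ℝ} (hf : IsExtremal a b p q u v P f) :
    ∃ c : Fin n → ℝ, ∀ k, MemLp k (ENNReal.ofReal p) (vol a b) →
      ∫ x, spow p (f x) * k x ∂(vol a b) - (supRatio a b p q u v P)⁻¹ *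
        ∫ x, spow q (hardyT a u v f x) * hardyT a u v k x ∂(vol a b) =
      ∑ i, c i * prim a u k (P i) := by
  let E : Submodule ℝ (ℝ → ℝ) :=
    { carrier := {k | MemLp k (ENNReal.ofReal p) (vol a b)}
      add_mem' := fun hf hg => hf.add hg
      zero_mem' := MemLp.zero
      smul_mem' := fun c f hf => hf.const_smul c }
  have hsT : ∀ k : E, Integrable (fun x => spow q (hardyT a u v f x) * hardyT a u v k x)
      (vol a b) := fun k => integrable_spow_mul W.hq (W.memLp_hardyT hf.adm.1) (W.memLp_hardyT k.2)
  have hsp : ∀ k : E, Integrable (fun x => spow p (f x) * k.1 x) (vol a b) := fun k =>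
    integrable_spow_mul W.hp hf.adm.1 k.2
  let L : Fin n → E →ₗ[ℝ] ℝ := fun i =>
    { toFun := fun k => prim a u k (P i)
      map_add' := fun k l => W.prim_add k.2 l.2 (hP i)
      map_smul' := fun c k => prim_const_mul c k.1 (P i) }
  let A : E →ₗ[ℝ] ℝ :=
    { toFun := fun k => ∫ x, spow p (f x) * k.1 x ∂(vol a b)
      map_add' := fun k l => by
        rw [← integral_add (hsp k) (hsp l)]; congr 1; ext x; simp [mul_add]
      map_smul' := fun c k => by
        rw [RingHom.id_apply, smul_eq_mul, ← integral_const_mul]; congr 1; ext x; simp; ring }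
  let B : E →ₗ[ℝ] ℝ :=
    { toFun := fun k => ∫ x, spow q (hardyT a u v f x) * hardyT a u v k x ∂(vol a b)
      map_add' := fun k l => by
        rw [← integral_add (hsT k) (hsT l)]
        refine integral_congr_ae ?_
        filter_upwards [ae_vol_mem] with x hx
        have := W.hardyT_add_mul k.2 l.2 1 hx
        simp only [one_mul] at this
        rw [show hardyT a u v (k + l : E).1 x = hardyT a u v k x + hardyT a u v l x from this]
        ring
      map_smul' := fun c k => by
        rw [RingHom.id_apply, smul_eq_mul, ← integral_const_mul]
        congr 1; ext x
        rw [show hardyT a u v (c • k : E).1 x = c * hardyT a u v k x from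
          congrFun (hardyT_const_mul c k.1) x]
        ring }
  -- The weak equation says that the functional `A - S⁻¹ • B` vanishes on the common kernel of the
  -- evaluations at the `P i`; a functional with this property is a linear combination of them.
  have hmem := mem_span_of_iInf_ker_le_ker (L := L) (K := A - (supRatio a b p q u v P)⁻¹ • B) (by
    intro k hk
    rw [Submodule.mem_iInf] at hk
    have hadm : Admissible a b p u P k := ⟨k.2, fun i => hk i⟩
    rw [LinearMap.mem_ker, LinearMap.sub_apply, LinearMap.smul_apply]
    exact sub_eq_zero.2 (W.weak_eq hP hf hadm))
  obtain ⟨c, hc⟩ := (Submodule.mem_span_range_iff_exists_fun ℝ).1 hmem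
  refine ⟨c, fun k hk => ?_⟩
  have := LinearMap.congr_fun hc ⟨k, hk⟩
  simp only [LinearMap.sum_apply, LinearMap.smul_apply, LinearMap.sub_apply] at this
  exact this.symm

theorem prim_eq_integral_indicator (k : ℝ → ℝ) {z : ℝ}
    (hz : z ∈ Icc a b) :
    prim a u k z = ∫ x, k x * u x * (Iic z).indicator 1 x ∂(vol a b) := by
  have : ∀ x, k x * u x * (Iic z).indicator 1 x = (Iic z).indicator (fun x => k x * u x) x := by
    intro x
    by_cases hx : x ∈ Iic z <;> simp [hx]
  simp only [this]
  rw [integral_indicator measurableSet_Iic, Measure.restrict_restrict measurableSet_Iic, prim,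
    intervalIntegral.integral_of_le hz.1, ← integral_Icc_eq_integral_Ioc]
  congr 2
  ext x; simp only [mem_inter_iff, mem_Iic, mem_Icc]
  constructor
  · rintro ⟨h1, h2⟩; exact ⟨h2, h1, h2.trans hz.2⟩
  · rintro ⟨h1, h2, -⟩; exact ⟨h2, h1⟩

/-- The Euler–Lagrange equation with multipliers in pointwise form. -/
theorem ae_eq_of_multipliers (W : Weights a b p p' q u v) {n : ℕ} {P : Fin n → ℝ}
    (hP : ∀ i, P i ∈ Icc a b) {f : ℝ → ℝ} (hf : MemLp f (ENNReal.ofReal p) (vol a b)) {lam : ℝ}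
    {c : Fin n → ℝ} (h : ∀ k, MemLp k (ENNReal.ofReal p) (vol a b) →
      ∫ x, spow p (f x) * k x ∂(vol a b) - lam *
        ∫ x, spow q (hardyT a u v f x) * hardyT a u v k x ∂(vol a b) =
      ∑ i, c i * prim a u k (P i)) :
    ∀ᵐ x ∂(vol a b), spow p (f x) = u x *
      (lam * tail b (fun y => v y * spow q (hardyT a u v f y)) x +
        ∑ i, c i * (Iic (P i)).indicator 1 x) := by
  set G := tail b (fun y => v y * spow q (hardyT a u v f y)) with hGdef
  have hGc : ContinuousOn G (Icc a b) := W.continuousOn_tail (W.integrable_v_spow hf)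
  obtain ⟨C, hC⟩ := isCompact_Icc.exists_bound_of_continuousOn hGc
  have hGm : AEStronglyMeasurable G (vol a b) := hGc.aestronglyMeasurable measurableSet_Icc
  have i1 : ∀ {k}, MemLp k (ENNReal.ofReal p) (vol a b) →
      Integrable (fun x => k x * u x * G x) (vol a b) := fun {k} hk => by
    refine (W.integrable_mul hk).mul_bdd (c := C) hGm ?_
    filter_upwards [ae_vol_mem] with x hx using hC x hx
  have i2 : ∀ {k} i, MemLp k (ENNReal.ofReal p) (vol a b) →
      Integrable (fun x => k x * u x * (Iic (P i)).indicator 1 x) (vol a b) := fun {k} i hk => by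
    refine (W.integrable_mul hk).mul_bdd (c := 1)
      ((measurable_one.indicator measurableSet_Iic).aestronglyMeasurable) (ae_of_all _ fun x => ?_)
    by_cases hx : x ∈ Iic (P i) <;> simp [hx]
  have i3 : ∀ {k}, MemLp k (ENNReal.ofReal p) (vol a b) →
      Integrable (fun x => k x * u x * ∑ i, c i * (Iic (P i)).indicator 1 x) (vol a b) :=
      fun {k} hk => by
    have : Integrable (fun x => ∑ i, c i * (k x * u x * (Iic (P i)).indicator 1 x)) (vol a b) :=
      integrable_finsetSum _ fun i _ => (i2 i hk).const_mul (c i)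
    refine this.congr (ae_of_all _ fun x => ?_)
    simp only [Finset.mul_sum]; congr 1; ext i; ring
  let D : ℝ → ℝ := fun x => spow p (f x) - u x *
      (lam * G x + ∑ i, c i * (Iic (P i)).indicator 1 x)
  have hsplit : ∀ {k}, MemLp k (ENNReal.ofReal p) (vol a b) →
      Integrable (fun x => D x * k x) (vol a b) ∧ ∫ x, D x * k x ∂(vol a b) = 0 := by
    intro k hk
    have e : (fun x => D x * k x) = fun x => spow p (f x) * k x - (lam * (k x * u x * G x) +
        k x * u x * ∑ i, c i * (Iic (P i)).indicator 1 x) := by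
      ext x; simp only [D]; ring
    have j1 := integrable_spow_mul W.hp hf hk
    have j2 := (i1 hk).const_mul lam
    have j3 := i3 hk
    have j4 : Integrable (fun x => lam * (k x * u x * G x) +
        k x * u x * ∑ i, c i * (Iic (P i)).indicator 1 x) (vol a b) := j2.add j3
    rw [e]
    refine ⟨j1.sub j4, ?_⟩
    rw [integral_sub j1 j4, integral_add j2 j3, integral_const_mul,
      ← W.integral_spow_hardyT hf hk]
    have h1 := h k hk
    have h2 : ∫ x, k x * u x * ∑ i, c i * (Iic (P i)).indicator 1 x ∂(vol a b) =
        ∑ i, c i * prim a u k (P i) := by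
      have : ∀ x, k x * u x * ∑ i, c i * (Iic (P i)).indicator 1 x =
          ∑ i, c i * (k x * u x * (Iic (P i)).indicator 1 x) := fun x => by
        rw [Finset.mul_sum]; congr 1; ext i; ring
      simp only [this]
      rw [integral_finsetSum _ fun i _ => (i2 i hk).const_mul (c i)]
      congr 1; ext i
      rw [integral_const_mul, prim_eq_integral_indicator k (hP i)]
    rw [h2]; linarith
  have hDint : Integrable D (vol a b) := by simpa using (hsplit W.memLp_one).1
  -- Indicator functions of measurable sets belong to L_p and may be used as test functions.
  have hD0 : D =ᵐ[vol a b] 0 := by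
    refine hDint.ae_eq_zero_of_forall_setIntegral_eq_zero fun s hs _ => ?_
    have hk : MemLp (s.indicator fun _ => (1:ℝ)) (ENNReal.ofReal p) (vol a b) :=
      W.memLp_one.indicator hs
    have := (hsplit hk).2
    rw [← integral_indicator hs, ← this]
    congr 1; ext x
    by_cases hx : x ∈ s <;> simp [hx]
  filter_upwards [hD0] with x hx
  have : D x = 0 := hx
  simp only [D] at this
  linarith

/-- The primitive is strictly increasing where the integrand is positive. -/
theorem prim_lt_of_pos (W : Weights a b p p' q u v) {f : ℝ → ℝ}
    (hf : MemLp f (ENNReal.ofReal p) (vol a b)) {x y : ℝ} (hx : x ∈ Icc a b) (hy : y ∈ Icc a b)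
    (hxy : x < y) (h : ∀ᵐ t ∂(vol a b), t ∈ Ioo x y → 0 < f t) :
    prim a u f x < prim a u f y := by
  have h1 := W.prim_sub hf hx hy
  have hint := intervalIntegrable_of_integrable (W.integrable_mul hf) hx hy
  have h2 : ∀ᵐ t, t ∈ Ioo x y → 0 < f t * u t := by
    filter_upwards [ae_vol_iff.1 h] with t ht hm
    have hm' : t ∈ Icc a b := ⟨hx.1.trans hm.1.le, hm.2.le.trans hy.2⟩
    exact mul_pos (ht hm' hm) (W.u_pos t hm')
  have h3 : 0 < ∫ t in x..y, f t * u t := by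
    rw [intervalIntegral.integral_of_le hxy.le, integral_Ioc_eq_integral_Ioo]
    have hi : IntegrableOn (fun t => f t * u t) (Ioo x y) :=
      ((intervalIntegrable_iff_integrableOn_Ioc_of_le hxy.le).1 hint).mono_set Ioo_subset_Ioc_self
    rw [setIntegral_pos_iff_support_of_nonneg_ae]
    · have hsub : (Ioo x y : Set ℝ) ≤ᵐ[volume]
          (Function.support (fun t => f t * u t) ∩ Ioo x y : Set ℝ) := by
        filter_upwards [h2] with t ht hm
        exact ⟨(ht hm).ne', hm⟩
      refine lt_of_lt_of_le ?_ (measure_mono_ae hsub)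
      simp [hxy]
    · rw [EventuallyLE, ae_restrict_iff' measurableSet_Ioo]
      filter_upwards [h2] with t ht hm using (ht hm).le
    · exact hi
  linarith

theorem prim_le_of_nonneg (W : Weights a b p p' q u v) {f : ℝ → ℝ}
    (hf : MemLp f (ENNReal.ofReal p) (vol a b)) {x y : ℝ} (hx : x ∈ Icc a b) (hy : y ∈ Icc a b)
    (hxy : x ≤ y) (h : ∀ᵐ t ∂(vol a b), t ∈ Ioo x y → 0 ≤ f t) :
    prim a u f x ≤ prim a u f y := by
  have h1 := W.prim_sub hf hx hy
  have h3 : 0 ≤ ∫ t in x..y, f t * u t := by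
    rw [intervalIntegral.integral_of_le hxy, integral_Ioc_eq_integral_Ioo]
    refine integral_nonneg_of_ae ?_
    rw [EventuallyLE, ae_restrict_iff' measurableSet_Ioo]
    filter_upwards [ae_vol_iff.1 h] with t ht hm
    have hm' : t ∈ Icc a b := ⟨hx.1.trans hm.1.le, hm.2.le.trans hy.2⟩
    exact mul_nonneg (ht hm' hm) (W.u_pos t hm').le
  linarith

theorem prim_neg (f : ℝ → ℝ) (x : ℝ) : prim a u (fun t => -f t) x = -prim a u f x := by
  have := prim_const_mul (a := a) (u := u) (-1) f x
  simpa using this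

theorem prim_lt_of_neg (W : Weights a b p p' q u v) {f : ℝ → ℝ}
    (hf : MemLp f (ENNReal.ofReal p) (vol a b)) {x y : ℝ} (hx : x ∈ Icc a b) (hy : y ∈ Icc a b)
    (hxy : x < y) (h : ∀ᵐ t ∂(vol a b), t ∈ Ioo x y → f t < 0) :
    prim a u f y < prim a u f x := by
  have := W.prim_lt_of_pos hf.neg hx hy hxy (by
    filter_upwards [h] with t ht hm using neg_pos.2 (ht hm))
  have e : ∀ x, prim a u (-f) x = -prim a u f x := fun x => prim_neg f x
  rw [e, e] at this; linarith

theorem prim_le_of_nonpos (W : Weights a b p p' q u v) {f : ℝ → ℝ}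
    (hf : MemLp f (ENNReal.ofReal p) (vol a b)) {x y : ℝ} (hx : x ∈ Icc a b) (hy : y ∈ Icc a b)
    (hxy : x ≤ y) (h : ∀ᵐ t ∂(vol a b), t ∈ Ioo x y → f t ≤ 0) :
    prim a u f y ≤ prim a u f x := by
  have := W.prim_le_of_nonneg hf.neg hx hy hxy (by
    filter_upwards [h] with t ht hm using neg_nonneg.2 (ht hm))
  have e : ∀ x, prim a u (-f) x = -prim a u f x := fun x => prim_neg f x
  rw [e, e] at this; linarith

/-- A density is determined by the primitive: it vanishes where the primitive does. -/
theorem ae_eq_zero_of_prim_eq_zero (W : Weights a b p p' q u v) {f : ℝ → ℝ}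
    (hf : MemLp f (ENNReal.ofReal p) (vol a b)) {U : Set ℝ} (hU : IsOpen U)
    (h : ∀ x ∈ U, x ∈ Icc a b → prim a u f x = 0) : ∀ᵐ x ∂(vol a b), x ∈ U → f x = 0 := by
  filter_upwards [W.ae_hasDerivAt_prim hf, ae_vol_mem_Ioo] with x hx hm hxU
  have hev : prim a u f =ᶠ[𝓝 x] fun _ => 0 := by
    filter_upwards [hU.mem_nhds hxU, Ioo_mem_nhds hm.1 hm.2] with y h1 h2
    exact h y h1 (Ioo_subset_Icc_self h2)
  have h0 := hx.unique ((hasDerivAt_const x (0:ℝ)).congr_of_eventuallyEq hev)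
  exact (mul_eq_zero.1 h0).resolve_right (W.u_pos x (Ioo_subset_Icc_self hm)).ne'

/-- On such a gap one can add `s` times a bump. Since `f` and its primitive vanish there, the
supports are disjoint: the numerator gains a multiple of `s ^ q`, the energy only a multiple of `s ^
p`. For `q < p` and small `s` the supremum would be exceeded. -/
theorem extremal_not_zero_on_Ioo (W : Weights a b p p' q u v) (hqp : q < p) {n : ℕ}
    {P : Fin n → ℝ} (hP : ∀ i, P i ∈ Icc a b) {f : ℝ → ℝ} (hf : IsExtremal a b p q u v P f)
    {c d : ℝ} (hc : a ≤ c) (hcd : c < d) (hd : d ≤ b) (hPcd : ∀ i, P i ∉ Ioo c d)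
    (h0 : ∀ x ∈ Ioo c d, prim a u f x = 0) : False := by
  have hp := W.p_pos
  have hq := W.q_pos
  have hS := W.supRatio_pos hP
  obtain ⟨k, hk, -, hk0, hkpos⟩ := W.exists_bump_Ioo (c := c) (d := d)
    ⟨hc, hcd.le.trans hd⟩ ⟨hc.trans hcd.le, hd⟩
  have hadm : Admissible a b p u P k := ⟨hk, fun i => hk0 _ (hP i) (hPcd i)⟩
  have hm : (c + d) / 2 ∈ Ioo c d := ⟨by linarith, by linarith⟩
  have hNk := W.energy_hardyT_pos hk (x := (c + d) / 2) ⟨hc.trans hm.1.le, hm.2.le.trans hd⟩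
    (hkpos _ hm).ne'
  have hf0 := W.ae_eq_zero_of_prim_eq_zero hf.adm.1 (isOpen_Ioo (a := c) (b := d))
    (fun x hx _ => h0 x hx)
  have hkz := W.ae_eq_zero_of_prim_eq_zero hk (isClosed_Icc (a := c) (b := d)).isOpen_compl
    (fun x hx hxm => hk0 x hxm fun h => hx (Ioo_subset_Icc_self h))
  have hdis : ∀ᵐ x ∂(vol a b), f x = 0 ∨ k x = 0 := by
    have hne : ∀ᵐ x ∂(vol a b), x ≠ c ∧ x ≠ d := by
      refine ae_restrict_of_ae ?_
      filter_upwards [Measure.ae_ne volume c, Measure.ae_ne volume d] with x h1 h2 using ⟨h1, h2⟩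
    filter_upwards [hf0, hkz, hne] with x h1 h2 h3
    by_cases hx : x ∈ Ioo c d
    · exact Or.inl (h1 hx)
    · refine Or.inr (h2 fun h => hx ⟨lt_of_le_of_ne h.1 h3.1.symm, lt_of_le_of_ne h.2 h3.2⟩)
  have hM : ∀ s : ℝ, 0 < s → energy p a b (fun x => f x + s * k x) = 1 + s ^ p * energy p a b k := by
    intro s hs
    rw [← hf.energy_eq]
    simp only [energy]
    rw [← integral_const_mul, ← integral_add (MemLp.integrable_abs_rpow hp hf.adm.1)
      ((MemLp.integrable_abs_rpow hp hk).const_mul _)]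
    refine integral_congr_ae ?_
    filter_upwards [hdis] with x hx
    rcases hx with hx | hx
    · rw [hx, zero_add, abs_zero, Real.zero_rpow hp.ne', zero_add, abs_mul,
        Real.mul_rpow (abs_nonneg _) (abs_nonneg _), abs_of_pos hs]
    · rw [hx, mul_zero, abs_zero, Real.zero_rpow hp.ne', mul_zero, add_zero, add_zero]
  have hN : ∀ s : ℝ, 0 < s → energy q a b (hardyT a u v fun x => f x + s * k x) =
      supRatio a b p q u v P + s ^ q * energy q a b (hardyT a u v k) := by
    intro s hs
    rw [W.energy_hardyT_add_mul hf.adm.1 hk, ← hf.energy_T]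
    simp only [energy]
    rw [← integral_const_mul, ← integral_add
      (MemLp.integrable_abs_rpow hq (W.memLp_hardyT hf.adm.1))
      ((MemLp.integrable_abs_rpow hq (W.memLp_hardyT hk)).const_mul _)]
    refine integral_congr_ae ?_
    filter_upwards [ae_vol_mem] with x hx
    simp only [hardyT_eq]
    by_cases hxc : x ∈ Ioo c d
    · rw [h0 x hxc, mul_zero, zero_add, abs_zero, Real.zero_rpow hq.ne', zero_add, abs_mul,
        Real.mul_rpow (abs_nonneg _) (abs_nonneg _), abs_of_pos hs]
    · rw [hk0 x hx hxc, mul_zero, mul_zero, abs_zero, Real.zero_rpow hq.ne', mul_zero, add_zero,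
        add_zero]
  set S := supRatio a b p q u v P
  set Nk := energy q a b (hardyT a u v k)
  set Mk := energy p a b k
  have hMk : 0 ≤ Mk := energy_nonneg _ _ _ _
  have key : ∀ s : ℝ, 0 < s → Nk ≤ S * (q / p) * Mk * s ^ (p - q) := by
    intro s hs
    have h1 := W.energy_le_mul_rpow (W.admissible_add hP hf.adm (hadm.const_mul s))
    rw [hN s hs, hM s hs] at h1
    have h2 : (1 + s ^ p * Mk) ^ (q / p) ≤ 1 + q / p * (s ^ p * Mk) :=
      rpow_one_add_le_one_add_mul_self (by have : 0 ≤ s ^ p * Mk := by positivity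
                                           linarith) (by positivity)
        (by rw [div_le_one hp]; exact hqp.le)
    have h3 : s ^ q * Nk ≤ S * (q / p * (s ^ p * Mk)) := by nlinarith
    have h4 : s ^ p = s ^ q * s ^ (p - q) := by rw [← Real.rpow_add hs]; ring_nf
    rw [h4] at h3
    have h5 : 0 < s ^ q := by positivity
    refine le_of_mul_le_mul_left (h3.trans_eq ?_) h5
    ring
  have hlim : Tendsto (fun s : ℝ => S * (q / p) * Mk * s ^ (p - q)) (𝓝[>] 0) (𝓝 0) := by
    have : Tendsto (fun s : ℝ => s ^ (p - q)) (𝓝[>] 0) (𝓝 (0 ^ (p - q))) :=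
      ((Real.continuous_rpow_const (by linarith)).tendsto 0).mono_left nhdsWithin_le_nhds
    rw [Real.zero_rpow (by linarith)] at this
    simpa using this.const_mul (S * (q / p) * Mk)
  have := ge_of_tendsto hlim (by
    filter_upwards [self_mem_nhdsWithin] with s hs using key s hs)
  linarith

/-- The absolute value of the primitive of an extremal function is one of an extremal function. -/
theorem exists_extremal_abs (W : Weights a b p p' q u v) {n : ℕ}
    {P : Fin n → ℝ} (hP : ∀ i, P i ∈ Icc a b) {f : ℝ → ℝ} (hf : IsExtremal a b p q u v P f) :
    ∃ g, IsExtremal a b p q u v P g ∧ ∀ x ∈ Icc a b, prim a u g x = |prim a u f x| := by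
  obtain ⟨g, hg, hge, hgp⟩ := W.exists_prim_eq_comp hf.adm.1 (φ := fun x => |x|)
    (lipschitzWith_one_norm (E := ℝ)) abs_zero
  refine ⟨g, W.isExtremal_of_le hP ⟨hg, fun i => by rw [hgp _ (hP i), hf.adm.2 i, abs_zero]⟩
    (hge.trans_eq hf.energy_eq) (le_of_eq ?_), hgp⟩
  rw [← hf.energy_T]
  refine integral_congr_ae ?_
  filter_upwards [ae_vol_mem] with x hx
  simp only [hardyT_eq]
  rw [hgp x hx, abs_mul, abs_mul, abs_abs]

/-- Pass to the extremal function `g` with primitive G = |F|. Near a zero `x₀` off `P` no multiplier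
jumps, so the function `w` with `spow p g = u w` is nonincreasing. From G ≥ 0 = G(x₀) it follows
that `w ≥ 0` to the left of `x₀` and `w ≤ 0` to the right, so G increases up to 0 and then
decreases. Hence G vanishes on an interval, which `extremal_not_zero_on_Ioo` excludes. -/
theorem extremal_zero_mem (W : Weights a b p p' q u v) (hqp : q < p) {n : ℕ}
    {P : Fin n → ℝ} (hP : ∀ i, P i ∈ Icc a b) {f : ℝ → ℝ} (hf : IsExtremal a b p q u v P f)
    {x₀ : ℝ} (hx₀ : x₀ ∈ Ioo a b) (h0 : prim a u f x₀ = 0) : x₀ ∈ range P := by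
  by_contra hxP
  obtain ⟨g, hg, hgp⟩ := W.exists_extremal_abs hP hf
  have hnn : ∀ x ∈ Icc a b, 0 ≤ prim a u g x := fun x hx => by rw [hgp x hx]; positivity
  have hg0 : prim a u g x₀ = 0 := by rw [hgp x₀ (Ioo_subset_Icc_self hx₀), h0, abs_zero]
  obtain ⟨c, hc⟩ := W.exists_multipliers hP hg
  have hae := W.ae_eq_of_multipliers hP hg.adm.1 hc
  set S := supRatio a b p q u v P
  have hS : 0 < S := W.supRatio_pos hP
  set h := fun y => v y * spow q (hardyT a u v g y)
  set w : ℝ → ℝ := fun x => S⁻¹ * tail b h x + ∑ i, c i * (Iic (P i)).indicator 1 x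
  have hopen : IsOpen (Ioo a b \ range P) := isOpen_Ioo.sdiff (finite_range P).isClosed
  obtain ⟨y, z, hyz, hsub⟩ := mem_nhds_iff_exists_Ioo_subset.1 (hopen.mem_nhds ⟨hx₀, hxP⟩)
  have hsubI : Ioo y z ⊆ Icc a b := fun x hx => Ioo_subset_Icc_self (hsub hx).1
  have hh : ∀ x ∈ Icc a b, 0 ≤ h x := fun x hx => by
    have h1 : 0 ≤ hardyT a u v g x := mul_nonneg (W.v_pos x hx).le (hnn x hx)
    simp only [h]
    rw [spow_of_nonneg W.hq h1]
    have := (W.v_pos x hx).le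
    positivity
  have hanti : ∀ s ∈ Ioo y z, ∀ t ∈ Ioo y z, s ≤ t → w t ≤ w s := by
    intro s hs t ht hst
    have h1 : tail b h t ≤ tail b h s := by
      have e : tail b h s = (∫ r in s..t, h r) + tail b h t :=
        (intervalIntegral.integral_add_adjacent_intervals
          (intervalIntegrable_of_integrable (W.integrable_v_spow hg.adm.1) (hsubI hs) (hsubI ht))
          (intervalIntegrable_of_integrable (W.integrable_v_spow hg.adm.1) (hsubI ht)
            W.right_mem)).symm
      have : 0 ≤ ∫ r in s..t, h r := intervalIntegral.integral_nonneg hst fun r hr =>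
        hh r ⟨(hsubI hs).1.trans hr.1, hr.2.trans (hsubI ht).2⟩
      linarith
    have h2 : ∀ i, (Iic (P i)).indicator (1 : ℝ → ℝ) t = (Iic (P i)).indicator 1 s := by
      intro i
      by_cases h3 : t ≤ P i
      · simp [h3, hst.trans h3]
      · by_cases h4 : s ≤ P i
        · exfalso
          push Not at h3
          have hPi : P i ∈ Ioo y z := ⟨hs.1.trans_le h4, h3.trans ht.2⟩
          exact (hsub hPi).2 (mem_range_self i)
        · simp [h3, h4]
    simp only [w, h2]
    gcongr
  have hsign : ∀ᵐ t ∂(vol a b), (0 < w t → 0 < g t) ∧ (w t < 0 → g t < 0) ∧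
      (0 ≤ w t → 0 ≤ g t) ∧ (w t ≤ 0 → g t ≤ 0) := by
    filter_upwards [hae, ae_vol_mem] with t ht hm
    have hu := W.u_pos t hm
    have ht' : spow p (g t) = u t * w t := ht
    have h1 : 0 < w t → 0 < g t := fun hw => by
      rw [← spow_pos_iff (p := p), ht']; positivity
    have h2 : w t < 0 → g t < 0 := fun hw => by
      rw [← spow_neg_iff (p := p), ht']; exact mul_neg_of_pos_of_neg hu hw
    have h3 : w t = 0 → g t = 0 := fun hw => by
      rw [← spow_eq_zero_iff (p := p), ht', hw, mul_zero]
    refine ⟨h1, h2, fun hw => ?_, fun hw => ?_⟩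
    · rcases hw.eq_or_lt with hw | hw
      · exact (h3 hw.symm).ge
      · exact (h1 hw).le
    · rcases hw.eq_or_lt with hw | hw
      · exact (h3 hw).le
      · exact (h2 hw).le
  have hleft : ∀ x ∈ Ioo y z, x < x₀ → 0 ≤ w x := by
    intro x hx hxx
    by_contra! hneg
    obtain ⟨t, ht1, ht2⟩ := exists_between hyz.2
    have ht : t ∈ Ioo y z := ⟨hyz.1.trans ht1, ht2⟩
    have := W.prim_lt_of_neg hg.adm.1 (hsubI hyz) (hsubI ht) ht1 (by
      filter_upwards [hsign] with r hr hm
      refine hr.2.1 ((hanti x hx r ⟨hyz.1.trans hm.1, hm.2.trans ht2⟩ ?_).trans_lt hneg)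
      exact (hxx.trans hm.1).le)
    linarith [hnn t (hsubI ht)]
  have hright : ∀ x ∈ Ioo y z, x₀ < x → w x ≤ 0 := by
    intro x hx hxx
    by_contra! hpos
    obtain ⟨t, ht1, ht2⟩ := exists_between hyz.1
    have ht : t ∈ Ioo y z := ⟨ht1, ht2.trans hyz.2⟩
    have := W.prim_lt_of_pos hg.adm.1 (hsubI ht) (hsubI hyz) ht2 (by
      filter_upwards [hsign] with r hr hm
      refine hr.1 (hpos.trans_le (hanti r ⟨ht1.trans hm.1, hm.2.trans hyz.2⟩ x hx ?_))
      exact (hm.2.trans hxx).le)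
    linarith [hnn t (hsubI ht)]
  have hzero : ∀ x ∈ Ioo y z, prim a u g x = 0 := by
    intro x hx
    refine le_antisymm ?_ (hnn x (hsubI hx))
    rw [← hg0]
    rcases le_total x x₀ with hxx | hxx
    · refine W.prim_le_of_nonneg hg.adm.1 (hsubI hx) (hsubI hyz) hxx ?_
      filter_upwards [hsign] with r hr hm
      exact hr.2.2.1 (hleft r ⟨hx.1.trans hm.1, hm.2.trans hyz.2⟩ hm.2)
    · refine W.prim_le_of_nonpos hg.adm.1 (hsubI hyz) (hsubI hx) hxx ?_
      filter_upwards [hsign] with r hr hm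
      exact hr.2.2.2 (hright r ⟨hyz.1.trans hm.1, hm.2.trans hx.2⟩ hm.1)
  have hyz' := hyz.1.trans hyz.2
  have hcl : Icc y z ⊆ Icc a b := by
    rw [← closure_Ioo hyz'.ne]
    exact closure_minimal hsubI isClosed_Icc
  exact W.extremal_not_zero_on_Ioo hqp hP hg (hcl (left_mem_Icc.2 hyz'.le)).1 hyz'
    (hcl (right_mem_Icc.2 hyz'.le)).2 (fun i hi => (hsub hi).2 (mem_range_self i)) hzero

end Weights

end HardySpectral

/-! ### Picone's inequality and the extremality of critical functions -/

namespace HardySpectral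

variable {a b p p' q : ℝ} {u v : ℝ → ℝ}

/-- Fatou's lemma for real-valued functions. -/
theorem integrable_of_tendsto_of_integral_le {α : Type*} {m : MeasurableSpace α} {μ : Measure α}
    {F : ℕ → α → ℝ} {f : α → ℝ} {C : ℝ} (hF : ∀ j, Integrable (F j) μ) (hF0 : ∀ j x, 0 ≤ F j x)
    (hC : ∀ j, ∫ x, F j x ∂μ ≤ C) (hf0 : ∀ x, 0 ≤ f x) (hf : AEStronglyMeasurable f μ)
    (h : ∀ᵐ x ∂μ, Tendsto (fun j => F j x) atTop (𝓝 (f x))) :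
    Integrable f μ ∧ ∫ x, f x ∂μ ≤ C := by
  have hC0 : 0 ≤ C := (integral_nonneg (hF0 0)).trans (hC 0)
  have key : ∫⁻ x, ENNReal.ofReal (f x) ∂μ ≤ ENNReal.ofReal C := by
    calc ∫⁻ x, ENNReal.ofReal (f x) ∂μ
        = ∫⁻ x, liminf (fun j => ENNReal.ofReal (F j x)) atTop ∂μ := by
          refine lintegral_congr_ae ?_
          filter_upwards [h] with x hx
          exact ((ENNReal.continuous_ofReal.tendsto _).comp hx).liminf_eq.symm
      _ ≤ liminf (fun j => ∫⁻ x, ENNReal.ofReal (F j x) ∂μ) atTop :=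
          lintegral_liminf_le' fun j => (hF j).1.aemeasurable.ennreal_ofReal
      _ ≤ ENNReal.ofReal C := by
          refine liminf_le_of_le (by isBoundedDefault) fun y hy => ?_
          obtain ⟨j, hj⟩ := hy.exists
          refine hj.trans ?_
          rw [← ofReal_integral_eq_lintegral_ofReal (hF j) (ae_of_all _ (hF0 j))]
          exact ENNReal.ofReal_le_ofReal (hC j)
  have hint : Integrable f μ := by
    refine ⟨hf, ?_⟩
    rw [hasFiniteIntegral_iff_ofReal (ae_of_all _ hf0)]
    exact key.trans_lt ENNReal.ofReal_lt_top
  refine ⟨hint, ?_⟩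
  rw [integral_eq_lintegral_of_nonneg_ae (ae_of_all _ hf0) hf]
  exact ENNReal.toReal_le_of_le_ofReal hC0 key

theorem measurable_sign : Measurable Real.sign := by
  unfold Real.sign
  exact Measurable.ite measurableSet_Iio measurable_const
    (Measurable.ite measurableSet_Ioi measurable_const measurable_const)

theorem abs_sign_le (x : ℝ) : |Real.sign x| ≤ 1 := by
  rcases Real.sign_apply_eq x with h | h | h <;> simp [h]

theorem sign_eventually_eq {F : ℝ → ℝ} {x : ℝ} (hF : ContinuousAt F x) (h : F x ≠ 0) :
    ∀ᶠ y in 𝓝 x, Real.sign (F y) = Real.sign (F x) := by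
  rcases h.lt_or_gt with h | h
  · filter_upwards [hF.eventually (gt_mem_nhds h)] with y hy
    rw [Real.sign_of_neg hy, Real.sign_of_neg h]
  · filter_upwards [hF.eventually (lt_mem_nhds h)] with y hy
    rw [Real.sign_of_pos hy, Real.sign_of_pos h]

theorem sign_mul_self_eq (x : ℝ) : Real.sign x * x = |x| := by
  rcases lt_trichotomy x 0 with h | rfl | h
  · rw [Real.sign_of_neg h, abs_of_neg h]; ring
  · simp
  · rw [Real.sign_of_pos h, abs_of_pos h]; ring

theorem sign_mul_sign {x : ℝ} (h : x ≠ 0) : Real.sign x * Real.sign x = 1 := by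
  rcases h.lt_or_gt with h | h
  · rw [Real.sign_of_neg h]; ring
  · rw [Real.sign_of_pos h]; ring

theorem lipschitzOnWith_abs_rpow {r : ℝ} (hr : 1 < r) {B : ℝ} (hB : 0 ≤ B) :
    LipschitzOnWith (Real.toNNReal (r * B ^ (r - 1))) (fun t : ℝ => |t| ^ r) (Icc (-B) B) := by
  refine (convex_Icc _ _).lipschitzOnWith_of_nnnorm_hasDerivWithin_le
    (fun t _ => (hasDerivAt_abs_rpow_spow hr t).hasDerivWithinAt) fun t ht => ?_
  rw [← NNReal.coe_le_coe, coe_nnnorm, Real.norm_eq_abs, abs_mul, abs_spow hr,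
    abs_of_pos (by linarith), Real.coe_toNNReal _ (by positivity)]
  have := abs_le.2 ht
  gcongr

theorem lipschitzOnWith_add_rpow {ε r : ℝ} (hε : 0 < ε) (hr : 0 < r) :
    LipschitzOnWith (Real.toNNReal (r * ε ^ (-r - 1))) (fun t : ℝ => (t + ε) ^ (-r)) (Ici 0) := by
  refine (convex_Ici 0).lipschitzOnWith_of_nnnorm_hasDerivWithin_le
    (f' := fun t => -r * (t + ε) ^ (-r - 1)) (fun t ht => ?_) fun t ht => ?_
  · have ht' : 0 < t + ε := by have : (0:ℝ) ≤ t := ht; linarith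
    have := ((hasDerivAt_id t).add_const ε).rpow_const (p := -r) (Or.inl ht'.ne')
    simpa using this.hasDerivWithinAt
  · have ht0 : (0:ℝ) ≤ t := ht
    have ht' : 0 < t + ε := by linarith
    rw [← NNReal.coe_le_coe, coe_nnnorm, Real.norm_eq_abs, abs_mul, abs_neg,
      abs_of_pos hr, abs_of_pos (by positivity), Real.coe_toNNReal _ (by positivity)]
    refine mul_le_mul_of_nonneg_left ?_ hr.le
    exact Real.rpow_le_rpow_of_nonpos hε (by linarith) (by linarith)

namespace Weights

theorem memLp_continuousOn_mul {s : ENNReal} {A k : ℝ → ℝ}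
    (hA : ContinuousOn A (Icc a b)) (hk : MemLp k s (vol a b)) :
    MemLp (fun x => A x * k x) s (vol a b) := by
  obtain ⟨C, hC⟩ := isCompact_Icc.exists_bound_of_continuousOn hA
  refine MemLp.of_le_mul (c := C) hk
    ((hA.aestronglyMeasurable measurableSet_Icc).mul hk.1) ?_
  filter_upwards [ae_vol_mem] with x hx
  rw [norm_mul]
  exact mul_le_mul_of_nonneg_right (hC x hx) (norm_nonneg _)

/-- The sign of a primitive with finitely many zeros turns primitives vanishing at these zeros into
primitives. -/
theorem sign_mul_prim (W : Weights a b p p' q u v) {n : ℕ} {P : Fin n → ℝ} {f k : ℝ → ℝ}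
    (hf : MemLp f (ENNReal.ofReal p) (vol a b))
    (hz : ∀ x ∈ Ioo a b, prim a u f x = 0 → x ∈ range P) (hk : Admissible a b p u P k) :
    MemLp (fun x => Real.sign (prim a u f x) * k x) (ENNReal.ofReal p) (vol a b) ∧
    ∀ x ∈ Ico a b, prim a u (fun x => Real.sign (prim a u f x) * k x) x =
      Real.sign (prim a u f x) * prim a u k x := by
  have hc := W.continuousOn_prim hf
  refine W.prim_mul_eq hk.1 ?_ (fun x => abs_sign_le _) (finite_range P) ?_ ?_
  · exact (measurable_sign.comp_aemeasurable
      (hc.aestronglyMeasurable measurableSet_Icc).aemeasurable).aestronglyMeasurable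
  · intro x hx hxP
    exact sign_eventually_eq (hc.continuousAt (Icc_mem_nhds hx.1 hx.2))
      fun h => hxP (hz x hx h)
  · rintro x - ⟨i, rfl⟩
    exact hk.2 i

theorem ae_prim_ne_zero {n : ℕ} {P : Fin n → ℝ} {f : ℝ → ℝ}
    (hz : ∀ x ∈ Ioo a b, prim a u f x = 0 → x ∈ range P) :
    ∀ᵐ x ∂(vol a b), prim a u f x ≠ 0 := by
  have h1 : ∀ᵐ x ∂(vol a b), x ∉ range P :=
    ae_restrict_of_ae (measure_eq_zero_iff_ae_notMem.1 ((finite_range P).measure_zero volume))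
  filter_upwards [h1, ae_vol_mem_Ioo] with x h2 h3 h4 using h2 (hz x h3 h4)

/-- The function `|K| ^ p / (G + ε) ^ (p - 1)` is a primitive if `K` and `G ≥ 0` are. -/
theorem prim_quotient (W : Weights a b p p' q u v) {k g : ℝ → ℝ}
    (hk : MemLp k (ENNReal.ofReal p) (vol a b)) (hg : MemLp g (ENNReal.ofReal p) (vol a b))
    (hg0 : ∀ x ∈ Icc a b, 0 ≤ prim a u g x) {ε : ℝ} (hε : 0 < ε) :
    MemLp (fun x => p * spow p (prim a u k x) * (prim a u g x + ε) ^ (-(p - 1)) * k x +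
      |prim a u k x| ^ p * (-(p - 1) * (prim a u g x + ε) ^ (-(p - 1) - 1)) * g x)
      (ENNReal.ofReal p) (vol a b) ∧
    ∀ x ∈ Icc a b,
      prim a u (fun x => p * spow p (prim a u k x) * (prim a u g x + ε) ^ (-(p - 1)) * k x +
        |prim a u k x| ^ p * (-(p - 1) * (prim a u g x + ε) ^ (-(p - 1) - 1)) * g x) x =
      |prim a u k x| ^ p * (prim a u g x + ε) ^ (-(p - 1)) := by
  have hp := W.hp
  have hp0 := W.p_pos
  have hcK := W.continuousOn_prim hk
  have hcε : ∀ r : ℝ, ContinuousOn (fun x => (prim a u g x + ε) ^ r) (Icc a b) := fun r =>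
    ((W.continuousOn_prim hg).add continuousOn_const).rpow_const fun x hx =>
      Or.inl (add_pos_of_nonneg_of_pos (hg0 x hx) hε).ne'
  have hcKp : ContinuousOn (fun x => |prim a u k x| ^ p) (Icc a b) :=
    (continuous_abs_rpow hp0).comp_continuousOn hcK
  have hac1 : AbsolutelyContinuousOnInterval (fun x => |prim a u k x| ^ p) a b := by
    obtain ⟨B, hB⟩ := isCompact_Icc.exists_bound_of_continuousOn hcK
    have hB0 : 0 ≤ B := (norm_nonneg _).trans (hB a W.left_mem)
    refine AbsolutelyContinuousOnInterval.comp_lipschitz (F := prim a u k)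
      (φ := fun t => |t| ^ p) (W.ac_prim hk) (lipschitzOnWith_abs_rpow hp hB0) fun x hx => ?_
    rw [uIcc_of_le W.le] at hx
    exact abs_le.1 (hB x hx)
  have hac2 : AbsolutelyContinuousOnInterval (fun x => (prim a u g x + ε) ^ (-(p - 1))) a b := by
    refine AbsolutelyContinuousOnInterval.comp_lipschitz (F := prim a u g)
      (φ := fun t => (t + ε) ^ (-(p - 1))) (W.ac_prim hg)
      (lipschitzOnWith_add_rpow hε (by linarith : 0 < p - 1)) fun x hx => ?_
    rw [uIcc_of_le W.le] at hx
    exact hg0 x hx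
  refine ⟨(memLp_continuousOn_mul ?_ hk).add (memLp_continuousOn_mul ?_ hg), fun x hx => ?_⟩
  · exact (continuousOn_const.mul ((continuous_spow hp).comp_continuousOn hcK)).mul (hcε _)
  · exact hcKp.mul (continuousOn_const.mul (hcε _))
  refine W.prim_eq_of_ac (G := fun x => |prim a u k x| ^ p * (prim a u g x + ε) ^ (-(p - 1)))
    (hac1.fun_mul hac2) ?_ ?_ hx
  · simp only [prim_self, abs_zero, Real.zero_rpow hp0.ne', zero_mul]
  · filter_upwards [W.ae_hasDerivAt_prim hk, W.ae_hasDerivAt_prim hg, ae_vol_mem]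
      with x h1 h2 hm
    have hpos : 0 < prim a u g x + ε := by have := hg0 x hm; linarith
    have e1 : HasDerivAt (fun x => |prim a u k x| ^ p)
        (p * spow p (prim a u k x) * (k x * u x)) x :=
      (hasDerivAt_abs_rpow_spow hp (prim a u k x)).comp x h1
    have e2 := (h2.add_const ε).rpow_const (p := -(p - 1)) (Or.inl hpos.ne')
    convert! e1.mul e2 using 1
    ring

/-- The weak equation is tested with the density of `sign F * |K| ^ p / (|F| + ε) ^ (p - 1)`. The
shift by `ε` is needed because `F` vanishes on `P`, and the sign makes the right-hand side
nonnegative. The product on the left is at most `|k| ^ p` pointwise, by Young's inequality. -/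
theorem picone_eps (W : Weights a b p p' q u v) {n : ℕ} {P : Fin n → ℝ}
    (hP : ∀ i, P i ∈ Icc a b) {f : ℝ → ℝ} (hf : Admissible a b p u P f) {lam : ℝ}
    (hweak : ∀ k, Admissible a b p u P k → ∫ x, spow p (f x) * k x ∂(vol a b) =
      lam * ∫ x, spow q (hardyT a u v f x) * hardyT a u v k x ∂(vol a b))
    (hz : ∀ x ∈ Ioo a b, prim a u f x = 0 → x ∈ range P) {k : ℝ → ℝ}
    (hk : Admissible a b p u P k) {ε : ℝ} (hε : 0 < ε) :
    Integrable (fun x => |v x| ^ q * |prim a u f x| ^ (q - 1) *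
      (|prim a u k x| ^ p * (|prim a u f x| + ε) ^ (-(p - 1)))) (vol a b) ∧
    lam * ∫ x, |v x| ^ q * |prim a u f x| ^ (q - 1) *
      (|prim a u k x| ^ p * (|prim a u f x| + ε) ^ (-(p - 1))) ∂(vol a b) ≤ energy p a b k := by
  have hp := W.hp
  have hp0 := W.p_pos
  have hcF := W.continuousOn_prim hf.1
  have hcK := W.continuousOn_prim hk.1
  set F := prim a u f with hFdef
  set K := prim a u k with hKdef
  let s : ℝ → ℝ := fun x => Real.sign (F x)
  obtain ⟨hsf, hsfp⟩ := W.sign_mul_prim hf.1 hz hf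
  have hsfp' : ∀ x ∈ Icc a b, prim a u (fun x => s x * f x) x = |F x| := by
    have h1 : ∀ x ∈ Ico a b, prim a u (fun x => s x * f x) x = |F x| := fun x hx =>
      (hsfp x hx).trans (sign_mul_self_eq _)
    intro x hx
    rcases hx.2.eq_or_lt with rfl | hxb
    · exact W.eq_right_of_eq_Ico (W.continuousOn_prim hsf) hcF.abs h1
    · exact h1 x ⟨hx.1, hxb⟩
  set Fa := prim a u (fun x => s x * f x) with hFa
  have hcFa : ContinuousOn Fa (Icc a b) := W.continuousOn_prim hsf
  have hFa0 : ∀ x ∈ Icc a b, 0 ≤ Fa x := fun x hx => by rw [hsfp' x hx]; positivity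
  let φ : ℝ → ℝ := fun x => |K x| ^ p * (Fa x + ε) ^ (-(p - 1))
  let l : ℝ → ℝ := fun x => p * spow p (K x) * (Fa x + ε) ^ (-(p - 1)) * k x +
    |K x| ^ p * (-(p - 1) * (Fa x + ε) ^ (-(p - 1) - 1)) * (s x * f x)
  obtain ⟨hl, hφp⟩ : MemLp l (ENNReal.ofReal p) (vol a b) ∧ ∀ x ∈ Icc a b, prim a u l x = φ x :=
    W.prim_quotient hk.1 hsf hFa0 hε
  have hladm : Admissible a b p u P l := ⟨hl, fun i => by
    rw [hφp _ (hP i)]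
    simp only [φ, hKdef, hk.2 i, abs_zero, Real.zero_rpow hp0.ne', zero_mul]⟩
  obtain ⟨hsl, hslp⟩ := W.sign_mul_prim hf.1 hz hladm
  have hsladm : Admissible a b p u P (fun x => s x * l x) := ⟨hsl, fun i => by
    rcases (hP i).2.eq_or_lt with h | h
    · have := W.prim_right_eq_zero hl hsl (s := s) (fun x => abs_sign_le _) hslp
        (by rw [← h]; exact hladm.2 i)
      rw [h]; exact this
    · have := hslp (P i) ⟨(hP i).1, h⟩
      rw [hladm.2 i, mul_zero] at this
      exact this⟩
  have hne := ae_prim_ne_zero hz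
  have hw := hweak _ hsladm
  have hint1 := integrable_spow_mul W.hq (W.memLp_hardyT hf.1) (W.memLp_hardyT hsl)
  have hae : ∀ᵐ x ∂(vol a b), spow q (hardyT a u v f x) * hardyT a u v (fun x => s x * l x) x =
      |v x| ^ q * |F x| ^ (q - 1) * (|K x| ^ p * (|F x| + ε) ^ (-(p - 1))) := by
    filter_upwards [hne, ae_vol_mem_Ioo] with x hx hm
    have hm' := Ioo_subset_Icc_self hm
    have hv := W.v_pos x hm'
    rw [hardyT_eq, hardyT_eq]
    have e1 : prim a u (fun x => s x * l x) x = s x * φ x := by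
      rw [← hφp x hm']; exact hslp x ⟨hm.1.le, hm.2⟩
    have e2 : φ x = |K x| ^ p * (|F x| + ε) ^ (-(p - 1)) := by
      simp only [φ]; rw [hsfp' x hm']
    rw [e1, e2, spow_mul, spow_of_pos hv, abs_of_pos hv]
    have e3 : v x ^ q = v x ^ (q - 1) * v x := by
      rw [← Real.rpow_add_one hv.ne']; ring_nf
    have e4 : spow q (prim a u f x) * s x = |F x| ^ (q - 1) := by
      simp only [spow, s]
      rw [mul_assoc, sign_mul_sign hx, mul_one]
    rw [e3, ← e4]; ring
  have hint : Integrable (fun x => |v x| ^ q * |F x| ^ (q - 1) *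
      (|K x| ^ p * (|F x| + ε) ^ (-(p - 1)))) (vol a b) := hint1.congr hae
  refine ⟨hint, ?_⟩
  rw [← integral_congr_ae hae, ← hw]
  refine integral_mono_ae (integrable_spow_mul hp hf.1 hsl)
    (MemLp.integrable_abs_rpow hp0 hk.1) ?_
  filter_upwards [hne, ae_vol_mem] with x hx hm
  have hpos : 0 < Fa x + ε := by have := hFa0 x hm; linarith
  -- In terms of `Y` the left-hand side is at most `p |k| Y ^ (p - 1) - (p - 1) Y ^ p`, and Young's
  -- inequality bounds this by `|k| ^ p`.
  set Y := |K x| * |f x| / (Fa x + ε) with hY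
  have hY0 : 0 ≤ Y := by positivity
  have hs2 : s x * s x = 1 := sign_mul_sign hx
  have e1 : spow p (f x) * (s x * l x) =
      p * (spow p (f x) * s x * spow p (K x) * k x) * (Fa x + ε) ^ (-(p - 1)) -
      (p - 1) * (|K x| ^ p * |f x| ^ p * (Fa x + ε) ^ (-p)) := by
    simp only [l]
    rw [← spow_mul_self (t := f x) hp, show -(p - 1) - 1 = -p by ring]
    linear_combination (-(p - 1)) * |K x| ^ p * (Fa x + ε) ^ (-p) * spow p (f x) * f x * hs2
  have e2 : |K x| ^ p * |f x| ^ p * (Fa x + ε) ^ (-p) = Y ^ p := by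
    rw [hY, Real.div_rpow (by positivity) hpos.le, Real.mul_rpow (abs_nonneg _) (abs_nonneg _),
      Real.rpow_neg hpos.le, div_eq_mul_inv]
  have e3 : spow p (f x) * s x * spow p (K x) * k x * (Fa x + ε) ^ (-(p - 1)) ≤
      |k x| * Y ^ (p - 1) := by
    refine (le_abs_self _).trans ?_
    rw [abs_mul, abs_mul, abs_mul, abs_mul, abs_spow hp, abs_spow hp, abs_of_pos
      (Real.rpow_pos_of_pos hpos _), hY, Real.div_rpow (by positivity) hpos.le,
      Real.mul_rpow (abs_nonneg _) (abs_nonneg _), Real.rpow_neg hpos.le]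
    have h5 : |s x| ≤ 1 := abs_sign_le _
    have h6 : 0 ≤ |f x| ^ (p - 1) * |K x| ^ (p - 1) * |k x| * ((Fa x + ε) ^ (p - 1))⁻¹ := by
      positivity
    calc _ = |s x| * (|f x| ^ (p - 1) * |K x| ^ (p - 1) * |k x| * ((Fa x + ε) ^ (p - 1))⁻¹) := by
          ring
      _ ≤ 1 * (|f x| ^ (p - 1) * |K x| ^ (p - 1) * |k x| * ((Fa x + ε) ^ (p - 1))⁻¹) := by
          gcongr
      _ = _ := by rw [div_eq_mul_inv]; ring
  have e4 : |k x| * Y ^ (p - 1) ≤ |k x| ^ p / p + Y ^ p / p' := by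
    have := Real.young_inequality_of_nonneg (abs_nonneg (k x)) (Real.rpow_nonneg hY0 (p - 1))
      W.conj
    rwa [← Real.rpow_mul hY0, W.conj.sub_one_mul_conj] at this
  have e5 : p * (Y ^ p / p') = (p - 1) * Y ^ p := by
    have := W.conj.symm.pos
    have h7 := W.conj.sub_one_mul_conj
    field_simp
    linear_combination (-Y ^ p) * h7
  have e6 : p * (|k x| ^ p / p) = |k x| ^ p := by field_simp
  rw [e1, e2]
  have e7 : p * (spow p (f x) * s x * spow p (K x) * k x) * (Fa x + ε) ^ (-(p - 1)) ≤
      p * (|k x| ^ p / p + Y ^ p / p') := by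
    rw [mul_assoc]
    exact mul_le_mul_of_nonneg_left (e3.trans e4) hp0.le
  rw [mul_add, e5, e6] at e7
  linarith

/-- Picone's inequality. -/
theorem picone (W : Weights a b p p' q u v) {n : ℕ} {P : Fin n → ℝ}
    (hP : ∀ i, P i ∈ Icc a b) {f : ℝ → ℝ} (hf : Admissible a b p u P f) {lam : ℝ} (hlam : 0 < lam)
    (hweak : ∀ k, Admissible a b p u P k → ∫ x, spow p (f x) * k x ∂(vol a b) =
      lam * ∫ x, spow q (hardyT a u v f x) * hardyT a u v k x ∂(vol a b))
    (hz : ∀ x ∈ Ioo a b, prim a u f x = 0 → x ∈ range P) {k : ℝ → ℝ}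
    (hk : Admissible a b p u P k) :
    Integrable (fun x => |v x| ^ q * (|prim a u f x| ^ (q - p) * |prim a u k x| ^ p)) (vol a b) ∧
    ∫ x, |v x| ^ q * (|prim a u f x| ^ (q - p) * |prim a u k x| ^ p) ∂(vol a b) ≤
      lam⁻¹ * energy p a b k := by
  have hF := (W.continuousOn_prim hf.1).aestronglyMeasurable (μ := volume) measurableSet_Icc
  have hK := (W.continuousOn_prim hk.1).aestronglyMeasurable (μ := volume) measurableSet_Icc
  -- Let `ε = 1 / (j + 1)` tend to 0. Fatou's lemma is used because `|F| ^ (q - p)` may be unbounded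
  -- near `P`; it provides integrability together with the bound.
  refine integrable_of_tendsto_of_integral_le (F := fun j : ℕ => fun x =>
      |v x| ^ q * |prim a u f x| ^ (q - 1) *
      (|prim a u k x| ^ p * (|prim a u f x| + 1 / ((j:ℝ) + 1)) ^ (-(p - 1))))
    (fun j => (W.picone_eps hP hf hweak hz hk (by positivity)).1) (fun j x => by positivity)
    (fun j => ?_) (fun x => by positivity) ?_ ?_
  · have := (W.picone_eps hP hf hweak hz hk (ε := 1 / ((j:ℝ) + 1)) (by positivity)).2
    rwa [le_inv_mul_iff₀ hlam]
  · have h1 := W.v_mem.1.aemeasurable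
    exact ((h1.abs.pow_const q).mul (((hF.aemeasurable.abs).pow_const (q - p)).mul
      ((hK.aemeasurable.abs).pow_const p))).aestronglyMeasurable
  · filter_upwards [ae_prim_ne_zero hz] with x hx
    have hpos : 0 < |prim a u f x| := abs_pos.2 hx
    have h1 : Tendsto (fun j : ℕ => (|prim a u f x| + 1 / ((j:ℝ) + 1)) ^ (-(p - 1))) atTop
        (𝓝 (|prim a u f x| ^ (-(p - 1)))) := by
      have := (tendsto_one_div_add_atTop_nhds_zero_nat (𝕜 := ℝ)).const_add |prim a u f x|
      rw [add_zero] at this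
      exact this.rpow_const (Or.inl hpos.ne')
    have h2 := (h1.const_mul (|prim a u k x| ^ p)).const_mul (|v x| ^ q * |prim a u f x| ^ (q - 1))
    convert! h2 using 2
    have : |prim a u f x| ^ (q - p) = |prim a u f x| ^ (q - 1) * |prim a u f x| ^ (-(p - 1)) := by
      rw [← Real.rpow_add hpos]; ring_nf
    rw [this]; ring

/-- Weighted arithmetic–geometric mean inequality: `K ^ q` is the geometric mean of `F ^ (q - p) * K
^ p` and `F ^ q` with weights `q / p` and `1 - q / p`. It converts Picone's weighted bound into one
for the L_q norm, and it is here that `q ≤ p` enters. -/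
theorem young_aux (hq : 0 < q) (hqp : q ≤ p) {F K : ℝ} (hF : 0 < F) (hK : 0 ≤ K) :
    K ^ q ≤ q / p * (F ^ (q - p) * K ^ p) + (1 - q / p) * F ^ q := by
  have hp : 0 < p := hq.trans_le hqp
  have hle : q / p ≤ 1 := (div_le_one hp).2 hqp
  have := Real.geom_mean_le_arith_mean2_weighted (w₁ := q / p) (w₂ := 1 - q / p)
    (p₁ := F ^ (q - p) * K ^ p) (p₂ := F ^ q) (by positivity) (by linarith) (by positivity)
    (by positivity) (by ring)
  refine le_trans (le_of_eq ?_) this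
  rw [Real.mul_rpow (by positivity) (by positivity), ← Real.rpow_mul hF.le, ← Real.rpow_mul hK,
    ← Real.rpow_mul hF.le, show p * (q / p) = q by field_simp, mul_right_comm, ← Real.rpow_add hF,
    show (q - p) * (q / p) + q * (1 - q / p) = 0 by field_simp; ring, Real.rpow_zero, one_mul]

/-- The equality case, from strict Bernoulli with exponent `q / p < 1`. It is the source of
uniqueness of extremal functions up to signs. -/
theorem young_aux_eq (hq : 0 < q) (hqp : q < p) {F K : ℝ} (hF : 0 < F) (hK : 0 ≤ K)
    (h : K ^ q = q / p * (F ^ (q - p) * K ^ p) + (1 - q / p) * F ^ q) : K = F := by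
  have hp : 0 < p := hq.trans hqp
  by_contra hne
  -- with `t = K / F` the identity reads `t ^ q = q / p * t ^ p + (1 - q / p)`
  set t := (K / F) ^ p with ht
  have ht0 : 0 ≤ t := by positivity
  have hKF : K / F ≠ 1 := fun h => hne ((div_eq_one_iff_eq hF.ne').1 h)
  have ht1 : t ≠ 1 := fun h1 => hKF (by
    have := congrArg (fun y => y ^ (1 / p)) h1
    simp only [ht] at this
    rwa [← Real.rpow_mul (by positivity), mul_one_div_cancel hp.ne', Real.rpow_one,
      Real.one_rpow] at this)
  have hs := rpow_one_add_lt_one_add_mul_self (s := t - 1) (by linarith) (sub_ne_zero.2 ht1)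
    (p := q / p) (by positivity) ((div_lt_one hp).2 hqp)
  rw [add_sub_cancel, ht, ← Real.rpow_mul (by positivity), show p * (q / p) = q by field_simp,
    Real.div_rpow hK hF.le, Real.div_rpow hK hF.le] at hs
  have hFq : 0 < F ^ q := by positivity
  rw [div_lt_iff₀ hFq] at hs
  have e : F ^ (q - p) = F ^ q / F ^ p := Real.rpow_sub hF q p
  rw [h, e] at hs
  have : (1 + q / p * (K ^ p / F ^ p - 1)) * F ^ q =
      q / p * (F ^ q / F ^ p * K ^ p) + (1 - q / p) * F ^ q := by field_simp; ring
  linarith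

/-- A critical function without zeros off `P` is extremal, and for `q < p` the extremal function is
unique up to signs. -/
theorem energy_le_of_critical (W : Weights a b p p' q u v) {n : ℕ} {P : Fin n → ℝ}
    (hP : ∀ i, P i ∈ Icc a b) {f : ℝ → ℝ} (hf : Admissible a b p u P f) {lam : ℝ} (hlam : 0 < lam)
    (hweak : ∀ k, Admissible a b p u P k → ∫ x, spow p (f x) * k x ∂(vol a b) =
      lam * ∫ x, spow q (hardyT a u v f x) * hardyT a u v k x ∂(vol a b))
    (hz : ∀ x ∈ Ioo a b, prim a u f x = 0 → x ∈ range P) (hf1 : energy p a b f = 1) {k : ℝ → ℝ}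
    (hk : Admissible a b p u P k) (hk1 : energy p a b k ≤ 1) :
    energy q a b (hardyT a u v k) ≤ lam⁻¹ ∧
      (q < p → energy q a b (hardyT a u v k) = lam⁻¹ →
        ∀ x ∈ Icc a b, |prim a u k x| = |prim a u f x|) := by
  have hp := W.p_pos
  have hq := W.q_pos
  obtain ⟨hi, hle⟩ := W.picone hP hf hlam hweak hz hk
  -- The critical equation tested with `f` itself.
  have hNf : energy q a b (hardyT a u v f) = lam⁻¹ := by
    have := hweak f hf
    simp only [spow_mul_self W.hp, spow_mul_self W.hq] at this
    rw [energy] at hf1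
    rw [hf1] at this
    exact eq_inv_of_mul_eq_one_right this.symm
  have hiF := MemLp.integrable_abs_rpow hq (W.memLp_hardyT hf.1)
  have hiK := MemLp.integrable_abs_rpow hq (W.memLp_hardyT hk.1)
  -- The pointwise majorant from `young_aux`. Its integral is at most `(q / p) * lam⁻¹ + (1 - q / p)
  -- * lam⁻¹`, the first part by Picone and the second by `hNf`.
  let R : ℝ → ℝ := fun x =>
    q / p * (|v x| ^ q * (|prim a u f x| ^ (q - p) * |prim a u k x| ^ p)) +
      (1 - q / p) * |hardyT a u v f x| ^ q
  have hiR : Integrable R (vol a b) := (hi.const_mul _).add (hiF.const_mul _)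
  have hR : ∫ x, R x ∂(vol a b) ≤ lam⁻¹ := by
    simp only [R]
    rw [integral_add (hi.const_mul _) (hiF.const_mul _), integral_const_mul, integral_const_mul]
    rw [energy] at hNf
    rw [hNf]
    have h1 : lam⁻¹ * energy p a b k ≤ lam⁻¹ := mul_le_of_le_one_right (by positivity) hk1
    have h2 : q / p * ∫ x, |v x| ^ q * (|prim a u f x| ^ (q - p) * |prim a u k x| ^ p) ∂(vol a b) ≤
        q / p * lam⁻¹ := by gcongr; exact hle.trans h1
    linarith
  have hmul : ∀ x, ∀ g : ℝ → ℝ, |hardyT a u v g x| ^ q = |v x| ^ q * |prim a u g x| ^ q :=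
    fun x g => by rw [hardyT_eq, abs_mul, Real.mul_rpow (abs_nonneg _) (abs_nonneg _)]
  have hae : ∀ᵐ x ∂(vol a b), |hardyT a u v k x| ^ q ≤ R x := by
    filter_upwards [ae_prim_ne_zero hz] with x hx
    have := young_aux hq W.hqp (abs_pos.2 hx) (abs_nonneg (prim a u k x))
    simp only [R, hmul]
    have hv : 0 ≤ |v x| ^ q := by positivity
    nlinarith
  refine ⟨(integral_mono_ae hiK hiR hae).trans hR, fun hqp heq => ?_⟩
  have hsub : ∫ x, (R x - |hardyT a u v k x| ^ q) ∂(vol a b) = 0 := by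
    refine le_antisymm ?_ (integral_nonneg_of_ae (by
      filter_upwards [hae] with x hx using sub_nonneg.2 hx))
    rw [integral_sub hiR hiK]
    rw [energy] at heq
    linarith
  have hz0 := (integral_eq_zero_iff_of_nonneg_ae (by
      filter_upwards [hae] with x hx using sub_nonneg.2 hx) (hiR.sub hiK)).1 hsub
  have hab : (fun x => |prim a u k x|) =ᵐ[vol a b] fun x => |prim a u f x| := by
    filter_upwards [hz0, ae_prim_ne_zero hz, ae_vol_mem] with x h1 h2 h3
    have h1' : R x - |hardyT a u v k x| ^ q = 0 := h1
    simp only [R, hmul] at h1'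
    have hv : 0 < |v x| ^ q := by have := abs_pos.2 (W.v_pos x h3).ne'; positivity
    refine young_aux_eq hq hqp (abs_pos.2 h2) (abs_nonneg _) ?_
    refine mul_left_cancel₀ hv.ne' ?_
    linarith
  exact Measure.eqOn_Icc_of_ae_eq volume W.hab.ne hab (W.continuousOn_prim hk.1).abs
    (W.continuousOn_prim hf.1).abs

end Weights

end HardySpectral

namespace HardySpectral

variable {a b p p' q : ℝ} {u v : ℝ → ℝ}

namespace Weights

/-! ### Spectral triples and extremal functions -/

theorem hardyTstar_eq {g f : ℝ → ℝ} (hg : ∀ x ∈ Icc a b, g x = hardyT a u v f x) {x : ℝ}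
    (hx : x ∈ Icc a b) : hardyTstar b u v (fun y => spow q (g y)) x =
      u x * tail b (fun y => v y * spow q (hardyT a u v f y)) x := by
  simp only [hardyTstar, tail]
  congr 1
  refine intervalIntegral.integral_congr fun y hy => ?_
  rw [uIcc_of_le hx.2] at hy
  rw [hg y ⟨hx.1.trans hy.1, hy.2⟩]

theorem hardyT_eq_zero_iff (W : Weights a b p p' q u v) {f : ℝ → ℝ} {x : ℝ} (hx : x ∈ Icc a b) :
    hardyT a u v f x = 0 ↔ prim a u f x = 0 := by
  rw [hardyT_eq, mul_eq_zero, or_iff_right (W.v_pos x hx).ne']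

theorem energy_eq_one_of_eLpNorm (W : Weights a b p p' q u v) {f : ℝ → ℝ}
    (hf : MemLp f (ENNReal.ofReal p) (vol a b)) :
    eLpNorm f (ENNReal.ofReal p) (vol a b) = 1 ↔ energy p a b f = 1 := by
  have hp := W.p_pos
  rw [eLpNorm_ofReal hp hf, ENNReal.ofReal_eq_one]
  constructor
  · intro h
    have := congrArg (fun y => y ^ p) h
    beta_reduce at this
    rwa [← Real.rpow_mul integral_abs_rpow_nonneg, one_div_mul_cancel hp.ne', Real.rpow_one,
      Real.one_rpow] at this
  · intro h
    rw [energy] at h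
    rw [h, Real.one_rpow]

/-- The pointwise equation of a spectral triple implies its weak form. -/
theorem weak_of_ae (W : Weights a b p p' q u v) {f : ℝ → ℝ}
    (hf : MemLp f (ENNReal.ofReal p) (vol a b)) {lam : ℝ}
    (h : ∀ᵐ x ∂(vol a b), spow p (f x) =
      u x * (lam * tail b (fun y => v y * spow q (hardyT a u v f y)) x)) {k : ℝ → ℝ}
    (hk : MemLp k (ENNReal.ofReal p) (vol a b)) :
    ∫ x, spow p (f x) * k x ∂(vol a b) =
      lam * ∫ x, spow q (hardyT a u v f x) * hardyT a u v k x ∂(vol a b) := by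
  rw [W.integral_spow_hardyT hf hk, ← integral_const_mul]
  refine integral_congr_ae ?_
  filter_upwards [h] with x hx
  rw [hx]; ring

/-- A normalized solution of the spectral equation whose primitive has the zeros `P`. -/
structure IsNodal (a b p q : ℝ) (u v : ℝ → ℝ) {n : ℕ} (P : Fin n → ℝ) (f : ℝ → ℝ) (lam : ℝ) :
    Prop where
  memLp : MemLp f (ENNReal.ofReal p) (vol a b)
  energy_eq : energy p a b f = 1
  ae_eq : ∀ᵐ x ∂(vol a b), spow p (f x) =
    u x * (lam * tail b (fun y => v y * spow q (hardyT a u v f y)) x)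
  strictMono : StrictMono P
  mem : ∀ i, P i ∈ Ioo a b
  zero_iff : ∀ x ∈ Ioo a b, prim a u f x = 0 ↔ x ∈ range P

theorem exists_isNodal_of_mem_spN (W : Weights a b p p' q u v) {n : ℕ} {lam : ℝ}
    (h : lam ∈ spN a b p q u v n) :
    ∃ (P : Fin n → ℝ) (f : ℝ → ℝ), IsNodal a b p q u v P f lam := by
  obtain ⟨g, f, ht, hz⟩ := h
  set Z := {x ∈ Ioo a b | g x = 0} with hZ
  have hfin : Z.Finite := finite_of_encard_eq_coe hz
  have hcard : hfin.toFinset.card = n := by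
    have h3 : Z.encard = n := hz
    rw [hfin.encard_eq_coe_toFinset_card] at h3
    exact_mod_cast h3
  have hrange : range (hfin.toFinset.orderEmbOfFin hcard) = Z := by
    rw [Finset.range_orderEmbOfFin]; simp
  refine ⟨hfin.toFinset.orderEmbOfFin hcard, f, ht.memLp,
    (W.energy_eq_one_of_eLpNorm ht.memLp).1 ht.norm_eq_one, ?_,
    (hfin.toFinset.orderEmbOfFin hcard).strictMono,
    fun i => (hrange.le (mem_range_self i)).1, fun x hx => ?_⟩
  · filter_upwards [ht.eq_Tstar, ae_vol_mem] with x hx hm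
    rw [hx, hardyTstar_eq ht.eq_T hm]; ring
  · rw [hrange, ← W.hardyT_eq_zero_iff (Ioo_subset_Icc_self hx), ← ht.eq_T x
      (Ioo_subset_Icc_self hx)]
    exact ⟨fun h => ⟨hx, h⟩, fun h => h.2⟩

/-- Testing the equation with `f` gives `1 = lam * ‖Tf‖_q ^ q`. -/
theorem lam_pos_of_ae (W : Weights a b p p' q u v) {f : ℝ → ℝ} {lam : ℝ}
    (hf : MemLp f (ENNReal.ofReal p) (vol a b)) (hf1 : energy p a b f = 1)
    (h : ∀ᵐ x ∂(vol a b), spow p (f x) =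
      u x * (lam * tail b (fun y => v y * spow q (hardyT a u v f y)) x)) : 0 < lam := by
  have h1 := W.weak_of_ae hf h hf
  simp only [spow_mul_self W.hp, spow_mul_self W.hq] at h1
  rw [energy] at hf1
  rw [hf1] at h1
  have h2 : 0 ≤ ∫ x, |hardyT a u v f x| ^ q ∂(vol a b) := integral_abs_rpow_nonneg
  by_contra! hneg
  nlinarith

/-- The upper bound for spectral numbers: a solution is admissible and critical for its own zeros,
and therefore extremal for them. -/
theorem exists_supRatio_le_of_mem_spN (W : Weights a b p p' q u v) {n : ℕ} {lam : ℝ}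
    (h : lam ∈ spN a b p q u v n) :
    0 < lam ∧ ∃ P : Fin n → ℝ, (∀ i, P i ∈ Icc a b) ∧ supRatio a b p q u v P ≤ lam⁻¹ := by
  obtain ⟨P, f, hf⟩ := W.exists_isNodal_of_mem_spN h
  have hlam := W.lam_pos_of_ae hf.memLp hf.energy_eq hf.ae_eq
  have hP : ∀ i, P i ∈ Icc a b := fun i => Ioo_subset_Icc_self (hf.mem i)
  have hadm : Admissible a b p u P f :=
    ⟨hf.memLp, fun i => (hf.zero_iff _ (hf.mem i)).2 (mem_range_self i)⟩
  refine ⟨hlam, P, hP, ?_⟩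
  refine csSup_le ⟨_, fun _ => 0, ⟨MemLp.zero, fun i => by simp [prim]⟩, by
    simp [energy, Real.zero_rpow W.p_pos.ne'], rfl⟩ ?_
  rintro y ⟨k, hk, hk1, rfl⟩
  exact (W.energy_le_of_critical hP hadm hlam (fun k hk => W.weak_of_ae hf.memLp hf.ae_eq hk.1)
    (fun x hx h0 => (hf.zero_iff x hx).1 h0) hf.energy_eq hk hk1).1

theorem mem_spN_of_ae (W : Weights a b p p' q u v) {n : ℕ} {P : Fin n → ℝ} {f : ℝ → ℝ} {lam : ℝ}
    (hf : MemLp f (ENNReal.ofReal p) (vol a b)) (hf1 : energy p a b f = 1)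
    (h : ∀ᵐ x ∂(vol a b), spow p (f x) =
      u x * (lam * tail b (fun y => v y * spow q (hardyT a u v f y)) x))
    (hinj : Function.Injective P) (hP : ∀ i, P i ∈ Ioo a b)
    (hz : ∀ x ∈ Ioo a b, prim a u f x = 0 ↔ x ∈ range P) : lam ∈ spN a b p q u v n := by
  refine ⟨hardyT a u v f, f, ⟨hf, (W.energy_eq_one_of_eLpNorm hf).2 hf1, fun _ _ => rfl, ?_⟩, ?_⟩
  · filter_upwards [h, ae_vol_mem] with x hx hm
    rw [hx, hardyTstar_eq (fun _ _ => rfl) hm]; ring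
  · have : {x ∈ Ioo a b | hardyT a u v f x = 0} = range P := by
      ext x
      simp only [mem_ofPred_eq]
      constructor
      · rintro ⟨h1, h2⟩
        exact (hz x h1).1 ((W.hardyT_eq_zero_iff (Ioo_subset_Icc_self h1)).1 h2)
      · rintro ⟨i, rfl⟩
        exact ⟨hP i, (W.hardyT_eq_zero_iff (Ioo_subset_Icc_self (hP i))).2
          ((hz _ (hP i)).2 (mem_range_self i))⟩
    rw [zeroCount, this, ← image_univ, hinj.encard_image, encard_univ]
    simp

/-! ### Variation of the zeros -/

/-- Thresholding at `δ = ∑ |F(P i)|` changes `Tf` by at most `δ |v|` pointwise. The estimate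
controls from above the extremal values of configurations near `P`. -/
theorem rpow_energy_le (W : Weights a b p p' q u v) {n : ℕ} {P : Fin n → ℝ}
    (hP : ∀ i, P i ∈ Icc a b) {f : ℝ → ℝ} (hf : MemLp f (ENNReal.ofReal p) (vol a b))
    (hf1 : energy p a b f ≤ 1) :
    energy q a b (hardyT a u v f) ^ (1 / q) ≤ supRatio a b p q u v P ^ (1 / q) +
      (∑ i, |prim a u f (P i)|) * energy q a b v ^ (1 / q) := by
  have hq := W.q_pos
  obtain ⟨k, hk, hke, hkp⟩ := W.exists_admissible_shrink hP hf
  set δ := ∑ i, |prim a u f (P i)|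
  have hδ : 0 ≤ δ := Finset.sum_nonneg fun _ _ => abs_nonneg _
  have h1 : energy q a b (hardyT a u v k) ^ (1 / q) ≤ supRatio a b p q u v P ^ (1 / q) :=
    Real.rpow_le_rpow (energy_nonneg _ _ _ _) (W.energy_le_supRatio hk (hke.trans hf1))
      (by positivity)
  have hmT := W.memLp_hardyT hf
  have hmk := W.memLp_hardyT hk.1
  have h2 : lpNorm (hardyT a u v f) (ENNReal.ofReal q) (vol a b) ≤
      lpNorm (hardyT a u v k) (ENNReal.ofReal q) (vol a b) +
        lpNorm (hardyT a u v f - hardyT a u v k) (ENNReal.ofReal q) (vol a b) := by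
    have := lpNorm_add_le (g := hardyT a u v f - hardyT a u v k) hmk (one_le_ofReal W.hq.le)
    rwa [add_sub_cancel] at this
  rw [lpNorm_ofReal hq hmT.1, lpNorm_ofReal hq hmk.1, lpNorm_ofReal hq (hmT.sub hmk).1] at h2
  have h3 : (∫ x, |(hardyT a u v f - hardyT a u v k) x| ^ q ∂(vol a b)) ≤
      δ ^ q * energy q a b v := by
    rw [energy, ← integral_const_mul]
    refine integral_mono_ae (MemLp.integrable_abs_rpow hq (hmT.sub hmk))
      (W.integrable_v.const_mul _) ?_
    filter_upwards [ae_vol_mem] with x hx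
    rw [Pi.sub_apply, hardyT_eq, hardyT_eq, hkp x hx, ← mul_sub, abs_mul,
      Real.mul_rpow (abs_nonneg _) (abs_nonneg _), mul_comm]
    have := abs_sub_shrink_le (y := prim a u f x) hδ
    gcongr
  have h4 := Real.rpow_le_rpow integral_abs_rpow_nonneg h3 (by positivity : 0 ≤ 1 / q)
  rw [Real.mul_rpow (by positivity) (energy_nonneg _ _ _ _), ← Real.rpow_mul hδ,
    mul_one_div_cancel hq.ne', Real.rpow_one] at h4
  exact (h2.trans (add_le_add le_rfl h4)).trans (add_le_add h1 le_rfl)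

/-- Extremal functions for varying points converge, up to subsequences, if the limit points
minimize. -/
theorem exists_subseq_tendsto_of_min (W : Weights a b p p' q u v) {n : ℕ} {P : Fin n → ℝ}
    (hP : ∀ i, P i ∈ Icc a b) (hmin : ∀ P' : Fin n → ℝ, (∀ i, P' i ∈ Icc a b) →
      supRatio a b p q u v P ≤ supRatio a b p q u v P') {Pk : ℕ → Fin n → ℝ}
    (hPk : ∀ k i, Pk k i ∈ Icc a b) (hlim : ∀ i, Tendsto (fun k => Pk k i) atTop (𝓝 (P i)))
    {f : ℕ → ℝ → ℝ} (hf : ∀ k, IsExtremal a b p q u v (Pk k) (f k)) :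
    ∃ φ : ℕ → ℕ, StrictMono φ ∧ ∃ g, IsExtremal a b p q u v P g ∧
      Tendsto (fun k => ∫ x, |f (φ k) x - g x| ^ p ∂(vol a b)) atTop (𝓝 0) ∧
      ∀ x ∈ Icc a b, Tendsto (fun k => prim a u (f (φ k)) x) atTop (𝓝 (prim a u g x)) := by
  have hq := W.q_pos
  have hfP : ∀ i, Tendsto (fun k => prim a u (f k) (P i)) atTop (𝓝 0) := by
    intro i
    rw [Metric.tendsto_atTop]
    intro ε hε
    obtain ⟨δ, hδ, h⟩ := W.prim_equicontinuous hε
    obtain ⟨K, hK⟩ := Metric.tendsto_atTop.1 (hlim i) δ hδ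
    refine ⟨K, fun k hk => ?_⟩
    have := h (f k) (hf k).adm.1 (hf k).energy_eq.le (P i) (hP i) (Pk k i) (hPk k i) (by
      rw [abs_sub_comm]; exact hK k hk)
    rwa [(hf k).adm.2 i] at this
  have hN : Tendsto (fun k => energy q a b (hardyT a u v (f k))) atTop
      (𝓝 (supRatio a b p q u v P)) := by
    have h1 : Tendsto (fun k => supRatio a b p q u v P ^ (1 / q) +
        (∑ i, |prim a u (f k) (P i)|) * energy q a b v ^ (1 / q)) atTop
        (𝓝 (supRatio a b p q u v P ^ (1 / q))) := by
      have h2 : Tendsto (fun k => ∑ i, |prim a u (f k) (P i)|) atTop (𝓝 (∑ i : Fin n, |(0:ℝ)|)) :=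
        tendsto_finsetSum _ fun i _ => (hfP i).abs
      have h3 := (h2.mul_const (energy q a b v ^ (1 / q))).const_add
        (supRatio a b p q u v P ^ (1 / q))
      simpa using h3
    -- Squeezed between minimality of `P` from below and `rpow_energy_le` from above: along the
    -- perturbed configurations the extremal values converge to the minimum.
    have h4 : Tendsto (fun k => energy q a b (hardyT a u v (f k)) ^ (1 / q)) atTop
        (𝓝 (supRatio a b p q u v P ^ (1 / q))) := by
      refine tendsto_of_tendsto_of_tendsto_of_le_of_le tendsto_const_nhds h1 (fun k => ?_)
        (fun k => W.rpow_energy_le hP (hf k).adm.1 (hf k).energy_eq.le)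
      simp only
      rw [(hf k).energy_T]
      exact Real.rpow_le_rpow (W.supRatio_pos hP).le (hmin _ (hPk k)) (by positivity)
    have h5 := h4.rpow_const (p := q) (Or.inr hq.le)
    simpa only [← Real.rpow_mul (energy_nonneg _ _ _ _), ← Real.rpow_mul (W.supRatio_pos hP).le,
      one_div_mul_cancel hq.ne', Real.rpow_one] using h5
  obtain ⟨φ, hφ, g, h1, h2, h3, h4, h5⟩ := W.exists_subseq_tendsto hP (fun k => (hf k).adm.1)
    (fun k => (hf k).energy_eq.le) hfP hN
  exact ⟨φ, hφ, g, ⟨h1, h2, h3⟩, h4, h5⟩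

theorem tendsto_energy_hardyT (W : Weights a b p p' q u v) {f : ℕ → ℝ → ℝ} {g h : ℝ → ℝ}
    (hf : ∀ k, MemLp (f k) (ENNReal.ofReal p) (vol a b))
    (hg : MemLp g (ENNReal.ofReal p) (vol a b)) (hh : MemLp h (ENNReal.ofReal p) (vol a b))
    (hlim : Tendsto (fun k => ∫ x, |f k x - g x| ^ p ∂(vol a b)) atTop (𝓝 0)) (s : ℝ) :
    Tendsto (fun k => ∫ x, |hardyT a u v (f k) x + s * hardyT a u v h x| ^ q ∂(vol a b)) atTop
      (𝓝 (∫ x, |hardyT a u v g x + s * hardyT a u v h x| ^ q ∂(vol a b))) := by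
  have hp := W.p_pos
  have hu : TendstoUniformlyOn (fun k => prim a u (f k)) (prim a u g) atTop (Icc a b) := by
    rw [Metric.tendstoUniformlyOn_iff]
    intro ε hε
    have h1 := (hlim.rpow_const (p := 1 / p) (Or.inr (by positivity))).mul_const
      ((∫ t, |u t| ^ p' ∂(vol a b)) ^ (1 / p'))
    rw [Real.zero_rpow (by positivity), zero_mul] at h1
    filter_upwards [h1.eventually (gt_mem_nhds hε)] with k hk x hx
    have h2 := W.abs_prim_le ((hf k).sub hg) hx
    have h3 : prim a u (f k - g) x = prim a u (f k) x - prim a u g x := by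
      have := W.prim_add (hf k) (hg.const_mul (-1)) hx
      rw [prim_const_mul] at this
      rw [sub_eq_add_neg (prim a u (f k) x), ← neg_one_mul, ← this]
      simp only [prim, Pi.sub_apply]
      congr 1; ext t; ring
    rw [h3] at h2
    rw [dist_comm]
    exact h2.trans_lt hk
  have hc := W.continuousOn_prim hh
  have hu2 : TendstoUniformlyOn (fun k x => prim a u (f k) x + s * prim a u h x)
      (fun x => prim a u g x + s * prim a u h x) atTop (Icc a b) := by
    rw [Metric.tendstoUniformlyOn_iff] at hu ⊢
    intro ε hε
    filter_upwards [hu ε hε] with k hk x hx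
    simpa using hk x hx
  have := W.tendsto_integral_of_uniform (fun k => (W.continuousOn_prim (hf k)).add
    (continuousOn_const.mul hc)) ((W.continuousOn_prim hg).add (continuousOn_const.mul hc)) hu2
  simp only [hardyT_eq]
  convert! this using 3 <;>
  · ext x
    simp only [Pi.add_apply, Pi.mul_apply]
    ring_nf

/-- First variation: if extremal functions for perturbed points are negative at the unperturbed
point, the multiplier of this point is nonnegative. -/
theorem multiplier_nonneg (W : Weights a b p p' q u v) {n : ℕ} {P : Fin n → ℝ}
    (hP : ∀ i, P i ∈ Icc a b) (hmin : ∀ P' : Fin n → ℝ, (∀ i, P' i ∈ Icc a b) →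
      supRatio a b p q u v P ≤ supRatio a b p q u v P') {Pk : ℕ → Fin n → ℝ}
    (hPk : ∀ k i, Pk k i ∈ Icc a b) {i : Fin n} (hPki : ∀ k j, j ≠ i → Pk k j = P j)
    {η : ℝ → ℝ} (hη : MemLp η (ENNReal.ofReal p) (vol a b))
    (hηi : prim a u η (P i) = 1) (hηj : ∀ j, j ≠ i → prim a u η (P j) = 0)
    {f : ℕ → ℝ → ℝ} (hf : ∀ k, IsExtremal a b p q u v (Pk k) (f k)) {g : ℝ → ℝ}
    (hg : IsExtremal a b p q u v P g)
    (hlim : Tendsto (fun k => ∫ x, |f k x - g x| ^ p ∂(vol a b)) atTop (𝓝 0))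
    (hlimi : Tendsto (fun k => prim a u (f k) (P i)) atTop (𝓝 0))
    (hneg : ∀ k, prim a u (f k) (P i) < 0) :
    0 ≤ ∫ x, spow p (g x) * η x ∂(vol a b) - (supRatio a b p q u v P)⁻¹ *
        ∫ x, spow q (hardyT a u v g x) * hardyT a u v η x ∂(vol a b) := by
  have hp := W.p_pos
  have hq := W.q_pos
  have hS := W.supRatio_pos hP
  set S := supRatio a b p q u v P with hSdef
  let Nk : ℕ → ℝ → ℝ := fun k s =>
    ∫ x, |hardyT a u v (f k) x + s * hardyT a u v η x| ^ q ∂(vol a b)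
  let N : ℝ → ℝ := fun s => ∫ x, |hardyT a u v g x + s * hardyT a u v η x| ^ q ∂(vol a b)
  let Mk : ℕ → ℝ → ℝ := fun k s => ∫ x, |f k x + s * η x| ^ p ∂(vol a b)
  let M : ℝ → ℝ := fun s => ∫ x, |g x + s * η x| ^ p ∂(vol a b)
  have hN : ∀ s, Tendsto (fun k => Nk k s) atTop (𝓝 (N s)) := fun s =>
    W.tendsto_energy_hardyT (fun k => (hf k).adm.1) hg.adm.1 hη hlim s
  have hM : ∀ s, Tendsto (fun k => Mk k s) atTop (𝓝 (M s)) := fun s => by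
    refine tendsto_integral_abs_rpow W.hp.le
      (F := fun k x => f k x + s * η x) (f := fun x => g x + s * η x)
      (fun k => (hf k).adm.1.add (hη.const_mul s))
      (hg.adm.1.add (hη.const_mul s)) ?_
    simpa using hlim
  have hN0 : N 0 = S := by
    have := hg.energy_T
    simpa [N, energy] using this
  have hM0 : M 0 = 1 := by
    have := hg.energy_eq
    simpa [M, energy] using this
  have hMk0 : ∀ k, Mk k 0 = 1 := fun k => by
    have := (hf k).energy_eq
    simpa [Mk, energy] using this
  have hNk0 : ∀ k, Nk k 0 = supRatio a b p q u v (Pk k) := fun k => by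
    have := (hf k).energy_T
    simpa [Nk, energy] using this
  -- With `s = -F_k(P i) > 0` the function `f k + s η` is admissible for `P`, so `Nk s ≤ S * Mk s ^
  -- (q / p)`, whereas minimality gives `S ≤ Nk 0`. The resulting comparison of slopes lives on `[0,
  -- s]` with `s` depending on `k`. Convexity in `s` extends it to the fixed increments `-δ` and
  -- `δ`, so that `k → ∞` can be taken before `δ → 0`.
  have hslope : ∀ δ > 0, (N 0 - N (-δ)) / δ ≤ S * (q / p) * ((M δ - M 0) / δ) := by
    intro δ hδ
    have h1 : Tendsto (fun k => (Nk k 0 - Nk k (-δ)) / δ) atTop (𝓝 ((N 0 - N (-δ)) / δ)) :=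
      ((hN 0).sub (hN (-δ))).div_const δ
    have h2 : Tendsto (fun k => Nk k 0 * (q / p) * ((Mk k δ - Mk k 0) / δ)) atTop
        (𝓝 (N 0 * (q / p) * ((M δ - M 0) / δ))) :=
      ((hN 0).mul_const _).mul (((hM δ).sub (hM 0)).div_const δ)
    rw [hN0] at h2
    rw [hN0] at h1 ⊢
    refine le_of_tendsto_of_tendsto h1 h2 ?_
    filter_upwards [hlimi.eventually (lt_mem_nhds (show -δ < 0 by linarith))] with k hk
    set s := -prim a u (f k) (P i) with hs
    have hs0 : 0 < s := by have := hneg k; linarith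
    have hsδ : s < δ := by linarith
    have hadm : Admissible a b p u P (fun x => f k x + s * η x) := by
      refine ⟨(hf k).adm.1.add (hη.const_mul s), fun j => ?_⟩
      rw [W.prim_add (hf k).adm.1 (hη.const_mul s) (hP j), prim_const_mul]
      by_cases hj : j = i
      · rw [hj, hηi, hs]; ring
      · rw [hηj j hj, ← hPki k j hj, (hf k).adm.2 j]; ring
    have e1 : Nk k s ≤ S * Mk k s ^ (q / p) := by
      have := W.energy_le_mul_rpow hadm
      rwa [W.energy_hardyT_add_mul (hf k).adm.1 hη] at this
    have e2 : S ≤ Nk k 0 := by rw [hNk0]; exact hmin _ (hPk k)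
    have hM0' : 0 ≤ Mk k s := integral_abs_rpow_nonneg
    have e3 : Mk k s ^ (q / p) ≤ 1 + q / p * (Mk k s - 1) := by
      have := rpow_one_add_le_one_add_mul_self (s := Mk k s - 1) (by linarith) (p := q / p)
        (by positivity) ((div_le_one hp).2 W.hqp)
      rwa [add_sub_cancel] at this
    have e4 : Nk k s - Nk k 0 ≤ Nk k 0 * (q / p) * (Mk k s - Mk k 0) := by
      have h5 : S * Mk k s ^ (q / p) ≤ Nk k 0 * Mk k s ^ (q / p) := by gcongr
      have h6 : Nk k 0 * Mk k s ^ (q / p) ≤ Nk k 0 * (1 + q / p * (Mk k s - 1)) := by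
        have : 0 ≤ Nk k 0 := hS.le.trans e2
        gcongr
      rw [hMk0]
      linarith
    have c1 := (convexOn_integral_abs_rpow W.hq.le (W.memLp_hardyT (hf k).adm.1)
      (W.memLp_hardyT hη)).slope_mono_adjacent (mem_univ (-δ)) (mem_univ s)
      (show -δ < 0 by linarith) hs0
    have c2 := (convexOn_integral_abs_rpow W.hp.le (hf k).adm.1 hη).secant_mono
      (mem_univ 0) (mem_univ s) (mem_univ δ) hs0.ne' hδ.ne' hsδ.le
    have c1' : (Nk k 0 - Nk k (-δ)) / δ ≤ (Nk k s - Nk k 0) / s := by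
      simpa [Nk] using c1
    have c2' : (Mk k s - Mk k 0) / s ≤ (Mk k δ - Mk k 0) / δ := by
      simpa [Mk] using c2
    refine c1'.trans ?_
    calc (Nk k s - Nk k 0) / s ≤ (Nk k 0 * (q / p) * (Mk k s - Mk k 0)) / s := by gcongr
      _ = Nk k 0 * (q / p) * ((Mk k s - Mk k 0) / s) := by ring
      _ ≤ _ := by
          have : 0 ≤ Nk k 0 := hS.le.trans e2
          gcongr
  set X := ∫ x, spow p (g x) * η x ∂(vol a b)
  set Y := ∫ x, spow q (hardyT a u v g x) * hardyT a u v η x ∂(vol a b)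
  have dN : HasDerivAt N (q * Y) 0 :=
    hasDerivAt_integral_abs_rpow W.hq (W.memLp_hardyT hg.adm.1) (W.memLp_hardyT hη)
  have dM : HasDerivAt M (p * X) 0 := hasDerivAt_integral_abs_rpow W.hp hg.adm.1 hη
  have tN : Tendsto (fun δ : ℝ => (N 0 - N (-δ)) / δ) (𝓝[>] 0) (𝓝 (q * Y)) := by
    have h1 : HasDerivAt (fun δ => -N (-δ)) (q * Y) 0 := by
      have h2 : HasDerivAt (fun δ : ℝ => -δ) (-1) 0 := (hasDerivAt_id (0:ℝ)).neg
      have h3 := (HasDerivAt.comp (0:ℝ) (h₂ := N) (h := fun δ : ℝ => -δ) (by simpa using dN) h2).neg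
      convert! h3 using 1
      ring
    have := (hasDerivAt_iff_tendsto_slope_zero.1 h1).mono_left (nhdsGT_le_nhdsNE 0)
    refine this.congr fun δ => ?_
    simp only [zero_add, neg_zero, smul_eq_mul]; ring
  have tM : Tendsto (fun δ : ℝ => S * (q / p) * ((M δ - M 0) / δ)) (𝓝[>] 0)
      (𝓝 (S * (q / p) * (p * X))) := by
    have := (hasDerivAt_iff_tendsto_slope_zero.1 dM).mono_left (nhdsGT_le_nhdsNE 0)
    refine Tendsto.const_mul _ (this.congr fun δ => ?_)
    simp only [zero_add, smul_eq_mul]; ring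
  have hfin : q * Y ≤ S * (q / p) * (p * X) := by
    refine le_of_tendsto_of_tendsto tN tM ?_
    filter_upwards [self_mem_nhdsWithin] with δ hδ using hslope δ hδ
  have h7 : S * (q / p) * (p * X) = q * (S * X) := by field_simp
  rw [h7] at hfin
  have h8 : Y ≤ S * X := le_of_mul_le_mul_left hfin hq
  rw [sub_nonneg, inv_mul_le_iff₀ hS]
  exact h8

end Weights

end HardySpectral

namespace HardySpectral

variable {a b p p' q : ℝ} {u v : ℝ → ℝ}

/-! ### Sign patterns -/

/-- The function equal to `1` up to `z` and to `-1` after it. -/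
noncomputable def step (z x : ℝ) : ℝ := if x ≤ z then 1 else -1

theorem step_eq (z x : ℝ) : step z x = 1 ∨ step z x = -1 := by
  unfold step; split_ifs <;> simp

theorem measurable_step (z : ℝ) : Measurable (step z) :=
  Measurable.ite measurableSet_Iic measurable_const measurable_const

theorem step_eventually_eq {z x : ℝ} (h : x ≠ z) : ∀ᶠ y in 𝓝 x, step z y = step z x := by
  rcases lt_or_gt_of_ne h with h | h
  · filter_upwards [gt_mem_nhds h] with y hy
    simp [step, hy.le, h.le]
  · filter_upwards [lt_mem_nhds h] with y hy
    simp [step, not_le.2 hy, not_le.2 h]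

theorem step_eventually_eq_left (z x : ℝ) : ∀ᶠ y in 𝓝[<] x, step z y = step z x := by
  rcases le_or_gt x z with h | h
  · filter_upwards [self_mem_nhdsWithin] with y hy
    simp [step, (le_of_lt hy).trans h, h]
  · exact (step_eventually_eq h.ne').filter_mono nhdsWithin_le_nhds

theorem step_eventually_eq_of_tendsto {t : ℕ → ℝ} {z x : ℝ} (ht : Tendsto t atTop (𝓝 z))
    (h : x ≠ z) : ∀ᶠ k in atTop, step (t k) x = step z x := by
  rcases lt_or_gt_of_ne h with h | h
  · filter_upwards [ht.eventually (lt_mem_nhds h)] with y hy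
    simp [step, hy.le, h.le]
  · filter_upwards [ht.eventually (gt_mem_nhds h)] with y hy
    simp [step, not_le.2 hy, not_le.2 h]

/-- The product of the sign changes at the points `P i`, `i ∈ T`. -/
noncomputable def signProd {n : ℕ} (T : Finset (Fin n)) (P : Fin n → ℝ) (x : ℝ) : ℝ :=
  ∏ j ∈ T, step (P j) x

theorem abs_signProd {n : ℕ} (T : Finset (Fin n)) (P : Fin n → ℝ) (x : ℝ) :
    |signProd T P x| = 1 := by
  rw [signProd, Finset.abs_prod]
  refine Finset.prod_eq_one fun j _ => ?_
  rcases step_eq (P j) x with h | h <;> simp [h]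

theorem signProd_mul_self {n : ℕ} (T : Finset (Fin n)) (P : Fin n → ℝ) (x : ℝ) :
    signProd T P x * signProd T P x = 1 := by
  rw [← abs_mul_abs_self, abs_signProd, one_mul]

theorem measurable_signProd {n : ℕ} (T : Finset (Fin n)) (P : Fin n → ℝ) :
    Measurable (signProd T P) :=
  Finset.measurable_fun_prod _ fun j _ => measurable_step (P j)

theorem prod_eventually_congr {ι : Type*} {l : Filter ι} {n : ℕ} {T : Finset (Fin n)}
    {g : Fin n → ι → ℝ} {c : Fin n → ℝ} (h : ∀ j, ∀ᶠ y in l, g j y = c j) :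
    ∀ᶠ y in l, ∏ j ∈ T, g j y = ∏ j ∈ T, c j := by
  filter_upwards [eventually_all.2 h] with y hy
  exact Finset.prod_congr rfl fun j _ => hy j

theorem signProd_eventually_eq {n : ℕ} (T : Finset (Fin n)) (P : Fin n → ℝ) {x : ℝ}
    (hx : x ∉ range P) : ∀ᶠ y in 𝓝 x, signProd T P y = signProd T P x :=
  prod_eventually_congr fun j => step_eventually_eq fun h => hx ⟨j, h.symm⟩

theorem signProd_eventually_eq_left {n : ℕ} (T : Finset (Fin n)) (P : Fin n → ℝ) (x : ℝ) :
    ∀ᶠ y in 𝓝[<] x, signProd T P y = signProd T P x :=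
  prod_eventually_congr fun j => step_eventually_eq_left (P j) x

namespace Weights

theorem isExtremal_neg (W : Weights a b p p' q u v) {n : ℕ} {P : Fin n → ℝ}
    (hP : ∀ i, P i ∈ Icc a b) {f : ℝ → ℝ} (hf : IsExtremal a b p q u v P f) :
    IsExtremal a b p q u v P fun x => -1 * f x := by
  refine W.isExtremal_of_le hP (hf.adm.const_mul (-1)) ?_ ?_
  · rw [energy_const_mul, hf.energy_eq]; simp
  · rw [hardyT_const_mul, energy_const_mul, hf.energy_T]; simp

/-- Left continuity of `s` at `b` is what extends the identity from `[a, b)` to the end point;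
products of functions `step` have it. -/
theorem prim_mul_eq_Icc (W : Weights a b p p' q u v) {k s : ℝ → ℝ}
    (hk : MemLp k (ENNReal.ofReal p) (vol a b)) (hs : AEStronglyMeasurable s (vol a b))
    (hs1 : ∀ x, |s x| ≤ 1) {Z : Set ℝ} (hZ : Z.Finite)
    (hloc : ∀ x ∈ Ioo a b, x ∉ Z → ∀ᶠ y in 𝓝 x, s y = s x)
    (h0 : ∀ x ∈ Ioo a b, x ∈ Z → prim a u k x = 0) (hb : ∀ᶠ y in 𝓝[<] b, s y = s b) :
    MemLp (fun x => s x * k x) (ENNReal.ofReal p) (vol a b) ∧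
      ∀ x ∈ Icc a b, prim a u (fun x => s x * k x) x = s x * prim a u k x := by
  obtain ⟨h1, h2⟩ := W.prim_mul_eq hk hs hs1 hZ hloc h0
  refine ⟨h1, fun x hx => ?_⟩
  rcases hx.2.lt_or_eq with hxb | rfl
  · exact h2 x ⟨hx.1, hxb⟩
  · have c1 := ((W.continuousOn_prim h1) x W.right_mem).mono_left
      (nhdsWithin_mono x (Ico_subset_Icc_self : Ico a x ⊆ Icc a x))
    have c2 := (((W.continuousOn_prim hk) x W.right_mem).mono_left
      (nhdsWithin_mono x (Ico_subset_Icc_self : Ico a x ⊆ Icc a x))).const_mul (s x)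
    rw [nhdsWithin_Ico_eq_nhdsLT W.hab] at c1 c2
    refine tendsto_nhds_unique (c1.congr' ?_) c2
    filter_upwards [hb, Ico_mem_nhdsLT W.hab] with y hy hm
    rw [h2 y hm, hy]

/-- There are extremal functions with any prescribed sign pattern. -/
theorem exists_extremal_signProd (W : Weights a b p p' q u v) {n : ℕ} {P : Fin n → ℝ}
    (hP : ∀ i, P i ∈ Icc a b) (T : Finset (Fin n)) :
    ∃ f, IsExtremal a b p q u v P f ∧
      ∀ x ∈ Icc a b, prim a u f x = signProd T P x * |prim a u f x| := by
  obtain ⟨f₀, hf₀⟩ := W.exists_extremal hP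
  obtain ⟨g, hg, hgf⟩ := W.exists_extremal_abs hP hf₀
  obtain ⟨h1, h3⟩ := W.prim_mul_eq_Icc hg.adm.1 (measurable_signProd T P).aestronglyMeasurable
    (fun x => (abs_signProd T P x).le) (finite_range P)
    (fun x _ hx => signProd_eventually_eq T P hx) (by
      rintro x _ ⟨i, rfl⟩; exact hg.adm.2 i) (signProd_eventually_eq_left T P b)
  set l : ℝ → ℝ := fun x => signProd T P x * g x with hl
  have h4 : ∀ x ∈ Icc a b, |prim a u l x| = prim a u g x := by
    intro x hx
    rw [h3 x hx, abs_mul, abs_signProd, one_mul, hgf x hx, abs_abs]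
  have hadm : Admissible a b p u P l := by
    refine ⟨h1, fun i => ?_⟩
    rw [h3 _ (hP i), hg.adm.2 i, mul_zero]
  refine ⟨l, W.isExtremal_of_le hP hadm ?_ ?_, fun x hx => ?_⟩
  · rw [← hg.energy_eq, energy, energy]
    refine le_of_eq (integral_congr_ae (Eventually.of_forall fun x => ?_))
    simp only [hl]
    rw [abs_mul, abs_signProd, one_mul]
  · rw [← hg.energy_T, energy, energy]
    refine le_of_eq (integral_congr_ae ?_)
    filter_upwards [ae_vol_mem] with x hx
    rw [hardyT_eq, hardyT_eq, abs_mul, abs_mul, ← h4 x hx, abs_abs]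
  · rw [h4 x hx, h3 x hx]

/-- On the last nodal interval a positive primitive makes the tail integral positive, hence also the
density; the primitive therefore keeps increasing up to `b`. -/
theorem prim_right_pos (W : Weights a b p p' q u v) {f : ℝ → ℝ}
    (hf : MemLp f (ENNReal.ofReal p) (vol a b)) {lam c : ℝ} (hlam : 0 < lam) (hc : c ∈ Ico a b)
    (h : ∀ᵐ x ∂(vol a b), x ∈ Ioo c b → spow p (f x) =
      u x * (lam * tail b (fun y => v y * spow q (hardyT a u v f y)) x))
    (hpos : ∀ x ∈ Ioo c b, 0 < prim a u f x) : 0 < prim a u f b := by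
  have hm : (c + b) / 2 ∈ Ioo c b := ⟨by linarith [hc.2], by linarith [hc.2]⟩
  refine (hpos _ hm).trans (W.prim_lt_of_pos hf ⟨by linarith [hc.1, hm.1], hm.2.le⟩ W.right_mem
    hm.2 ?_)
  filter_upwards [h] with x hx hxm
  have hxc : x ∈ Ioo c b := ⟨hm.1.trans hxm.1, hxm.2⟩
  have hxI : x ∈ Icc a b := ⟨hc.1.trans hxc.1.le, hxc.2.le⟩
  rw [← spow_pos_iff (p := p), hx hxc]
  refine mul_pos (W.u_pos x hxI) (mul_pos hlam ?_)
  refine intervalIntegral.intervalIntegral_pos_of_pos_on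
    (intervalIntegrable_of_integrable (W.integrable_v_spow hf) hxI W.right_mem) (fun y hy => ?_)
    hxc.2
  have hyI : y ∈ Icc a b := ⟨hxI.1.trans hy.1.le, hy.2.le⟩
  have := W.v_pos y hyI
  refine mul_pos this (spow_pos ?_)
  rw [hardyT_eq]
  exact mul_pos this (hpos y ⟨hxc.1.trans hy.1, hy.2⟩)

theorem prim_right_ne_zero (W : Weights a b p p' q u v) {f : ℝ → ℝ}
    (hf : MemLp f (ENNReal.ofReal p) (vol a b)) {lam c : ℝ} (hlam : 0 < lam) (hc : c ∈ Ico a b)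
    (h : ∀ᵐ x ∂(vol a b), x ∈ Ioo c b → spow p (f x) =
      u x * (lam * tail b (fun y => v y * spow q (hardyT a u v f y)) x))
    (hne : ∀ x ∈ Ioo c b, prim a u f x ≠ 0) : prim a u f b ≠ 0 := by
  have hcont : ContinuousOn (prim a u f) (Ioo c b) :=
    (W.continuousOn_prim hf).mono fun x hx => ⟨hc.1.trans hx.1.le, hx.2.le⟩
  have hsign : (∀ x ∈ Ioo c b, 0 < prim a u f x) ∨ (∀ x ∈ Ioo c b, prim a u f x < 0) := by
    by_contra! hcon
    obtain ⟨⟨x, hx, hx0⟩, y, hy, hy0⟩ := hcon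
    obtain ⟨z, hz, hz0⟩ := (isPreconnected_Ioo (a := c) (b := b)).intermediate_value hx hy hcont
      ⟨hx0, hy0⟩
    exact hne z hz hz0
  rcases hsign with hs | hs
  · exact (W.prim_right_pos hf hlam hc h hs).ne'
  · have h1 := W.prim_right_pos (f := fun x => -f x) hf.neg hlam hc ?_ ?_
    · rw [prim_neg] at h1; linarith
    · filter_upwards [h] with x hx hxm
      have : (fun y => v y * spow q (hardyT a u v (fun x => -f x) y)) =
          fun y => -(v y * spow q (hardyT a u v f y)) := by
        ext y
        rw [hardyT_eq, hardyT_eq, prim_neg, mul_neg, spow_neg]; ring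
      rw [spow_neg, hx hxm, this, tail, tail, intervalIntegral.integral_neg]; ring
    · intro x hx
      rw [prim_neg]; linarith [hs x hx]

theorem exists_left_of_right (W : Weights a b p p' q u v) {n : ℕ} {P : Fin n → ℝ}
    (hP : ∀ i, P i < b) : ∃ c ∈ Ico a b, ∀ i, P i < c := by
  have h1 : ∀ᶠ c in 𝓝[<] b, ∀ i, P i < c :=
    eventually_all.2 fun i => (lt_mem_nhds (hP i)).filter_mono nhdsWithin_le_nhds
  obtain ⟨c, hc, hc'⟩ := (h1.and (Ico_mem_nhdsLT W.hab)).exists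
  exact ⟨c, hc', hc⟩

/-- An extremal function for points different from `b` does not vanish at `b`. -/
theorem extremal_right_ne_zero (W : Weights a b p p' q u v) (hqp : q < p) {n : ℕ} {P : Fin n → ℝ}
    (hP : ∀ i, P i ∈ Icc a b) (hPb : ∀ i, P i < b) {f : ℝ → ℝ}
    (hf : IsExtremal a b p q u v P f) : prim a u f b ≠ 0 := by
  obtain ⟨c, hc, hPc⟩ := W.exists_left_of_right hPb
  obtain ⟨m, hm⟩ := W.exists_multipliers hP hf
  have hae := W.ae_eq_of_multipliers hP hf.adm.1 hm
  refine W.prim_right_ne_zero hf.adm.1 (inv_pos.2 (W.supRatio_pos hP)) hc ?_ fun x hx h0 => ?_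
  · filter_upwards [hae] with x hx hxm
    rw [hx, Finset.sum_eq_zero, add_zero]
    intro i _
    rw [indicator_of_notMem, mul_zero]
    exact not_le.2 ((hPc i).trans hxm.1)
  · obtain ⟨i, rfl⟩ := W.extremal_zero_mem hqp hP hf ⟨hc.1.trans_lt hx.1, hx.2⟩ h0
    exact lt_asymm (hPc i) hx.1

/-- A bump at `P i` narrower than the distance to the other points, one-sided if `P i = b`. Used as
a test function it isolates the multiplier `c i`. -/
theorem exists_eta (W : Weights a b p p' q u v) {n : ℕ} {P : Fin n → ℝ}
    (hP : ∀ i, P i ∈ Ioc a b) (hinj : Function.Injective P) (i : Fin n) :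
    ∃ η, MemLp η (ENNReal.ofReal p) (vol a b) ∧ prim a u η (P i) = 1 ∧
      ∀ j, j ≠ i → prim a u η (P j) = 0 := by
  have hI : ∀ j, P j ∈ Icc a b := fun j => Ioc_subset_Icc_self (hP j)
  suffices ∃ η, MemLp η (ENNReal.ofReal p) (vol a b) ∧ 0 < prim a u η (P i) ∧
      ∀ j, j ≠ i → prim a u η (P j) = 0 by
    obtain ⟨η, h1, h2, h3⟩ := this
    refine ⟨fun x => (prim a u η (P i))⁻¹ * η x, h1.const_mul _, ?_, fun j hj => ?_⟩
    · rw [prim_const_mul, inv_mul_cancel₀ h2.ne']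
    · rw [prim_const_mul, h3 j hj, mul_zero]
  obtain ⟨ε, hε, hball⟩ : ∃ ε > 0, ∀ j, j ≠ i → ε ≤ |P j - P i| := by
    have : ∀ᶠ ε in 𝓝[>] (0:ℝ), ∀ j, j ≠ i → ε ≤ |P j - P i| := by
      refine eventually_all.2 fun j => ?_
      by_cases hj : j = i
      · simp [hj]
      · have : 0 < |P j - P i| := abs_pos.2 (sub_ne_zero.2 fun h => hj (hinj h))
        filter_upwards [Ioo_mem_nhdsGT this] with ε hε _ using hε.2.le
    obtain ⟨ε, h1, h2⟩ := (this.and self_mem_nhdsWithin).exists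
    exact ⟨ε, h2, h1⟩
  have hcI : max a (P i - ε) ∈ Icc a b := ⟨le_max_left _ _, max_le W.le (by linarith [(hP i).2])⟩
  have hci : max a (P i - ε) < P i := max_lt (hP i).1 (by linarith)
  rcases (hP i).2.lt_or_eq with hib | hib
  · obtain ⟨k, hk, -, hk0, hk1⟩ := W.exists_bump_Ioo hcI (d := min b (P i + ε))
      ⟨le_min W.le (by linarith [(hP i).1]), min_le_left _ _⟩
    refine ⟨k, hk, hk1 _ ⟨hci, lt_min hib (by linarith)⟩, fun j hj => hk0 _ (hI j) fun hm => ?_⟩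
    have h1 := hball j hj
    have h2 := (max_lt_iff.1 hm.1).2
    have h3 := (lt_min_iff.1 hm.2).2
    exact absurd (abs_lt.2 ⟨by linarith, by linarith⟩) (not_lt.2 h1)
  · obtain ⟨k, hk, hk0, hk1⟩ := W.exists_bump_Ioc hcI
    refine ⟨k, hk, hk1 _ ⟨hci, (hP i).2⟩, fun j hj => hk0 _ ⟨(hP j).1.le, ?_⟩⟩
    have h1 := hball j hj
    rw [abs_of_nonpos (by linarith [(hP j).2])] at h1
    exact le_max_of_le_right (by linarith)

/-- A minimal point configuration has distinct points, different from `a`. -/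
theorem min_injective (W : Weights a b p p' q u v) (hqp : q < p) {n : ℕ} {P : Fin n → ℝ}
    (hP : ∀ i, P i ∈ Icc a b) (hmin : ∀ P' : Fin n → ℝ, (∀ i, P' i ∈ Icc a b) →
      supRatio a b p q u v P ≤ supRatio a b p q u v P') :
    Function.Injective P ∧ ∀ i, P i ≠ a := by
  have key : ∀ i, (P i = a ∨ ∃ j, j ≠ i ∧ P j = P i) → False := by
    intro i hi
    -- A point that equals `a` or repeats another point imposes no constraint of its own. Moving it
    -- to a fresh `x` gives an extremal function that is admissible for `P` and, by minimality,
    -- extremal for `P`, although its primitive vanishes at `x` outside `range P`.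
    obtain ⟨x, hx, hxP⟩ := ((Ioo_infinite W.hab).sdiff (finite_range P)).nonempty
    have hP' : ∀ j, Function.update P i x j ∈ Icc a b := by
      intro j
      by_cases hj : j = i
      · subst hj; simpa using Ioo_subset_Icc_self hx
      · simpa [hj] using hP j
    obtain ⟨f, hf⟩ := W.exists_extremal hP'
    have hadm : Admissible a b p u P f := by
      refine ⟨hf.adm.1, fun j => ?_⟩
      have hne : ∀ j, j ≠ i → prim a u f (P j) = 0 := fun j hj => by
        simpa [hj] using hf.adm.2 j
      by_cases hj : j = i
      · subst hj
        rcases hi with hi | ⟨l, hl, hl'⟩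
        · rw [hi, prim_self]
        · rw [← hl', hne l hl]
      · exact hne j hj
    have hE : IsExtremal a b p q u v P f := by
      refine W.isExtremal_of_le hP hadm hf.energy_eq.le ?_
      rw [hf.energy_T]
      exact hmin _ hP'
    exact hxP (W.extremal_zero_mem hqp hP hE hx (by simpa using hf.adm.2 i))
  refine ⟨fun i j hij => ?_, fun i hi => key i (Or.inl hi)⟩
  by_contra hne
  exact key i (Or.inr ⟨j, Ne.symm hne, hij.symm⟩)

/-- The first variation of the minimal configuration in the direction of perturbed extremal
functions with compatible signs. -/
theorem multiplier_nonneg_of_sign (W : Weights a b p p' q u v) (hqp : q < p) {n : ℕ}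
    {P : Fin n → ℝ}
    (hP : ∀ i, P i ∈ Icc a b) (hmin : ∀ P' : Fin n → ℝ, (∀ i, P' i ∈ Icc a b) →
      supRatio a b p q u v P ≤ supRatio a b p q u v P') {i : Fin n} {t : ℕ → ℝ}
    (ht : ∀ k, t k ∈ Icc a b) (hti : Tendsto t atTop (𝓝 (P i))) {η : ℝ → ℝ}
    (hη : MemLp η (ENNReal.ofReal p) (vol a b))
    (hηi : prim a u η (P i) = 1) (hηj : ∀ j, j ≠ i → prim a u η (P j) = 0)
    {g : ℝ → ℝ} (hg : IsExtremal a b p q u v P g)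
    {f : ℕ → ℝ → ℝ} (hf : ∀ k, IsExtremal a b p q u v (Function.update P i (t k)) (f k))
    (hsign : ∀ x ∈ Ioo a b, x ≠ P i → ∀ᶠ k in atTop, 0 ≤ prim a u (f k) x * prim a u g x)
    (hneg : ∀ k, prim a u (f k) (P i) < 0) :
    0 ≤ ∫ x, spow p (g x) * η x ∂(vol a b) - (supRatio a b p q u v P)⁻¹ *
        ∫ x, spow q (hardyT a u v g x) * hardyT a u v η x ∂(vol a b) := by
  have hPk : ∀ k j, Function.update P i (t k) j ∈ Icc a b := by
    intro k j
    by_cases hj : j = i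
    · subst hj; simpa using ht k
    · simpa [hj] using hP j
  have hlim : ∀ j, Tendsto (fun k => Function.update P i (t k) j) atTop (𝓝 (P j)) := by
    intro j
    by_cases hj : j = i
    · subst hj; simpa using hti
    · simp [hj]
  obtain ⟨φ, hφ, g', hg', hL, hpt⟩ := W.exists_subseq_tendsto_of_min hP hmin hPk hlim hf
  -- Uniqueness up to signs: the limit and `g` have primitives of equal absolute value. The sign
  -- hypothesis then forces the two functions to agree, so the perturbed extremal functions converge
  -- to the prescribed `g`.
  have habs := (W.energy_le_of_critical hP hg.adm (inv_pos.2 (W.supRatio_pos hP))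
    (fun k hk => W.weak_eq hP hg hk) (fun x hx h0 => W.extremal_zero_mem hqp hP hg hx h0)
    hg.energy_eq hg'.adm hg'.energy_eq.le).2 hqp (by rw [inv_inv, hg'.energy_T])
  have heq : ∀ x ∈ Ioo a b, prim a u g' x = prim a u g x := by
    intro x hx
    by_cases hxi : x = P i
    · rw [hxi, hg.adm.2, hg'.adm.2]
    · have h1 : 0 ≤ prim a u g' x * prim a u g x :=
        ge_of_tendsto ((hpt x (Ioo_subset_Icc_self hx)).mul_const _)
          (hφ.tendsto_atTop.eventually (hsign x hx hxi))
      rcases abs_eq_abs.1 (habs x (Ioo_subset_Icc_self hx)) with h | h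
      · exact h
      · rw [h] at h1 ⊢
        nlinarith [mul_self_nonneg (prim a u g x), mul_self_eq_zero.1 (le_antisymm
          (by nlinarith : prim a u g x * prim a u g x ≤ 0) (mul_self_nonneg _))]
  have hae : ∀ᵐ x ∂(vol a b), g' x = g x := by
    have hd : MemLp (fun x => g' x + -1 * g x) (ENNReal.ofReal p) (vol a b) :=
      hg'.adm.1.add (hg.adm.1.const_mul (-1))
    have := W.ae_eq_zero_of_prim_eq_zero hd isOpen_Ioo (U := Ioo a b) (fun x hx hxI => by
      rw [W.prim_add hg'.adm.1 (hg.adm.1.const_mul (-1)) hxI, prim_const_mul, heq x hx]; ring)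
    filter_upwards [this, ae_vol_mem_Ioo] with x hx hm
    linarith [hx hm]
  have hL' : Tendsto (fun k => ∫ x, |f (φ k) x - g x| ^ p ∂(vol a b)) atTop (𝓝 0) := by
    refine hL.congr fun k => integral_congr_ae ?_
    filter_upwards [hae] with x hx
    rw [hx]
  refine W.multiplier_nonneg hP hmin (fun k => hPk (φ k)) (i := i)
    (fun k j hj => by simp [hj]) hη hηi hηj (fun k => hf (φ k)) hg hL' ?_ (fun k => hneg _)
  have := hpt _ (hP i)
  rwa [hg'.adm.2] at this

/-- For `q < p` the reciprocal of the minimum is a spectral number with `n` zeros. -/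
theorem inv_min_mem_spN_of_lt (W : Weights a b p p' q u v) (hqp : q < p) {n : ℕ} {P : Fin n → ℝ}
    (hP : ∀ i, P i ∈ Icc a b) (hmin : ∀ P' : Fin n → ℝ, (∀ i, P' i ∈ Icc a b) →
      supRatio a b p q u v P ≤ supRatio a b p q u v P') :
    (supRatio a b p q u v P)⁻¹ ∈ spN a b p q u v n := by
  obtain ⟨hinj, hPa⟩ := W.min_injective hqp hP hmin
  have hP' : ∀ i, P i ∈ Ioc a b := fun i => ⟨(hP i).1.lt_of_ne (hPa i).symm, (hP i).2⟩
  -- With a sign change at every `P i`, the patterns for `P i` moved left and moved right both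
  -- converge to that of `g` off `P i` but have opposite signs at `P i`. Both one-sided variations
  -- become available.
  obtain ⟨g, hg, hgs⟩ := W.exists_extremal_signProd hP Finset.univ
  obtain ⟨c, hc⟩ := W.exists_multipliers hP hg
  have hneg : IsExtremal a b p q u v P fun x => -1 * g x := W.isExtremal_neg hP hg
  have hbP : ∀ x ∈ Ioo a b, prim a u g x = 0 → x ∈ range P :=
    fun x hx h0 => W.extremal_zero_mem hqp hP hg hx h0
  -- the one-sided conclusion for perturbations with a given sign at the point
  have key : ∀ i (e : ℝ), (e = 1 ∨ e = -1) → (∃ t : ℕ → ℝ, (∀ k, t k ∈ Icc a b) ∧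
      Tendsto t atTop (𝓝 (P i)) ∧ ∃ f : ℕ → ℝ → ℝ,
        (∀ k, IsExtremal a b p q u v (Function.update P i (t k)) (f k)) ∧
        (∀ x ∈ Ioo a b, x ≠ P i → ∀ᶠ k in atTop, 0 ≤ prim a u (f k) x * prim a u g x) ∧
        ∀ k, e * prim a u (f k) (P i) < 0) → 0 ≤ e * c i := by
    rintro i e he ⟨t, ht, hti, f, hf, hs, hn⟩
    obtain ⟨η, hη, hηi, hηj⟩ := W.exists_eta hP' hinj i
    have hci : ∫ x, spow p (g x) * η x ∂(vol a b) - (supRatio a b p q u v P)⁻¹ *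
        ∫ x, spow q (hardyT a u v g x) * hardyT a u v η x ∂(vol a b) = c i := by
      rw [hc η hη, Finset.sum_eq_single i (fun j _ hj => by rw [hηj j hj, mul_zero]) (by simp),
        hηi, mul_one]
    rcases he with rfl | rfl
    · have := W.multiplier_nonneg_of_sign hqp hP hmin ht hti hη hηi hηj hg hf hs
        (fun k => by simpa using hn k)
      rw [hci] at this
      linarith
    · have := W.multiplier_nonneg_of_sign hqp hP hmin ht hti hη hηi hηj hneg
        (fun k => W.isExtremal_neg (fun j => by
          by_cases hj : j = i
          · subst hj; simpa using ht k
          · simpa [hj] using hP j) (hf k)) (fun x hx hxi => by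
          filter_upwards [hs x hx hxi] with k hk
          rw [prim_const_mul, prim_const_mul]; linarith)
        (fun k => by rw [prim_const_mul]; exact hn k)
      have h1 : ∀ x, spow p (-1 * g x) * η x = -(spow p (g x) * η x) := fun x => by
        rw [neg_one_mul, spow_neg]; ring
      have h2 : ∀ x, spow q (hardyT a u v (fun x => -1 * g x) x) * hardyT a u v η x =
          -(spow q (hardyT a u v g x) * hardyT a u v η x) := fun x => by
        rw [hardyT_const_mul]
        simp only
        rw [neg_one_mul, spow_neg]; ring
      simp only [h1, h2, integral_neg] at this
      linarith
  -- perturbed extremal functions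
  have hper : ∀ i (T : Finset (Fin n)) (t : ℕ → ℝ), (∀ k, t k ∈ Ioo a b) → (∀ k, t k ≠ P i) →
      Tendsto t atTop (𝓝 (P i)) → (∀ x ∈ Ioo a b, x ≠ P i →
        ∀ᶠ k in atTop, signProd T (Function.update P i (t k)) x = signProd Finset.univ P x) →
      ∀ e : ℝ, (e = 1 ∨ e = -1) → (∀ k, signProd T (Function.update P i (t k)) (P i) = -e) →
      0 ≤ e * c i := by
    intro i T t ht hne hti hsp e he hse
    have hPk : ∀ k j, Function.update P i (t k) j ∈ Icc a b := by
      intro k j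
      by_cases hj : j = i
      · subst hj; simpa using Ioo_subset_Icc_self (ht k)
      · simpa [hj] using hP j
    choose f hf hfs using fun k => W.exists_extremal_signProd (hPk k) T
    refine key i e he ⟨t, fun k => Ioo_subset_Icc_self (ht k), hti, f, hf, fun x hx hxi => ?_,
      fun k => ?_⟩
    · filter_upwards [hsp x hx hxi] with k hk
      have hxI := Ioo_subset_Icc_self hx
      rw [hfs k x hxI, hgs x hxI, hk, mul_mul_mul_comm, signProd_mul_self, one_mul]
      positivity
    · have h0 : prim a u (f k) (P i) ≠ 0 := by
        rcases (hP' i).2.lt_or_eq with hib | hib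
        · intro h0
          obtain ⟨j, hj⟩ := W.extremal_zero_mem hqp (hPk k) (hf k) ⟨(hP' i).1, hib⟩ h0
          by_cases hji : j = i
          · subst hji; exact hne k (by simpa using hj)
          · exact hji (hinj (by simpa [hji] using hj))
        · rw [hib]
          refine W.extremal_right_ne_zero hqp (hPk k) (fun j => ?_) (hf k)
          by_cases hji : j = i
          · subst hji; simpa using (ht k).2
          · simp only [ne_eq, hji, not_false_eq_true, Function.update_of_ne]
            exact (hP j).2.lt_of_ne fun h => hji (hinj (h.trans hib.symm))
      have h1 := hfs k _ (hP i)
      rw [hse k] at h1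
      have h2 := abs_pos.2 h0
      rcases he with rfl | rfl <;> linarith
  have hprod : ∀ i (t : ℝ) x, signProd Finset.univ (Function.update P i t) x =
      signProd (Finset.univ.erase i) P x * step t x := by
    intro i t x
    rw [signProd, ← Finset.prod_erase_mul _ _ (Finset.mem_univ i), signProd]
    simp only [Function.update_self]
    congr 1
    refine Finset.prod_congr rfl fun j hj => ?_
    rw [Function.update_of_ne (Finset.ne_of_mem_erase hj)]
  have hprod' : ∀ i (t : ℝ) x, signProd (Finset.univ.erase i) (Function.update P i t) x =
      signProd (Finset.univ.erase i) P x := by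
    intro i t x
    refine Finset.prod_congr rfl fun j hj => ?_
    rw [Function.update_of_ne (Finset.ne_of_mem_erase hj)]
  have hself : ∀ i x, signProd Finset.univ P x =
      signProd (Finset.univ.erase i) P x * step (P i) x := fun i x => by
    rw [← hprod, Function.update_eq_self]
  have hone : ∀ i, signProd (Finset.univ.erase i) P (P i) = 1 ∨
      signProd (Finset.univ.erase i) P (P i) = -1 := fun i =>
    eq_or_eq_neg_of_abs_eq (abs_signProd _ _ _)
  have hc0 : ∀ i, c i = 0 := by
    intro i
    set C := signProd (Finset.univ.erase i) P (P i) with hC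
    have hseq : ∀ {t : ℕ → ℝ}, Tendsto t atTop (𝓝 (P i)) → ∀ x ∈ Ioo a b, x ≠ P i →
        ∀ᶠ k in atTop, signProd Finset.univ (Function.update P i (t k)) x =
          signProd Finset.univ P x := by
      intro t ht x _ hxi
      filter_upwards [step_eventually_eq_of_tendsto ht hxi] with k hk
      rw [hprod, hk, ← hself]
    -- When `P i` is moved to the left, the sign change has already occurred at `P i`, so the sign
    -- there is `-C`.
    have hleft : 0 ≤ C * c i := by
      obtain ⟨t, -, ht1, ht2⟩ := exists_seq_strictMono_tendsto' (hP' i).1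
      refine hper i Finset.univ t (fun k => ⟨(ht1 k).1, (ht1 k).2.trans_le (hP' i).2⟩)
        (fun k => (ht1 k).2.ne) ht2 (hseq ht2) C (hone i) fun k => ?_
      rw [hprod, ← hC, step, if_neg (not_le.2 (ht1 k).2)]; ring
    -- When `P i` is moved to the right, the sign at `P i` is still `C`. If `P i = b` there is no
    -- room on the right; the point is then moved left without a sign change at it, which is
    -- harmless because the sign change of `g` at `b` is invisible on `(a, b)`.
    have hright : 0 ≤ -C * c i := by
      have hC' : -C = 1 ∨ -C = -1 := by
        rcases hone i with h | h
        · right; rw [hC, h]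
        · left; rw [hC, h]; ring
      rcases (hP' i).2.lt_or_eq with hib | hib
      · obtain ⟨t, -, ht1, ht2⟩ := exists_seq_strictAnti_tendsto' hib
        refine hper i Finset.univ t (fun k => ⟨(hP' i).1.trans (ht1 k).1, (ht1 k).2⟩)
          (fun k => (ht1 k).1.ne') ht2 (hseq ht2) (-C) hC' fun k => ?_
        rw [hprod, ← hC, step, if_pos (ht1 k).1.le]; ring
      · obtain ⟨t, -, ht1, ht2⟩ := exists_seq_strictMono_tendsto' (hP' i).1
        refine hper i (Finset.univ.erase i) t
          (fun k => ⟨(ht1 k).1, (ht1 k).2.trans_le (hP' i).2⟩)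
          (fun k => (ht1 k).2.ne) ht2 (fun x hx _ => Eventually.of_forall fun k => ?_) (-C) hC'
          fun k => ?_
        · rw [hprod', hself i, step, if_pos (by rw [hib]; exact hx.2.le), mul_one]
        · rw [hprod', ← hC]; ring
    rcases hone i with h | h <;> rw [← hC] at h <;> rw [h] at hleft hright <;> linarith
  have hae := W.ae_eq_of_multipliers hP hg.adm.1 hc
  simp only [hc0, zero_mul, Finset.sum_const_zero, add_zero] at hae
  -- Once the multipliers are gone, the equation holds on the whole last nodal interval, where the
  -- primitive is strictly monotone near `b` and so cannot vanish at `b`.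
  have hPb : ∀ i, P i < b := by
    by_contra! hcon
    obtain ⟨i, hi⟩ := hcon
    have hib : P i = b := le_antisymm (hP i).2 hi
    obtain ⟨m, hm, hmP⟩ : ∃ m ∈ Ico a b, ∀ j, P j ≠ b → P j < m := by
      have h1 : ∀ᶠ c in 𝓝[<] b, ∀ j, P j ≠ b → P j < c := by
        refine eventually_all.2 fun j => ?_
        by_cases hj : P j = b
        · simp [hj]
        · filter_upwards [(lt_mem_nhds ((hP j).2.lt_of_ne hj)).filter_mono
            nhdsWithin_le_nhds] with c hc _ using hc
      obtain ⟨c, hc, hc'⟩ := (h1.and (Ico_mem_nhdsLT W.hab)).exists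
      exact ⟨c, hc', hc⟩
    refine W.prim_right_ne_zero hg.adm.1 (inv_pos.2 (W.supRatio_pos hP)) hm
      (by filter_upwards [hae] with x hx _ using hx) (fun x hx h0 => ?_) (hib ▸ hg.adm.2 i)
    obtain ⟨j, rfl⟩ := hbP x ⟨hm.1.trans_lt hx.1, hx.2⟩ h0
    exact lt_asymm (hmP j hx.2.ne) hx.1
  refine W.mem_spN_of_ae hg.adm.1 hg.energy_eq hae hinj (fun i => ⟨(hP' i).1, hPb i⟩)
    fun x hx => ⟨hbP x hx, ?_⟩
  rintro ⟨i, rfl⟩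
  exact hg.adm.2 i

end Weights

end HardySpectral

/-! ### Preparations for the homogeneous case: Rolle, Cauchy uniqueness, uniform bounds -/

namespace HardySpectral

variable {a b p p' q : ℝ} {u v : ℝ → ℝ}

/-- Pigeonhole: `n` points cannot meet `n + 1` cells. Half-open cells are disjoint, so a point at a
division point is counted once. -/
theorem exists_Ioc_disjoint {n : ℕ} {c : ℕ → ℝ} (hc : Monotone c) (P : Fin n → ℝ) :
    ∃ j ≤ n, ∀ i, P i ∉ Ioc (c j) (c (j + 1)) := by
  by_contra! hcon
  choose g hg using fun j : Fin (n + 1) => hcon j (Nat.lt_succ_iff.1 j.2)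
  obtain ⟨j, j', hne, heq⟩ := Fintype.exists_ne_map_eq_of_card_lt g (by simp)
  have key : ∀ j j' : Fin (n + 1), j < j' → g j = g j' → False := by
    intro j j' hlt heq
    have h1 := (hg j).2
    have h2 := (hg j').1
    rw [heq] at h1
    exact absurd (h1.trans (hc (Nat.succ_le_of_lt hlt))) (not_le.2 h2)
  rcases lt_or_gt_of_ne hne with h | h
  · exact key j j' h heq
  · exact key j' j h heq.symm

theorem abs_integral_le_of_abs_le {F g : ℝ → ℝ} (hg : Integrable g (vol a b)) {x y : ℝ}
    (hx : x ∈ Icc a b) (hy : y ∈ Icc a b)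
    (h : ∀ᵐ t ∂(vol a b), t ∈ uIcc x y → |F t| ≤ g t) :
    |∫ t in x..y, F t| ≤ |∫ t in x..y, g t| := by
  refine intervalIntegral.norm_integral_le_abs_of_norm_le (f := F) ?_
    (intervalIntegrable_of_integrable hg hx hy)
  rw [ae_vol_iff] at h
  rw [ae_restrict_iff' measurableSet_uIoc]
  filter_upwards [h] with t ht hm
  have hm' := uIoc_subset_uIcc hm
  exact ht (uIcc_subset_Icc hx hy hm') hm'

theorem tendsto_integral_of_dominated {F : ℕ → ℝ → ℝ} {f g : ℝ → ℝ}
    (hF : ∀ k, AEStronglyMeasurable (F k) (vol a b))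
    (hg : Integrable g (vol a b)) (hbd : ∀ k, ∀ᵐ t ∂(vol a b), |F k t| ≤ g t)
    (hlim : ∀ᵐ t ∂(vol a b), Tendsto (fun k => F k t) atTop (𝓝 (f t))) {x y : ℝ}
    (hx : x ∈ Icc a b) (hy : y ∈ Icc a b) :
    Tendsto (fun k => ∫ t in x..y, F k t) atTop (𝓝 (∫ t in x..y, f t)) := by
  have hsub : uIoc x y ⊆ Icc a b := uIoc_subset_uIcc.trans (uIcc_subset_Icc hx hy)
  refine intervalIntegral.tendsto_integral_filter_of_dominated_convergence g
    (Eventually.of_forall fun k => (hF k).mono_set hsub) (Eventually.of_forall fun k => ?_)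
    (intervalIntegrable_of_integrable hg hx hy) ?_
  · filter_upwards [ae_vol_iff.1 (hbd k)] with t ht hm using ht (hsub hm)
  · filter_upwards [ae_vol_iff.1 hlim] with t ht hm using ht (hsub hm)

theorem rpow_le_one_add_rpow {x r s : ℝ} (hx : 0 ≤ x) (hr : 0 ≤ r) (hrs : r ≤ s) :
    x ^ r ≤ 1 + x ^ s := by
  rcases le_or_gt x 1 with h | h
  · have := Real.rpow_le_one hx h hr
    have := Real.rpow_nonneg hx s
    linarith
  · have := Real.rpow_le_rpow_of_exponent_le h.le hrs
    linarith

/-- Continuity jointly in the exponent and the argument, as the exponent varies along the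
approximation of the homogeneous case. -/
theorem tendsto_spow {r t : ℕ → ℝ} {r₀ t₀ : ℝ} (hr : Tendsto r atTop (𝓝 r₀)) (hr₀ : 1 < r₀)
    (ht : Tendsto t atTop (𝓝 t₀)) :
    Tendsto (fun k => spow (r k) (t k)) atTop (𝓝 (spow r₀ t₀)) := by
  have h1 : Tendsto (fun k => |t k| ^ (r k - 1)) atTop (𝓝 (|t₀| ^ (r₀ - 1))) :=
    ht.abs.rpow (hr.sub_const 1) (Or.inr (by linarith))
  by_cases h0 : t₀ = 0
  · subst h0
    rw [spow_zero]
    rw [abs_zero, Real.zero_rpow (by linarith)] at h1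
    refine squeeze_zero_norm (fun k => ?_) h1
    rw [spow, Real.norm_eq_abs, abs_mul, abs_of_nonneg (Real.rpow_nonneg (abs_nonneg _) _)]
    exact mul_le_of_le_one_right (Real.rpow_nonneg (abs_nonneg _) _) (abs_sign_le _)
  · have h2 : ∀ᶠ k in atTop, Real.sign (t k) = Real.sign t₀ :=
      ht.eventually (sign_eventually_eq (F := id) continuousAt_id h0)
    refine (h1.mul_const (Real.sign t₀)).congr' ?_
    filter_upwards [h2] with k hk
    rw [spow, hk]

namespace Weights

theorem tail_sub (W : Weights a b p p' q u v) {H : ℝ → ℝ} (hH : Integrable H (vol a b)) {x y : ℝ}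
    (hx : x ∈ Icc a b) (hy : y ∈ Icc a b) : tail b H x - tail b H y = ∫ t in x..y, H t := by
  rw [tail, tail, intervalIntegral.integral_symm b x, intervalIntegral.integral_symm b y,
    neg_sub_neg]
  exact intervalIntegral.integral_interval_sub_left
    (intervalIntegrable_of_integrable hH W.right_mem hy)
    (intervalIntegrable_of_integrable hH W.right_mem hx)

theorem abs_integral_le_integral {h : ℝ → ℝ} (hh : Integrable h (vol a b)) (h0 : ∀ x, 0 ≤ h x)
    {x y : ℝ} (hx : x ∈ Icc a b) (hy : y ∈ Icc a b) :
    |∫ t in x..y, h t| ≤ ∫ t, h t ∂(vol a b) := by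
  refine (intervalIntegral.norm_integral_le_integral_norm_uIoc (f := h)).trans ?_
  simp_rw [Real.norm_eq_abs, abs_of_nonneg (h0 _)]
  exact setIntegral_mono_set hh (Eventually.of_forall h0)
    (LE.le.eventuallyLE (uIoc_subset_uIcc.trans (uIcc_subset_Icc hx hy)))

theorem v_mul_spow (W : Weights a b p p' q u v) (x y : ℝ) :
    v x * spow q (v x * y) = |v x| ^ q * spow q y := by
  rw [spow_mul, ← mul_assoc, mul_comm (v x), spow_mul_self W.hq]

theorem abs_v_mul_spow_le (W : Weights a b p p' q u v) (x : ℝ) {y B : ℝ} (hy : |y| ≤ B) : |v x * spow q (v x * y)| ≤ B ^ (q - 1) * |v x| ^ q := by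
  rw [W.v_mul_spow, abs_mul, abs_of_nonneg (Real.rpow_nonneg (abs_nonneg _) _),
    abs_spow W.hq, mul_comm]
  have := W.hq
  gcongr

/-- Solutions of the spectral equation increase where the tail is positive. -/
theorem prim_lt_of_tail_pos (W : Weights a b p p' q u v) {f T : ℝ → ℝ} {lam : ℝ} (hlam : 0 < lam)
    (hf : MemLp f (ENNReal.ofReal p) (vol a b))
    (h : ∀ᵐ x ∂(vol a b), spow p (f x) = u x * (lam * T x)) {x y : ℝ} (hx : x ∈ Icc a b)
    (hy : y ∈ Icc a b) (hxy : x < y) (hT : ∀ t ∈ Ioo x y, 0 < T t) :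
    prim a u f x < prim a u f y := by
  refine W.prim_lt_of_pos hf hx hy hxy ?_
  filter_upwards [h, ae_vol_mem] with t ht hm htm
  rw [← spow_pos_iff (p := p), ht]
  exact mul_pos (W.u_pos t hm) (mul_pos hlam (hT t htm))

theorem prim_lt_of_tail_neg (W : Weights a b p p' q u v) {f T : ℝ → ℝ} {lam : ℝ} (hlam : 0 < lam)
    (hf : MemLp f (ENNReal.ofReal p) (vol a b))
    (h : ∀ᵐ x ∂(vol a b), spow p (f x) = u x * (lam * T x)) {x y : ℝ} (hx : x ∈ Icc a b)
    (hy : y ∈ Icc a b) (hxy : x < y) (hT : ∀ t ∈ Ioo x y, T t < 0) :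
    prim a u f y < prim a u f x := by
  refine W.prim_lt_of_neg hf hx hy hxy ?_
  filter_upwards [h, ae_vol_mem] with t ht hm htm
  rw [← spow_neg_iff (p := p), ht]
  exact mul_neg_of_pos_of_neg (W.u_pos t hm) (mul_neg_of_pos_of_neg hlam (hT t htm))

/-- Rolle's theorem for solutions of the spectral equation. -/
theorem exists_tail_eq_zero (W : Weights a b p p' q u v) {f T : ℝ → ℝ} {lam : ℝ} (hlam : 0 < lam)
    (hf : MemLp f (ENNReal.ofReal p) (vol a b)) (hTc : ContinuousOn T (Icc a b))
    (h : ∀ᵐ x ∂(vol a b), spow p (f x) = u x * (lam * T x)) {x y : ℝ} (hx : x ∈ Icc a b)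
    (hy : y ∈ Icc a b) (hxy : x < y) (heq : prim a u f x = prim a u f y) :
    ∃ t ∈ Ioo x y, T t = 0 := by
  by_contra! hne
  have hcont : ContinuousOn T (Ioo x y) :=
    hTc.mono fun t ht => ⟨hx.1.trans ht.1.le, ht.2.le.trans hy.2⟩
  have hsign : (∀ t ∈ Ioo x y, 0 < T t) ∨ (∀ t ∈ Ioo x y, T t < 0) := by
    by_contra! hcon
    obtain ⟨⟨s, hs, hs0⟩, t, ht, ht0⟩ := hcon
    obtain ⟨z, hz, hz0⟩ := (isPreconnected_Ioo (a := x) (b := y)).intermediate_value hs ht hcont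
      ⟨hs0, ht0⟩
    exact hne z hz hz0
  rcases hsign with hs | hs
  · exact (W.prim_lt_of_tail_pos hlam hf h hx hy hxy hs).ne heq
  · exact (W.prim_lt_of_tail_neg hlam hf h hx hy hxy hs).ne' heq

/-- Zeros of a solution with nonzero tail are sign changes. -/
theorem exists_sign_change (W : Weights a b p p' q u v) {f T : ℝ → ℝ} {lam : ℝ} (hlam : 0 < lam)
    (hf : MemLp f (ENNReal.ofReal p) (vol a b)) (hTc : ContinuousOn T (Icc a b))
    (h : ∀ᵐ x ∂(vol a b), spow p (f x) = u x * (lam * T x)) {z : ℝ} (hz : z ∈ Ioo a b)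
    (hz0 : prim a u f z = 0) (hTz : T z ≠ 0) {ε : ℝ} (hε : 0 < ε) :
    ∃ x y, x ∈ Ioo a b ∧ y ∈ Ioo a b ∧ z - ε < x ∧ x < y ∧ y < z + ε ∧
      prim a u f x * prim a u f y < 0 := by
  have hca : ContinuousAt T z := hTc.continuousAt (Icc_mem_nhds hz.1 hz.2)
  obtain ⟨δ, hδ, hδε, hδI, hδT⟩ : ∃ δ > 0, δ < ε ∧ (∀ t, |t - z| ≤ δ → t ∈ Ioo a b) ∧
      ((∀ t, |t - z| ≤ δ → 0 < T t) ∨ (∀ t, |t - z| ≤ δ → T t < 0)) := by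
    have h1 : ∀ᶠ t in 𝓝 z, t ∈ Ioo a b := Ioo_mem_nhds hz.1 hz.2
    rcases lt_or_gt_of_ne hTz with h0 | h0
    · obtain ⟨δ, hδ, hb⟩ := Metric.eventually_nhds_iff.1
        (h1.and (hca.eventually (gt_mem_nhds h0)))
      refine ⟨min (δ / 2) (ε / 2), by positivity, (min_le_right _ _).trans_lt (by linarith),
        fun t ht => (hb ?_).1, Or.inr fun t ht => (hb ?_).2⟩ <;>
      · rw [Real.dist_eq]; exact (ht.trans (min_le_left _ _)).trans_lt (by linarith)
    · obtain ⟨δ, hδ, hb⟩ := Metric.eventually_nhds_iff.1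
        (h1.and (hca.eventually (lt_mem_nhds h0)))
      refine ⟨min (δ / 2) (ε / 2), by positivity, (min_le_right _ _).trans_lt (by linarith),
        fun t ht => (hb ?_).1, Or.inl fun t ht => (hb ?_).2⟩ <;>
      · rw [Real.dist_eq]; exact (ht.trans (min_le_left _ _)).trans_lt (by linarith)
  have hx : z - δ ∈ Ioo a b := hδI _ (by rw [sub_sub_cancel_left, abs_neg, abs_of_pos hδ])
  have hy : z + δ ∈ Ioo a b := hδI _ (by rw [add_sub_cancel_left, abs_of_pos hδ])
  have hI := Ioo_subset_Icc_self (a := a) (b := b)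
  refine ⟨z - δ, z + δ, hx, hy, by linarith, by linarith, by linarith, ?_⟩
  rcases hδT with hT | hT
  · have e1 := W.prim_lt_of_tail_pos hlam hf h (hI hx) (hI hz) (by linarith) fun t ht =>
      hT t (by rw [abs_le]; constructor <;> linarith [ht.1, ht.2])
    have e2 := W.prim_lt_of_tail_pos hlam hf h (hI hz) (hI hy) (by linarith) fun t ht =>
      hT t (by rw [abs_le]; constructor <;> linarith [ht.1, ht.2])
    rw [hz0] at e1 e2
    exact mul_neg_of_neg_of_pos e1 e2
  · have e1 := W.prim_lt_of_tail_neg hlam hf h (hI hx) (hI hz) (by linarith) fun t ht =>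
      hT t (by rw [abs_le]; constructor <;> linarith [ht.1, ht.2])
    have e2 := W.prim_lt_of_tail_neg hlam hf h (hI hz) (hI hy) (by linarith) fun t ht =>
      hT t (by rw [abs_le]; constructor <;> linarith [ht.1, ht.2])
    rw [hz0] at e1 e2
    exact mul_neg_of_pos_of_neg e1 e2

/-- Uniqueness for the homogeneous equation. -/
theorem prim_eq_zero_of_cauchy (W : Weights a b q p' q u v) {f : ℝ → ℝ} {lam : ℝ} (hlam : 0 < lam)
    (hf : MemLp f (ENNReal.ofReal q) (vol a b))
    (h : ∀ᵐ x ∂(vol a b), spow q (f x) =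
      u x * (lam * tail b (fun y => v y * spow q (hardyT a u v f y)) x)) {z : ℝ}
    (hz : z ∈ Icc a b) (hz0 : prim a u f z = 0)
    (hz1 : tail b (fun y => v y * spow q (hardyT a u v f y)) z = 0) :
    ∀ x ∈ Icc a b, prim a u f x = 0 := by
  set H := fun y => v y * spow q (hardyT a u v f y) with hH
  have hHi : Integrable H (vol a b) := W.integrable_v_spow hf
  have hp' : 1 < p' := W.conj.symm.lt
  have hq := W.hq
  set V := ∫ t, |v t| ^ q ∂(vol a b) with hV
  have hV0 : 0 ≤ V := integral_abs_rpow_nonneg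
  -- If `|F| ≤ m` near `z` and the Cauchy data at `z` vanish, then `|f u| ≤ K * m * |u| ^ p'` there.
  set K := (lam * V) ^ (p' - 1) with hK
  have hK0 : 0 ≤ K := by positivity
  have hHle : ∀ {x : ℝ}, x ∈ Icc a b → ∀ {B}, |prim a u f x| ≤ B → |H x| ≤ B ^ (q - 1) * |v x| ^ q :=
    fun {x} hx {B} hB => by
      have := W.abs_v_mul_spow_le x hB
      rwa [← hardyT_eq] at this
  have hfu : ∀ᵐ x ∂(vol a b), f x * u x = |u x| ^ p' * spow p' (lam * tail b H x) := by
    filter_upwards [h] with x hx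
    have h1 : f x = spow p' (u x * (lam * tail b H x)) := by
      rw [← hx, spow_spow W.conj]
    rw [h1, spow_mul, mul_right_comm, spow_mul_self hp']
  -- On intervals this short the factor `K * ∫ |u| ^ p'` is below 1, which closes a Gronwall-type
  -- estimate.
  obtain ⟨δ, hδ, hloc⟩ : ∃ δ > 0, ∀ z ∈ Icc a b, ∀ x ∈ Icc a b, |x - z| < δ →
      |∫ t in z..x, |u t| ^ p'| < 1 / (K + 1) := by
    have hc := W.continuousOn_primitive W.integrable_u
    have huc := isCompact_Icc.uniformContinuousOn_of_continuous hc
    obtain ⟨δ, hδ, hb⟩ := Metric.uniformContinuousOn_iff.1 huc (1 / (K + 1)) (by positivity)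
    refine ⟨δ, hδ, fun z hz x hx hxz => ?_⟩
    have := hb x hx z hz hxz
    rwa [Real.dist_eq, intervalIntegral.integral_interval_sub_left
      (intervalIntegrable_of_integrable W.integrable_u W.left_mem hx)
      (intervalIntegrable_of_integrable W.integrable_u W.left_mem hz)] at this
  -- With `m` the maximum of `|F|` between `z` and `x`, the tail is at most `m ^ (q - 1) * V`.
  -- Inverting the signed power gives a bound linear in `m`, since `(q - 1) * (p' - 1) = 1`; this is
  -- where homogeneity is used. The bound forces `m = 0`.
  have hstep : ∀ z ∈ Icc a b, prim a u f z = 0 → tail b H z = 0 → ∀ x ∈ Icc a b, |x - z| < δ →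
      prim a u f x = 0 ∧ tail b H x = 0 := by
    intro z hz hz0 hz1 x hx hxz
    have hJ : uIcc z x ⊆ Icc a b := uIcc_subset_Icc hz hx
    obtain ⟨y, hy, hmax⟩ := isCompact_uIcc.exists_isMaxOn nonempty_uIcc
      (((W.continuousOn_prim hf).mono hJ).abs)
    set m := |prim a u f y| with hm
    have hm0 : 0 ≤ m := abs_nonneg _
    have hT : ∀ t ∈ uIcc z x, |tail b H t| ≤ m ^ (q - 1) * V := by
      intro t ht
      have e1 : tail b H t = ∫ s in t..z, H s := by rw [← W.tail_sub hHi (hJ ht) hz, hz1, sub_zero]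
      rw [e1]
      refine (abs_integral_le_of_abs_le (W.integrable_v.const_mul (m ^ (q - 1))) (hJ ht) hz ?_).trans
        ?_
      · filter_upwards [ae_vol_mem] with s hs hst
        exact hHle hs (hmax (uIcc_subset_uIcc ht left_mem_uIcc hst))
      · rw [intervalIntegral.integral_const_mul, abs_mul, abs_of_nonneg (by positivity)]
        gcongr
        exact abs_integral_le_integral W.integrable_v (fun s => by positivity) (hJ ht) hz
    have hF : m ≤ K * m * |∫ t in z..y, |u t| ^ p'| := by
      have e1 : prim a u f y = ∫ t in z..y, f t * u t := by
        rw [← W.prim_sub hf hz (hJ hy), hz0, sub_zero]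
      rw [hm, e1, ← abs_of_nonneg (show 0 ≤ K * |∫ t in z..y, f t * u t| by positivity), ← abs_mul,
        ← intervalIntegral.integral_const_mul]
      refine abs_integral_le_of_abs_le (W.integrable_u.const_mul _) hz (hJ hy) ?_
      filter_upwards [hfu] with t ht htm
      rw [ht, ← e1, ← hm, abs_mul, abs_spow hp', abs_of_nonneg (by positivity), mul_comm]
      gcongr
      have e2 := hT t (uIcc_subset_uIcc left_mem_uIcc hy htm)
      rw [abs_mul, abs_of_pos hlam]
      calc (lam * |tail b H t|) ^ (p' - 1) ≤ (lam * (m ^ (q - 1) * V)) ^ (p' - 1) := by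
            have : 0 ≤ p' - 1 := by linarith
            gcongr
        _ = K * m := by
            rw [hK, show lam * (m ^ (q - 1) * V) = lam * V * m ^ (q - 1) by ring,
              Real.mul_rpow (by positivity) (by positivity), ← Real.rpow_mul hm0,
              show (q - 1) * (p' - 1) = 1 by have := W.conj.mul_eq_add; nlinarith, Real.rpow_one]
    have hy' : |y - z| < δ := by
      refine lt_of_le_of_lt ?_ hxz
      exact abs_sub_left_of_mem_uIcc hy
    have hm1 : m = 0 := by
      by_contra hne
      have hmpos : 0 < m := lt_of_le_of_ne hm0 (Ne.symm hne)
      have e3 := hloc z hz y (hJ hy) hy'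
      have e4 : K * |∫ t in z..y, |u t| ^ p'| ≤ K * (1 / (K + 1)) := by gcongr
      have e5 : K * (1 / (K + 1)) < 1 := by
        rw [mul_one_div, div_lt_one (by positivity)]; linarith
      nlinarith
    refine ⟨abs_eq_zero.1 (le_antisymm (hm1 ▸ hmax right_mem_uIcc) (abs_nonneg _)), ?_⟩
    have e6 := hT x right_mem_uIcc
    rw [hm1, Real.zero_rpow (by linarith), zero_mul] at e6
    exact abs_eq_zero.1 (le_antisymm e6 (abs_nonneg _))
  -- Zero Cauchy data spread from `z` in steps of length at most `δ / 2`.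
  have hind : ∀ N : ℕ, ∀ x ∈ Icc a b, |x - z| ≤ N * (δ / 2) →
      prim a u f x = 0 ∧ tail b H x = 0 := by
    intro N
    induction N with
    | zero =>
      intro x _ hxz
      rw [Nat.cast_zero, zero_mul] at hxz
      have : x = z := by
        have := abs_eq_zero.1 (le_antisymm hxz (abs_nonneg _)); linarith
      rw [this]; exact ⟨hz0, hz1⟩
    | succ N ih =>
      intro x hx hxz
      push_cast at hxz
      have hN : (0:ℝ) < N + 1 := by positivity
      set y := z + (x - z) * (N / (N + 1)) with hy
      have hr0 : (0:ℝ) ≤ N / (N + 1) := by positivity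
      have hr1 : (N:ℝ) / (N + 1) ≤ 1 := by rw [div_le_one hN]; linarith
      have hyI : y ∈ Icc a b := by
        have := (convex_Icc a b) hz hx (sub_nonneg.2 hr1) hr0 (by ring)
        convert this using 1
        simp only [smul_eq_mul, hy]; ring
      obtain ⟨e1, e2⟩ := ih y hyI (by
        rw [hy, add_sub_cancel_left, abs_mul, abs_of_nonneg hr0]
        calc |x - z| * (N / (N + 1)) ≤ ((N + 1) * (δ / 2)) * (N / (N + 1)) := by gcongr
          _ = N * (δ / 2) := by field_simp)
      refine hstep y hyI e1 e2 x hx ?_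
      have : x - y = (x - z) / (N + 1) := by rw [hy]; field_simp; ring
      rw [this, abs_div, abs_of_pos hN, div_lt_iff₀ hN]
      nlinarith
  intro x hx
  obtain ⟨N, hN⟩ := exists_nat_ge (|x - z| / (δ / 2))
  exact (hind N x hx (by rwa [div_le_iff₀ (by positivity)] at hN)).1

/-- The suprema are bounded below independently of the exponent. -/
theorem exists_supRatio_lower (W : Weights a b p p' q u v) (n : ℕ) :
    ∃ s > 0, ∀ r r', Weights a b r r' q u v → ∀ P : Fin n → ℝ, (∀ i, P i ∈ Icc a b) →
      s ≤ supRatio a b r q u v P := by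
  -- The ends of `n + 1` equal cells, frozen at `b` afterwards so that the sequence is monotone on
  -- all of ℕ. One cell contains no point of `P`, and the primitive of the bump on it does not
  -- depend on the exponent.
  let c : ℕ → ℝ := fun j => a + (b - a) * min 1 ((j:ℝ) / (n + 1))
  have hab := W.hab
  have hcm : Monotone c := by
    intro j j' h
    have : (j:ℝ) ≤ j' := by exact_mod_cast h
    simp only [c]
    have : (0:ℝ) ≤ b - a := by linarith
    gcongr
  have hcI : ∀ j, c j ∈ Icc a b := by
    intro j
    have h1 : (0:ℝ) ≤ min 1 ((j:ℝ) / (n + 1)) := le_min zero_le_one (by positivity)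
    have h2 : min 1 ((j:ℝ) / (n + 1)) ≤ 1 := min_le_left _ _
    simp only [c]
    constructor <;> nlinarith
  have hcs : ∀ j ≤ n, c j < c (j + 1) := by
    intro j hj
    have hj' : (j:ℝ) ≤ n := by exact_mod_cast hj
    simp only [c]
    push_cast
    have hn : (0:ℝ) < n + 1 := by positivity
    rw [min_eq_right ((div_le_one hn).2 (by linarith)),
      min_eq_right ((div_le_one hn).2 (by linarith))]
    have : (j:ℝ) / (n + 1) < (j + 1) / (n + 1) := by gcongr; linarith
    nlinarith
  let G : ℕ → ℝ → ℝ := fun j x => max 0 (min (prim a u (fun _ => 1) x - prim a u (fun _ => 1) (c j))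
      (prim a u (fun _ => 1) (c (j + 1)) - prim a u (fun _ => 1) x))
  let ν : ℕ → ℝ := fun j => ∫ x, |v x * G j x| ^ q ∂(vol a b)
  have hν : ∀ j ≤ n, 0 < ν j := by
    intro j hj
    obtain ⟨k, hk, -, hkG⟩ := W.exists_bump (hcI j) (prim a u (fun _ => 1) (c (j + 1)))
    have hm : (c j + c (j + 1)) / 2 ∈ Ioo (c j) (c (j + 1)) := by
      have := hcs j hj
      constructor <;> linarith
    have hmI : (c j + c (j + 1)) / 2 ∈ Icc a b :=
      ⟨(hcI j).1.trans hm.1.le, hm.2.le.trans (hcI _).2⟩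
    have := W.energy_hardyT_pos hk hmI (by
      rw [hkG _ hmI]
      refine (lt_max_of_lt_right (lt_min ?_ ?_)).ne'
      · exact sub_pos.2 (W.prim_one_lt (hcI j) hmI hm.1)
      · exact sub_pos.2 (W.prim_one_lt hmI (hcI _) hm.2))
    rwa [energy_hardyT_congr hkG] at this
  obtain ⟨s, hs, hsν⟩ : ∃ s > 0, ∀ j ≤ n, s ≤ ν j := by
    have h1 : ∀ᶠ s in 𝓝[>] (0:ℝ), ∀ j ∈ Finset.range (n + 1), s ≤ ν j := by
      refine (Finset.eventually_all _).2 fun j hj => ?_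
      filter_upwards [Ioo_mem_nhdsGT (hν j (Nat.lt_succ_iff.1 (Finset.mem_range.1 hj)))] with s hs
        using hs.2.le
    obtain ⟨s, h2, h3⟩ := (h1.and self_mem_nhdsWithin).exists
    exact ⟨s, h3, fun j hj => h2 j (Finset.mem_range.2 (Nat.lt_succ_of_le hj))⟩
  -- The density of the bump has energy at most `b - a`, and its power `q / r ≤ 1` is at most `max 1
  -- (b - a)` for every exponent `r`.
  refine ⟨s / max 1 (b - a), by positivity, fun r r' Wr P hP => ?_⟩
  obtain ⟨j, hj, hPj⟩ := exists_Ioc_disjoint hcm P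
  obtain ⟨k, hk, hke, hkG⟩ := Wr.exists_bump (hcI j) (prim a u (fun _ => 1) (c (j + 1)))
  have hadm : Admissible a b r u P k := by
    refine ⟨hk, fun i => ?_⟩
    rw [hkG _ (hP i)]
    refine max_eq_left ?_
    rcases le_or_gt (P i) (c j) with h | h
    · exact (min_le_left _ _).trans (sub_nonpos.2 (Wr.prim_one_le (hP i) (hcI j) h))
    · refine (min_le_right _ _).trans (sub_nonpos.2 (Wr.prim_one_le (hcI _) (hP i) ?_))
      by_contra! hlt
      exact hPj i ⟨h, hlt.le⟩
  have h1 := Wr.energy_le_mul_rpow hadm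
  have h2 : energy r a b k ^ (q / r) ≤ max 1 (b - a) := by
    have hr := Wr.p_pos
    calc energy r a b k ^ (q / r) ≤ max 1 (b - a) ^ (q / r) :=
          Real.rpow_le_rpow (energy_nonneg _ _ _ _) (hke.trans (le_max_right _ _))
            (div_nonneg Wr.q_pos.le hr.le)
      _ ≤ max 1 (b - a) ^ (1:ℝ) :=
          Real.rpow_le_rpow_of_exponent_le (le_max_left _ _) ((div_le_one hr).2 Wr.hqp)
      _ = _ := Real.rpow_one _
  rw [div_le_iff₀ (by positivity)]
  calc s ≤ ν j := hsν j hj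
    _ = energy q a b (hardyT a u v k) := (energy_hardyT_congr hkG).symm
    _ ≤ _ := h1
    _ ≤ _ := by
      have := (Wr.supRatio_pos hP).le
      gcongr

end Weights

end HardySpectral

/-! ### Solutions under a change of the exponent -/

namespace HardySpectral

variable {a b p p' q : ℝ} {u v : ℝ → ℝ}

namespace Weights

theorem abs_tail_sub_le (W : Weights a b p p' q u v) {f : ℝ → ℝ}
    (hf : MemLp f (ENNReal.ofReal p) (vol a b)) {B : ℝ} (hB : ∀ x ∈ Icc a b, |prim a u f x| ≤ B)
    {x y : ℝ} (hx : x ∈ Icc a b) (hy : y ∈ Icc a b) :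
    |tail b (fun y => v y * spow q (hardyT a u v f y)) x -
      tail b (fun y => v y * spow q (hardyT a u v f y)) y| ≤
      B ^ (q - 1) * |∫ t in x..y, |v t| ^ q| := by
  have hB0 : 0 ≤ B := (abs_nonneg _).trans (hB x hx)
  rw [W.tail_sub (W.integrable_v_spow hf) hx hy,
    ← abs_of_nonneg (Real.rpow_nonneg hB0 (q - 1)), ← abs_mul,
    ← intervalIntegral.integral_const_mul]
  refine abs_integral_le_of_abs_le (W.integrable_v.const_mul _) hx hy ?_
  filter_upwards [ae_vol_mem] with t ht _
  rw [hardyT_eq]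
  exact W.abs_v_mul_spow_le t (hB t ht)

theorem tail_self (H : ℝ → ℝ) : tail b H b = 0 := by simp [tail]

theorem abs_tail_le (W : Weights a b p p' q u v) {f : ℝ → ℝ}
    (hf : MemLp f (ENNReal.ofReal p) (vol a b)) {B : ℝ} (hB : ∀ x ∈ Icc a b, |prim a u f x| ≤ B)
    {x : ℝ} (hx : x ∈ Icc a b) :
    |tail b (fun y => v y * spow q (hardyT a u v f y)) x| ≤
      B ^ (q - 1) * ∫ t, |v t| ^ q ∂(vol a b) := by
  have hB0 : 0 ≤ B := (abs_nonneg _).trans (hB x hx)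
  have h1 := W.abs_tail_sub_le hf hB hx W.right_mem
  rw [tail_self, sub_zero] at h1
  refine h1.trans ?_
  gcongr
  exact abs_integral_le_integral W.integrable_v (fun t => by positivity) hx W.right_mem

/-- Bounds for solutions of the spectral equation, uniform in the exponent. -/
theorem solution_bounds (W : Weights a b p p' q u v) {r' : ℝ} (hpr : p' ≤ r') {f : ℝ → ℝ}
    (hf : MemLp f (ENNReal.ofReal p) (vol a b)) {B : ℝ} (hB : ∀ x ∈ Icc a b, |prim a u f x| ≤ B)
    {lam Λ : ℝ} (hlam : 0 ≤ lam) (hΛ : lam ≤ Λ)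
    (h : ∀ᵐ x ∂(vol a b), spow p (f x) =
      u x * (lam * tail b (fun y => v y * spow q (hardyT a u v f y)) x)) :
    ∀ᵐ x ∂(vol a b),
      |f x| ≤ (1 + Λ * (B ^ (q - 1) * ∫ t, |v t| ^ q ∂(vol a b)) * |u x|) ^ (r' - 1) ∧
      |f x| ^ p ≤ (1 + Λ * (B ^ (q - 1) * ∫ t, |v t| ^ q ∂(vol a b)) * |u x|) ^ r' := by
  set C := B ^ (q - 1) * ∫ t, |v t| ^ q ∂(vol a b) with hC
  have hp' : 1 < p' := W.conj.symm.lt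
  have hB0 : 0 ≤ B := (abs_nonneg _).trans (hB a W.left_mem)
  have hC0 : 0 ≤ C := mul_nonneg (Real.rpow_nonneg hB0 _) integral_abs_rpow_nonneg
  have hΛ0 : 0 ≤ Λ := hlam.trans hΛ
  filter_upwards [h, ae_vol_mem] with x hx hm
  set y := u x * (lam * tail b (fun y => v y * spow q (hardyT a u v f y)) x) with hy
  have h1 : |y| ≤ 1 + Λ * C * |u x| := by
    rw [hy, abs_mul, abs_mul, abs_of_nonneg hlam]
    have := W.abs_tail_le hf hB hm
    calc |u x| * (lam * |tail b (fun y => v y * spow q (hardyT a u v f y)) x|)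
        ≤ |u x| * (Λ * C) := by gcongr
      _ ≤ _ := by linarith [mul_comm (|u x|) (Λ * C)]
  have h2 : 1 ≤ 1 + Λ * C * |u x| := by
    have : 0 ≤ Λ * C * |u x| := by positivity
    linarith
  have h3 : |f x| = |y| ^ (p' - 1) := by
    rw [← abs_spow hp', ← hx, spow_spow W.conj]
  constructor
  · rw [h3]
    calc |y| ^ (p' - 1) ≤ (1 + Λ * C * |u x|) ^ (p' - 1) :=
          Real.rpow_le_rpow (abs_nonneg _) h1 (by linarith)
      _ ≤ _ := Real.rpow_le_rpow_of_exponent_le h2 (by linarith)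
  · rw [h3, ← Real.rpow_mul (abs_nonneg _),
      show (p' - 1) * p = p' by have := W.conj.mul_eq_add; nlinarith]
    calc |y| ^ p' ≤ (1 + Λ * C * |u x|) ^ p' :=
          Real.rpow_le_rpow (abs_nonneg _) h1 (by linarith)
      _ ≤ _ := Real.rpow_le_rpow_of_exponent_le h2 hpr

theorem memLp_one_add (W : Weights a b p p' q u v) (C : ℝ) :
    MemLp (fun x => 1 + C * |u x|) (ENNReal.ofReal p') (vol a b) :=
  MemLp.add (f := fun _ => (1:ℝ)) (g := fun x => C * |u x|) (memLp_const 1)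
    (MemLp.const_mul (f := fun x => |u x|) W.u_mem.abs C)

theorem integrable_majorant (W : Weights a b p p' q u v) {C : ℝ} (hC : 0 ≤ C) :
    Integrable (fun x => (1 + C * |u x|) ^ (p' - 1) * |u x|) (vol a b) := by
  have h1 := spow_memLp W.conj.symm (W.memLp_one_add C)
  refine (integrable_mul_of_conj W.conj h1 W.u_mem.abs).congr (Eventually.of_forall fun x => ?_)
  have : 0 < 1 + C * |u x| := by positivity
  simp only [spow_of_pos this, Pi.abs_apply]

/-- Passage to the limit in the spectral equation. -/
theorem exists_limit_solution (W : Weights a b p p' q u v) {r r' lam : ℕ → ℝ} {lam₀ Λ B : ℝ}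
    (Wk : ∀ k, Weights a b (r k) (r' k) q u v) (hr : Tendsto r atTop (𝓝 p))
    (hr' : Tendsto r' atTop (𝓝 p')) (hrp : ∀ k, r' k ≤ p')
    (hlam : Tendsto lam atTop (𝓝 lam₀)) (hlam0 : ∀ k, 0 ≤ lam k) (hΛ : ∀ k, lam k ≤ Λ)
    {f : ℕ → ℝ → ℝ} (hf : ∀ k, MemLp (f k) (ENNReal.ofReal (r k)) (vol a b))
    (hf1 : ∀ k, energy (r k) a b (f k) = 1)
    (hB : ∀ k, ∀ x ∈ Icc a b, |prim a u (f k) x| ≤ B)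
    (hae : ∀ k, ∀ᵐ x ∂(vol a b), spow (r k) (f k x) =
      u x * (lam k * tail b (fun y => v y * spow q (hardyT a u v (f k) y)) x))
    {Φ : ℝ → ℝ}
    (hΦ : ∀ x ∈ Icc a b, Tendsto (fun k => prim a u (f k) x) atTop (𝓝 (Φ x))) :
    ∃ g, MemLp g (ENNReal.ofReal p) (vol a b) ∧ energy p a b g = 1 ∧
      (∀ᵐ x ∂(vol a b), spow p (g x) =
        u x * (lam₀ * tail b (fun y => v y * spow q (hardyT a u v g y)) x)) ∧
      (∀ x ∈ Icc a b, prim a u g x = Φ x) ∧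
      ∀ x ∈ Icc a b, Tendsto (fun k => tail b (fun y => v y * spow q (hardyT a u v (f k) y)) x)
        atTop (𝓝 (tail b (fun y => v y * spow q (hardyT a u v g y)) x)) := by
  have hp' : 1 < p' := W.conj.symm.lt
  have hB0 : 0 ≤ B := (abs_nonneg _).trans (hB 0 a W.left_mem)
  have hΛ0 : 0 ≤ Λ := (hlam0 0).trans (hΛ 0)
  set C := Λ * (B ^ (q - 1) * ∫ t, |v t| ^ q ∂(vol a b)) with hC
  have hC0 : 0 ≤ C := mul_nonneg hΛ0 (mul_nonneg (Real.rpow_nonneg hB0 _) integral_abs_rpow_nonneg)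
  set T : ℕ → ℝ → ℝ := fun k => tail b (fun y => v y * spow q (hardyT a u v (f k) y)) with hT
  set T₀ : ℝ → ℝ := tail b (fun y => v y * spow q (v y * Φ y)) with hT₀
  have hTlim : ∀ x ∈ Icc a b, Tendsto (fun k => T k x) atTop (𝓝 (T₀ x)) := by
    intro x hx
    refine tendsto_integral_of_dominated (fun k => ((Wk k).integrable_v_spow (hf k)).1)
      (W.integrable_v.const_mul (B ^ (q - 1))) (fun k => ?_) ?_ hx W.right_mem
    · filter_upwards [ae_vol_mem] with t ht
      rw [hardyT_eq]
      exact W.abs_v_mul_spow_le t (hB k t ht)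
    · filter_upwards [ae_vol_mem] with t ht
      simp only [hardyT_eq]
      exact ((continuous_spow W.hq).continuousAt.tendsto.comp ((hΦ t ht).const_mul (v t))).const_mul
        (v t)
  -- The equation solved for the unknown density, with the limit primitive inserted on the right.
  set g : ℝ → ℝ := fun x => spow p' (u x * (lam₀ * T₀ x)) with hg
  -- A single majorant serves all exponents because `r' k ≤ p'` and the base is at least 1; this is
  -- why the exponents are taken above the limit.
  have hbd : ∀ k, ∀ᵐ x ∂(vol a b), |f k x| ≤ (1 + C * |u x|) ^ (p' - 1) ∧
      |f k x| ^ (r k) ≤ (1 + C * |u x|) ^ p' := fun k =>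
    (Wk k).solution_bounds (hrp k) (hf k) (hB k) (hlam0 k) (hΛ k) (hae k)
  have hflim : ∀ᵐ x ∂(vol a b), Tendsto (fun k => f k x) atTop (𝓝 (g x)) := by
    filter_upwards [ae_all_iff.2 hae, ae_vol_mem] with x hx hm
    have h1 : ∀ k, f k x = spow (r' k) (u x * (lam k * T k x)) := fun k => by
      rw [← hx k, spow_spow (Wk k).conj]
    simp only [h1]
    exact tendsto_spow hr' hp' ((hlam.mul (hTlim x hm)).const_mul (u x))
  have hFlim : ∀ x ∈ Icc a b, prim a u g x = Φ x := by
    intro x hx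
    refine tendsto_nhds_unique ?_ (hΦ x hx)
    refine tendsto_integral_of_dominated (fun k => ((Wk k).integrable_mul (hf k)).1)
      (W.integrable_majorant hC0) (fun k => ?_) ?_ W.left_mem hx
    · filter_upwards [hbd k] with t ht
      rw [abs_mul]
      exact mul_le_mul_of_nonneg_right ht.1 (abs_nonneg _)
    · filter_upwards [hflim] with t ht using ht.mul_const _
  have hgm : AEStronglyMeasurable g (vol a b) :=
    aestronglyMeasurable_of_tendsto_ae atTop (fun k => (hf k).1) hflim
  have hmaj : Integrable (fun x => (1 + C * |u x|) ^ p') (vol a b) := by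
    refine (MemLp.integrable_abs_rpow (by linarith) (W.memLp_one_add C)).congr
      (Eventually.of_forall fun x => ?_)
    have : 0 ≤ 1 + C * |u x| := by positivity
    simp only [abs_of_nonneg this]
  have hplim : ∀ᵐ x ∂(vol a b), Tendsto (fun k => |f k x| ^ r k) atTop (𝓝 (|g x| ^ p)) := by
    filter_upwards [hflim] with x hx
    exact hx.abs.rpow hr (Or.inr W.p_pos)
  have hgi : Integrable (fun x => |g x| ^ p) (vol a b) := by
    refine hmaj.mono' ((continuous_abs_rpow W.p_pos).comp_aestronglyMeasurable hgm) ?_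
    filter_upwards [hplim, ae_all_iff.2 hbd] with x hx hxb
    rw [Real.norm_eq_abs, abs_of_nonneg (by positivity)]
    exact le_of_tendsto' hx fun k => (hxb k).2
  have hgmem : MemLp g (ENNReal.ofReal p) (vol a b) := (memLp_ofReal_iff W.p_pos).2 ⟨hgm, hgi⟩
  have hTg : ∀ x ∈ Icc a b, tail b (fun y => v y * spow q (hardyT a u v g y)) x = T₀ x := by
    intro x hx
    refine intervalIntegral.integral_congr fun y hy => ?_
    rw [uIcc_of_le hx.2] at hy
    rw [hardyT_eq, hFlim y ⟨hx.1.trans hy.1, hy.2⟩]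
  refine ⟨g, hgmem, ?_, ?_, hFlim, fun x hx => ?_⟩
  · have h1 : Tendsto (fun k => energy (r k) a b (f k)) atTop (𝓝 (energy p a b g)) := by
      refine tendsto_integral_of_dominated_convergence _
        (fun k => (MemLp.integrable_abs_rpow (Wk k).p_pos (hf k)).1) hmaj (fun k => ?_) hplim
      filter_upwards [hbd k] with x hx
      rw [Real.norm_eq_abs, abs_of_nonneg (by positivity)]
      exact hx.2
    simp only [hf1] at h1
    exact (tendsto_nhds_unique h1 tendsto_const_nhds)
  · filter_upwards [ae_vol_mem] with x hx
    rw [hTg x hx, hg]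
    exact spow_spow W.conj.symm
  · rw [hTg x hx]
    exact hTlim x hx

theorem abs_prim_le_uniform (W : Weights a b p p' q u v) {r' : ℝ} (hpr : p' ≤ r')
    (hu : Integrable (fun t => |u t| ^ r') (vol a b)) {f : ℝ → ℝ}
    (hf : MemLp f (ENNReal.ofReal p) (vol a b)) (hf1 : energy p a b f = 1) {x : ℝ}
    (hx : x ∈ Icc a b) :
    |prim a u f x| ≤ max 1 (∫ t, (1 + |u t| ^ r') ∂(vol a b)) := by
  have hp' : 1 < p' := W.conj.symm.lt
  have h1 := W.abs_prim_le hf hx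
  rw [energy] at hf1
  rw [hf1, Real.one_rpow, one_mul] at h1
  refine h1.trans ?_
  have h2 : ∫ t, |u t| ^ p' ∂(vol a b) ≤ ∫ t, (1 + |u t| ^ r') ∂(vol a b) :=
    integral_mono W.integrable_u ((integrable_const 1).add hu)
      fun t => rpow_le_one_add_rpow (abs_nonneg _) (by linarith) hpr
  calc (∫ t, |u t| ^ p' ∂(vol a b)) ^ (1 / p')
      ≤ (max 1 (∫ t, (1 + |u t| ^ r') ∂(vol a b))) ^ (1 / p') :=
        Real.rpow_le_rpow integral_abs_rpow_nonneg (h2.trans (le_max_right _ _)) (by positivity)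
    _ ≤ (max 1 (∫ t, (1 + |u t| ^ r') ∂(vol a b))) ^ (1 : ℝ) :=
        Real.rpow_le_rpow_of_exponent_le (le_max_left _ _)
          ((div_le_one (by linarith)).2 hp'.le)
    _ = _ := Real.rpow_one _

/-- Lowering the conjugate exponent. -/
theorem of_le (W : Weights a b p p' q u v) {r r' : ℝ} (hr : r.HolderConjugate r') (hpr : p ≤ r) :
    Weights a b r r' q u v ∧ r' ≤ p' := by
  have h1 : r' ≤ p' := by
    rw [hr.conjugate_eq, W.conj.conjugate_eq]
    have := W.hp
    rw [div_le_div_iff₀ (by linarith) (by linarith)]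
    nlinarith
  exact ⟨⟨W.hab, hr, W.hq, W.hqp.trans hpr, W.u_pos, W.v_pos,
    W.u_mem.mono_exponent (ENNReal.ofReal_le_ofReal h1), W.v_mem⟩, h1⟩

end Weights

end HardySpectral

/-! ### The homogeneous case and the largest spectral number -/

namespace HardySpectral

variable {a b p p' q : ℝ} {u v : ℝ → ℝ}

namespace Weights

/-- With zero Cauchy data the primitive vanishes identically, and testing the equation with `f`
would give 1 = 0. -/
theorem not_cauchy_zero (W : Weights a b q p' q u v) {f : ℝ → ℝ} {lam : ℝ} (hlam : 0 < lam)
    (hf : MemLp f (ENNReal.ofReal q) (vol a b)) (hf1 : energy q a b f = 1)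
    (h : ∀ᵐ x ∂(vol a b), spow q (f x) =
      u x * (lam * tail b (fun y => v y * spow q (hardyT a u v f y)) x)) {z : ℝ}
    (hz : z ∈ Icc a b) (hz0 : prim a u f z = 0) :
    tail b (fun y => v y * spow q (hardyT a u v f y)) z ≠ 0 := by
  intro hz1
  have h0 := W.prim_eq_zero_of_cauchy hlam hf h hz hz0 hz1
  have h1 := W.weak_of_ae hf h hf
  simp only [spow_mul_self W.hq] at h1
  rw [energy] at hf1
  rw [hf1] at h1
  have h2 : ∫ x, |hardyT a u v f x| ^ q ∂(vol a b) = 0 := by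
    refine integral_eq_zero_of_ae ?_
    filter_upwards [ae_vol_mem] with x hx
    rw [hardyT_eq, h0 x hx, mul_zero, abs_zero, Real.zero_rpow W.q_pos.ne', Pi.zero_apply]
  rw [h2, mul_zero] at h1
  exact one_ne_zero h1

/-- Take nodal solutions for exponents decreasing to `q`. The spectral numbers are bounded by
`exists_supRatio_lower` and the primitives are equicontinuous, so that numbers, primitives and zeros
converge along a subsequence to a normalized solution. Two zeros that merge, or a zero that reaches
`a`, enclose by Rolle a zero of the tail; in the limit both Cauchy data vanish at one point, which
is impossible. -/
theorem spN_nonempty_of_eq (W : Weights a b q p' q u v) (n : ℕ) :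
    (spN a b q q u v n).Nonempty := by
  have hq := W.hq
  have hI := Ioo_subset_Icc_self (a := a) (b := b)
  let r : ℕ → ℝ := fun k => q + 1 / ((k:ℝ) + 1)
  have hrq : ∀ k, q < r k := fun k => by
    have : (0:ℝ) < 1 / ((k:ℝ) + 1) := by positivity
    simp only [r]; linarith
  have hr1 : ∀ k, 1 < r k := fun k => hq.trans (hrq k)
  have hconj : ∀ k, (r k).HolderConjugate (r k).conjExponent := fun k =>
    Real.HolderConjugate.conjExponent (hr1 k)
  let r' : ℕ → ℝ := fun k => (r k).conjExponent
  have hr : Tendsto r atTop (𝓝 q) := by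
    simpa [r] using (tendsto_one_div_add_atTop_nhds_zero_nat (𝕜 := ℝ)).const_add q
  have hr' : Tendsto r' atTop (𝓝 p') := by
    have h1 : Tendsto (fun k => r k / (r k - 1)) atTop (𝓝 (q / (q - 1))) :=
      hr.div (hr.sub_const 1) (by linarith)
    rw [W.conj.conjugate_eq]
    exact h1
  have Wk : ∀ k, Weights a b (r k) (r' k) q u v := fun k => (W.of_le (hconj k) (hrq k).le).1
  have hrp : ∀ k, r' k ≤ p' := fun k => (W.of_le (hconj k) (hrq k).le).2
  have hex : ∀ k, ∃ (lam : ℝ) (P : Fin n → ℝ) (f : ℝ → ℝ), lam ∈ spN a b (r k) q u v n ∧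
      IsNodal a b (r k) q u v P f lam := by
    intro k
    obtain ⟨P, hP, hmin⟩ := (Wk k).exists_min_supRatio n
    have hmem := (Wk k).inv_min_mem_spN_of_lt (hrq k) hP hmin
    obtain ⟨P', f, hN⟩ := (Wk k).exists_isNodal_of_mem_spN hmem
    exact ⟨_, P', f, hmem, hN⟩
  choose lam P f hmem hN using hex
  have hlampos : ∀ k, 0 < lam k := fun k => ((Wk k).exists_supRatio_le_of_mem_spN (hmem k)).1
  obtain ⟨s, hs, hlow⟩ := W.exists_supRatio_lower n
  have hlamle : ∀ k, lam k ≤ s⁻¹ := fun k => by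
    obtain ⟨h0, Q, hQ, hle⟩ := (Wk k).exists_supRatio_le_of_mem_spN (hmem k)
    exact (le_inv_comm₀ hs h0).1 ((hlow _ _ (Wk k) Q hQ).trans hle)
  set B := max 1 (∫ t, (1 + |u t| ^ p') ∂(vol a b)) with hBdef
  have hB0 : 0 ≤ B := zero_le_one.trans (le_max_left _ _)
  have hB : ∀ k, ∀ x ∈ Icc a b, |prim a u (f k) x| ≤ B := fun k x hx =>
    (Wk k).abs_prim_le_uniform (hrp k) W.integrable_u (hN k).memLp (hN k).energy_eq hx
  set C := s⁻¹ * (B ^ (q - 1) * ∫ t, |v t| ^ q ∂(vol a b)) with hC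
  have hC0 : 0 ≤ C := mul_nonneg (inv_nonneg.2 hs.le)
    (mul_nonneg (Real.rpow_nonneg hB0 _) integral_abs_rpow_nonneg)
  have hmaj := W.integrable_majorant hC0
  have hequi : ∀ ε > 0, ∃ δ > 0, ∀ k, ∀ x ∈ Icc a b, ∀ y ∈ Icc a b, |x - y| < δ →
      |prim a u (f k) x - prim a u (f k) y| < ε := by
    intro ε hε
    have huc := isCompact_Icc.uniformContinuousOn_of_continuous (W.continuousOn_primitive hmaj)
    obtain ⟨δ, hδ, hb⟩ := Metric.uniformContinuousOn_iff.1 huc ε hε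
    refine ⟨δ, hδ, fun k x hx y hy hxy => ?_⟩
    have h1 := hb x hx y hy hxy
    rw [Real.dist_eq, intervalIntegral.integral_interval_sub_left
      (intervalIntegrable_of_integrable hmaj W.left_mem hx)
      (intervalIntegrable_of_integrable hmaj W.left_mem hy)] at h1
    rw [(Wk k).prim_sub (hN k).memLp hy hx]
    refine (abs_integral_le_of_abs_le hmaj hy hx ?_).trans_lt h1
    filter_upwards [(Wk k).solution_bounds (hrp k) (hN k).memLp (hB k) (hlampos k).le (hlamle k)
      (hN k).ae_eq] with t ht _
    rw [abs_mul]
    exact mul_le_mul_of_nonneg_right ht.1 (abs_nonneg _)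
  obtain ⟨φ, hφ, Φ, hΦc, hΦ⟩ := exists_subseq_tendstoUniformlyOn hB hequi
  have hcomp : IsCompact (Icc (0:ℝ) s⁻¹ ×ˢ univ.pi fun _ : Fin n => Icc a b) :=
    isCompact_Icc.prod (isCompact_univ_pi fun _ => isCompact_Icc)
  obtain ⟨⟨lam₀, P₀⟩, hmem₀, ψ, hψ, hlim⟩ := hcomp.tendsto_subseq
    (x := fun k => (lam (φ k), P (φ k))) fun k =>
      ⟨⟨(hlampos _).le, hlamle _⟩, fun i _ => hI ((hN _).mem i)⟩
  have hP₀ : ∀ i, P₀ i ∈ Icc a b := fun i => hmem₀.2 i (mem_univ i)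
  set θ : ℕ → ℕ := fun k => φ (ψ k) with hθ
  have hθt : Tendsto θ atTop atTop := hφ.tendsto_atTop.comp hψ.tendsto_atTop
  have hlam₀ : Tendsto (fun k => lam (θ k)) atTop (𝓝 lam₀) :=
    (continuous_fst.tendsto _).comp hlim
  have hPlim : ∀ i, Tendsto (fun k => P (θ k) i) atTop (𝓝 (P₀ i)) := fun i =>
    ((continuous_apply i).tendsto _).comp ((continuous_snd.tendsto _).comp hlim)
  have hΦθ : TendstoUniformlyOn (fun k => prim a u (f (θ k))) Φ atTop (Icc a b) :=
    fun w hw => hψ.tendsto_atTop.eventually (hΦ w hw)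
  obtain ⟨g, hg, hg1, hgae, hgΦ, hTlim⟩ := W.exists_limit_solution (fun k => Wk (θ k))
    (hr.comp hθt) (hr'.comp hθt) (fun k => hrp _) hlam₀ (fun k => (hlampos _).le)
    (fun k => hlamle _) (fun k => (hN (θ k)).memLp) (fun k => (hN (θ k)).energy_eq)
    (fun k => hB _) (fun k => (hN (θ k)).ae_eq) fun x hx => hΦθ.tendsto_at hx
  have hl0 := W.lam_pos_of_ae hg hg1 hgae
  have hnc := fun {z : ℝ} (hz : z ∈ Icc a b) => W.not_cauchy_zero hl0 hg hg1 hgae hz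
  set T : ℕ → ℝ → ℝ := fun k => tail b (fun y => v y * spow q (hardyT a u v (f (θ k)) y)) with hT
  set T₀ : ℝ → ℝ := tail b (fun y => v y * spow q (hardyT a u v g y)) with hT₀
  have hFt : ∀ {t : ℕ → ℝ} {z : ℝ}, (∀ k, t k ∈ Icc a b) → z ∈ Icc a b →
      Tendsto t atTop (𝓝 z) → Tendsto (fun k => prim a u (f (θ k)) (t k)) atTop
        (𝓝 (prim a u g z)) := by
    intro t z ht hz htz
    rw [hgΦ z hz]
    exact hΦθ.tendsto_comp (hΦc z hz)
      (tendsto_nhdsWithin_iff.2 ⟨htz, Eventually.of_forall ht⟩)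
  have hTt : ∀ {t : ℕ → ℝ} {z : ℝ}, (∀ k, t k ∈ Icc a b) → z ∈ Icc a b →
      Tendsto t atTop (𝓝 z) → Tendsto (fun k => T k (t k)) atTop (𝓝 (T₀ z)) := by
    intro t z ht hz htz
    have h1 : Tendsto (fun k => T k (t k) - T k z) atTop (𝓝 0) := by
      have h2 : Tendsto (fun k => B ^ (q - 1) * |∫ s in (t k)..z, |v s| ^ q|) atTop (𝓝 0) := by
        have h3 := ((W.continuousOn_primitive W.integrable_v) z hz).tendsto.comp
          (tendsto_nhdsWithin_iff.2 ⟨htz, Eventually.of_forall ht⟩)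
        have h4 := ((h3.const_sub (∫ s in a..z, |v s| ^ q)).abs).const_mul (B ^ (q - 1))
        rw [sub_self, abs_zero, mul_zero] at h4
        refine h4.congr fun k => ?_
        simp only [Function.comp]
        rw [intervalIntegral.integral_interval_sub_left
          (intervalIntegrable_of_integrable W.integrable_v W.left_mem hz)
          (intervalIntegrable_of_integrable W.integrable_v W.left_mem (ht k))]
      exact squeeze_zero_norm (fun k => (Wk (θ k)).abs_tail_sub_le (hN _).memLp (hB _) (ht k) hz) h2
    have h5 := h1.add (hTlim z hz)
    rw [zero_add] at h5
    exact h5.congr fun k => sub_add_cancel _ _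
  have hF0 : ∀ i, prim a u g (P₀ i) = 0 := fun i => by
    refine tendsto_nhds_unique (hFt (fun k => hI ((hN _).mem i)) (hP₀ i) (hPlim i)) ?_
    refine tendsto_const_nhds.congr fun k => ?_
    exact (((hN (θ k)).zero_iff _ ((hN _).mem i)).2 (mem_range_self i)).symm
  -- zeros of the tails between zeros of the primitives
  have hrolle : ∀ {x y : ℕ → ℝ} {z : ℝ}, (∀ k, x k ∈ Icc a b) → (∀ k, y k ∈ Icc a b) →
      (∀ k, x k < y k) → (∀ k, prim a u (f (θ k)) (x k) = 0) →
      (∀ k, prim a u (f (θ k)) (y k) = 0) → z ∈ Icc a b → Tendsto x atTop (𝓝 z) →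
      Tendsto y atTop (𝓝 z) → False := by
    intro x y z hx hy hxy hx0 hy0 hz hxz hyz
    choose t ht ht0 using fun k => (Wk (θ k)).exists_tail_eq_zero (hlampos (θ k)) (hN _).memLp
      ((Wk (θ k)).continuousOn_tail ((Wk (θ k)).integrable_v_spow (hN _).memLp)) (hN (θ k)).ae_eq
      (hx k) (hy k) (hxy k) ((hx0 k).trans (hy0 k).symm)
    have htI : ∀ k, t k ∈ Icc a b := fun k =>
      ⟨(hx k).1.trans (ht k).1.le, (ht k).2.le.trans (hy k).2⟩
    have htz : Tendsto t atTop (𝓝 z) := tendsto_of_tendsto_of_tendsto_of_le_of_le hxz hyz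
      (fun k => (ht k).1.le) fun k => (ht k).2.le
    have e1 : T₀ z = 0 := tendsto_nhds_unique (hTt htI hz htz)
      (tendsto_const_nhds.congr fun k => (ht0 k).symm)
    have e2 : prim a u g z = 0 := tendsto_nhds_unique (hFt hx hz hxz)
      (tendsto_const_nhds.congr fun k => (hx0 k).symm)
    exact hnc hz e2 e1
  have hPk0 : ∀ k i, prim a u (f (θ k)) (P (θ k) i) = 0 := fun k i =>
    ((hN (θ k)).zero_iff _ ((hN _).mem i)).2 (mem_range_self i)
  have hinj : Function.Injective P₀ := by
    have key : ∀ i j, i < j → P₀ i ≠ P₀ j := fun i j hij heq =>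
      hrolle (fun k => hI ((hN (θ k)).mem i)) (fun k => hI ((hN (θ k)).mem j))
        (fun k => (hN (θ k)).strictMono hij) (fun k => hPk0 k i) (fun k => hPk0 k j) (hP₀ i)
        (hPlim i) (heq ▸ hPlim j)
    intro i j hij
    by_contra hne
    rcases lt_or_gt_of_ne hne with h | h
    · exact key i j h hij
    · exact key j i h hij.symm
  have hPIoo : ∀ i, P₀ i ∈ Ioo a b := by
    intro i
    refine ⟨(hP₀ i).1.lt_of_ne fun h => ?_, (hP₀ i).2.lt_of_ne fun h => ?_⟩
    · exact hrolle (fun _ => W.left_mem) (fun k => hI ((hN (θ k)).mem i))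
        (fun k => ((hN (θ k)).mem i).1) (fun k => prim_self _) (fun k => hPk0 k i) W.left_mem
        tendsto_const_nhds (h ▸ hPlim i)
    -- The tail vanishes at `b` by definition, so a zero of the primitive there would again give
    -- zero Cauchy data.
    · exact hnc W.right_mem (h ▸ hF0 i) (tail_self _)
  refine ⟨lam₀, W.mem_spN_of_ae hg hg1 hgae hinj hPIoo fun x hx => ⟨fun hx0 => ?_, ?_⟩⟩
  · by_contra hxr
    -- No zero appears in the limit: at a zero off the limit nodes the limit primitive changes sign,
    -- and the sign change persists for the approximating primitives. They would have a node nearby,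
    -- whereas their nodes converge to `P₀`.
    obtain ⟨ε, hε, hball⟩ := Metric.isOpen_iff.1 (finite_range P₀).isClosed.isOpen_compl x hxr
    obtain ⟨y, z, hy, hz, hxy, hyz, hzx, hneg⟩ := W.exists_sign_change hl0 hg
      (W.continuousOn_tail (W.integrable_v_spow hg)) hgae hx hx0 (hnc (hI hx) hx0) (half_pos hε)
    have h1 : ∀ᶠ k in atTop, prim a u (f (θ k)) y * prim a u (f (θ k)) z < 0 :=
      ((hFt (fun _ => hI hy) (hI hy) tendsto_const_nhds).mul
        (hFt (fun _ => hI hz) (hI hz) tendsto_const_nhds)).eventually (gt_mem_nhds hneg)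
    have h2 : ∀ᶠ k in atTop, ∀ i, dist (P (θ k) i) (P₀ i) < ε / 2 :=
      eventually_all.2 fun i => (Metric.tendsto_nhds.1 (hPlim i)) _ (half_pos hε)
    obtain ⟨k, hk1, hk2⟩ := (h1.and h2).exists
    have hcont : ContinuousOn (prim a u (f (θ k))) (Icc y z) :=
      ((Wk (θ k)).continuousOn_prim (hN _).memLp).mono (Icc_subset_Icc hy.1.le hz.2.le)
    obtain ⟨t, ht, ht0⟩ : (0:ℝ) ∈ prim a u (f (θ k)) '' Icc y z := by
      rcases mul_neg_iff.1 hk1 with ⟨h3, h4⟩ | ⟨h3, h4⟩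
      · exact intermediate_value_Icc' hyz.le hcont ⟨h4.le, h3.le⟩
      · exact intermediate_value_Icc hyz.le hcont ⟨h3.le, h4.le⟩
    have htI : t ∈ Ioo a b := ⟨hy.1.trans_le ht.1, ht.2.trans_lt hz.2⟩
    obtain ⟨i, hi⟩ := ((hN (θ k)).zero_iff t htI).1 ht0
    refine hball (a := P₀ i) ?_ (mem_range_self i)
    have h5 := hk2 i
    rw [hi, Real.dist_eq] at h5
    rw [Metric.mem_ball, Real.dist_eq]
    have h6 := abs_lt.1 h5
    rw [abs_lt]
    constructor <;> linarith [ht.1, ht.2]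
  · rintro ⟨i, rfl⟩
    exact hF0 i

/-- In the homogeneous case the spectral number of a solution with `n` zeros is determined. -/
theorem inv_le_supRatio_of_isNodal (W : Weights a b q p' q u v) {n : ℕ} {P : Fin n → ℝ}
    {f : ℝ → ℝ} {lam : ℝ} (hN : IsNodal a b q q u v P f lam) {P' : Fin n → ℝ}
    (hP' : ∀ i, P' i ∈ Icc a b) : lam⁻¹ ≤ supRatio a b q q u v P' := by
  have hq := W.hq
  have hlam := W.lam_pos_of_ae hN.memLp hN.energy_eq hN.ae_eq
  -- The `n + 1` nodal cells: `c 0 = a`, then the zeros in order, then the constant value `b`.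
  let c : ℕ → ℝ := fun j => Nat.casesOn j a fun j => if h : j < n then P ⟨j, h⟩ else b
  have hc0 : c 0 = a := rfl
  have hcs : ∀ j, c (j + 1) = if h : j < n then P ⟨j, h⟩ else b := fun j => rfl
  have hcI : ∀ j, c j ∈ Icc a b := by
    intro j
    cases j with
    | zero => exact W.left_mem
    | succ j =>
      rw [hcs]
      split_ifs with h
      · exact Ioo_subset_Icc_self (hN.mem _)
      · exact W.right_mem
  have hlt : ∀ j ≤ n, c j < c (j + 1) := by
    intro j hj
    cases j with
    | zero =>
      rw [hc0, hcs]
      split_ifs with h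
      · exact (hN.mem _).1
      · exact W.hab
    | succ j =>
      rw [hcs, hcs, dif_pos (Nat.lt_of_succ_le hj)]
      split_ifs with h
      · exact hN.strictMono (by simp)
      · exact (hN.mem _).2
  have hmono : Monotone c := by
    refine monotone_nat_of_le_succ fun j => ?_
    rcases le_or_gt j n with h | h
    · exact (hlt j h).le
    · have : c (j + 1) = b := by rw [hcs, dif_neg (by omega)]
      rw [this]
      exact (hcI j).2
  have hcz : ∀ j, c j ∈ Ioo a b → prim a u f (c j) = 0 := by
    intro j hj
    cases j with
    | zero => exact prim_self f
    | succ j =>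
      rw [hcs] at hj ⊢
      split_ifs at hj ⊢ with h
      · exact (hN.zero_iff _ hj).2 (mem_range_self _)
      · exact absurd hj.2 (lt_irrefl b)
  obtain ⟨j, hj, hPj⟩ := exists_Ioc_disjoint hmono P'
  -- The indicator function of a nodal cell without points of `P'`. The truncation of `f` to it is
  -- admissible for `P'`, and as a test function it gives energy `lam * ‖Tk‖_q ^ q`; with `q / p =
  -- 1` this is the bound. If the cell ends at `b` the primitive need not vanish there, but `P'`
  -- does not contain `b` in that case.
  set s : ℝ → ℝ := fun x => (step (c (j + 1)) x - step (c j) x) / 2 with hs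
  have hjl := hlt j hj
  have hs_in : ∀ x ∈ Ioc (c j) (c (j + 1)), s x = 1 := by
    intro x hx
    simp only [hs, step, if_pos hx.2, if_neg (not_le.2 hx.1)]; norm_num
  have hs_out : ∀ x ∉ Ioc (c j) (c (j + 1)), s x = 0 := by
    intro x hx
    simp only [hs, step]
    rcases le_or_gt x (c j) with h | h
    · rw [if_pos h, if_pos (h.trans hjl.le)]; norm_num
    · have : ¬ x ≤ c (j + 1) := fun h' => hx ⟨h, h'⟩
      rw [if_neg this, if_neg (not_le.2 h)]; norm_num
  have hs01 : ∀ x, s x = 0 ∨ s x = 1 := fun x => by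
    by_cases hx : x ∈ Ioc (c j) (c (j + 1))
    · exact Or.inr (hs_in x hx)
    · exact Or.inl (hs_out x hx)
  obtain ⟨hk, hkp⟩ := W.prim_mul_eq_Icc hN.memLp (s := s)
    (((measurable_step _).sub (measurable_step _)).div_const 2).aestronglyMeasurable
    (fun x => by rcases hs01 x with h | h <;> rw [h] <;> norm_num)
    (Z := {c j, c (j + 1)}) (by simp) (fun x _ hx => by
      simp only [mem_insert_iff, mem_singleton_iff, not_or] at hx
      filter_upwards [step_eventually_eq hx.1, step_eventually_eq hx.2] with y h1 h2
      simp only [hs, h1, h2])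
    (by
      rintro x hx (rfl | rfl)
      · exact hcz j hx
      · exact hcz (j + 1) hx) (by
      filter_upwards [step_eventually_eq_left (c j) b, step_eventually_eq_left (c (j + 1)) b]
        with y h1 h2
      simp only [hs, h1, h2])
  set k : ℝ → ℝ := fun x => s x * f x with hkdef
  have hadm : Admissible a b q u P' k :=
    ⟨hk, fun i => by rw [hkp _ (hP' i), hs_out _ (hPj i), zero_mul]⟩
  have hMN : energy q a b k = lam * energy q a b (hardyT a u v k) := by
    have h1 := W.weak_of_ae hN.memLp hN.ae_eq hk
    rw [energy, energy]
    refine Eq.trans (integral_congr_ae (Eventually.of_forall fun x => ?_)) (h1.trans ?_)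
    · simp only [hkdef]
      rcases hs01 x with h | h
      · rw [h, zero_mul, abs_zero, Real.zero_rpow (by linarith), mul_zero]
      · rw [h, one_mul, spow_mul_self hq]
    · congr 1
      refine integral_congr_ae ?_
      filter_upwards [ae_vol_mem] with x hx
      rw [hardyT_eq, hardyT_eq, hkp x hx]
      rcases hs01 x with h | h
      · rw [h, zero_mul, mul_zero, abs_zero, Real.zero_rpow (by linarith), mul_zero]
      · rw [h, one_mul, spow_mul_self hq]
  have hNpos : 0 < energy q a b (hardyT a u v k) := by
    have hm : (c j + c (j + 1)) / 2 ∈ Ioo (c j) (c (j + 1)) := by constructor <;> linarith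
    have hmI : (c j + c (j + 1)) / 2 ∈ Ioo a b :=
      ⟨(hcI j).1.trans_lt hm.1, hm.2.trans_le (hcI (j + 1)).2⟩
    refine W.energy_hardyT_pos hk (Ioo_subset_Icc_self hmI) ?_
    rw [hkp _ (Ioo_subset_Icc_self hmI), hs_in _ ⟨hm.1, hm.2.le⟩, one_mul]
    intro h0
    obtain ⟨i, hi⟩ := (hN.zero_iff _ hmI).1 h0
    have hci : c (i + 1) = P i := by rw [hcs, dif_pos i.2]
    rw [← hi, ← hci] at hm
    rcases le_or_gt (i + 1 : ℕ) j with h | h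
    · exact absurd (hmono h) (not_le.2 hm.1)
    · exact absurd (hmono (Nat.succ_le_of_lt h)) (not_le.2 hm.2)
  have h2 := W.energy_le_mul_rpow hadm
  rw [div_self W.q_pos.ne', Real.rpow_one, hMN] at h2
  rw [inv_le_iff_one_le_mul₀ hlam]
  have h3 : 1 * energy q a b (hardyT a u v k) ≤
      (supRatio a b q q u v P' * lam) * energy q a b (hardyT a u v k) := by
    rw [one_mul]; linarith
  exact le_of_mul_le_mul_right h3 hNpos

/-- The reciprocal of the minimum is the largest spectral number with `n` zeros. -/
theorem isGreatest_inv_min (W : Weights a b p p' q u v) {n : ℕ} {P : Fin n → ℝ}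
    (hP : ∀ i, P i ∈ Icc a b) (hmin : ∀ P' : Fin n → ℝ, (∀ i, P' i ∈ Icc a b) →
      supRatio a b p q u v P ≤ supRatio a b p q u v P') :
    IsGreatest (spN a b p q u v n) (supRatio a b p q u v P)⁻¹ := by
  have hub : ∀ lam ∈ spN a b p q u v n, lam ≤ (supRatio a b p q u v P)⁻¹ := by
    intro lam hl
    obtain ⟨h0, Q, hQ, hle⟩ := W.exists_supRatio_le_of_mem_spN hl
    rw [← inv_inv lam]
    exact inv_anti₀ (W.supRatio_pos hP) ((hmin Q hQ).trans hle)
  refine ⟨?_, hub⟩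
  rcases W.hqp.lt_or_eq with h | h
  · exact W.inv_min_mem_spN_of_lt h hP hmin
  · subst h
    obtain ⟨lam, hl⟩ := W.spN_nonempty_of_eq n
    obtain ⟨Q, f, hN⟩ := W.exists_isNodal_of_mem_spN hl
    have h1 := W.inv_le_supRatio_of_isNodal hN hP
    have h0 := W.lam_pos_of_ae hN.memLp hN.energy_eq hN.ae_eq
    have h2 : (supRatio a b q q u v P)⁻¹ ≤ lam := by
      rw [← inv_inv lam]
      exact inv_anti₀ (inv_pos.2 h0) h1
    rwa [le_antisymm h2 (hub lam hl)]

end Weights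

end HardySpectral

namespace HardySpectral

variable {a b p p' q : ℝ} {u v : ℝ → ℝ}

/-! ### The best constant on an interval and its dependence on the weights -/

/-- The `L_r` norm on `[a, b]`. -/
noncomputable def nrm (r a b : ℝ) (f : ℝ → ℝ) : ℝ := energy r a b f ^ (1 / r)

theorem nrm_nonneg (r a b : ℝ) (f : ℝ → ℝ) : 0 ≤ nrm r a b f :=
  Real.rpow_nonneg (energy_nonneg _ _ _ _) _

theorem nrm_rpow {r : ℝ} (hr : 0 < r) (f : ℝ → ℝ) : nrm r a b f ^ r = energy r a b f := by
  rw [nrm, ← Real.rpow_mul (energy_nonneg _ _ _ _), one_div_mul_cancel hr.ne', Real.rpow_one]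

theorem nrm_add_le {r : ℝ} (hr : 1 ≤ r) {f g : ℝ → ℝ}
    (hf : MemLp f (ENNReal.ofReal r) (vol a b)) (hg : MemLp g (ENNReal.ofReal r) (vol a b)) :
    nrm r a b (fun x => f x + g x) ≤ nrm r a b f + nrm r a b g := by
  have h := lpNorm_add_le (g := g) hf (one_le_ofReal hr)
  have hr0 : 0 < r := by linarith
  rw [lpNorm_ofReal hr0 hf.1, lpNorm_ofReal hr0 hg.1, lpNorm_ofReal hr0 (hf.add hg).1] at h
  exact h

theorem nrm_le_mul {r : ℝ} (hr : 0 < r) {f g : ℝ → ℝ} (hg : MemLp g (ENNReal.ofReal r) (vol a b))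
    {C : ℝ} (hC : 0 ≤ C) (h : ∀ x ∈ Icc a b, |f x| ≤ C * |g x|) :
    nrm r a b f ≤ C * nrm r a b g := by
  have h1 : energy r a b f ≤ C ^ r * energy r a b g := by
    rw [energy, energy, ← integral_const_mul]
    refine integral_mono_of_nonneg (Eventually.of_forall fun x => by
      simp only [Pi.zero_apply]; positivity) ((MemLp.integrable_abs_rpow hr hg).const_mul _) ?_
    filter_upwards [ae_vol_mem] with x hx
    rw [← Real.mul_rpow hC (abs_nonneg _)]
    exact Real.rpow_le_rpow (abs_nonneg _) (h x hx) hr.le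
  calc nrm r a b f ≤ (C ^ r * energy r a b g) ^ (1 / r) :=
        Real.rpow_le_rpow (energy_nonneg _ _ _ _) h1 (by positivity)
    _ = C * nrm r a b g := by
        rw [Real.mul_rpow (by positivity) (energy_nonneg _ _ _ _), ← Real.rpow_mul hC,
          mul_one_div_cancel hr.ne', Real.rpow_one, nrm]

theorem nrm_sub_comm (r a b : ℝ) (f g : ℝ → ℝ) :
    nrm r a b (fun x => f x - g x) = nrm r a b (fun x => g x - f x) := by
  simp only [nrm, energy, abs_sub_comm]

theorem nrm_le_add_sub {r : ℝ} (hr : 1 ≤ r) {f g : ℝ → ℝ}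
    (hf : MemLp f (ENNReal.ofReal r) (vol a b)) (hg : MemLp g (ENNReal.ofReal r) (vol a b)) :
    nrm r a b g ≤ nrm r a b f + nrm r a b (fun x => f x - g x) := by
  have h := nrm_add_le hr hf (g := fun x => g x - f x) (hg.sub hf)
  rw [nrm_sub_comm]
  simpa only [add_sub_cancel] using h

/-- The best constant in `‖T f‖_q ≤ C ‖f‖_p` for functions `f` with `∫ f u = 0`. -/
noncomputable def bestConst (a b p q : ℝ) (u v : ℝ → ℝ) : ℝ :=
  supRatio a b p q u v (fun _ : Fin 1 => b) ^ (1 / q)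

namespace Weights

theorem bestConst_pos (W : Weights a b p p' q u v) : 0 < bestConst a b p q u v :=
  Real.rpow_pos_of_pos (W.supRatio_pos fun _ => W.right_mem) _

theorem bestConst_rpow (W : Weights a b p p' q u v) :
    bestConst a b p q u v ^ q = supRatio a b p q u v (fun _ : Fin 1 => b) := by
  rw [bestConst, ← Real.rpow_mul (W.supRatio_pos fun _ => W.right_mem).le,
    one_div_mul_cancel W.q_pos.ne', Real.rpow_one]

theorem nrm_hardyT_le (W : Weights a b p p' q u v) {f : ℝ → ℝ}
    (hf : MemLp f (ENNReal.ofReal p) (vol a b)) (h0 : prim a u f b = 0) :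
    nrm q a b (hardyT a u v f) ≤ bestConst a b p q u v * nrm p a b f := by
  have hq := W.q_pos
  have hp := W.p_pos
  have h1 := W.energy_le_mul_rpow (P := fun _ : Fin 1 => b) ⟨hf, fun _ => h0⟩
  refine (Real.rpow_le_rpow (energy_nonneg _ _ _ _) h1 (by positivity : 0 ≤ 1 / q)).trans_eq ?_
  rw [Real.mul_rpow (W.supRatio_pos fun _ => W.right_mem).le
    (Real.rpow_nonneg (energy_nonneg _ _ _ _) _), ← Real.rpow_mul (energy_nonneg _ _ _ _),
    bestConst, nrm]
  congr 2
  field_simp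

theorem exists_nrm_eq_bestConst (W : Weights a b p p' q u v) :
    ∃ f, MemLp f (ENNReal.ofReal p) (vol a b) ∧ prim a u f b = 0 ∧ nrm p a b f = 1 ∧
      nrm q a b (hardyT a u v f) = bestConst a b p q u v := by
  obtain ⟨f, hf⟩ := W.exists_extremal (P := fun _ : Fin 1 => b) fun _ => W.right_mem
  exact ⟨f, hf.adm.1, hf.adm.2 0, by rw [nrm, hf.energy_eq, Real.one_rpow], by
    rw [nrm, hf.energy_T, bestConst]⟩

theorem abs_prim_le_nrm (W : Weights a b p p' q u v) {f w : ℝ → ℝ}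
    (hf : MemLp f (ENNReal.ofReal p) (vol a b)) (hw : MemLp w (ENNReal.ofReal p') (vol a b)) {x : ℝ}
    (hx : x ∈ Icc a b) : |prim a w f x| ≤ nrm p a b f * nrm p' a b w := by
  have hi := integrable_mul_of_conj W.conj hf hw
  have h1 := abs_integral_mul_le W.conj hf.abs hw.abs
  simp only [Pi.abs_apply, abs_abs] at h1
  refine le_trans ?_ ((le_abs_self _).trans h1)
  refine (abs_integral_le_of_abs_le (g := fun x => |f x| * |w x|) ?_ W.left_mem hx ?_).trans
    (abs_integral_le_integral ?_ (fun x => by positivity) W.left_mem hx)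
  · simpa [abs_mul] using hi.abs
  · exact Eventually.of_forall fun x _ => (abs_mul _ _).le
  · simpa [abs_mul] using hi.abs

theorem bestConst_le (W : Weights a b p p' q u v) :
    bestConst a b p q u v ≤ nrm p' a b u * nrm q a b v := by
  obtain ⟨f, hf, -, hf1, hfT⟩ := W.exists_nrm_eq_bestConst
  rw [← hfT]
  refine nrm_le_mul W.q_pos W.v_mem (nrm_nonneg _ _ _ _) fun x hx => ?_
  have := W.abs_prim_le_nrm hf W.u_mem hx
  rw [hf1, one_mul] at this
  rw [hardyT_eq, abs_mul, mul_comm]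
  gcongr

/-- Dependence of the best constant on the weights. -/
theorem bestConst_le_add (W : Weights a b p p' q u v) {u₁ v₁ : ℝ → ℝ}
    (W₁ : Weights a b p p' q u₁ v₁) :
    bestConst a b p q u v ≤ bestConst a b p q u₁ v₁ +
      3 * (nrm p' a b (fun x => u x - u₁ x) * nrm q a b v₁) +
      nrm q a b (fun x => v x - v₁ x) * nrm p' a b u := by
  have hp := W.p_pos
  have hp' : 1 < p' := W.conj.symm.lt
  have hp'0 : 0 < p' := by linarith
  obtain ⟨f, hf, hf0, hf1, hfT⟩ := W.exists_nrm_eq_bestConst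
  set x₀ := nrm p' a b (fun x => u x - u₁ x) with hx₀
  have hx₀0 : 0 ≤ x₀ := nrm_nonneg _ _ _ _
  have hud : MemLp (fun x => u x - u₁ x) (ENNReal.ofReal p') (vol a b) := W.u_mem.sub W₁.u_mem
  have hi := fun {w : ℝ → ℝ} (hw : MemLp w (ENNReal.ofReal p') (vol a b)) =>
    integrable_mul_of_conj W.conj hf hw
  have hdiff : ∀ x ∈ Icc a b, prim a u f x - prim a u₁ f x = prim a (fun x => u x - u₁ x) f x := by
    intro x hx
    rw [prim, prim, prim, ← intervalIntegral.integral_sub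
      (intervalIntegrable_of_integrable (hi W.u_mem) W.left_mem hx)
      (intervalIntegrable_of_integrable (hi W₁.u_mem) W.left_mem hx)]
    congr 1; ext t; ring
  have hdle : ∀ x ∈ Icc a b, |prim a u f x - prim a u₁ f x| ≤ x₀ := by
    intro x hx
    rw [hdiff x hx]
    have := W.abs_prim_le_nrm hf hud hx
    rwa [hf1, one_mul] at this
  set e := prim a u₁ f b with he
  have he0 : |e| ≤ x₀ := by
    have := hdle b W.right_mem
    rwa [hf0, zero_sub, abs_neg] at this
  set M := energy p' a b u₁ with hM
  -- The equality case of Hölder for `u₁`: subtracting a multiple of `h` restores `∫ f₁ u₁ = 0` at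
  -- the cost `x₀ / ‖u₁‖` in the norm.
  set h : ℝ → ℝ := fun x => spow p' (u₁ x) with hh
  have hhm : MemLp h (ENNReal.ofReal p) (vol a b) := spow_memLp W.conj.symm W₁.u_mem
  have hhu : ∀ x, h x * u₁ x = |u₁ x| ^ p' := fun x => spow_mul_self hp'
  have hMb : prim a u₁ h b = M := by
    rw [prim, hM, energy, integral_vol W.le]
    exact intervalIntegral.integral_congr fun x _ => hhu x
  have hMpos : 0 < M := by
    rw [← hMb]
    have := W₁.prim_lt_of_pos hhm W.left_mem W.right_mem W.hab (by
      filter_upwards [ae_vol_mem] with x hx _ using spow_pos (W₁.u_pos x hx))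
    rwa [prim_self] at this
  have hMx : ∀ x ∈ Icc a b, |prim a u₁ h x| ≤ M := by
    intro x hx
    rw [prim, hM, energy]
    simp only [hhu]
    exact abs_integral_le_integral W₁.integrable_u (fun t => by positivity) W.left_mem hx
  have hhn : nrm p a b h = M / nrm p' a b u₁ := by
    have h1 : energy p a b h = M := by
      rw [energy, hM, energy]
      congr 1; ext x
      rw [hh, abs_spow hp', ← Real.rpow_mul (abs_nonneg _)]
      congr 1
      have := W.conj.mul_eq_add; nlinarith
    rw [nrm, h1, nrm, ← hM, eq_div_iff (Real.rpow_pos_of_pos hMpos _).ne', ← Real.rpow_add hMpos]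
    rw [one_div, one_div, W.conj.inv_add_inv_eq_one, Real.rpow_one]
  set f₁ : ℝ → ℝ := fun x => f x + (-(e / M)) * h x with hf₁
  have hf₁m : MemLp f₁ (ENNReal.ofReal p) (vol a b) := hf.add (hhm.const_mul _)
  have hF₁ : ∀ x ∈ Icc a b, prim a u₁ f₁ x = prim a u₁ f x + (-(e / M)) * prim a u₁ h x := by
    intro x hx
    rw [hf₁, W₁.prim_add hf (hhm.const_mul _) hx, prim_const_mul]
  have hF₁b : prim a u₁ f₁ b = 0 := by
    rw [hF₁ b W.right_mem, hMb, ← he]; field_simp; ring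
  have hUpos : 0 < nrm p' a b u₁ := Real.rpow_pos_of_pos hMpos _
  have hf₁n : nrm p a b f₁ ≤ 1 + x₀ / nrm p' a b u₁ := by
    refine (nrm_add_le W.hp.le hf (hhm.const_mul _)).trans ?_
    rw [hf1]
    gcongr
    refine (nrm_le_mul (C := |e| / M) hp hhm (by positivity) fun x _ => ?_).trans ?_
    · rw [abs_mul, abs_neg, abs_div, abs_of_pos hMpos]
    · rw [hhn, div_mul_div_cancel₀ hMpos.ne']
      gcongr
  have hFF₁ : ∀ x ∈ Icc a b, |prim a u f x - prim a u₁ f₁ x| ≤ 2 * x₀ := by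
    intro x hx
    rw [hF₁ x hx, show prim a u f x - (prim a u₁ f x + -(e / M) * prim a u₁ h x) =
      (prim a u f x - prim a u₁ f x) + e / M * prim a u₁ h x by ring]
    refine (abs_add_le _ _).trans ?_
    have h1 := hdle x hx
    have h2 : |e / M * prim a u₁ h x| ≤ x₀ := by
      rw [abs_mul, abs_div, abs_of_pos hMpos]
      calc |e| / M * |prim a u₁ h x| ≤ x₀ / M * M := by
            have := hMx x hx
            gcongr
        _ = x₀ := div_mul_cancel₀ _ hMpos.ne'
    linarith
  -- The increase of the norm of `f₁` costs `x₀ ‖v₁‖` because the best constant is at most `‖u₁‖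
  -- ‖v₁‖`. The difference of the primitives costs `2 x₀ ‖v₁‖`; together they give the factor 3.
  have hT₁ : nrm q a b (hardyT a u₁ v₁ f₁) ≤ bestConst a b p q u₁ v₁ + x₀ * nrm q a b v₁ := by
    refine (W₁.nrm_hardyT_le hf₁m hF₁b).trans ?_
    have h1 := W₁.bestConst_pos.le
    calc bestConst a b p q u₁ v₁ * nrm p a b f₁
        ≤ bestConst a b p q u₁ v₁ * (1 + x₀ / nrm p' a b u₁) := by gcongr
      _ = bestConst a b p q u₁ v₁ + x₀ * (bestConst a b p q u₁ v₁ / nrm p' a b u₁) := by ring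
      _ ≤ _ := by
          gcongr
          rw [div_le_iff₀ hUpos, mul_comm]
          exact W₁.bestConst_le
  have hvd : MemLp (fun x => v x - v₁ x) (ENNReal.ofReal q) (vol a b) := W.v_mem.sub W₁.v_mem
  have hcF := W.continuousOn_prim hf
  have hcF₁ := W₁.continuousOn_prim hf₁m
  have hm1 : MemLp (fun x => v₁ x * (prim a u f x - prim a u₁ f₁ x)) (ENNReal.ofReal q) (vol a b) :=
    W₁.memLp_v_mul (hcF.sub hcF₁)
  have hm2 : MemLp (fun x => (v x - v₁ x) * prim a u f x) (ENNReal.ofReal q) (vol a b) := by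
    simp only [mul_comm _ (prim a u f _)]
    exact memLp_continuousOn_mul hcF hvd
  have hsplit : hardyT a u v f = fun x => hardyT a u₁ v₁ f₁ x +
      (v₁ x * (prim a u f x - prim a u₁ f₁ x) + (v x - v₁ x) * prim a u f x) := by
    ext x
    rw [hardyT_eq, hardyT_eq]; ring
  rw [← hfT, hsplit]
  have hq1 := W.hq.le
  have hm12 : MemLp (fun x => v₁ x * (prim a u f x - prim a u₁ f₁ x) + (v x - v₁ x) * prim a u f x)
    (ENNReal.ofReal q) (vol a b) := hm1.add hm2
  have e1 := nrm_add_le hq1 (W₁.memLp_hardyT hf₁m) hm12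
  have e2 := nrm_add_le hq1 hm1 hm2
  have e3 : nrm q a b (fun x => v₁ x * (prim a u f x - prim a u₁ f₁ x)) ≤
      2 * x₀ * nrm q a b v₁ := by
    refine nrm_le_mul W.q_pos W₁.v_mem (by positivity) fun x hx => ?_
    rw [abs_mul, mul_comm]
    have := hFF₁ x hx
    gcongr
  have e4 : nrm q a b (fun x => (v x - v₁ x) * prim a u f x) ≤
      nrm p' a b u * nrm q a b (fun x => v x - v₁ x) := by
    refine nrm_le_mul W.q_pos hvd (nrm_nonneg _ _ _ _) fun x hx => ?_
    rw [abs_mul, mul_comm]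
    have := W.abs_prim_le_nrm hf W.u_mem hx
    rw [hf1, one_mul] at this
    gcongr
  linarith [mul_comm (nrm p' a b u) (nrm q a b (fun x => v x - v₁ x))]

/-- The one-sided estimate used in both directions. Replacing the norms of `u₁`, `v₁` by those of
`u`, `v` plus the differences produces the product term. -/
theorem abs_bestConst_sub_le (W : Weights a b p p' q u v) {u₁ v₁ : ℝ → ℝ}
    (W₁ : Weights a b p p' q u₁ v₁) :
    |bestConst a b p q u v - bestConst a b p q u₁ v₁| ≤
      3 * (nrm p' a b (fun x => u x - u₁ x) * nrm q a b v +
        nrm q a b (fun x => v x - v₁ x) * nrm p' a b u +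
        nrm p' a b (fun x => u x - u₁ x) * nrm q a b (fun x => v x - v₁ x)) := by
  have h1 := W.bestConst_le_add W₁
  have h2 := W₁.bestConst_le_add W
  rw [nrm_sub_comm p' a b u₁ u, nrm_sub_comm q a b v₁ v] at h2
  have h3 := nrm_le_add_sub W.hq.le W.v_mem W₁.v_mem
  have h4 := nrm_le_add_sub W.conj.symm.lt.le W.u_mem W₁.u_mem
  set x := nrm p' a b (fun x => u x - u₁ x)
  set y := nrm q a b (fun x => v x - v₁ x)
  have hx : 0 ≤ x := nrm_nonneg _ _ _ _
  have hy : 0 ≤ y := nrm_nonneg _ _ _ _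
  have hU : 0 ≤ nrm p' a b u := nrm_nonneg _ _ _ _
  have hV : 0 ≤ nrm q a b v := nrm_nonneg _ _ _ _
  have e1 := mul_le_mul_of_nonneg_left h3 hx
  have e2 := mul_le_mul_of_nonneg_left h4 hy
  have e3 := mul_nonneg hx hy
  have e4 := mul_nonneg hx hV
  have e5 := mul_nonneg hy hU
  rw [abs_le]
  constructor <;> nlinarith

end Weights

end HardySpectral

namespace HardySpectral

variable {a b p p' q : ℝ} {u v : ℝ → ℝ}

/-! ### Constant weights -/

theorem integral_Ioo_beta {α β : ℝ} (hα : 0 < α) (hβ : 0 < β) :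
    ∫ x in Ioo (0:ℝ) 1, x ^ (α - 1) * (1 - x) ^ (β - 1) = ProbabilityTheory.beta α β := by
  rw [ProbabilityTheory.beta_eq_betaIntegralReal α β hα hβ, Complex.betaIntegral,
    intervalIntegral.integral_of_le (by norm_num), ← integral_Ioc_eq_integral_Ioo,
    ← RCLike.re_to_complex, ← integral_re]
  · refine setIntegral_congr_fun measurableSet_Ioc fun x ⟨hx1, hx₂⟩ ↦ ?_
    norm_cast
    rw [← Complex.ofReal_cpow, ← Complex.ofReal_cpow, RCLike.re_to_complex,
      Complex.re_mul_ofReal, Complex.ofReal_re]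
    all_goals linarith
  · have := Complex.betaIntegral_convergent (u := α) (v := β) (by simpa) (by simpa)
    rwa [intervalIntegrable_iff_integrableOn_Ioc_of_le (by simp)] at this

/-- The integrand of the inverse of the generalized sine. -/
noncomputable def arcKernel (p q s : ℝ) : ℝ := (1 - s ^ q) ^ (-(1 / p))

/-- The inverse of the generalized sine function. -/
noncomputable def arc (p q y : ℝ) : ℝ := ∫ s in (0:ℝ)..y, arcKernel p q s

theorem measurable_arcKernel (p q : ℝ) : Measurable (arcKernel p q) :=
  (measurable_const.sub (measurable_id.pow_const q)).pow_const _

theorem intervalIntegrable_arcKernel (hp : 1 < p) (hq : 1 ≤ q) :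
    IntervalIntegrable (arcKernel p q) volume 0 1 := by
  have h1 : IntervalIntegrable (fun s : ℝ => (1 - s) ^ (-(1 / p))) volume 0 1 := by
    have h2 : IntervalIntegrable (fun s : ℝ => s ^ (-(1 / p))) volume 1 0 :=
      intervalIntegral.intervalIntegrable_rpow' (by
        rw [neg_lt_neg_iff, div_lt_one (by linarith)]; exact hp)
    simpa using h2.comp_sub_left 1
  rw [intervalIntegrable_iff_integrableOn_Ioo_of_le zero_le_one] at h1 ⊢
  refine h1.mono' (measurable_arcKernel p q).aestronglyMeasurable ?_
  rw [ae_restrict_iff' measurableSet_Ioo]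
  refine Eventually.of_forall fun s hs => ?_
  have h3 : s ^ q ≤ s := by
    have := Real.rpow_le_rpow_of_exponent_ge hs.1 hs.2.le hq
    rwa [Real.rpow_one] at this
  have h4 : 0 < 1 - s := by linarith [hs.2]
  rw [arcKernel, Real.norm_eq_abs, abs_of_nonneg (Real.rpow_nonneg (by linarith) _)]
  exact Real.rpow_le_rpow_of_nonpos h4 (by linarith) (by
    have : 0 < 1 / p := by positivity
    linarith)

theorem arc_zero (p q : ℝ) : arc p q 0 = 0 := by simp [arc]

theorem continuousOn_arc (hp : 1 < p) (hq : 1 ≤ q) : ContinuousOn (arc p q) (Icc 0 1) := by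
  have h := intervalIntegrable_arcKernel hp hq
  rw [intervalIntegrable_iff_integrableOn_Icc_of_le zero_le_one] at h
  have := intervalIntegral.continuousOn_primitive_interval (f := arcKernel p q) (a := 0) (b := 1)
    (μ := volume) (by rwa [uIcc_of_le zero_le_one])
  rwa [uIcc_of_le zero_le_one] at this

theorem hasDerivAt_arc (hp : 1 < p) (hq : 1 ≤ q) {y : ℝ} (hy : y ∈ Ioo (0:ℝ) 1) :
    HasDerivAt (arc p q) (arcKernel p q y) y := by
  have hy1 : y ^ q < 1 := Real.rpow_lt_one hy.1.le hy.2 (by linarith)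
  refine intervalIntegral.integral_hasDerivAt_right
    ((intervalIntegrable_arcKernel hp hq).mono_set ?_)
    (measurable_arcKernel p q).stronglyMeasurable.stronglyMeasurableAtFilter ?_
  · rw [uIcc_of_le hy.1.le, uIcc_of_le zero_le_one]
    exact Icc_subset_Icc le_rfl hy.2.le
  · refine ContinuousAt.rpow_const ?_ (Or.inl (by linarith))
    exact continuousAt_const.sub (continuousAt_id.rpow_const (Or.inl hy.1.ne'))

/-- The substitution `s = x ^ (1 / q)` turns the integral into a Beta integral. -/
theorem arc_one (hpp : p.HolderConjugate p') (hq : 1 < q) :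
    arc p q 1 = ProbabilityTheory.beta (1 / q) (1 / p') / q := by
  have hq0 : 0 < q := by linarith
  have hp' : 0 < p' := hpp.symm.pos
  have h1 := integral_comp_rpow_Ioi (fun s => (Ioo (0:ℝ) 1).indicator (arcKernel p q) s)
    (p := 1 / q) (by positivity)
  rw [setIntegral_indicator measurableSet_Ioo,
    inter_eq_self_of_subset_right (Ioo_subset_Ioi_self : Ioo (0:ℝ) 1 ⊆ Ioi 0)] at h1
  rw [arc, intervalIntegral.integral_of_le zero_le_one, integral_Ioc_eq_integral_Ioo, ← h1,
    div_eq_inv_mul (ProbabilityTheory.beta _ _), ← integral_Ioo_beta (by positivity) (by positivity),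
    ← integral_const_mul,
    ← integral_indicator measurableSet_Ioi, ← integral_indicator measurableSet_Ioo]
  congr 1
  ext x
  by_cases hx0 : x ∈ Ioi (0:ℝ)
  · have hx0' : (0:ℝ) < x := hx0
    rw [indicator_of_mem hx0]
    by_cases hx1 : x < 1
    · have hm : x ^ (1 / q) ∈ Ioo (0:ℝ) 1 :=
        ⟨Real.rpow_pos_of_pos hx0' _, Real.rpow_lt_one hx0'.le hx1 (by positivity)⟩
      have hm' : x ∈ Ioo (0:ℝ) 1 := ⟨hx0', hx1⟩
      rw [indicator_of_mem hm, indicator_of_mem hm', arcKernel,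
        ← Real.rpow_mul hx0'.le, one_div_mul_cancel hq0.ne', Real.rpow_one, smul_eq_mul,
        abs_of_pos (by positivity), one_div q, mul_assoc]
      congr 3
      have := hpp.inv_add_inv_eq_one
      rw [one_div, one_div]; linarith
    · have hm : x ^ (1 / q) ∉ Ioo (0:ℝ) 1 := fun h =>
        not_lt.2 (Real.one_le_rpow (not_lt.1 hx1) (by positivity : 0 ≤ 1 / q)) h.2
      rw [indicator_of_notMem hm, indicator_of_notMem (fun h => hx1 h.2), smul_zero]
  · rw [indicator_of_notMem hx0, indicator_of_notMem (fun h => hx0 h.1)]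

theorem hasDerivAt_integral_of_continuousOn {h : ℝ → ℝ} (hh : ContinuousOn h (Icc a b)) {x : ℝ}
    (hx : x ∈ Ioo a b) : HasDerivAt (fun x => ∫ t in a..x, h t) (h x) x := by
  have hm : Icc a b ∈ 𝓝 x := Icc_mem_nhds hx.1 hx.2
  refine intervalIntegral.integral_hasDerivAt_right ?_
    (hh.stronglyMeasurableAtFilter_nhdsWithin measurableSet_Icc x |>.filter_mono ?_)
    (hh.continuousAt hm)
  · exact (hh.mono (by rw [uIcc_of_le hx.1.le]; exact Icc_subset_Icc le_rfl hx.2.le)).intervalIntegrable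
  · rw [nhdsWithin_eq_nhds.2 hm]

/-- A continuous function with constant derivative. -/
theorem sub_eq_mul_sub_of_hasDerivAt {c d ω : ℝ} (hcd : c ≤ d) {D : ℝ → ℝ}
    (hD : ContinuousOn D (Icc c d)) (h : ∀ x ∈ Ioo c d, HasDerivAt D ω x) :
    D d - D c = ω * (d - c) := by
  have := eq_left_of_hasDerivAt_zero_off_countable (D := fun x => D x - ω * x) countable_empty
    (hD.sub (continuousOn_const.mul continuousOn_id)) (fun x hx => by
      have h1 := (h x hx.1).sub ((hasDerivAt_id x).const_mul ω)
      rw [mul_one, sub_self] at h1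
      exact h1) d ⟨hcd, le_rfl⟩
  beta_reduce at this
  linarith

namespace Weights

/-- The conserved energy and the profile of an extremal function for constant weights. -/
theorem exists_const_profile {α β : ℝ} (W : Weights a b p p' q (fun _ => α) (fun _ => β)) :
    ∃ E Fm : ℝ, 0 < Fm ∧ E * (b - a) = 1 + p' / q ∧
      p' / q * (β * Fm) ^ q = E * supRatio a b p q (fun _ => α) (fun _ => β) (fun _ : Fin 1 => b) ∧
      2 * arc p q 1 = α * E ^ (1 / p) / Fm * (b - a) := by
  have hab := W.hab
  have hα : 0 < α := W.u_pos a W.left_mem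
  have hβ : 0 < β := W.v_pos a W.left_mem
  have hp := W.p_pos
  have hq := W.q_pos
  have hp' : 1 < p' := W.conj.symm.lt
  have hp'0 : 0 < p' := by linarith
  have hP : ∀ i : Fin 1, (fun _ : Fin 1 => b) i ∈ Icc a b := fun _ => W.right_mem
  obtain ⟨f₀, hf₀⟩ := W.exists_extremal hP
  obtain ⟨g, hg, hgabs⟩ := W.exists_extremal_abs hP hf₀
  obtain ⟨c, hc⟩ := W.exists_multipliers hP hg
  have hae := W.ae_eq_of_multipliers hP hg.adm.1 hc
  set S := supRatio a b p q (fun _ => α) (fun _ => β) (fun _ : Fin 1 => b) with hS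
  have hS0 : 0 < S := W.supRatio_pos hP
  set F := prim a (fun _ => α) g with hF
  have hFc : ContinuousOn F (Icc a b) := W.continuousOn_prim hg.adm.1
  have hF0 : ∀ x ∈ Icc a b, 0 ≤ F x := fun x hx => by rw [hgabs x hx]; exact abs_nonneg _
  have hFa : F a = 0 := prim_self g
  have hFb : F b = 0 := hg.adm.2 0
  set h : ℝ → ℝ := fun y => β * spow q (β * F y) with hh
  have hhc : ContinuousOn h (Icc a b) :=
    continuousOn_const.mul ((continuous_spow W.hq).comp_continuousOn (continuousOn_const.mul hFc))
  have hhi : Integrable h (vol a b) := hhc.integrableOn_Icc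
  set w : ℝ → ℝ := fun x => S⁻¹ * tail b h x + c 0 with hw
  have hwc : ContinuousOn w (Icc a b) :=
    (continuousOn_const.mul (W.continuousOn_tail hhi)).add continuousOn_const
  have haew : ∀ᵐ x ∂(vol a b), spow p (g x) = α * (1 * w x) := by
    filter_upwards [hae, ae_vol_mem] with x hx hm
    rw [hx, one_mul]
    simp only [hw, Finset.univ_unique, Fin.default_eq_zero, Finset.sum_singleton]
    rw [indicator_of_mem (by exact hm.2), Pi.one_apply, mul_one]
    rfl
  -- A continuous representative of the extremal density, so that the primitive is differentiable
  -- everywhere in `(a, b)`.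
  set f : ℝ → ℝ := fun x => spow p' (α * w x) with hf
  have hfc : ContinuousOn f (Icc a b) :=
    (continuous_spow hp').comp_continuousOn (continuousOn_const.mul hwc)
  have hgf : ∀ᵐ x ∂(vol a b), g x = f x := by
    filter_upwards [haew] with x hx
    simp only [hf]
    rw [← one_mul (w x), ← hx, spow_spow W.conj]
  have hFder : ∀ x ∈ Ioo a b, HasDerivAt F (f x * α) x := by
    intro x hx
    have h1 := hasDerivAt_integral_of_continuousOn (hfc.mul (continuousOn_const (c := α))) hx
    refine h1.congr_of_eventuallyEq ?_
    filter_upwards [Icc_mem_nhds hx.1 hx.2] with y hy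
    exact prim_congr (u := fun _ => α) hgf hy
  have hwder : ∀ x ∈ Ioo a b, HasDerivAt w (-(S⁻¹ * h x)) x := by
    intro x hx
    have h1 := (((hasDerivAt_integral_of_continuousOn hhc hx).const_sub
      (∫ t in a..b, h t)).const_mul S⁻¹).add_const (c 0)
    rw [mul_neg] at h1
    refine h1.congr_of_eventuallyEq ?_
    filter_upwards [Icc_mem_nhds hx.1 hx.2] with y hy
    simp only [hw, tail]
    rw [← intervalIntegral.integral_interval_sub_left
      (intervalIntegrable_of_integrable hhi W.left_mem W.right_mem)
      (intervalIntegrable_of_integrable hhi W.left_mem hy)]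
  -- The conserved energy: with `F' = α spow p' (α w)` and `w' = -S⁻¹ h` the two contributions to
  -- `K'` cancel.
  set K : ℝ → ℝ := fun x => |α * w x| ^ p' + p' / q * S⁻¹ * |β * F x| ^ q with hK
  have hKc : ContinuousOn K (Icc a b) :=
    ((continuous_abs_rpow hp'0).comp_continuousOn (continuousOn_const.mul hwc)).add
      (continuousOn_const.mul
        ((continuous_abs_rpow hq).comp_continuousOn (continuousOn_const.mul hFc)))
  have hKE : ∀ x ∈ Icc a b, K x = K a := by
    refine eq_left_of_hasDerivAt_zero_off_countable countable_empty hKc fun x hx => ?_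
    have h1 := (hasDerivAt_abs_rpow_spow hp' (α * w x)).comp x ((hwder x hx.1).const_mul α)
    have h2 := ((hasDerivAt_abs_rpow_spow W.hq (β * F x)).comp x
      ((hFder x hx.1).const_mul β)).const_mul (p' / q * S⁻¹)
    have h3 := h1.add h2
    convert! h3 using 1
    simp only [hf, hh]
    field_simp
    ring
  set E := K a with hE
  -- Integrate the conserved energy: its parts contribute `‖f‖_p ^ p = 1` and `p' / q * S⁻¹ * ‖Tf‖_q
  -- ^ q = p' / q`.
  have hEint : E * (b - a) = 1 + p' / q := by
    have h1 : ∫ x, K x ∂(vol a b) = E * (b - a) := by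
      rw [integral_congr_ae (g := fun _ => E) (by
        filter_upwards [ae_vol_mem] with x hx using hKE x hx), integral_const]
      simp [hab.le, mul_comm]
    have h2 : ∫ x, |α * w x| ^ p' ∂(vol a b) = 1 := by
      rw [← hg.energy_eq, energy]
      refine integral_congr_ae ?_
      filter_upwards [haew] with x hx
      rw [← one_mul (w x), ← hx, abs_spow W.hp, ← Real.rpow_mul (abs_nonneg _)]
      congr 1
      have := W.conj.mul_eq_add; nlinarith
    have h3 : ∫ x, |β * F x| ^ q ∂(vol a b) = S := hg.energy_T
    rw [← h1, hK, integral_add, integral_const_mul, h2, h3]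
    · field_simp
    · exact ((continuous_abs_rpow hp'0).comp_continuousOn
        (continuousOn_const.mul hwc)).integrableOn_Icc
    · exact (continuousOn_const.mul ((continuous_abs_rpow hq).comp_continuousOn
        (continuousOn_const.mul hFc))).integrableOn_Icc
  have hE0 : 0 < E := by
    have : 0 < 1 + p' / q := by positivity
    rw [← hEint] at this
    exact pos_of_mul_pos_left this (by linarith)
  have hFpos : ∀ x ∈ Ioo a b, 0 < F x := by
    intro x hx
    refine lt_of_le_of_ne (hF0 x (Ioo_subset_Icc_self hx)) fun h0 => ?_
    have hmin : IsLocalMin F x := by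
      filter_upwards [Icc_mem_nhds hx.1 hx.2] with y hy
      rw [← h0]; exact hF0 y hy
    have h1 := hmin.hasDerivAt_eq_zero (hFder x hx)
    have h2 : α * w x = 0 := by
      rcases mul_eq_zero.1 h1 with h | h
      · exact spow_eq_zero_iff.1 h
      · exact absurd h hα.ne'
    have h3 := hKE x (Ioo_subset_Icc_self hx)
    simp only [hK] at h3
    rw [h2, ← h0, mul_zero, abs_zero, Real.zero_rpow hp'0.ne', Real.zero_rpow hq.ne', mul_zero,
      add_zero] at h3
    exact hE0.ne h3
  have hwanti : ∀ {x y : ℝ}, x ∈ Icc a b → y ∈ Icc a b → x < y → w y < w x := by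
    intro x y hx hy hxy
    have h1 : 0 < tail b h x - tail b h y := by
      rw [W.tail_sub hhi hx hy]
      refine intervalIntegral.intervalIntegral_pos_of_pos_on
        (intervalIntegrable_of_integrable hhi hx hy) (fun t ht => ?_) hxy
      exact mul_pos hβ (spow_pos (mul_pos hβ
        (hFpos t ⟨hx.1.trans_lt ht.1, ht.2.trans_le hy.2⟩)))
    simp only [hw]
    have := mul_pos (inv_pos.2 hS0) h1
    linarith
  -- Rolle gives the point where `F` is maximal. Evaluating the energy there relates `E`, `S` and `F
  -- x₀`.
  obtain ⟨x₀, hx₀, hwx₀⟩ := W.exists_tail_eq_zero one_pos hg.adm.1 hwc haew W.left_mem W.right_mem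
    hab (by rw [← hF, hFa, hFb])
  have hx₀I := Ioo_subset_Icc_self hx₀
  have hFm : 0 < F x₀ := hFpos x₀ hx₀
  have hEm : p' / q * S⁻¹ * (β * F x₀) ^ q = E := by
    have h1 := hKE x₀ hx₀I
    simp only [hK] at h1
    rwa [hwx₀, mul_zero, abs_zero, Real.zero_rpow hp'0.ne', zero_add, abs_of_pos (by positivity)]
      at h1
  set y : ℝ → ℝ := fun x => F x / F x₀ with hy
  have hyK : ∀ x ∈ Icc a b, |α * w x| ^ p' = E * (1 - y x ^ q) := by
    intro x hx
    have h1 := hKE x hx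
    simp only [hK] at h1
    have h2 : (β * F x) ^ q = (β * F x₀) ^ q * y x ^ q := by
      rw [← Real.mul_rpow (by positivity) (div_nonneg (hF0 x hx) hFm.le)]
      congr 1
      field_simp
    rw [abs_of_nonneg (mul_nonneg hβ.le (hF0 x hx)), h2] at h1
    linear_combination h1 - y x ^ q * hEm
  have hy0 : ∀ x ∈ Icc a b, 0 ≤ y x := fun x hx => div_nonneg (hF0 x hx) hFm.le
  have hy1 : ∀ x ∈ Icc a b, y x ≤ 1 := by
    intro x hx
    by_contra! h1
    have h2 : 1 < y x ^ q := Real.one_lt_rpow h1 hq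
    have h3 := hyK x hx
    have h4 : 0 ≤ |α * w x| ^ p' := by positivity
    nlinarith
  have hfabs : ∀ x ∈ Icc a b, |f x| = E ^ (1 / p) * (1 - y x ^ q) ^ (1 / p) := by
    intro x hx
    have h1 : 0 ≤ 1 - y x ^ q := by
      have := Real.rpow_le_one (hy0 x hx) (hy1 x hx) hq.le
      linarith
    rw [← Real.mul_rpow hE0.le h1, ← hyK x hx, ← Real.rpow_mul (abs_nonneg _), hf, abs_spow hp']
    congr 1
    have := W.conj.mul_eq_add
    field_simp
    linarith
  have hyc : ContinuousOn y (Icc a b) := hFc.div_const _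
  have hyder : ∀ x ∈ Ioo a b, HasDerivAt y (f x * α / F x₀) x := fun x hx =>
    (hFder x hx).div_const _
  have harcc : ContinuousOn (fun x => arc p q (y x)) (Icc a b) :=
    (continuousOn_arc W.hp W.hq.le).comp hyc fun x hx => ⟨hy0 x hx, hy1 x hx⟩
  -- Energy conservation says that `arc (F / F x₀)` moves with speed `ω`, upwards before `x₀` and
  -- downwards after it. Each half covers `arc 1`, whence `2 * arc 1 = ω * (b - a)`.
  set ω := α * E ^ (1 / p) / F x₀ with hω
  have harcder : ∀ x ∈ Ioo a b, w x ≠ 0 →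
      HasDerivAt (fun x => arc p q (y x)) (Real.sign (w x) * ω) x := by
    intro x hx hwx
    have hxI := Ioo_subset_Icc_self hx
    have h1 : 0 < 1 - y x ^ q := by
      have h2 : 0 < |α * w x| ^ p' :=
        Real.rpow_pos_of_pos (abs_pos.2 (mul_ne_zero hα.ne' hwx)) _
      rw [hyK x hxI] at h2
      exact pos_of_mul_pos_right h2 hE0.le
    have h2 : y x ∈ Ioo (0:ℝ) 1 := by
      refine ⟨div_pos (hFpos x hx) hFm, lt_of_le_of_ne (hy1 x hxI) fun h => ?_⟩
      rw [h, Real.one_rpow, sub_self] at h1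
      exact lt_irrefl _ h1
    have h3 := (hasDerivAt_arc W.hp W.hq.le h2).comp x (hyder x hx)
    convert! h3 using 1
    have h4 : f x = Real.sign (w x) * |f x| := by
      have : Real.sign (f x) = Real.sign (w x) := by
        rcases lt_or_gt_of_ne hwx with h | h
        · rw [Real.sign_of_neg h, Real.sign_of_neg
            (spow_neg_of_neg (mul_neg_of_pos_of_neg hα h))]
        · rw [Real.sign_of_pos h, Real.sign_of_pos (spow_pos (mul_pos hα h))]
      rw [← sign_mul_self_eq (f x), this, ← mul_assoc, sign_mul_sign hwx, one_mul]
    rw [h4, hfabs x hxI, arcKernel, Real.rpow_neg h1.le, hω]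
    have h5 : (1 - y x ^ q) ^ (1 / p) ≠ 0 := (Real.rpow_pos_of_pos h1 _).ne'
    field_simp
  have hyx₀ : y x₀ = 1 := div_self hFm.ne'
  have hleft : arc p q 1 = ω * (x₀ - a) := by
    have h1 := sub_eq_mul_sub_of_hasDerivAt (ω := ω) hx₀.1.le
      (harcc.mono (Icc_subset_Icc le_rfl hx₀.2.le)) (fun x hx => by
      have hxI : x ∈ Ioo a b := ⟨hx.1, hx.2.trans hx₀.2⟩
      have h2 : 0 < w x := hwx₀ ▸ hwanti (Ioo_subset_Icc_self hxI) hx₀I hx.2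
      simpa [Real.sign_of_pos h2] using harcder x hxI h2.ne')
    simp only [hyx₀] at h1
    rw [← h1]
    simp only [hy, hFa, zero_div, arc_zero, sub_zero]
  have hright : arc p q 1 = ω * (b - x₀) := by
    have h1 := sub_eq_mul_sub_of_hasDerivAt (ω := -ω) hx₀.2.le
      (harcc.mono (Icc_subset_Icc hx₀.1.le le_rfl)) (fun x hx => by
      have hxI : x ∈ Ioo a b := ⟨hx₀.1.trans hx.1, hx.2⟩
      have h2 : w x < 0 := hwx₀ ▸ hwanti hx₀I (Ioo_subset_Icc_self hxI) hx.1
      simpa [Real.sign_of_neg h2] using harcder x hxI h2.ne)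
    simp only [hyx₀] at h1
    simp only [hy, hFb, zero_div, arc_zero, zero_sub] at h1
    linarith
  refine ⟨E, F x₀, hFm, hEint, ?_, by linarith⟩
  rw [← hEm]
  field_simp

/-- Elimination of the energy and of the maximal value from the three relations of
`exists_const_profile`. The power of the length is `1 - (1 / p - 1 / q) = 1 / p' + 1 / q`. -/
theorem bestConst_const {α β : ℝ} (W : Weights a b p p' q (fun _ => α) (fun _ => β)) :
    bestConst a b p q (fun _ => α) (fun _ => β) =
      cConst p p' q * (α * β) * (b - a) ^ (1 / p' + 1 / q) := by
  have hα : 0 < α := W.u_pos a W.left_mem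
  have hβ : 0 < β := W.v_pos a W.left_mem
  have hp := W.p_pos
  have hq := W.q_pos
  have hp' : 0 < p' := W.conj.symm.pos
  have hℓ : 0 < b - a := sub_pos.2 W.hab
  obtain ⟨E, Fm, hFm, hE, hS, harc⟩ := W.exists_const_profile
  rw [arc_one W.conj W.hq] at harc
  set B := ProbabilityTheory.beta (1 / q) (1 / p') with hB
  have hB0 : 0 < B := ProbabilityTheory.beta_pos (by positivity) (by positivity)
  set S := supRatio a b p q (fun _ => α) (fun _ => β) (fun _ : Fin 1 => b) with hSdef
  have hE' : E = (p' + q) / q / (b - a) := by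
    rw [eq_div_iff hℓ.ne', hE]; field_simp; ring
  have hE0 : 0 < E := by rw [hE']; positivity
  have hFm' : Fm = q * α * E ^ (1 / p) * (b - a) / (2 * B) := by
    rw [eq_div_iff (by positivity)]
    field_simp at harc
    linarith
  have hS' : S = p' / q * (β * Fm) ^ q / E := by
    rw [eq_div_iff hE0.ne', mul_comm, ← hS]
  have hbest : bestConst a b p q (fun _ => α) (fun _ => β) =
      (p' / q) ^ (1 / q) * (β * Fm) / E ^ (1 / q) := by
    rw [bestConst, ← hSdef, hS', Real.div_rpow (by positivity) hE0.le,
      Real.mul_rpow (by positivity) (by positivity), ← Real.rpow_mul (by positivity),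
      mul_one_div_cancel hq.ne', Real.rpow_one]
  have h1 : E ^ (1 / p) / E ^ (1 / q) =
      (p' + q) ^ (1 / p - 1 / q) / q ^ (1 / p - 1 / q) / (b - a) ^ (1 / p - 1 / q) := by
    rw [← Real.rpow_sub hE0, hE', Real.div_rpow (by positivity) hℓ.le,
      Real.div_rpow (by positivity) hq.le]
  have hconj : 1 / p' = 1 - 1 / p := by
    have := W.conj.inv_add_inv_eq_one
    rw [one_div, one_div]; linarith
  have h2 : (b - a) / (b - a) ^ (1 / p - 1 / q) = (b - a) ^ (1 / p' + 1 / q) := by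
    rw [← Real.rpow_one_sub' hℓ.le]
    · congr 1; rw [hconj]; ring
    · rw [show 1 - (1 / p - 1 / q) = 1 / p' + 1 / q by rw [hconj]; ring]; positivity
  have h3 : q / q ^ (1 / q) / q ^ (1 / p - 1 / q) = q ^ (1 / p') := by
    nth_rewrite 1 [← Real.rpow_one q]
    rw [← Real.rpow_sub hq, ← Real.rpow_sub hq, hconj]
    congr 1; ring
  rw [hbest, hFm', cConst, ← hB, ← h2, ← h3, Real.div_rpow hp'.le hq.le]
  calc p' ^ (1 / q) / q ^ (1 / q) * (β * (q * α * E ^ (1 / p) * (b - a) / (2 * B))) / E ^ (1 / q)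
      = p' ^ (1 / q) / q ^ (1 / q) * (β * (q * α * (b - a) / (2 * B))) *
          (E ^ (1 / p) / E ^ (1 / q)) := by ring
    _ = _ := by rw [h1]; ring

end Weights

end HardySpectral

namespace HardySpectral

variable {a b p p' q : ℝ} {u v : ℝ → ℝ}

/-! ### Partitions -/

/-- `a = t 0 < t 1 < ⋯ < t N = b`. -/
structure IsPartition (a b : ℝ) (N : ℕ) (t : ℕ → ℝ) : Prop where
  zero : t 0 = a
  last : t N = b
  lt : ∀ j < N, t j < t (j + 1)

namespace IsPartition

variable {N : ℕ} {t : ℕ → ℝ}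

theorem le (h : IsPartition a b N t) {i j : ℕ} (hij : i ≤ j) (hj : j ≤ N) : t i ≤ t j := by
  induction j, hij using Nat.le_induction with
  | base => exact le_rfl
  | succ j hij ih => exact (ih (Nat.le_of_succ_le hj)).trans (h.lt j hj).le

theorem mem (h : IsPartition a b N t) {j : ℕ} (hj : j ≤ N) : t j ∈ Icc a b :=
  ⟨h.zero ▸ h.le (Nat.zero_le j) hj, h.last ▸ h.le hj le_rfl⟩

theorem index_eq (h : IsPartition a b N t) {i j : ℕ} (hi : i < N) (hj : j < N) {x : ℝ}
    (hxi : x ∈ Ioc (t i) (t (i + 1))) (hxj : x ∈ Ioc (t j) (t (j + 1))) : i = j := by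
  rcases lt_trichotomy i j with hij | hij | hij
  · exact absurd (hxi.2.trans (h.le hij hj.le)) (not_le.2 hxj.1)
  · exact hij
  · exact absurd (hxj.2.trans (h.le hij hi.le)) (not_le.2 hxi.1)

theorem sum_integral (h : IsPartition a b N t) (hab : a ≤ b) {k : ℝ → ℝ}
    (hk : Integrable k (vol a b)) :
    ∑ j ∈ Finset.range N, ∫ x, k x ∂(vol (t j) (t (j + 1))) = ∫ x, k x ∂(vol a b) := by
  rw [integral_vol hab, ← h.zero, ← h.last, ← intervalIntegral.sum_integral_adjacent_intervals]
  · exact Finset.sum_congr rfl fun j hj => integral_vol (h.lt j (Finset.mem_range.1 hj)).le _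
  · intro j hj
    exact intervalIntegrable_of_integrable hk (h.mem hj.le) (h.mem hj)

end IsPartition

theorem exists_partition {X : Finset ℝ} (haX : a ∈ X) (hbX : b ∈ X)
    (hX : ∀ x ∈ X, x ∈ Icc a b) :
    ∃ N t, IsPartition a b N t ∧ N + 1 = X.card ∧ (∀ x ∈ X, ∃ j ≤ N, t j = x) ∧
      ∀ j < N, ∀ x ∈ X, x ∉ Ioo (t j) (t (j + 1)) := by
  have hne : X.Nonempty := ⟨a, haX⟩
  have hc : 0 < X.card := hne.card_pos
  set N := X.card - 1 with hN
  have hNc : N + 1 = X.card := Nat.succ_pred_eq_of_pos hc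
  let t : ℕ → ℝ := fun j => X.orderEmbOfFin rfl ⟨min j N, by omega⟩
  have hmin : X.min' hne = a := le_antisymm (X.min'_le a haX)
    (X.le_min' hne a fun y hy => (hX y hy).1)
  have hmax : X.max' hne = b := le_antisymm (X.max'_le hne b fun y hy => (hX y hy).2)
    (X.le_max' b hbX)
  have hpart : IsPartition a b N t := by
    refine ⟨?_, ?_, fun j hj => ?_⟩
    · simp only [t, Nat.zero_min]
      rw [Finset.orderEmbOfFin_zero rfl hc, hmin]
    · simp only [t, min_self]
      rw [Finset.orderEmbOfFin_last rfl hc, hmax]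
    · refine (X.orderEmbOfFin rfl).strictMono ?_
      rw [Fin.mk_lt_mk]
      omega
  have hsurj : ∀ x ∈ X, ∃ j ≤ N, t j = x := by
    intro x hx
    have : x ∈ range (X.orderEmbOfFin rfl) := by rw [Finset.range_orderEmbOfFin]; exact hx
    obtain ⟨i, rfl⟩ := this
    refine ⟨i, by omega, ?_⟩
    simp only [t]
    congr 1
    ext
    simp only
    omega
  refine ⟨N, t, hpart, hNc, hsurj, fun j hj x hx hm => ?_⟩
  obtain ⟨i, hi, rfl⟩ := hsurj x hx
  rcases le_or_gt i j with h | h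
  · exact absurd (hpart.le h hj.le) (not_le.2 hm.1)
  · exact absurd (hpart.le h hi) (not_le.2 hm.2)

theorem vol_mono {c d : ℝ} (hc : a ≤ c) (hd : d ≤ b) : vol c d ≤ vol a b :=
  Measure.restrict_mono (Icc_subset_Icc hc hd) le_rfl

namespace Weights

theorem restrict (W : Weights a b p p' q u v) {c d : ℝ} (hc : a ≤ c) (hcd : c < d) (hd : d ≤ b) :
    Weights c d p p' q u v :=
  ⟨hcd, W.conj, W.hq, W.hqp, fun x hx => W.u_pos x ⟨hc.trans hx.1, hx.2.trans hd⟩,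
    fun x hx => W.v_pos x ⟨hc.trans hx.1, hx.2.trans hd⟩, W.u_mem.mono_measure (vol_mono hc hd),
    W.v_mem.mono_measure (vol_mono hc hd)⟩

theorem restrict_partition (W : Weights a b p p' q u v) {N : ℕ} {t : ℕ → ℝ}
    (ht : IsPartition a b N t) {j : ℕ} (hj : j < N) : Weights (t j) (t (j + 1)) p p' q u v :=
  W.restrict (ht.mem hj.le).1 (ht.lt j hj) (ht.mem hj).2

theorem prim_eq_add (W : Weights a b p p' q u v) {f : ℝ → ℝ}
    (hf : MemLp f (ENNReal.ofReal p) (vol a b)) {x y : ℝ} (hx : x ∈ Icc a b) (hy : y ∈ Icc a b) :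
    prim a u f y = prim a u f x + prim x u f y := by
  have := W.prim_sub hf hx hy
  rw [prim, prim, prim] at *
  linarith

/-- Power mean inequality. With `s = q / p` it is the price of distributing the L_p norm over `N`
cells. -/
theorem sum_rpow_le {N : ℕ} {s : ℝ} (hs : 0 < s) (hs1 : s ≤ 1) {M : ℕ → ℝ} (hM : ∀ j, 0 ≤ M j) :
    ∑ j ∈ Finset.range N, M j ^ s ≤ (N:ℝ) ^ (1 - s) * (∑ j ∈ Finset.range N, M j) ^ s := by
  have h1 := Real.rpow_sum_le_const_mul_sum_rpow_of_nonneg (s := Finset.range N)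
    (f := fun j => M j ^ s) (p := 1 / s) ((one_le_div hs).2 hs1)
    (fun j _ => Real.rpow_nonneg (hM j) s)
  simp only [← Real.rpow_mul (hM _), mul_one_div_cancel hs.ne', Real.rpow_one,
    Finset.card_range] at h1
  have h0 : 0 ≤ ∑ j ∈ Finset.range N, M j ^ s :=
    Finset.sum_nonneg fun j _ => Real.rpow_nonneg (hM j) s
  have h2 := Real.rpow_le_rpow (Real.rpow_nonneg h0 _) h1 hs.le
  rw [← Real.rpow_mul h0, one_div_mul_cancel hs.ne', Real.rpow_one,
    Real.mul_rpow (by positivity) (Finset.sum_nonneg fun j _ => hM j),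
    ← Real.rpow_mul (by positivity)] at h2
  convert h2 using 3
  field_simp

/-- Upper bound for the supremum by the best constants of a partition contained in the points. -/
theorem supRatio_le_of_partition (W : Weights a b p p' q u v) {N : ℕ} {t : ℕ → ℝ}
    (ht : IsPartition a b N t) {n : ℕ} {P : Fin n → ℝ} (hPt : ∀ j < N, ∃ i, P i = t (j + 1))
    {σ : ℝ} (hσ0 : 0 ≤ σ) (hσ : ∀ j < N, bestConst (t j) (t (j + 1)) p q u v ^ q ≤ σ) :
    supRatio a b p q u v P ≤ σ * (N:ℝ) ^ (1 - q / p) := by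
  have hp := W.p_pos
  have hq := W.q_pos
  refine csSup_le ⟨_, fun _ => 0, ⟨MemLp.zero, fun i => by simp [prim]⟩, by
    simp [energy, Real.zero_rpow hp.ne'], rfl⟩ ?_
  rintro y ⟨f, hf, hf1, rfl⟩
  have hFt : ∀ j ≤ N, prim a u f (t j) = 0 := by
    intro j hj
    cases j with
    | zero => rw [ht.zero, prim_self]
    | succ j =>
      obtain ⟨i, hi⟩ := hPt j hj
      rw [← hi, hf.2 i]
  have hfj : ∀ j < N, MemLp f (ENNReal.ofReal p) (vol (t j) (t (j + 1))) := fun j hj =>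
    hf.1.mono_measure (vol_mono (ht.mem hj.le).1 (ht.mem hj).2)
  have hj : ∀ j < N, energy q (t j) (t (j + 1)) (hardyT a u v f) ≤
      σ * energy p (t j) (t (j + 1)) f ^ (q / p) := by
    intro j hj
    have Wj := W.restrict_partition ht hj
    have hpr : ∀ x ∈ Icc (t j) (t (j + 1)), prim (t j) u f x = prim a u f x := by
      intro x hx
      rw [W.prim_eq_add hf.1 (ht.mem hj.le)
        ⟨(ht.mem hj.le).1.trans hx.1, hx.2.trans (ht.mem hj).2⟩, hFt j hj.le, zero_add]
    have h1 := Wj.energy_le_mul_rpow (P := fun _ : Fin 1 => t (j + 1)) ⟨hfj j hj, fun _ => by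
      rw [hpr _ Wj.right_mem, hFt _ hj]⟩
    rw [energy_hardyT_congr hpr, ← Wj.bestConst_rpow] at h1
    refine le_trans (le_of_eq ?_) (h1.trans (mul_le_mul_of_nonneg_right (hσ j hj)
      (Real.rpow_nonneg (energy_nonneg _ _ _ _) _)))
    simp only [energy, hardyT_eq]
  have e1 := ht.sum_integral W.le (MemLp.integrable_abs_rpow hq (W.memLp_hardyT hf.1))
  have e2 := ht.sum_integral W.le (MemLp.integrable_abs_rpow hp hf.1)
  have e3 : energy q a b (hardyT a u v f) ≤
      ∑ j ∈ Finset.range N, σ * energy p (t j) (t (j + 1)) f ^ (q / p) := by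
    rw [energy, ← e1]
    exact Finset.sum_le_sum fun j hj' => hj j (Finset.mem_range.1 hj')
  rw [← Finset.mul_sum] at e3
  refine e3.trans (mul_le_mul_of_nonneg_left ?_ hσ0)
  refine (sum_rpow_le (by positivity) ((div_le_one hp).2 W.hqp)
    fun j => energy_nonneg _ _ _ _).trans ?_
  refine mul_le_of_le_one_right (by positivity) (Real.rpow_le_one
    (Finset.sum_nonneg fun j _ => energy_nonneg _ _ _ _) ?_ (by positivity))
  simp only [energy] at hf1 ⊢
  rw [e2]
  exact hf1

/-- Lower bound for the supremum by the best constants of a partition containing the points. -/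
theorem sum_bestConst_le (W : Weights a b p p' q u v) {N : ℕ} {t : ℕ → ℝ}
    (ht : IsPartition a b N t) {n : ℕ} {P : Fin n → ℝ} (hPt : ∀ i, ∃ j ≤ N, P i = t j) {r : ℝ}
    (hr : r = 1 / p' + 1 / q) :
    (∑ j ∈ Finset.range N, bestConst (t j) (t (j + 1)) p q u v ^ (1 / r)) ^ r ≤
      N * supRatio a b p q u v P ^ (1 / q) := by
  have hp := W.p_pos
  have hq := W.q_pos
  have hp' : 0 < p' := W.conj.symm.pos
  have hr0 : 0 < r := by rw [hr]; positivity
  have hconj : 1 / p' = 1 - 1 / p := by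
    have := W.conj.inv_add_inv_eq_one
    rw [one_div, one_div]; linarith
  have hP : ∀ i, P i ∈ Icc a b := fun i => by
    obtain ⟨j, hj, h⟩ := hPt i
    rw [h]; exact ht.mem hj
  have hN : 0 < N := by
    rcases Nat.eq_zero_or_pos N with h | h
    · subst h
      exact absurd (ht.zero.symm.trans ht.last) W.hab.ne
    · exact h
  have hex : ∀ j, ∃ f, j < N → IsExtremal (t j) (t (j + 1)) p q u v (fun _ : Fin 1 => t (j + 1)) f :=
    fun j => by
      by_cases hj : j < N
      · obtain ⟨f, hf⟩ := (W.restrict_partition ht hj).exists_extremal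
          (P := fun _ : Fin 1 => t (j + 1)) fun _ => (W.restrict_partition ht hj).right_mem
        exact ⟨f, fun _ => hf⟩
      · exact ⟨0, fun h => absurd h hj⟩
  choose g hg using hex
  set A : ℕ → ℝ := fun j => bestConst (t j) (t (j + 1)) p q u v with hA
  have hA0 : ∀ j < N, 0 < A j := fun j hj => (W.restrict_partition ht hj).bestConst_pos
  -- The cell extremals are glued with coefficients `α ^ (1 / p)`, `α = A ^ (1 / r)`. Then the
  -- energy is `∑ α`, and `‖Tf‖_q ^ q = ∑ α ^ (q + 1)` since `q / p + r q = q + 1`. The power mean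
  -- inequality for the exponent `q + 1` gives the claim.
  set α : ℕ → ℝ := fun j => A j ^ (1 / r) with hα
  have hα0 : ∀ j < N, 0 < α j := fun j hj => Real.rpow_pos_of_pos (hA0 j hj) _
  set κ : ℕ → ℝ := fun j => α j ^ (1 / p) with hκ
  have hκ0 : ∀ j < N, 0 < κ j := fun j hj => Real.rpow_pos_of_pos (hα0 j hj) _
  set f : ℝ → ℝ := fun x => ∑ j ∈ Finset.range N,
    (Ioc (t j) (t (j + 1))).indicator (fun x => κ j * g j x) x with hf
  have hfj : ∀ j < N, ∀ x ∈ Ioc (t j) (t (j + 1)), f x = κ j * g j x := by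
    intro j hj x hx
    rw [hf]
    beta_reduce
    rw [Finset.sum_eq_single j, indicator_of_mem hx]
    · intro i hi hne
      refine indicator_of_notMem (fun h => hne ?_) _
      exact ht.index_eq (Finset.mem_range.1 hi) hj h hx
    · intro h
      exact absurd (Finset.mem_range.2 hj) h
  have hfm : MemLp f (ENNReal.ofReal p) (vol a b) := by
    refine memLp_finsetSum _ fun j hj => ?_
    have hj' := Finset.mem_range.1 hj
    rw [memLp_indicator_iff_restrict measurableSet_Ioc]
    refine ((hg j hj').adm.1.const_mul (κ j)).mono_measure ?_
    rw [Measure.restrict_restrict measurableSet_Ioc]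
    exact Measure.restrict_mono (inter_subset_left.trans Ioc_subset_Icc_self) le_rfl
  have hprim : ∀ j < N, ∀ x ∈ Icc (t j) (t (j + 1)), prim (t j) u f x =
      κ j * prim (t j) u (g j) x := by
    intro j hj x hx
    rw [← prim_const_mul, prim, prim, intervalIntegral.integral_of_le hx.1,
      intervalIntegral.integral_of_le hx.1]
    refine setIntegral_congr_fun measurableSet_Ioc fun y hy => ?_
    rw [hfj j hj y ⟨hy.1, hy.2.trans hx.2⟩]
  have hFt : ∀ j ≤ N, prim a u f (t j) = 0 := by
    intro j
    induction j with
    | zero => intro _; rw [ht.zero, prim_self]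
    | succ j ih =>
      intro hj
      rw [W.prim_eq_add hfm (ht.mem (Nat.le_of_succ_le hj)) (ht.mem hj), ih (Nat.le_of_succ_le hj),
        hprim j hj _ (right_mem_Icc.2 (ht.lt j hj).le), (hg j hj).adm.2 0, mul_zero, add_zero]
  have hadm : Admissible a b p u P f := by
    refine ⟨hfm, fun i => ?_⟩
    obtain ⟨j, hj, h⟩ := hPt i
    rw [h, hFt j hj]
  have hM : energy p a b f = ∑ j ∈ Finset.range N, α j := by
    rw [energy, ← ht.sum_integral W.le (MemLp.integrable_abs_rpow hp hfm)]
    refine Finset.sum_congr rfl fun j hj => ?_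
    have hj' := Finset.mem_range.1 hj
    have h1 : ∫ x, |f x| ^ p ∂(vol (t j) (t (j + 1))) =
        energy p (t j) (t (j + 1)) fun x => κ j * g j x := by
      refine integral_congr_ae ?_
      filter_upwards [ae_vol_mem_Ioo] with x hx
      rw [hfj j hj' x (Ioo_subset_Ioc_self hx)]
    rw [h1, energy_const_mul, (hg j hj').energy_eq, mul_one, abs_of_pos (hκ0 j hj'), hκ,
      ← Real.rpow_mul (hα0 j hj').le, one_div_mul_cancel hp.ne', Real.rpow_one]
  have hNf : energy q a b (hardyT a u v f) = ∑ j ∈ Finset.range N, α j ^ (q + 1) := by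
    rw [energy, ← ht.sum_integral W.le (MemLp.integrable_abs_rpow hq (W.memLp_hardyT hfm))]
    refine Finset.sum_congr rfl fun j hj => ?_
    have hj' := Finset.mem_range.1 hj
    have h1 : ∫ x, |hardyT a u v f x| ^ q ∂(vol (t j) (t (j + 1))) =
        energy q (t j) (t (j + 1)) fun x => κ j * hardyT (t j) u v (g j) x := by
      refine integral_congr_ae ?_
      filter_upwards [ae_vol_mem] with x hx
      rw [hardyT_eq, hardyT_eq, W.prim_eq_add hfm (ht.mem hj'.le)
        ⟨(ht.mem hj'.le).1.trans hx.1, hx.2.trans (ht.mem hj').2⟩, hFt j hj'.le, zero_add,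
        hprim j hj' x hx, mul_left_comm]
    have h2 : A j = α j ^ r := by
      rw [hα, ← Real.rpow_mul (hA0 j hj').le, one_div_mul_cancel hr0.ne', Real.rpow_one]
    rw [h1, energy_const_mul, (hg j hj').energy_T, abs_of_pos (hκ0 j hj'),
      ← (W.restrict_partition ht hj').bestConst_rpow]
    change κ j ^ q * A j ^ q = _
    rw [h2, hκ, ← Real.rpow_mul (hα0 j hj').le, ← Real.rpow_mul (hα0 j hj').le,
      ← Real.rpow_add (hα0 j hj')]
    congr 1
    rw [hr, hconj]
    field_simp
    ring
  set s₀ := ∑ j ∈ Finset.range N, α j with hs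
  have hs₀ : 0 < s₀ := Finset.sum_pos (fun j hj => hα0 j (Finset.mem_range.1 hj))
    ⟨0, Finset.mem_range.2 hN⟩
  have h1 := W.energy_le_mul_rpow hadm
  rw [hM, hNf] at h1
  have h2 := Real.rpow_sum_le_const_mul_sum_rpow_of_nonneg (s := Finset.range N) (f := α)
    (p := q + 1) (by linarith) (fun j hj => (hα0 j (Finset.mem_range.1 hj)).le)
  rw [Finset.card_range, add_sub_cancel_right, ← hs] at h2
  set S := supRatio a b p q u v P with hS
  have hS0 : 0 < S := W.supRatio_pos hP
  have h3 : s₀ ^ (q + 1) ≤ (N:ℝ) ^ q * S * s₀ ^ (q / p) := by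
    calc s₀ ^ (q + 1) ≤ (N:ℝ) ^ q * (S * s₀ ^ (q / p)) :=
          h2.trans (mul_le_mul_of_nonneg_left h1 (by positivity))
      _ = _ := by ring
  have h4 : (s₀ ^ r) ^ q ≤ (N:ℝ) ^ q * S := by
    have h5 : s₀ ^ (q + 1) = (s₀ ^ r) ^ q * s₀ ^ (q / p) := by
      rw [← Real.rpow_mul hs₀.le, ← Real.rpow_add hs₀]
      congr 1
      rw [hr, hconj]
      field_simp
      ring
    rw [h5] at h3
    exact le_of_mul_le_mul_right h3 (Real.rpow_pos_of_pos hs₀ _)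
  have h6 := Real.rpow_le_rpow (by positivity) h4 (by positivity : 0 ≤ 1 / q)
  rwa [← Real.rpow_mul (by positivity), mul_one_div_cancel hq.ne', Real.rpow_one,
    Real.mul_rpow (by positivity) hS0.le, ← Real.rpow_mul (by positivity),
    mul_one_div_cancel hq.ne', Real.rpow_one] at h6

end Weights

end HardySpectral

namespace HardySpectral

variable {a b p p' q : ℝ} {u v : ℝ → ℝ}

/-! ### Approximation of the best constant on short intervals -/

/-- Rounding down to the grid with origin `a` and mesh `δ`. -/
noncomputable def gridFloor (a δ x : ℝ) : ℝ := a + δ * ⌊(x - a) / δ⌋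

theorem measurable_gridFloor (a δ : ℝ) : Measurable (gridFloor a δ) := by
  unfold gridFloor
  have : Measurable fun x : ℝ => (⌊(x - a) / δ⌋ : ℤ) := by fun_prop
  have h2 : Measurable fun n : ℤ => (n : ℝ) := measurable_from_top
  exact measurable_const.add ((h2.comp this).const_mul δ)

theorem abs_gridFloor_sub_le {δ : ℝ} (hδ : 0 < δ) (x : ℝ) : |gridFloor a δ x - x| ≤ δ := by
  have h1 := Int.floor_le ((x - a) / δ)
  have h2 := Int.lt_floor_add_one ((x - a) / δ)
  rw [le_div_iff₀ hδ] at h1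
  rw [div_lt_iff₀ hδ] at h2
  rw [gridFloor, abs_le]
  constructor <;> nlinarith

theorem gridFloor_eq {N : ℕ} (hN : 0 < N) (hab : a < b) {c d : ℝ} (hc : a ≤ c) (hd : d ≤ b)
    (hG : ∀ j ≤ N, a + (b - a) / N * j ∉ Ioo c d) {x y : ℝ} (hx : x ∈ Ioo c d) (hy : y ∈ Ioo c d) :
    gridFloor a ((b - a) / N) x = gridFloor a ((b - a) / N) y := by
  wlog hxy : x ≤ y generalizing x y
  · exact (this hy hx (le_of_not_ge hxy)).symm
  have hN' : (0:ℝ) < N := Nat.cast_pos.2 hN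
  set δ := (b - a) / N with hδ
  have hδ0 : 0 < δ := div_pos (sub_pos.2 hab) hN'
  have hmono : ⌊(x - a) / δ⌋ ≤ ⌊(y - a) / δ⌋ := Int.floor_mono (by gcongr)
  rcases hmono.eq_or_lt with h | h
  · rw [gridFloor, gridFloor, h]
  · exfalso
    have hx0 : 0 ≤ ⌊(x - a) / δ⌋ :=
      Int.floor_nonneg.2 (div_nonneg (sub_nonneg.2 (hc.trans hx.1.le)) hδ0.le)
    obtain ⟨m, hm⟩ := Int.eq_ofNat_of_zero_le (hx0.trans h.le)
    have h1 := Int.floor_le ((y - a) / δ)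
    have h2 := Int.lt_floor_add_one ((x - a) / δ)
    have h3 : ((⌊(x - a) / δ⌋ : ℤ) : ℝ) + 1 ≤ (⌊(y - a) / δ⌋ : ℤ) := by exact_mod_cast h
    rw [hm] at h1 h3
    rw [Int.cast_natCast] at h1 h3
    have h4 := h2.trans_le h3
    rw [div_lt_iff₀ hδ0] at h4
    rw [le_div_iff₀ hδ0] at h1
    have hmN : m ≤ N := by
      have : (m:ℝ) * δ ≤ N * δ := by
        have : (N:ℝ) * δ = b - a := by rw [hδ]; field_simp
        have := hy.2
        linarith
      exact_mod_cast le_of_mul_le_mul_right this hδ0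
    refine hG m hmN ⟨?_, ?_⟩
    · have := hx.1
      linarith
    · have := hy.2
      linarith

/-- Approximation of a positive function in `L_r` by positive step functions. -/
theorem exists_step_approx (hab : a < b) {r : ℝ} (hr : 1 ≤ r) {f : ℝ → ℝ}
    (hf : MemLp f (ENNReal.ofReal r) (vol a b)) (hf0 : ∀ x ∈ Icc a b, 0 < f x) {ε : ℝ}
    (hε : 0 < ε) :
    ∃ (G : Finset ℝ) (g : ℝ → ℝ), MemLp g (ENNReal.ofReal r) (vol a b) ∧ (∀ x, 0 < g x) ∧
      ∫ x, |f x - g x| ^ r ∂(vol a b) ≤ ε ∧ ∀ c d, a ≤ c → c < d → d ≤ b →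
        (∀ x ∈ G, x ∉ Ioo c d) → ∃ α, 0 < α ∧ ∀ x ∈ Ioo c d, g x = α := by
  have hr0 : 0 < r := by linarith
  obtain ⟨h, hh, -⟩ := hf.exists_boundedContinuous_integral_rpow_sub_le hr0 (half_pos hε)
  set δ : ℕ → ℝ := fun M => (b - a) / (M + 1 : ℕ) with hδ
  have hδ0 : ∀ M, 0 < δ M := fun M => div_pos (sub_pos.2 hab) (by positivity)
  have hδlim : Tendsto δ atTop (𝓝 0) :=
    (tendsto_const_div_atTop_nhds_zero_nat (b - a)).comp (tendsto_add_atTop_nat 1)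
  -- A bounded continuous approximation sampled on a grid, and cut off below by a vanishing constant
  -- to remain positive.
  set g : ℕ → ℝ → ℝ := fun M x => max (h (gridFloor a (δ M) x)) (1 / ((M:ℝ) + 1)) with hg
  have hgpos : ∀ M x, 0 < g M x := fun M x => lt_max_of_lt_right (by positivity)
  have hgm : ∀ M, Measurable (g M) := fun M =>
    (h.continuous.measurable.comp (measurable_gridFloor a (δ M))).max measurable_const
  have hgb : ∀ M x, |g M x| ≤ ‖h‖ + 1 := by
    intro M x
    rw [abs_of_pos (hgpos M x)]
    refine max_le ?_ ?_
    · have := (le_abs_self _).trans (h.norm_coe_le_norm (gridFloor a (δ M) x))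
      linarith
    · have : 1 / ((M:ℝ) + 1) ≤ 1 := by
        rw [div_le_one (by positivity)]
        linarith [(Nat.cast_nonneg M : (0:ℝ) ≤ M)]
      linarith [norm_nonneg h]
  have hgL : ∀ M, MemLp (g M) (ENNReal.ofReal r) (vol a b) := fun M =>
    MemLp.of_bound (hgm M).aestronglyMeasurable (‖h‖ + 1) (ae_of_all _ fun x => hgb M x)
  have hglim : ∀ x, Tendsto (fun M => g M x) atTop (𝓝 (max (h x) 0)) := by
    intro x
    refine Tendsto.max ?_ tendsto_one_div_add_atTop_nhds_zero_nat
    refine (h.continuous.tendsto x).comp ?_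
    rw [tendsto_iff_dist_tendsto_zero]
    exact squeeze_zero (fun M => dist_nonneg)
      (fun M => by rw [Real.dist_eq]; exact abs_gridFloor_sub_le (hδ0 M) x) hδlim
  have hdom : Integrable (fun x => |(|f x| + (‖h‖ + 1))| ^ r) (vol a b) :=
    MemLp.integrable_abs_rpow hr0 (hf.abs.add (memLp_const (‖h‖ + 1)))
  have hlim : Tendsto (fun M => ∫ x, |f x - g M x| ^ r ∂(vol a b)) atTop
      (𝓝 (∫ x, |f x - max (h x) 0| ^ r ∂(vol a b))) := by
    refine tendsto_integral_of_dominated_convergence _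
      (fun M => (MemLp.integrable_abs_rpow hr0 (hf.sub (hgL M))).aestronglyMeasurable) hdom
      (fun M => ae_of_all _ fun x => ?_) (ae_of_all _ fun x => ?_)
    · rw [Real.norm_eq_abs, abs_of_nonneg (by positivity)]
      refine Real.rpow_le_rpow (abs_nonneg _) ?_ hr0.le
      rw [abs_of_nonneg (by positivity : 0 ≤ |f x| + (‖h‖ + 1))]
      have h1 := abs_sub (f x) (g M x)
      have h2 := hgb M x
      linarith
    · exact ((continuous_abs_rpow hr0).tendsto _).comp (tendsto_const_nhds.sub (hglim x))
  -- Passing to the positive part of `h` does not increase the distance to the positive function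
  -- `f`.
  have hlt : ∫ x, |f x - max (h x) 0| ^ r ∂(vol a b) < ε := by
    have : ∫ x, |f x - max (h x) 0| ^ r ∂(vol a b) ≤ ∫ x, ‖f x - h x‖ ^ r ∂(vol a b) := by
      have hhL : MemLp (fun x => h x) (ENNReal.ofReal r) (vol a b) :=
        MemLp.of_bound h.continuous.aestronglyMeasurable ‖h‖ (ae_of_all _ h.norm_coe_le_norm)
      refine integral_mono_of_nonneg (ae_of_all _ fun x => by positivity)
        (MemLp.integrable_abs_rpow hr0 (hf.sub hhL)) ?_
      filter_upwards [ae_vol_mem] with x hx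
      rw [Real.norm_eq_abs]
      refine Real.rpow_le_rpow (abs_nonneg _) ?_ hr0.le
      have := hf0 x hx
      rcases le_total (h x) 0 with h0 | h0
      · rw [max_eq_right h0, sub_zero, abs_of_pos this, abs_of_pos (by linarith)]
        linarith
      · rw [max_eq_left h0]
    linarith
  obtain ⟨M, hM⟩ := (hlim.eventually_lt_const hlt).exists
  refine ⟨(Finset.range (M + 2)).image fun j : ℕ => a + δ M * j, g M, hgL M, hgpos M, hM.le,
    fun c d hc hcd hd hG => ?_⟩
  obtain ⟨y, hy⟩ := exists_between hcd
  refine ⟨g M y, hgpos M y, fun x hx => ?_⟩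
  simp only [hg]
  rw [gridFloor_eq (Nat.succ_pos M) hab hc hd (fun j hj => hG _ (Finset.mem_image.2
    ⟨j, Finset.mem_range.2 (by omega), rfl⟩)) hx hy]

theorem bestConst_congr (hab : a ≤ b) {u₁ v₁ : ℝ → ℝ} (hu : ∀ x ∈ Ioo a b, u x = u₁ x)
    (hv : ∀ x ∈ Ioo a b, v x = v₁ x) : bestConst a b p q u v = bestConst a b p q u₁ v₁ := by
  have hpr : ∀ f x, x ∈ Icc a b → prim a u f x = prim a u₁ f x := by
    intro f x hx
    rw [prim, prim, intervalIntegral.integral_of_le hx.1, intervalIntegral.integral_of_le hx.1,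
      integral_Ioc_eq_integral_Ioo, integral_Ioc_eq_integral_Ioo]
    refine setIntegral_congr_fun measurableSet_Ioo fun t ht => ?_
    rw [hu t ⟨ht.1, ht.2.trans_le hx.2⟩]
  have hen : ∀ f, energy q a b (hardyT a u v f) = energy q a b (hardyT a u₁ v₁ f) := by
    intro f
    refine integral_congr_ae ?_
    filter_upwards [ae_vol_mem_Ioo] with x hx
    rw [hardyT_eq, hardyT_eq, hv x hx, hpr f x (Ioo_subset_Icc_self hx)]
  have hadm : ∀ f, Admissible a b p u (fun _ : Fin 1 => b) f ↔
      Admissible a b p u₁ (fun _ : Fin 1 => b) f := by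
    intro f
    simp only [Admissible, hpr f b (right_mem_Icc.2 hab)]
  simp only [bestConst, supRatio, hen, hadm]

theorem abs_rpow_sub_rpow_le {s x y : ℝ} (hs : 0 ≤ s) (hs1 : s ≤ 1) (hx : 0 ≤ x) (hy : 0 ≤ y) :
    |x ^ s - y ^ s| ≤ |x - y| ^ s := by
  have key : ∀ x y : ℝ, 0 ≤ x → 0 ≤ y → x ^ s ≤ y ^ s + |x - y| ^ s := by
    intro x y hx hy
    refine (Real.rpow_le_rpow hx ?_ hs).trans
      (Real.rpow_add_le_add_rpow hy (abs_nonneg (x - y)) hs hs1)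
    linarith [le_abs_self (x - y)]
  rw [abs_le]
  constructor
  · have := key y x hy hx
    rw [abs_sub_comm] at this
    linarith
  · linarith [key x y hx hy]

/-- Young's inequality for `l⁻¹ x` and `l y` with `l ^ s' = τ`. -/
theorem exists_mul_le_add {s s' : ℝ} (h : s.HolderConjugate s') {τ : ℝ} (hτ : 0 < τ) :
    ∃ C, 0 < C ∧ ∀ x y : ℝ, 0 ≤ x → 0 ≤ y → x * y ≤ C * x ^ s + τ * y ^ s' := by
  have hs := h.pos
  have hs' := h.symm.pos
  set l := τ ^ (1 / s') with hl
  have hl0 : 0 < l := Real.rpow_pos_of_pos hτ _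
  refine ⟨(l⁻¹) ^ s, by positivity, fun x y hx hy => ?_⟩
  have h1 := Real.young_inequality_of_nonneg (mul_nonneg (inv_pos.2 hl0).le hx)
    (mul_nonneg hl0.le hy) h
  rw [Real.mul_rpow (by positivity) hx, Real.mul_rpow (by positivity) hy] at h1
  have h2 : l ^ s' = τ := by
    rw [hl, ← Real.rpow_mul hτ.le, one_div_mul_cancel hs'.ne', Real.rpow_one]
  rw [h2] at h1
  have h3 : l⁻¹ * x * (l * y) = x * y := by field_simp
  rw [h3] at h1
  refine h1.trans (add_le_add ?_ ?_)
  · exact div_le_self (by positivity) h.lt.le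
  · exact div_le_self (by positivity) h.symm.lt.le

namespace Weights

/-- Because `r = 1 / p' + 1 / q`, the exponents `p' r` and `q r` are conjugate, so Young's
inequality splits `(x y) ^ (1 / r)` into `x ^ p'` and `y ^ q`. The large constant falls on the
perturbations `x₁`, `y₁`, the small one on the weights. Applied to norms on cells the right-hand
side is additive over the cells. -/
theorem exists_rpow_le_add (W : Weights a b p p' q u v) {r : ℝ} (hr : r = 1 / p' + 1 / q)
    (hr1 : 1 ≤ r) {τ : ℝ} (hτ : 0 < τ) :
    ∃ C, 0 < C ∧ ∀ x y x₁ y₁ : ℝ, 0 ≤ x → 0 ≤ y → 0 ≤ x₁ → 0 ≤ y₁ →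
      (x₁ * y + y₁ * x + x₁ * y₁) ^ (1 / r) ≤
        C * (x₁ ^ p' + y₁ ^ q) + τ * (x ^ p' + y ^ q) := by
  have hq := W.q_pos
  have hp' : 0 < p' := W.conj.symm.pos
  have hr0 : 0 < r := by linarith
  have hconj : (p' * r).HolderConjugate (q * r) := by
    rw [Real.holderConjugate_iff]
    constructor
    · rw [hr]; field_simp; linarith
    · rw [hr]; field_simp
  obtain ⟨C₁, hC₁, h₁⟩ := exists_mul_le_add hconj hτ
  obtain ⟨C₂, hC₂, h₂⟩ := exists_mul_le_add hconj.symm hτ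
  have e : ∀ {s x : ℝ}, 0 ≤ x → (x ^ (1 / r)) ^ (s * r) = x ^ s := by
    intro s x hx
    rw [← Real.rpow_mul hx]
    congr 1
    field_simp
  have hs : 0 ≤ 1 / r := by positivity
  have hs1 : 1 / r ≤ 1 := (div_le_one hr0).2 hr1
  refine ⟨2 * C₁ + C₂ + τ, by positivity, fun x y x₁ y₁ hx hy hx₁ hy₁ => ?_⟩
  have a1 := h₁ (x₁ ^ (1 / r)) (y ^ (1 / r)) (by positivity) (by positivity)
  have a2 := h₂ (y₁ ^ (1 / r)) (x ^ (1 / r)) (by positivity) (by positivity)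
  have a3 := h₁ (x₁ ^ (1 / r)) (y₁ ^ (1 / r)) (by positivity) (by positivity)
  rw [e (by assumption), e (by assumption), ← Real.mul_rpow (by assumption) (by assumption)]
    at a1 a2 a3
  have b1 := Real.rpow_add_le_add_rpow (add_nonneg (mul_nonneg hx₁ hy) (mul_nonneg hy₁ hx))
    (mul_nonneg hx₁ hy₁) hs hs1
  have b2 := Real.rpow_add_le_add_rpow (mul_nonneg hx₁ hy) (mul_nonneg hy₁ hx) hs hs1
  have c1 : 0 ≤ x₁ ^ p' := by positivity
  have c2 : 0 ≤ y₁ ^ q := by positivity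
  have c3 : 0 ≤ C₂ * x₁ ^ p' := by positivity
  have c4 : 0 ≤ τ * x₁ ^ p' := by positivity
  have c5 : 0 ≤ C₁ * y₁ ^ q := by positivity
  nlinarith

theorem integrable_mul_rpow (W : Weights a b p p' q u v) {r : ℝ} (hr : r = 1 / p' + 1 / q)
    (hr1 : 1 ≤ r) : Integrable (fun x => |u x * v x| ^ (1 / r)) (vol a b) := by
  obtain ⟨C, hC, h⟩ := W.exists_rpow_le_add hr hr1 one_pos
  have hr0 : 0 < r := by linarith
  refine ((W.integrable_u.add W.integrable_v).const_mul (C + 1)).mono' ?_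
    (ae_of_all _ fun x => ?_)
  · exact ((continuous_abs_rpow (by positivity)).comp_aestronglyMeasurable
      (W.u_mem.aestronglyMeasurable.mul W.v_mem.aestronglyMeasurable))
  · have h1 := h |u x| |v x| |u x| |v x| (abs_nonneg _) (abs_nonneg _) (abs_nonneg _) (abs_nonneg _)
    rw [Real.norm_eq_abs, abs_of_nonneg (by positivity)]
    refine (Real.rpow_le_rpow (abs_nonneg _) ?_ (by positivity)).trans (h1.trans (le_of_eq ?_))
    · rw [abs_mul]
      have := mul_nonneg (abs_nonneg (u x)) (abs_nonneg (v x))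
      nlinarith
    · simp only [Pi.add_apply]
      ring

theorem abs_sub_mul_rpow_le {s : ℝ} (hs : 0 ≤ s) (hs1 : s ≤ 1) (x y x₁ y₁ : ℝ) :
    |(|x * y| ^ s - |x₁ * y₁| ^ s)| ≤
      (|x - x₁| * |y| + |y - y₁| * |x| + |x - x₁| * |y - y₁|) ^ s := by
  refine (abs_rpow_sub_rpow_le hs hs1 (abs_nonneg _) (abs_nonneg _)).trans
    (Real.rpow_le_rpow (abs_nonneg _) ((abs_abs_sub_abs_le_abs_sub _ _).trans ?_) hs)
  have e : x * y - x₁ * y₁ = (x - x₁) * y + (y - y₁) * x - (x - x₁) * (y - y₁) := by ring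
  rw [e, ← abs_mul, ← abs_mul, ← abs_mul]
  exact (abs_sub _ _).trans (add_le_add (abs_add_le _ _) le_rfl)

end Weights

end HardySpectral

/-! ### The density of the best constant -/

namespace HardySpectral

variable {a b p p' q : ℝ} {u v : ℝ → ℝ}

theorem cConst_pos (hp' : 0 < p') (hq : 0 < q) : 0 < cConst p p' q := by
  have := ProbabilityTheory.beta_pos (α := 1 / q) (β := 1 / p') (by positivity) (by positivity)
  unfold cConst
  positivity

namespace Weights

/-- The best constant scales as the `r`-th power of the length, so its power `1 / r` is an integral
over the interval. -/
theorem rpow_bestConst_of_const (W : Weights a b p p' q u v) {r : ℝ} (hr : r = 1 / p' + 1 / q)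
    {α β : ℝ} (hα : 0 < α) (hβ : 0 < β) (hu : ∀ x ∈ Ioo a b, u x = α)
    (hv : ∀ x ∈ Ioo a b, v x = β) :
    bestConst a b p q u v ^ (1 / r) =
      cConst p p' q ^ (1 / r) * ∫ x, |u x * v x| ^ (1 / r) ∂(vol a b) := by
  have hq := W.q_pos
  have hp' : 0 < p' := W.conj.symm.pos
  have hr0 : 0 < r := by rw [hr]; positivity
  have hba : 0 < b - a := sub_pos.2 W.hab
  have Wc : Weights a b p p' q (fun _ => α) (fun _ => β) :=
    ⟨W.hab, W.conj, W.hq, W.hqp, fun _ _ => hα, fun _ _ => hβ, memLp_const _, memLp_const _⟩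
  have h1 : ∫ x, |u x * v x| ^ (1 / r) ∂(vol a b) = ∫ _, (α * β) ^ (1 / r) ∂(vol a b) := by
    refine integral_congr_ae ?_
    filter_upwards [ae_vol_mem_Ioo] with x hx
    rw [hu x hx, hv x hx, abs_of_pos (mul_pos hα hβ)]
  rw [bestConst_congr W.le hu hv, Wc.bestConst_const, ← hr, h1, integral_vol W.le,
    intervalIntegral.integral_const, smul_eq_mul,
    Real.mul_rpow (mul_pos (cConst_pos hp' hq) (mul_pos hα hβ)).le (by positivity),
    Real.mul_rpow (cConst_pos hp' hq).le (by positivity), ← Real.rpow_mul hba.le,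
    mul_one_div_cancel hr0.ne', Real.rpow_one]
  ring

/-- Away from finitely many points, the best constant is an almost additive set function with
density `cConst p p' q ^ (1 / r) * |u v| ^ (1 / r)`. -/
theorem exists_local_estimate (W : Weights a b p p' q u v) {r : ℝ} (hr : r = 1 / p' + 1 / q)
    (hr1 : 1 ≤ r) {ε : ℝ} (hε : 0 < ε) :
    ∃ (G : Finset ℝ) (D : ℝ → ℝ), (∀ x, 0 ≤ D x) ∧ Integrable D (vol a b) ∧
      ∫ x, D x ∂(vol a b) ≤ ε ∧ ∀ c d, a ≤ c → c < d → d ≤ b → (∀ x ∈ G, x ∉ Ioo c d) →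
        |bestConst c d p q u v ^ (1 / r) -
          cConst p p' q ^ (1 / r) * ∫ x, |u x * v x| ^ (1 / r) ∂(vol c d)| ≤
            ∫ x, D x ∂(vol c d) := by
  have hq := W.q_pos
  have hp' : 0 < p' := W.conj.symm.pos
  have hr0 : 0 < r := by linarith
  have hs : 0 ≤ 1 / r := by positivity
  have hs1 : 1 / r ≤ 1 := (div_le_one hr0).2 hr1
  set κ := cConst p p' q ^ (1 / r) with hκ
  have hκ0 : 0 < κ := Real.rpow_pos_of_pos (cConst_pos hp' hq) _
  set E := energy p' a b u + energy q a b v with hE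
  have hE0 : 0 ≤ E := add_nonneg (energy_nonneg _ _ _ _) (energy_nonneg _ _ _ _)
  -- The constants are chosen in this order: `τ` makes the part of the error from the full weights
  -- at most `ε / 2`, then `C` depends on `τ`, and `η` makes the approximation part, of size `2 C η
  -- (3 + κ)`, equal to `ε / 2`.
  set τ := ε / (2 * (3 + κ) * (E + 1)) with hτ
  have hτ0 : 0 < τ := by positivity
  obtain ⟨C, hC, hyoung⟩ := W.exists_rpow_le_add hr hr1 hτ0
  set η := ε / (4 * (3 + κ) * C) with hη
  have hη0 : 0 < η := by positivity
  obtain ⟨G₁, u₂, hu₂, hu₂0, hu₂e, hG₁⟩ := exists_step_approx W.hab W.conj.symm.lt.le W.u_mem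
    W.u_pos hη0
  obtain ⟨G₂, v₂, hv₂, hv₂0, hv₂e, hG₂⟩ := exists_step_approx W.hab W.hq.le W.v_mem W.v_pos hη0
  have W₂ : Weights a b p p' q u₂ v₂ :=
    ⟨W.hab, W.conj, W.hq, W.hqp, fun x _ => hu₂0 x, fun x _ => hv₂0 x, hu₂, hv₂⟩
  have i₁ : Integrable (fun x => |u x - u₂ x| ^ p') (vol a b) :=
    MemLp.integrable_abs_rpow hp' (W.u_mem.sub hu₂)
  have i₂ : Integrable (fun x => |v x - v₂ x| ^ q) (vol a b) :=
    MemLp.integrable_abs_rpow hq (W.v_mem.sub hv₂)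
  -- One density controls both errors: 3 times its integral bounds the change of the best constant,
  -- and `κ` times its integral the change of the integral of `|u v| ^ (1 / r)`.
  set D₀ : ℝ → ℝ := fun x => C * (|u x - u₂ x| ^ p' + |v x - v₂ x| ^ q) +
    τ * (|u x| ^ p' + |v x| ^ q) with hD₀
  have hD₀i : Integrable D₀ (vol a b) :=
    ((i₁.add i₂).const_mul C).add ((W.integrable_u.add W.integrable_v).const_mul τ)
  have hD₀int : ∀ c d, a ≤ c → d ≤ b → ∫ x, D₀ x ∂(vol c d) =
      C * (energy p' c d (fun x => u x - u₂ x) + energy q c d (fun x => v x - v₂ x)) +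
        τ * (energy p' c d u + energy q c d v) := by
    intro c d hc hd
    have hm := vol_mono hc hd
    simp only [hD₀, energy]
    rw [integral_add, integral_const_mul, integral_const_mul, integral_add, integral_add]
    · exact W.integrable_u.mono_measure hm
    · exact W.integrable_v.mono_measure hm
    · exact i₁.mono_measure hm
    · exact i₂.mono_measure hm
    · exact ((i₁.add i₂).const_mul C).mono_measure hm
    · exact ((W.integrable_u.add W.integrable_v).const_mul τ).mono_measure hm
  refine ⟨G₁ ∪ G₂, fun x => (3 + κ) * D₀ x, fun x => by positivity, hD₀i.const_mul _, ?_, ?_⟩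
  · rw [integral_const_mul, hD₀int a b le_rfl le_rfl]
    have h1 : C * (energy p' a b (fun x => u x - u₂ x) + energy q a b (fun x => v x - v₂ x)) ≤
        C * (η + η) := mul_le_mul_of_nonneg_left (add_le_add hu₂e hv₂e) hC.le
    have h2 : (3 + κ) * (C * (η + η)) = ε / 2 := by rw [hη]; field_simp; norm_num
    have h3 : (3 + κ) * (τ * E) ≤ ε / 2 := by
      have : (3 + κ) * (τ * (E + 1)) = ε / 2 := by rw [hτ]; field_simp
      have : 0 ≤ (3 + κ) * τ := by positivity
      nlinarith
    have h4 := mul_le_mul_of_nonneg_left h1 (by positivity : 0 ≤ 3 + κ)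
    rw [← hE]
    linarith
  · intro c d hc hcd hd hG
    have hm := vol_mono hc hd
    have Wc := W.restrict hc hcd hd
    have Wc₂ := W₂.restrict hc hcd hd
    obtain ⟨α, hα, hα'⟩ := hG₁ c d hc hcd hd fun x hx => hG x (Finset.mem_union_left _ hx)
    obtain ⟨β, hβ, hβ'⟩ := hG₂ c d hc hcd hd fun x hx => hG x (Finset.mem_union_right _ hx)
    have e := Wc₂.rpow_bestConst_of_const hr hα hβ hα' hβ'
    have h1 : |bestConst c d p q u v ^ (1 / r) - bestConst c d p q u₂ v₂ ^ (1 / r)| ≤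
        3 * ∫ x, D₀ x ∂(vol c d) := by
      refine (abs_rpow_sub_rpow_le hs hs1 Wc.bestConst_pos.le Wc₂.bestConst_pos.le).trans ?_
      refine (Real.rpow_le_rpow (abs_nonneg _) (Wc.abs_bestConst_sub_le Wc₂) hs).trans ?_
      have n₁ := nrm_nonneg p' c d u
      have n₂ := nrm_nonneg q c d v
      have n₃ := nrm_nonneg p' c d (fun x => u x - u₂ x)
      have n₄ := nrm_nonneg q c d (fun x => v x - v₂ x)
      rw [Real.mul_rpow (by norm_num) (by positivity)]
      have hy := hyoung _ _ _ _ n₁ n₂ n₃ n₄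
      rw [nrm_rpow hp', nrm_rpow hp', nrm_rpow hq, nrm_rpow hq, ← hD₀int c d hc hd] at hy
      refine mul_le_mul ?_ hy (by positivity) (by norm_num)
      calc (3:ℝ) ^ (1 / r) ≤ 3 ^ (1:ℝ) := Real.rpow_le_rpow_of_exponent_le (by norm_num) hs1
        _ = 3 := Real.rpow_one 3
    have j₁ := Wc.integrable_mul_rpow hr hr1
    have j₂ := Wc₂.integrable_mul_rpow hr hr1
    have h2 : |(∫ x, |u₂ x * v₂ x| ^ (1 / r) ∂(vol c d)) -
        ∫ x, |u x * v x| ^ (1 / r) ∂(vol c d)| ≤ ∫ x, D₀ x ∂(vol c d) := by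
      rw [abs_sub_comm, ← integral_sub j₁ j₂]
      refine (abs_integral_le_integral_abs).trans (integral_mono (j₁.sub j₂).abs
        (hD₀i.mono_measure hm) fun x => ?_)
      exact (abs_sub_mul_rpow_le hs hs1 _ _ _ _).trans (hyoung _ _ _ _ (abs_nonneg _)
        (abs_nonneg _) (abs_nonneg _) (abs_nonneg _))
    have h3 := mul_le_mul_of_nonneg_left h2 hκ0.le
    rw [← abs_of_pos hκ0, ← abs_mul, abs_of_pos hκ0, mul_sub, ← e] at h3
    rw [integral_const_mul, add_mul]
    exact (abs_sub_le _ _ _).trans (add_le_add h1 h3)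

end Weights

end HardySpectral

namespace HardySpectral

variable {a b p p' q : ℝ} {u v : ℝ → ℝ}

/-! ### Asymptotics -/

/-- Points dividing the mass of `m` into `k` equal parts. An interval with more than one part of the
mass contains a quantile in its interior. Where `m` vanishes quantiles may be chosen arbitrarily and
may coincide, so only their number is bounded. -/
theorem exists_quantiles (hab : a ≤ b) {m : ℝ → ℝ} (hm0 : ∀ x, 0 ≤ m x)
    (hm : Integrable m (vol a b)) {k : ℕ} (hk : 0 < k) :
    ∃ Y : Finset ℝ, Y.card ≤ k - 1 ∧ (∀ x ∈ Y, x ∈ Icc a b) ∧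
      ∀ c d, a ≤ c → c ≤ d → d ≤ b → (∀ x ∈ Y, x ∉ Ioo c d) →
        ∫ x, m x ∂(vol c d) ≤ (∫ x, m x ∂(vol a b)) / k := by
  have hk' : (0:ℝ) < k := Nat.cast_pos.2 hk
  set I := ∫ x, m x ∂(vol a b) with hI
  have hI0 : 0 ≤ I := integral_nonneg hm0
  set Q : ℝ → ℝ := fun x => ∫ t in a..x, m t with hQ
  have hii : ∀ {x y}, x ∈ Icc a b → y ∈ Icc a b → IntervalIntegrable m volume x y :=
    fun hx hy => intervalIntegrable_of_integrable hm hx hy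
  have hal : a ∈ Icc a b := left_mem_Icc.2 hab
  have hbl : b ∈ Icc a b := right_mem_Icc.2 hab
  have hQsub : ∀ {c d}, c ∈ Icc a b → d ∈ Icc a b → Q d - Q c = ∫ t in c..d, m t :=
    fun hc hd => intervalIntegral.integral_interval_sub_left (hii hal hd) (hii hal hc)
  have hQmono : ∀ {c d}, c ∈ Icc a b → d ∈ Icc a b → c ≤ d → Q c ≤ Q d := by
    intro c d hc hd hcd
    rw [← sub_nonneg, hQsub hc hd]
    exact intervalIntegral.integral_nonneg hcd fun x _ => hm0 x
  have hQc : ContinuousOn Q (Icc a b) := by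
    have := intervalIntegral.continuousOn_primitive_interval (f := m) (a := a) (b := b)
      (μ := volume) (by rw [uIcc_of_le hab]; exact hm)
    rwa [uIcc_of_le hab] at this
  have hQa : Q a = 0 := intervalIntegral.integral_same
  have hQb : Q b = I := (integral_vol hab m).symm
  set h := I / k with hh
  have hh0 : 0 ≤ h := by positivity
  have hkh : k * h = I := by rw [hh]; field_simp
  have hex : ∀ i : ℕ, ∃ x ∈ Icc a b, i ≤ k → Q x = i * h := by
    intro i
    by_cases hi : i ≤ k
    · have : (i * h) ∈ Icc (Q a) (Q b) := by
        rw [hQa, hQb, ← hkh]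
        exact ⟨by positivity, mul_le_mul_of_nonneg_right (by exact_mod_cast hi) hh0⟩
      obtain ⟨x, hx, hxi⟩ := intermediate_value_Icc hab hQc this
      exact ⟨x, hx, fun _ => hxi⟩
    · exact ⟨a, hal, fun h => absurd h hi⟩
  choose y hy hyQ using hex
  refine ⟨(Finset.range (k - 1)).image fun i => y (i + 1),
    Finset.card_image_le.trans (Finset.card_range _).le, ?_, ?_⟩
  · intro x hx
    obtain ⟨i, -, rfl⟩ := Finset.mem_image.1 hx
    exact hy _
  · intro c d hc hcd hd hY
    have hcm : c ∈ Icc a b := ⟨hc, hcd.trans hd⟩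
    have hdm : d ∈ Icc a b := ⟨hc.trans hcd, hd⟩
    rw [integral_vol hcd, ← hQsub hcm hdm]
    by_contra! hlt
    have hQc0 : 0 ≤ Q c := hQa ▸ hQmono hal hcm hc
    have hQd : Q d ≤ I := hQb ▸ hQmono hdm hbl hd
    have hhpos : 0 < h := by
      rcases hh0.eq_or_lt with h0 | h0
      · rw [← h0, mul_zero] at hkh
        linarith
      · exact h0
    have f1 := Nat.floor_le (div_nonneg hQc0 hhpos.le)
    have f2 := Nat.lt_floor_add_one (Q c / h)
    -- The quantile with index `i + 1` is the first whose level exceeds `Q c`; its level is at most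
    -- `Q c + h < Q d`.
    set i := ⌊Q c / h⌋₊ with hi
    rw [le_div_iff₀ hhpos] at f1
    rw [div_lt_iff₀ hhpos] at f2
    have hik : i + 1 < k := by
      have : ((i + 1 : ℕ) : ℝ) * h < k * h := by
        push_cast
        linarith
      exact_mod_cast lt_of_mul_lt_mul_right this hhpos.le
    have hQy := hyQ (i + 1) hik.le
    push_cast at hQy
    refine hY (y (i + 1)) (Finset.mem_image.2 ⟨i, Finset.mem_range.2 (by omega), rfl⟩) ⟨?_, ?_⟩
    · by_contra! hle
      have := hQmono (hy _) hcm hle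
      linarith
    · by_contra! hle
      have := hQmono hdm (hy _) hle
      linarith

namespace Weights

theorem one_le_r (W : Weights a b p p' q u v) {r : ℝ} (hr : r = 1 / p' + 1 / q) : 1 ≤ r := by
  have h1 := W.conj.inv_add_inv_eq_one
  have h2 := one_div_le_one_div_of_le W.q_pos W.hqp
  rw [hr]
  rw [one_div, one_div] at *
  linarith

/-- Spend `g` points on the exceptional set of the local estimate and the others on quantiles of the
density plus its error. Then every cell has best constant at most `(I' / (n - g)) ^ r`, and the
partition estimate contributes `n ^ (r - 1)`. -/
theorem exists_supRatio_upper (W : Weights a b p p' q u v) {r : ℝ} (hr : r = 1 / p' + 1 / q)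
    {ε : ℝ} (hε : 0 < ε) :
    ∃ g : ℕ, ∀ n > g, ∃ P : Fin n → ℝ, (∀ i, P i ∈ Icc a b) ∧
      n * supRatio a b p q u v P ^ (1 / q) ≤
        ((n:ℝ) / (n - g) * (cConst p p' q ^ (1 / r) *
          (∫ x, |u x * v x| ^ (1 / r) ∂(vol a b)) + ε)) ^ r := by
  have hr1 := W.one_le_r hr
  have hr0 : 0 < r := by linarith
  have hp := W.p_pos
  have hq := W.q_pos
  have hp' : 0 < p' := W.conj.symm.pos
  obtain ⟨G, D, hD0, hDi, hDε, hloc⟩ := W.exists_local_estimate hr hr1 hε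
  set κ := cConst p p' q ^ (1 / r) with hκ
  have hκ0 : 0 < κ := Real.rpow_pos_of_pos (cConst_pos hp' hq) _
  have hji := W.integrable_mul_rpow hr hr1
  set m : ℝ → ℝ := fun x => κ * |u x * v x| ^ (1 / r) + D x with hm
  have hm0 : ∀ x, 0 ≤ m x := fun x =>
    add_nonneg (mul_nonneg hκ0.le (Real.rpow_nonneg (abs_nonneg _) _)) (hD0 x)
  have hmi : Integrable m (vol a b) := (hji.const_mul κ).add hDi
  have hmint : ∀ c d, a ≤ c → d ≤ b → ∫ x, m x ∂(vol c d) =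
      κ * (∫ x, |u x * v x| ^ (1 / r) ∂(vol c d)) + ∫ x, D x ∂(vol c d) := by
    intro c d hc hd
    rw [← integral_const_mul]
    exact integral_add ((hji.const_mul κ).mono_measure (vol_mono hc hd))
      (hDi.mono_measure (vol_mono hc hd))
  refine ⟨G.card, fun n hn => ?_⟩
  obtain ⟨Y, hYc, hYm, hY⟩ := exists_quantiles W.le hm0 hmi (Nat.sub_pos_of_lt hn)
  set I' := ∫ x, m x ∂(vol a b) with hI'
  have hI'0 : 0 ≤ I' := integral_nonneg hm0
  set k := n - G.card with hk
  have hk0 : 0 < k := Nat.sub_pos_of_lt hn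
  have hkR : (0:ℝ) < k := Nat.cast_pos.2 hk0
  classical
  -- At most `2 + g + (n - g - 1) = n + 1` division points, hence at most `n` cells.
  set X : Finset ℝ := insert a (insert b ((G.filter fun x => x ∈ Icc a b) ∪ Y)) with hX
  have hXc : X.card ≤ n + 1 := by
    rw [hX]
    have h1 := Finset.card_insert_le a (insert b ((G.filter fun x => x ∈ Icc a b) ∪ Y))
    have h2 := Finset.card_insert_le b ((G.filter fun x => x ∈ Icc a b) ∪ Y)
    have h3 := Finset.card_union_le (G.filter fun x => x ∈ Icc a b) Y
    have h4 := Finset.card_filter_le G fun x => x ∈ Icc a b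
    omega
  obtain ⟨N, t, ht, hNX, -, hgap⟩ := exists_partition (a := a) (b := b) (X := X)
    (Finset.mem_insert_self _ _) (Finset.mem_insert_of_mem (Finset.mem_insert_self _ _)) (by
      intro x hx
      simp only [hX, Finset.mem_insert, Finset.mem_union, Finset.mem_filter] at hx
      rcases hx with rfl | rfl | h | h
      · exact W.left_mem
      · exact W.right_mem
      · exact h.2
      · exact hYm x h)
  have hNn : N ≤ n := by omega
  -- The right ends of the cells; if there are fewer than `n`, the surplus points are placed at `b`.
  refine ⟨fun i => t (min (i + 1) N), fun i => ht.mem (min_le_right _ _), ?_⟩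
  set P : Fin n → ℝ := fun i => t (min (i + 1) N) with hP
  have hPm : ∀ i, P i ∈ Icc a b := fun i => ht.mem (min_le_right _ _)
  have hσ : ∀ j < N, bestConst (t j) (t (j + 1)) p q u v ^ q ≤ ((I' / k) ^ r) ^ q := by
    intro j hj
    have hc := (ht.mem hj.le).1
    have hd := (ht.mem hj).2
    have Wj := W.restrict_partition ht hj
    have h1 := hloc _ _ hc (ht.lt j hj) hd fun x hx hxm =>
      hgap j hj x (Finset.mem_insert_of_mem (Finset.mem_insert_of_mem (Finset.mem_union_left _
        (Finset.mem_filter.2 ⟨hx, hc.trans hxm.1.le, hxm.2.le.trans hd⟩)))) hxm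
    have h2 := hY _ _ hc (ht.lt j hj).le hd fun x hx =>
      hgap j hj x (Finset.mem_insert_of_mem (Finset.mem_insert_of_mem
        (Finset.mem_union_right _ hx)))
    rw [hmint _ _ hc hd] at h2
    have h3 := (abs_le.1 h1).2
    have h4 : bestConst (t j) (t (j + 1)) p q u v ^ (1 / r) ≤ I' / k := by linarith
    have h5 := Real.rpow_le_rpow (Real.rpow_nonneg Wj.bestConst_pos.le _) h4 hr0.le
    rw [← Real.rpow_mul Wj.bestConst_pos.le, one_div_mul_cancel hr0.ne', Real.rpow_one] at h5
    exact Real.rpow_le_rpow Wj.bestConst_pos.le h5 hq.le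
  have hS := W.supRatio_le_of_partition ht (P := P)
    (fun j hj => ⟨⟨j, hj.trans_le hNn⟩, by simp only [hP]; rw [min_eq_left hj]⟩)
    (by positivity) hσ
  have hexp : 0 ≤ 1 - q / p := sub_nonneg.2 ((div_le_one hp).2 W.hqp)
  have hS2 : supRatio a b p q u v P ≤ ((I' / k) ^ r) ^ q * (n:ℝ) ^ (1 - q / p) :=
    hS.trans (mul_le_mul_of_nonneg_left (Real.rpow_le_rpow (by positivity)
      (by exact_mod_cast hNn) hexp) (by positivity))
  have hS3 := Real.rpow_le_rpow (W.supRatio_pos hPm).le hS2 (by positivity : 0 ≤ 1 / q)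
  have hn0 : (0:ℝ) < n := Nat.cast_pos.2 (by omega)
  rw [Real.mul_rpow (by positivity) (by positivity), ← Real.rpow_mul (by positivity),
    mul_one_div_cancel hq.ne', Real.rpow_one, ← Real.rpow_mul (by positivity)] at hS3
  have hconj : 1 / p' = 1 - 1 / p := by
    have := W.conj.inv_add_inv_eq_one
    rw [one_div, one_div]; linarith
  have he : (1 - q / p) * (1 / q) = r - 1 := by
    rw [hr, hconj]
    field_simp
    ring
  rw [he] at hS3
  have hkn : (k:ℝ) = n - G.card := by rw [hk, Nat.cast_sub hn.le]
  calc n * supRatio a b p q u v P ^ (1 / q) ≤ n * ((I' / k) ^ r * (n:ℝ) ^ (r - 1)) :=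
        mul_le_mul_of_nonneg_left hS3 hn0.le
    _ = (n / k * I') ^ r := by
        rw [Real.rpow_sub_one hn0.ne', div_mul_eq_mul_div, mul_div_assoc,
          Real.mul_rpow hn0.le (by positivity)]
        field_simp
    _ ≤ _ := by
        rw [← hkn]
        refine Real.rpow_le_rpow (by positivity) (mul_le_mul_of_nonneg_left ?_ (by positivity))
          hr0.le
        rw [hI', hmint a b le_rfl le_rfl]
        linarith

/-- Adding the exceptional set and the end points to an arbitrary configuration leaves at most `n +
g` cells, where `g` exceeds the size of the exceptional set by one. The gluing estimate bounds the
supremum from below, and summation of the local estimates recovers the full integral up to `ε`. -/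
theorem exists_supRatio_lower_bound (W : Weights a b p p' q u v) {r : ℝ}
    (hr : r = 1 / p' + 1 / q) {ε : ℝ} (hε : 0 < ε) :
    ∃ g : ℕ, ∀ (n : ℕ) (P : Fin n → ℝ), (∀ i, P i ∈ Icc a b) →
      (max (cConst p p' q ^ (1 / r) * (∫ x, |u x * v x| ^ (1 / r) ∂(vol a b)) - ε) 0) ^ r ≤
        ((n:ℝ) + g) * supRatio a b p q u v P ^ (1 / q) := by
  have hr1 := W.one_le_r hr
  have hr0 : 0 < r := by linarith
  have hji := W.integrable_mul_rpow hr hr1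
  obtain ⟨G, D, hD0, hDi, hDε, hloc⟩ := W.exists_local_estimate hr hr1 hε
  refine ⟨G.card + 1, fun n P hP => ?_⟩
  classical
  set X : Finset ℝ := insert a (insert b ((G.filter fun x => x ∈ Icc a b) ∪
    Finset.univ.image P)) with hX
  have hXc : X.card ≤ n + (G.card + 1) + 1 := by
    rw [hX]
    have h1 := Finset.card_insert_le a
      (insert b ((G.filter fun x => x ∈ Icc a b) ∪ Finset.univ.image P))
    have h2 := Finset.card_insert_le b ((G.filter fun x => x ∈ Icc a b) ∪ Finset.univ.image P)
    have h3 := Finset.card_union_le (G.filter fun x => x ∈ Icc a b) (Finset.univ.image P)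
    have h4 := Finset.card_filter_le G fun x => x ∈ Icc a b
    have h5 := Finset.card_image_le (s := Finset.univ) (f := P)
    rw [Finset.card_univ, Fintype.card_fin] at h5
    omega
  obtain ⟨N, t, ht, hNX, hsurj, hgap⟩ := exists_partition (a := a) (b := b) (X := X)
    (Finset.mem_insert_self _ _) (Finset.mem_insert_of_mem (Finset.mem_insert_self _ _)) (by
      intro x hx
      simp only [hX, Finset.mem_insert, Finset.mem_union, Finset.mem_filter, Finset.mem_image] at hx
      rcases hx with rfl | rfl | h | ⟨i, -, rfl⟩
      · exact W.left_mem
      · exact W.right_mem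
      · exact h.2
      · exact hP i)
  have hNn : N ≤ n + (G.card + 1) := by omega
  have h1 := W.sum_bestConst_le ht (P := P) (fun i => by
    obtain ⟨j, hj, h⟩ := hsurj (P i) (Finset.mem_insert_of_mem (Finset.mem_insert_of_mem
      (Finset.mem_union_right _ (Finset.mem_image.2 ⟨i, Finset.mem_univ _, rfl⟩))))
    exact ⟨j, hj, h.symm⟩) hr
  have hsum : cConst p p' q ^ (1 / r) * (∫ x, |u x * v x| ^ (1 / r) ∂(vol a b)) - ε ≤
      ∑ j ∈ Finset.range N, bestConst (t j) (t (j + 1)) p q u v ^ (1 / r) := by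
    have h2 : ∑ j ∈ Finset.range N, (cConst p p' q ^ (1 / r) *
          (∫ x, |u x * v x| ^ (1 / r) ∂(vol (t j) (t (j + 1)))) -
          ∫ x, D x ∂(vol (t j) (t (j + 1)))) ≤
        ∑ j ∈ Finset.range N, bestConst (t j) (t (j + 1)) p q u v ^ (1 / r) := by
      refine Finset.sum_le_sum fun j hj => ?_
      have hj := Finset.mem_range.1 hj
      have hc := (ht.mem hj.le).1
      have hd := (ht.mem hj).2
      have h1 := hloc _ _ hc (ht.lt j hj) hd fun x hx hxm =>
        hgap j hj x (Finset.mem_insert_of_mem (Finset.mem_insert_of_mem (Finset.mem_union_left _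
          (Finset.mem_filter.2 ⟨hx, hc.trans hxm.1.le, hxm.2.le.trans hd⟩)))) hxm
      linarith [(abs_le.1 h1).1]
    rw [Finset.sum_sub_distrib, ← Finset.mul_sum, ht.sum_integral W.le hji,
      ht.sum_integral W.le hDi] at h2
    linarith
  have hsum0 : 0 ≤ ∑ j ∈ Finset.range N, bestConst (t j) (t (j + 1)) p q u v ^ (1 / r) :=
    Finset.sum_nonneg fun j hj => Real.rpow_nonneg
      (W.restrict_partition ht (Finset.mem_range.1 hj)).bestConst_pos.le _
  refine (Real.rpow_le_rpow (le_max_right _ _) (max_le hsum hsum0) hr0.le).trans (h1.trans ?_)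
  refine mul_le_mul_of_nonneg_right ?_ (Real.rpow_nonneg (W.supRatio_pos hP).le _)
  exact_mod_cast hNn

/-- Asymptotics of the minimal values of `supRatio`. -/
theorem tendsto_mul_min_supRatio (W : Weights a b p p' q u v) {r : ℝ} (hr : r = 1 / p' + 1 / q)
    {P : ∀ n, Fin n → ℝ} (hP : ∀ n i, P n i ∈ Icc a b)
    (hmin : ∀ n (Q : Fin n → ℝ), (∀ i, Q i ∈ Icc a b) →
      supRatio a b p q u v (P n) ≤ supRatio a b p q u v Q) :
    Tendsto (fun n : ℕ => (n:ℝ) * supRatio a b p q u v (P n) ^ (1 / q)) atTop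
      (𝓝 (cConst p p' q * (∫ x, |u x * v x| ^ (1 / r) ∂(vol a b)) ^ r)) := by
  have hr1 := W.one_le_r hr
  have hr0 : 0 < r := by linarith
  have hq := W.q_pos
  have hp' : 0 < p' := W.conj.symm.pos
  have hc0 := cConst_pos (p := p) hp' hq
  set J := ∫ x, |u x * v x| ^ (1 / r) ∂(vol a b) with hJ
  have hJ0 : 0 ≤ J := integral_nonneg fun x => Real.rpow_nonneg (abs_nonneg _) _
  set I := cConst p p' q ^ (1 / r) * J with hI
  have hI0 : 0 ≤ I := by positivity
  have hIr : cConst p p' q * J ^ r = I ^ r := by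
    rw [hI, Real.mul_rpow (by positivity) hJ0, ← Real.rpow_mul hc0.le,
      one_div_mul_cancel hr0.ne', Real.rpow_one]
  rw [hIr]
  have hg1 : ∀ g : ℕ, Tendsto (fun n : ℕ => (n:ℝ) / (n + g)) atTop (𝓝 1) := fun g => by
    simpa using tendsto_natCast_div_add_atTop (𝕜 := ℝ) (g:ℝ)
  have hg2 : ∀ g : ℕ, Tendsto (fun n : ℕ => (n:ℝ) / (n - g)) atTop (𝓝 1) := fun g => by
    simpa [sub_eq_add_neg] using tendsto_natCast_div_add_atTop (𝕜 := ℝ) (-(g:ℝ))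
  -- In both bounds `ε` is fixed first, close enough to 0 for the given level `l`; the number `g`
  -- then depends on `ε` only, and the quotients `n / (n ± g)` tend to 1.
  refine tendsto_order.2 ⟨fun l hl => ?_, fun l hl => ?_⟩
  · have hcont : Tendsto (fun ε : ℝ => (max (I - ε) 0) ^ r) (𝓝[>] 0) (𝓝 (I ^ r)) := by
      have : Continuous fun ε : ℝ => (max (I - ε) 0) ^ r :=
        ((continuous_const.sub continuous_id).max continuous_const).rpow_const
          fun _ => Or.inr hr0.le
      have h2 := this.tendsto 0
      rw [sub_zero, max_eq_left hI0] at h2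
      exact h2.mono_left nhdsWithin_le_nhds
    obtain ⟨ε, hεl, hε⟩ := ((hcont.eventually_const_lt hl).and self_mem_nhdsWithin).exists
    obtain ⟨g, hg⟩ := W.exists_supRatio_lower_bound hr hε
    have hlim := (hg1 g).mul_const ((max (I - ε) 0) ^ r)
    rw [one_mul] at hlim
    filter_upwards [hlim.eventually_const_lt hεl, eventually_gt_atTop 0] with n hn hn0
    refine hn.trans_le ?_
    have h1 := hg n (P n) (hP n)
    have hn0' : (0:ℝ) < n := Nat.cast_pos.2 hn0
    calc (n:ℝ) / (n + g) * (max (I - ε) 0) ^ r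
        ≤ (n:ℝ) / (n + g) * (((n:ℝ) + g) * supRatio a b p q u v (P n) ^ (1 / q)) :=
          mul_le_mul_of_nonneg_left h1 (by positivity)
      _ = _ := by field_simp
  · have hcont : Tendsto (fun ε : ℝ => (I + ε) ^ r) (𝓝[>] 0) (𝓝 (I ^ r)) := by
      have : Continuous fun ε : ℝ => (I + ε) ^ r :=
        (continuous_const.add continuous_id).rpow_const fun _ => Or.inr hr0.le
      have h2 := this.tendsto 0
      rw [add_zero] at h2
      exact h2.mono_left nhdsWithin_le_nhds
    obtain ⟨ε, hεl, hε⟩ := ((hcont.eventually_lt_const hl).and self_mem_nhdsWithin).exists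
    obtain ⟨g, hg⟩ := W.exists_supRatio_upper hr hε
    have hlim := ((hg2 g).mul_const (I + ε)).rpow_const (p := r) (Or.inr hr0.le)
    rw [one_mul] at hlim
    filter_upwards [hlim.eventually_lt_const hεl, eventually_gt_atTop g] with n hn hng
    obtain ⟨Q, hQ, hQle⟩ := hg n hng
    refine lt_of_le_of_lt ?_ hn
    refine le_trans (mul_le_mul_of_nonneg_left (Real.rpow_le_rpow (W.supRatio_pos (hP n)).le
      (hmin n Q hQ) (by positivity)) (by positivity)) hQle

end Weights

end HardySpectral
-- The theorem
theorem theorem3 (a b : ℝ) (hab : a < b) (p p' q r : ℝ) (hq : 1 < q) (hqp : q ≤ p)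
    (hp' : 1 / p' = 1 - 1 / p) (hr : r = 1 / p' + 1 / q)
    (u v : ℝ → ℝ) (hu_pos : ∀ x ∈ Icc a b, 0 < u x) (hv_pos : ∀ x ∈ Icc a b, 0 < v x)
    (hu : MemLp u (ENNReal.ofReal p') (volume.restrict (Icc a b)))
    (hv : MemLp v (ENNReal.ofReal q) (volume.restrict (Icc a b))) :
    ∃ lamHat : ℕ → ℝ,
      (∀ n : ℕ, IsGreatest (HardySpectral.spN a b p q u v n) (lamHat n)) ∧
      Tendsto (fun n : ℕ => (n : ℝ) * lamHat n ^ (-(1 / q))) atTop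
        (𝓝 (HardySpectral.cConst p p' q *
          (∫ t in Icc a b, |u t * v t| ^ (1 / r)) ^ r)) := by
  have hp : 1 < p := hq.trans_le hqp
  have hconj : p.HolderConjugate p' := by
    rw [Real.holderConjugate_iff]
    refine ⟨hp, ?_⟩
    rw [← one_div, ← one_div, hp']
    ring
  have W : HardySpectral.Weights a b p p' q u v :=
    ⟨hab, hconj, hq, hqp, hu_pos, hv_pos, hu, hv⟩
  choose P hP hmin using W.exists_min_supRatio
  refine ⟨fun n => (HardySpectral.supRatio a b p q u v (P n))⁻¹,
    fun n => W.isGreatest_inv_min (hP n) (hmin n), ?_⟩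
  refine (W.tendsto_mul_min_supRatio hr hP hmin).congr fun n => ?_
  rw [Real.rpow_neg (inv_pos.2 (W.supRatio_pos (hP n))).le,
    Real.inv_rpow (W.supRatio_pos (hP n)).le, inv_inv]
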